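/- **Computing a shortest homology basis.** Let $K$ be a finite connected abstract simplicial complex of size $n$, i.e. with $n$ (nonempty) simplices of all dimensions, and let $w(e)\ge 0$ be a real weight for every edge $e$ of $K$. Homology is simplicial homology with coefficients in $\mathbb{Z}_2$: $H_1(K)=\ker\partial_1/\operatorname{im}\partial_2$, and $g=\dim_{\mathbb{Z}_2}H_1(K)$ is the first Betti number. A *homology cycle basis* is a family of $1$-cycles $z_1,\dots,z_g$ whose classes $[z_1],\dots,[z_g]$ form a basis of $H_1(K)$; the weight of a cycle is $w(z)=\sum_{e\in z}w(e)$, and a homology cycle basis is a *shortest homology basis* if $\sum_{j=1}^g w(z_j)$ is minimal among all homology cycle bases of $K$. The model of computation is the random access machine with words of $O(\log N)$ bits for inputs of size $N$ (arithmetic operations, comparisons and indirect addressing on words, each in one time unit), which can in addition store real numbers, and copy, add and compare them in one time unit each. Let $\omega>2$ be a real number such that two $n\times n$ matrices over $\mathbb{Z}_2$ can be multiplied in $O(n^{\omega})$ time by a program for this machine. Then there is a program for this machine which, given any complex $K$ as above (vertices numbered $0,\dots,m-1$, all $n$ simplices listed in an arbitrary order by their vertices) and the weights of its edges, computes a shortest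 homology basis $z_1,\dots,z_g$ of $K$, returned as the number $g$ and the incidence vectors of the cycles $z_j$, in time $$O\bigl(n^{\omega}+n^{2}g^{\omega-1}\bigr).$$ The constant in the $O$-bound does not depend on $K$, on the listing of its simplices, or on $w$. -/

import Mathlib

/-! ## Random access machine

The machine is a word RAM that can also store real numbers.  A program is a fixed finite piece
of code in a small imperative language.

* Words are natural numbers below a bound `W`; a computation in which some word reaches `W`
  has no run.  With `W` polynomial in the input size this is the usual word RAM whose words
  have logarithmically many bits.
* Memory consists of banks of word cells and banks of real cells, with indirect addressing inside
  a bank.  Banks are named in the program text, so that a program uses only finitely many of them.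
* Reals can only be copied, added and compared; they cannot be converted to words or back, and
  no nonzero real constants are available.
* Every elementary operation costs one time unit. -/

namespace RAM

structure State where
  words : ℕ → ℕ → ℕ
  reals : ℕ → ℕ → ℝ

/-- Write the word `v` to address `a` of word bank `b`. -/
def State.writeWord (s : State) (b a v : ℕ) : State :=
  { s with words := Function.update s.words b (Function.update (s.words b) a v) }

/-- Write the real `v` to address `a` of real bank `b`. -/
noncomputable def State.writeReal (s : State) (b a : ℕ) (v : ℝ) : State :=
  { s with reals := Function.update s.reals b (Function.update (s.reals b) a v) }

/-- The memory in which word bank `b` starts with the `b`-th list of `ws`, real bank `0` starts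
with `rs`, and all other cells are zero. -/
def State.input (ws : List (List ℕ)) (rs : List ℝ) : State where
  words b a := (ws.getD b []).getD a 0
  reals b a := if b = 0 then rs.getD a 0 else 0

/-- Arithmetic on words: addition, truncated subtraction, multiplication, and division with
remainder (where `x / 0 = 0` and `x % 0 = x`). -/
inductive Op
  | add
  | sub
  | mul
  | div
  | mod

def Op.apply : Op → ℕ → ℕ → ℕ
  | .add, x, y => x + y
  | .sub, x, y => x - y
  | .mul, x, y => x * y
  | .div, x, y => x / y
  | .mod, x, y => x % y

/-- Word expressions; `get b e` is the content of word bank `b` at address `e`. -/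
inductive Expr
  | lit (k : ℕ)
  | get (b : ℕ) (e : Expr)
  | op (o : Op) (e₁ e₂ : Expr)

/-- The value `k`, if it fits into a word. -/
def word (W k : ℕ) : Option ℕ := if k < W then some k else none

/-- The value of a word expression, undefined if a word overflows. -/
def Expr.eval (W : ℕ) (s : State) : Expr → Option ℕ
  | .lit k => word W k
  | .get b e => (e.eval W s).bind fun a => word W (s.words b a)
  | .op o e₁ e₂ => (e₁.eval W s).bind fun x => (e₂.eval W s).bind fun y => word W (o.apply x y)

def Expr.cost : Expr → ℕ
  | .lit _ => 1
  | .get _ e => e.cost + 1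
  | .op _ e₁ e₂ => e₁.cost + e₂.cost + 1

/-- Real expressions; `get b e` is the content of real bank `b` at address `e`. -/
inductive RExpr
  | get (b : ℕ) (e : Expr)
  | add (r₁ r₂ : RExpr)

noncomputable def RExpr.eval (W : ℕ) (s : State) : RExpr → Option ℝ
  | .get b e => (e.eval W s).map fun a => s.reals b a
  | .add r₁ r₂ => (r₁.eval W s).bind fun x => (r₂.eval W s).map fun y => x + y

def RExpr.cost : RExpr → ℕ
  | .get _ e => e.cost + 1
  | .add r₁ r₂ => r₁.cost + r₂.cost + 1

/-- Tests: comparison of words, comparison of reals, and Boolean combinations. -/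
inductive Test
  | wordLe (e₁ e₂ : Expr)
  | realLe (r₁ r₂ : RExpr)
  | not (c : Test)
  | and (c₁ c₂ : Test)

open Classical in
noncomputable def Test.eval (W : ℕ) (s : State) : Test → Option Bool
  | .wordLe e₁ e₂ => (e₁.eval W s).bind fun x => (e₂.eval W s).map fun y => decide (x ≤ y)
  | .realLe r₁ r₂ => (r₁.eval W s).bind fun x => (r₂.eval W s).map fun y => decide (x ≤ y)
  | .not c => (c.eval W s).map fun b => !b
  | .and c₁ c₂ => (c₁.eval W s).bind fun x => (c₂.eval W s).map fun y => x && y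

def Test.cost : Test → ℕ
  | .wordLe e₁ e₂ => e₁.cost + e₂.cost + 1
  | .realLe r₁ r₂ => r₁.cost + r₂.cost + 1
  | .not c => c.cost + 1
  | .and c₁ c₂ => c₁.cost + c₂.cost + 1

/-- Programs.  `setWord b e v` stores the value of `v` at address `e` of word bank `b`, and
`setReal` does the same for a real bank. -/
inductive Program
  | skip
  | setWord (b : ℕ) (e v : Expr)
  | setReal (b : ℕ) (e : Expr) (r : RExpr)
  | seq (p q : Program)
  | ite (c : Test) (p q : Program)
  | loop (c : Test) (p : Program)

/-- `p.Run W s t s'`: started in the memory `s`, with words below `W`, the program `p` halts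
after exactly `t` time units with the memory `s'`. -/
inductive Program.Run (W : ℕ) : Program → State → ℕ → State → Prop
  | skip (s : State) : Run W .skip s 1 s
  | setWord {s : State} {b : ℕ} {e v : Expr} {a x : ℕ}
      (he : e.eval W s = some a) (hv : v.eval W s = some x) :
      Run W (.setWord b e v) s (e.cost + v.cost + 1) (s.writeWord b a x)
  | setReal {s : State} {b : ℕ} {e : Expr} {r : RExpr} {a : ℕ} {x : ℝ}
      (he : e.eval W s = some a) (hr : r.eval W s = some x) :
      Run W (.setReal b e r) s (e.cost + r.cost + 1) (s.writeReal b a x)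
  | seq {p q : Program} {s s' s'' : State} {t t' : ℕ}
      (hp : Run W p s t s') (hq : Run W q s' t' s'') :
      Run W (.seq p q) s (t + t') s''
  | ite_true {c : Test} {p q : Program} {s s' : State} {t : ℕ}
      (hc : c.eval W s = some true) (hp : Run W p s t s') :
      Run W (.ite c p q) s (c.cost + t) s'
  | ite_false {c : Test} {p q : Program} {s s' : State} {t : ℕ}
      (hc : c.eval W s = some false) (hq : Run W q s t s') :
      Run W (.ite c p q) s (c.cost + t) s'
  | loop_true {c : Test} {p : Program} {s s' s'' : State} {t t' : ℕ}
      (hc : c.eval W s = some true) (hp : Run W p s t s') (hl : Run W (.loop c p) s' t' s'') :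
      Run W (.loop c p) s (c.cost + t + t') s''
  | loop_false {c : Test} {p : Program} {s : State}
      (hc : c.eval W s = some false) :
      Run W (.loop c p) s c.cost s

/-- The entries of a square matrix over `ℤ/2`, row by row, as words `0` and `1`. -/
def rowMajor {n : ℕ} (A : Matrix (Fin n) (Fin n) (ZMod 2)) : List ℕ :=
  (List.finRange n).flatMap fun i => (List.finRange n).map fun j => (A i j).val

/-- Two `n × n` matrices over `ℤ/2` can be multiplied in `O(n ^ ω)` time: the word banks `0`, `1`
and `2` hold `n` and the two matrices, and the product is returned in word bank `3`. -/
def MatMulIn (ω : ℝ) : Prop :=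
  ∃ (P : Program) (c : ℕ) (C : ℝ), ∀ (n : ℕ), 1 ≤ n → ∀ A B : Matrix (Fin n) (Fin n) (ZMod 2),
    ∃ (t : ℕ) (s : State),
      P.Run ((n + 2) ^ c) (State.input [[n], rowMajor A, rowMajor B] []) t s ∧
      (t : ℝ) ≤ C * (n : ℝ) ^ ω ∧
      ∀ i j : Fin n, s.words 3 (i * n + j) = ((A * B) i j).val

end RAM

/-! ## Simplicial homology over `ℤ/2` -/

namespace AbstractSimplicialComplex

variable {V : Type*}

/-- The `p`-dimensional simplices of `K`. -/
@[ext]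
structure Simplex (K : AbstractSimplicialComplex V) (p : ℕ) where
  face : Finset V
  mem : face ∈ K
  card_eq : face.card = p + 1

noncomputable instance [Finite V] (K : AbstractSimplicialComplex V) (p : ℕ) : Fintype (K.Simplex p) :=
  letI : Fintype V := Fintype.ofFinite V
  Fintype.ofInjective (fun s : K.Simplex p => s.face) fun _ _ h => Simplex.ext h

/-- The space of `p`-chains with coefficients in `ℤ/2`. -/
abbrev Chain (K : AbstractSimplicialComplex V) (p : ℕ) : Type _ := K.Simplex p → ZMod 2

variable [Finite V]

open Classical in
/-- The boundary map from `(p + 1)`-chains to `p`-chains: the boundary of a simplex is the sum of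
its `p`-dimensional faces. -/
noncomputable def boundary (K : AbstractSimplicialComplex V) (p : ℕ) :
    K.Chain (p + 1) →ₗ[ZMod 2] K.Chain p :=
  Matrix.mulVecLin (Matrix.of fun τ σ => if τ.face ⊆ σ.face then 1 else 0)

/-- The space of `1`-cycles. -/
noncomputable def oneCycles (K : AbstractSimplicialComplex V) : Submodule (ZMod 2) (K.Chain 1) :=
  LinearMap.ker (K.boundary 0)

/-- The space of `1`-boundaries. -/
noncomputable def oneBoundaries (K : AbstractSimplicialComplex V) :
    Submodule (ZMod 2) (K.Chain 1) :=
  LinearMap.range (K.boundary 1)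

/-- The first homology group with coefficients in `ℤ/2`. -/
abbrev H1 (K : AbstractSimplicialComplex V) : Type _ :=
  K.oneCycles ⧸ K.oneBoundaries.submoduleOf K.oneCycles

/-- The homology class of a `1`-cycle. -/
noncomputable def homologyClass (K : AbstractSimplicialComplex V) (z : K.oneCycles) : K.H1 :=
  Submodule.Quotient.mk z

/-- The first Betti number. -/
noncomputable def betti1 (K : AbstractSimplicialComplex V) : ℕ := Module.finrank (ZMod 2) K.H1

/-- A family of `g` cycles, with `g` the first Betti number, whose homology classes form a basis
of the first homology group. -/
def IsHomologyCycleBasis (K : AbstractSimplicialComplex V) (z : Fin K.betti1 → K.oneCycles) :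
    Prop :=
  LinearIndependent (ZMod 2) (fun j => K.homologyClass (z j)) ∧
    Submodule.span (ZMod 2) (Set.range fun j => K.homologyClass (z j)) = ⊤

/-- The weight of a cycle: the sum of the weights of its edges. -/
noncomputable def cycleWeight (K : AbstractSimplicialComplex V) (w : K.Simplex 1 → ℝ)
    (z : K.oneCycles) : ℝ :=
  ∑ e : K.Simplex 1, if z.1 e = 1 then w e else 0

/-- A homology cycle basis whose total weight is minimal among all homology cycle bases. -/
def IsShortestHomologyBasis (K : AbstractSimplicialComplex V) (w : K.Simplex 1 → ℝ)
    (z : Fin K.betti1 → K.oneCycles) : Prop :=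
  K.IsHomologyCycleBasis z ∧
    ∀ z' : Fin K.betti1 → K.oneCycles, K.IsHomologyCycleBasis z' →
      ∑ j, K.cycleWeight w (z j) ≤ ∑ j, K.cycleWeight w (z' j)

/-- The vertices and edges of `K` as a graph. -/
def edgeGraph [DecidableEq V] (K : AbstractSimplicialComplex V) : SimpleGraph V where
  Adj u v := u ≠ v ∧ ({u, v} : Finset V) ∈ K
  symm := ⟨fun u v h => ⟨h.1.symm, by rw [Finset.pair_comm]; exact h.2⟩⟩
  loopless := ⟨fun _ h => h.1 rfl⟩

/-- `K` is connected, equivalently, its `1`-skeleton is. -/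
def IsConnected [DecidableEq V] (K : AbstractSimplicialComplex V) : Prop := K.edgeGraph.Connected

/-! ## Input and output of the algorithm

A complex with the vertices `0, …, m - 1` is given through a list `S` of all its simplices, in
any order. -/

variable {m n : ℕ}

/-- The simplices one after the other, each given by its number of vertices followed by its
vertices in increasing order. -/
def simplexStream (K : AbstractSimplicialComplex (Fin m))
    (S : Fin n ≃ {s : Finset (Fin m) // s ∈ K}) : List ℕ :=
  (List.finRange n).flatMap fun i => (S i).1.card :: ((S i).1.sort).map fun v => (v : ℕ)

open Classical in
/-- The value at a listed simplex of a function on the edges, and zero if the simplex is not an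
edge. -/
noncomputable def atEdge {R : Type*} [Zero R] (K : AbstractSimplicialComplex (Fin m))
    (S : Fin n ≃ {s : Finset (Fin m) // s ∈ K}) (f : K.Simplex 1 → R) (i : Fin n) : R :=
  if h : (S i).1.card = 2 then f ⟨(S i).1, (S i).2, h⟩ else 0

/-- The initial memory: the numbers of vertices and of simplices are in word bank `0`, the
simplices in word bank `1`, and the weights of the edges in real bank `0`. -/
noncomputable def inputState (K : AbstractSimplicialComplex (Fin m))
    (S : Fin n ≃ {s : Finset (Fin m) // s ∈ K}) (w : K.Simplex 1 → ℝ) : RAM.State :=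
  RAM.State.input [[m, n], K.simplexStream S] ((List.finRange n).map (K.atEdge S w))

/-- The memory `s` holds the cycles `z`: their number is in word bank `2`, and their incidence
vectors with respect to the list `S` are, one after the other, in word bank `3`. -/
def IsOutput (K : AbstractSimplicialComplex (Fin m))
    (S : Fin n ≃ {s : Finset (Fin m) // s ∈ K}) (z : Fin K.betti1 → K.oneCycles)
    (s : RAM.State) : Prop :=
  s.words 2 0 = K.betti1 ∧
    ∀ (j : Fin K.betti1) (i : Fin n), s.words 3 (j * n + i) = (K.atEdge S (z j).1 i).val

end AbstractSimplicialComplex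

/-! Fix a shortest path tree at every vertex p. For an edge e = uv, the candidate (p, e) is the
cycle formed by e and the tree paths from u and v to p. Its key is d(p,u) + w(e) + d(p,v), the
length of the corresponding closed walk, and its weight is at most its key. There are at most n²
candidates.

Two facts give optimality. First, every cycle z is a sum of candidates with keys at most w(z)
(`Net.mem_span_short`). The support of z contains a closed trail c through any prescribed edge of z;
let p be an end of that edge. Around c the tree paths cancel, so c is the sum of the candidates (p,
f) over f in c. Reaching the two ends of f from p along the two arcs of c bounds each of these keys
by w(c) ≤ w(z). Then z + c has smaller support, and induction finishes; no uniqueness of shortest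
paths is needed. Second, the greedy exchange argument (`sum_le_sum_of_mem_span`): scan the
candidates by increasing key and keep those whose classes are independent of the earlier ones. The
class of any cycle z' lies in the span of the kept candidates with key at most w(z'). So for any
other basis, sorted by weight, the i-th weight is at least the i-th key, by counting dimensions. The
weights of the kept cycles are at most their keys, hence the kept family is shortest.

Coordinates on homology come from the tree T at vertex 0. A cycle that vanishes off T is zero, and
the candidates at the root 0 realize all values off T. Eliminating the boundary matrix of the
triangles, restricted to the edges off T, gives an injective transformation; a cycle is a boundary
exactly when its transform vanishes at the edges off T that are not pivot rows. There are g such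
edges, and the entries there are the coordinates (`CoordData.exists_equiv`). They are linear, so a
candidate's label is the sum of the labels of one edge and two paths, and path labels are
accumulated down the trees in O(n²g) time.

Elimination overwrites the matrix in place: a processed block of columns stores a transformation v ↦
v + ∑ v(p_t) U_t, and the composite of two such maps has the same form (`blk_comp`). A dyadic
recursion on columns therefore needs only products of square blocks, T(2S) = 2 T(S) + O(N S^(ω-1)),
which gives O(N^ω) since ω > 2. The pivot columns are the first independent ones from the left
(`Elim.mem_span`), so elimination itself makes the greedy choice. One round eliminates a matrix
whose N columns are the kept labels followed by the next candidates, where N is a power of two with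
2g ≤ N ≤ 4g + 1. If g > 0, a round consumes at least g new candidates in O(g^ω) time, and at most
n²/g + 1 ≤ 2n²/g rounds take O(n² g^(ω-1)); if g = 0, there are n² + 1 rounds of constant cost.
Dijkstra's algorithm from all vertices and the sorting of the candidates take O(n² log n), which n^ω
absorbs because ω > 2.

On the machine side, programs are verified with unbounded words, where only stored words obey a
polynomial bound B; the values of the finitely many expressions of a fixed program then stay below a
fixed power of B. The given multiplication program is a black box that expects zeroed memory, so
each call is relocated to cells that have never been used. -/

/-! ## Unbounded execution

To reason about programs we let words be unbounded, and record only that all stored words stay below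
a bound `B`.  For `W` a large enough power of `B` such an execution is a run with words below `W`. -/

namespace RAM

/-- The value of a word expression, disregarding overflow. -/
@[simp] def Expr.val (s : State) : Expr → ℕ
  | .lit k => k
  | .get b e => s.words b (e.val s)
  | .op o e1 e2 => o.apply (e1.val s) (e2.val s)

@[simp] theorem Op.apply_add (x y : ℕ) : Op.add.apply x y = x + y := rfl
@[simp] theorem Op.apply_sub (x y : ℕ) : Op.sub.apply x y = x - y := rfl
@[simp] theorem Op.apply_mul (x y : ℕ) : Op.mul.apply x y = x * y := rfl
@[simp] theorem Op.apply_div (x y : ℕ) : Op.div.apply x y = x / y := rfl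
@[simp] theorem Op.apply_mod (x y : ℕ) : Op.mod.apply x y = x % y := rfl

@[simp] def RExpr.val (s : State) : RExpr → ℝ
  | .get b e => s.reals b (e.val s)
  | .add r1 r2 => r1.val s + r2.val s

@[simp] def Test.holds (s : State) : Test → Prop
  | .wordLe e1 e2 => e1.val s ≤ e2.val s
  | .realLe r1 r2 => r1.val s ≤ r2.val s
  | .not c => ¬ c.holds s
  | .and c1 c2 => c1.holds s ∧ c2.holds s

/-- Only stored words are bounded. Intermediate values and addresses are unrestricted, so that
evaluation is a total function on which `simp` computes; time is charged as in `Run`. -/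
inductive Program.Exec (B : ℕ) : Program → State → ℕ → State → Prop
  | skip (s : State) : Exec B .skip s 1 s
  | setWord {s : State} {b : ℕ} {e v : Expr} (hv : v.val s < B) :
      Exec B (.setWord b e v) s (e.cost + v.cost + 1) (s.writeWord b (e.val s) (v.val s))
  | setReal {s : State} {b : ℕ} {e : Expr} {r : RExpr} :
      Exec B (.setReal b e r) s (e.cost + r.cost + 1) (s.writeReal b (e.val s) (r.val s))
  | seq {p q : Program} {s s' s'' : State} {t t' : ℕ}
      (hp : Exec B p s t s') (hq : Exec B q s' t' s'') :
      Exec B (.seq p q) s (t + t') s''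
  | ite_true {c : Test} {p q : Program} {s s' : State} {t : ℕ}
      (hc : c.holds s) (hp : Exec B p s t s') :
      Exec B (.ite c p q) s (c.cost + t) s'
  | ite_false {c : Test} {p q : Program} {s s' : State} {t : ℕ}
      (hc : ¬ c.holds s) (hq : Exec B q s t s') :
      Exec B (.ite c p q) s (c.cost + t) s'
  | loop_true {c : Test} {p : Program} {s s' s'' : State} {t t' : ℕ}
      (hc : c.holds s) (hp : Exec B p s t s') (hl : Exec B (.loop c p) s' t' s'') :
      Exec B (.loop c p) s (c.cost + t + t') s''
  | loop_false {c : Test} {p : Program} {s : State} (hc : ¬ c.holds s) :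
      Exec B (.loop c p) s c.cost s

/-- All words in memory are below `B`. -/
def State.Bdd (B : ℕ) (s : State) : Prop := ∀ b a, s.words b a < B

theorem State.words_writeWord (s : State) (b a v b' a' : ℕ) :
    (s.writeWord b a v).words b' a' = if b' = b ∧ a' = a then v else s.words b' a' := by
  simp only [State.writeWord, Function.update_apply]; split_ifs <;> simp_all

@[simp] theorem State.words_same (s : State) (b a v a' : ℕ) :
    (s.writeWord b a v).words b a' = if a' = a then v else s.words b a' := by
  simp [State.words_writeWord]

@[simp] theorem State.words_of_ne (s : State) {b b' : ℕ} (h : b' ≠ b) (a v : ℕ) :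
    (s.writeWord b a v).words b' = s.words b' := by funext a'; simp [State.words_writeWord, h]

@[simp] theorem State.reals_writeWord (s : State) (b a v : ℕ) :
    (s.writeWord b a v).reals = s.reals := rfl

@[simp] theorem State.words_writeReal (s : State) (b a : ℕ) (v : ℝ) :
    (s.writeReal b a v).words = s.words := rfl

@[simp] theorem State.reals_writeReal_same (s : State) (b a : ℕ) (v : ℝ) (a' : ℕ) :
    (s.writeReal b a v).reals b a' = if a' = a then v else s.reals b a' := by
  simp [State.writeReal, Function.update_apply]

@[simp] theorem State.reals_writeReal_of_ne (s : State) {b b' : ℕ} (h : b' ≠ b) (a : ℕ) (v : ℝ) :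
    (s.writeReal b a v).reals b' = s.reals b' := by simp [State.writeReal, h]

theorem State.Bdd.writeWord {B : ℕ} {s : State} (h : s.Bdd B) {b a v : ℕ} (hv : v < B) :
    (s.writeWord b a v).Bdd B := by
  intro b' a'; rw [State.words_writeWord]; split_ifs
  · exact hv
  · exact h b' a'

theorem Program.Exec.bdd {B : ℕ} {p : Program} {s s' : State} {t : ℕ} (h : p.Exec B s t s')
    (hs : s.Bdd B) : s'.Bdd B := by
  induction h with
  | skip => exact hs
  | setWord hv => exact hs.writeWord hv
  | setReal => exact hs
  | seq _ _ ih1 ih2 => exact ih2 (ih1 hs)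
  | ite_true _ _ ih => exact ih hs
  | ite_false _ _ ih => exact ih hs
  | loop_true _ _ _ ih1 ih2 => exact ih2 (ih1 hs)
  | loop_false => exact hs

/-- Expressions over words below `B` have values below `B ^ size`. -/
def Expr.size : Expr → ℕ
  | .lit k => k + 1
  | .get _ e => e.size
  | .op _ e1 e2 => e1.size + e2.size

def RExpr.size : RExpr → ℕ
  | .get _ e => e.size
  | .add r1 r2 => r1.size + r2.size

def Test.size : Test → ℕ
  | .wordLe e1 e2 => e1.size + e2.size
  | .realLe r1 r2 => r1.size + r2.size
  | .not c => c.size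
  | .and c1 c2 => c1.size + c2.size

def Program.size : Program → ℕ
  | .skip => 1
  | .setWord _ e v => e.size + v.size
  | .setReal _ e r => e.size + r.size
  | .seq p q => p.size + q.size
  | .ite c p q => c.size + p.size + q.size
  | .loop c p => c.size + p.size

theorem Expr.one_le_size (e : Expr) : 1 ≤ e.size := by
  induction e <;> simp_all [Expr.size]; omega

/-- The extreme case is (x + 1)(y + 1) ≤ XY, which exceeds both the sum and the product. Bounds
multiply, hence exponents add, and this is why `Expr.size` is additive. -/
theorem Op.apply_lt {o : Op} {x y X Y : ℕ} (hx : x < X) (hy : y < Y) : o.apply x y < X * Y := by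
  have hX : X ≤ X * Y := Nat.le_mul_of_pos_right _ (by omega)
  cases o <;> simp only [Op.apply]
  · nlinarith
  · omega
  · nlinarith
  · exact (Nat.div_le_self _ _).trans_lt (by omega)
  · exact (Nat.mod_le _ _).trans_lt (by omega)

theorem Expr.val_lt {B : ℕ} (hB : 2 ≤ B) {s : State} (hs : s.Bdd B) (e : Expr) :
    e.val s < B ^ e.size := by
  induction e with
  | lit k =>
    exact (Nat.lt_pow_self (by omega)).trans_le
      (Nat.pow_le_pow_right (by omega) (by simp [Expr.size]))
  | get b e ih =>
    exact (hs _ _).trans_le (Nat.le_self_pow (by have := e.one_le_size; simp [Expr.size]; omega) _)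
  | op o e1 e2 ih1 ih2 =>
    rw [Expr.size, pow_add]; exact Op.apply_lt ih1 ih2

theorem Expr.eval_eq {B W : ℕ} (hB : 2 ≤ B) {s : State} (hs : s.Bdd B) (e : Expr)
    (hW : B ^ e.size ≤ W) : e.eval W s = some (e.val s) := by
  have key := (e.val_lt hB hs).trans_le hW
  induction e with
  | lit k => simpa [Expr.eval, word] using key
  | get b e ih =>
    rw [Expr.eval, ih hW ((e.val_lt hB hs).trans_le hW)]; simpa [word] using key
  | op o e1 e2 ih1 ih2 =>
    have h1 : B ^ e1.size ≤ W := (Nat.pow_le_pow_right (by omega) (by simp [Expr.size])).trans hW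
    have h2 : B ^ e2.size ≤ W := (Nat.pow_le_pow_right (by omega) (by simp [Expr.size])).trans hW
    rw [Expr.eval, ih1 h1 ((e1.val_lt hB hs).trans_le h1), ih2 h2 ((e2.val_lt hB hs).trans_le h2)]
    simpa [word] using key

theorem pow_le_of_le {B W k l : ℕ} (hB : 2 ≤ B) (hW : B ^ l ≤ W) (h : k ≤ l) : B ^ k ≤ W :=
  (Nat.pow_le_pow_right (by omega) h).trans hW

theorem RExpr.eval_eq {B W : ℕ} (hB : 2 ≤ B) {s : State} (hs : s.Bdd B) (r : RExpr)
    (hW : B ^ r.size ≤ W) : r.eval W s = some (r.val s) := by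
  induction r with
  | get b e => simp [RExpr.eval, e.eval_eq hB hs hW]
  | add r1 r2 ih1 ih2 =>
    rw [RExpr.eval, ih1 (pow_le_of_le hB hW (by simp [RExpr.size])),
      ih2 (pow_le_of_le hB hW (by simp [RExpr.size]))]
    simp

open Classical in
theorem Test.eval_eq {B W : ℕ} (hB : 2 ≤ B) {s : State} (hs : s.Bdd B) (c : Test)
    (hW : B ^ c.size ≤ W) : c.eval W s = some (decide (c.holds s)) := by
  induction c with
  | wordLe e1 e2 =>
    rw [Test.eval, e1.eval_eq hB hs (pow_le_of_le hB hW (by simp [Test.size])),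
      e2.eval_eq hB hs (pow_le_of_le hB hW (by simp [Test.size]))]
    by_cases h : e1.val s ≤ e2.val s <;> simp [h]
  | realLe e1 e2 =>
    rw [Test.eval, e1.eval_eq hB hs (pow_le_of_le hB hW (by simp [Test.size])),
      e2.eval_eq hB hs (pow_le_of_le hB hW (by simp [Test.size]))]
    by_cases h : e1.val s ≤ e2.val s <;> simp [h]
  | not c ih =>
    rw [Test.eval, ih hW]; by_cases h : c.holds s <;> simp [h]
  | and c1 c2 ih1 ih2 =>
    rw [Test.eval, ih1 (pow_le_of_le hB hW (by simp [Test.size])),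
      ih2 (pow_le_of_le hB hW (by simp [Test.size]))]
    by_cases h : c1.holds s <;> by_cases h' : c2.holds s <;> simp [h, h']

/-- The bridge back to the machine. The exponent depends only on the program text, so a bound B that
is polynomial in the input size gives a polynomial word bound W. -/
theorem Program.Exec.run {B W : ℕ} (hB : 2 ≤ B) {p : Program} {s s' : State} {t : ℕ}
    (h : p.Exec B s t s') (hs : s.Bdd B) (hW : B ^ p.size ≤ W) : p.Run W s t s' := by
  have le {k l : ℕ} (hW : B ^ l ≤ W) (h : k ≤ l) : B ^ k ≤ W := pow_le_of_le hB hW h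
  induction h with
  | skip => exact .skip _
  | setWord hv =>
    exact .setWord (Expr.eval_eq hB hs _ (le hW (by simp [Program.size])))
      (Expr.eval_eq hB hs _ (le hW (by simp [Program.size])))
  | setReal =>
    exact .setReal (Expr.eval_eq hB hs _ (le hW (by simp [Program.size])))
      (RExpr.eval_eq hB hs _ (le hW (by simp [Program.size])))
  | seq hp _ ih1 ih2 =>
    exact .seq (ih1 hs (le hW (by simp [Program.size])))
      (ih2 (hp.bdd hs) (le hW (by simp [Program.size])))
  | ite_true hc _ ih =>
    exact .ite_true (by rw [Test.eval_eq hB hs _ (le hW (by simp [Program.size]; omega))]; simp [hc])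
      (ih hs (le hW (by simp [Program.size]; omega)))
  | ite_false hc _ ih =>
    exact .ite_false (by rw [Test.eval_eq hB hs _ (le hW (by simp [Program.size]; omega))]; simp [hc])
      (ih hs (le hW (by simp [Program.size])))
  | loop_true hc hp _ ih1 ih2 =>
    exact .loop_true (by rw [Test.eval_eq hB hs _ (le hW (by simp [Program.size]))]; simp [hc])
      (ih1 hs (le hW (by simp [Program.size]))) (ih2 (hp.bdd hs) hW)
  | loop_false hc =>
    exact .loop_false (by rw [Test.eval_eq hB hs _ (le hW (by simp [Program.size]))]; simp [hc])

/-! ### Frames -/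

/-- The word banks that a program may write. -/
@[simp] def Program.wr : Program → ℕ → Prop
  | .skip, _ => False
  | .setWord b _ _, b' => b' = b
  | .setReal _ _ _, _ => False
  | .seq p q, b => p.wr b ∨ q.wr b
  | .ite _ p q, b => p.wr b ∨ q.wr b
  | .loop _ p, b => p.wr b

/-- The real banks that a program may write. -/
@[simp] def Program.wrR : Program → ℕ → Prop
  | .skip, _ => False
  | .setWord _ _ _, _ => False
  | .setReal b _ _, b' => b' = b
  | .seq p q, b => p.wrR b ∨ q.wrR b
  | .ite _ p q, b => p.wrR b ∨ q.wrR b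
  | .loop _ p, b => p.wrR b

/-- `s` and `s'` agree outside of the banks that `p` may write. -/
structure Program.Frame (p : Program) (s s' : State) : Prop where
  w : ∀ b, ¬ p.wr b → s'.words b = s.words b
  r : ∀ b, ¬ p.wrR b → s'.reals b = s.reals b

theorem Program.Frame.refl (p : Program) (s : State) : p.Frame s s := ⟨fun _ _ => rfl, fun _ _ => rfl⟩

theorem Program.Frame.mono {p q : Program} {s s' : State} (h : p.Frame s s')
    (hw : ∀ b, p.wr b → q.wr b) (hr : ∀ b, p.wrR b → q.wrR b) : q.Frame s s' :=
  ⟨fun b hb => h.w b (mt (hw b) hb), fun b hb => h.r b (mt (hr b) hb)⟩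

theorem Program.Frame.trans {p : Program} {s s' s'' : State} (h : p.Frame s s')
    (h' : p.Frame s' s'') : p.Frame s s'' :=
  ⟨fun b hb => (h'.w b hb).trans (h.w b hb), fun b hb => (h'.r b hb).trans (h.r b hb)⟩

/-- Specifications need to mention only the banks that change in a relevant way; all other banks are
preserved by inspection of the program text. -/
theorem Program.Exec.frame {B : ℕ} {p : Program} {s s' : State} {t : ℕ} (h : p.Exec B s t s') :
    p.Frame s s' := by
  induction h with
  | skip => exact .refl _ _
  | setWord hv => exact ⟨fun b hb => State.words_of_ne _ (by simpa using hb) _ _, fun b hb => rfl⟩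
  | setReal => exact ⟨fun b hb => rfl,
      fun b hb => State.reals_writeReal_of_ne _ (by simpa using hb) _ _⟩
  | seq _ _ ih1 ih2 =>
    exact (ih1.mono (by simp +contextual) (by simp +contextual)).trans
      (ih2.mono (by simp +contextual) (by simp +contextual))
  | ite_true _ _ ih => exact ih.mono (by simp +contextual) (by simp +contextual)
  | ite_false _ _ ih => exact ih.mono (by simp +contextual) (by simp +contextual)
  | loop_true _ _ _ ih1 ih2 =>
    exact (ih1.mono (by simp +contextual) (by simp +contextual)).trans ih2
  | loop_false => exact .refl _ _

/-! ### Blocks without loops -/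

open Classical in
/-- The effect of a program without loops. -/
@[simp] noncomputable def Program.exec : Program → State → State
  | .skip, s => s
  | .setWord b e v, s => s.writeWord b (e.val s) (v.val s)
  | .setReal b e r, s => s.writeReal b (e.val s) (r.val s)
  | .seq p q, s => q.exec (p.exec s)
  | .ite c p q, s => if c.holds s then p.exec s else q.exec s
  | .loop _ _, s => s

/-- A program without loops stores only words below `B`. -/
@[simp] def Program.Safe (B : ℕ) : Program → State → Prop
  | .skip, _ => True
  | .setWord _ _ v, s => v.val s < B
  | .setReal _ _ _, _ => True
  | .seq p q, s => p.Safe B s ∧ q.Safe B (p.exec s)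
  | .ite c p q, s => (c.holds s → p.Safe B s) ∧ (¬ c.holds s → q.Safe B s)
  | .loop _ _, _ => False

/-- An upper bound for the cost of a program without loops. -/
def Program.cost : Program → ℕ
  | .skip => 1
  | .setWord _ e v => e.cost + v.cost + 1
  | .setReal _ e r => e.cost + r.cost + 1
  | .seq p q => p.cost + q.cost
  | .ite c p q => c.cost + p.cost + q.cost
  | .loop _ _ => 0

/-- Loop-free code is verified by computing with `exec` and `Safe` instead of inverting runs. -/
theorem Program.Safe.exec {B : ℕ} (p : Program) {s : State} (h : p.Safe B s) :
    ∃ t, p.Exec B s t (p.exec s) ∧ t ≤ p.cost := by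
  induction p generalizing s with
  | skip => exact ⟨_, .skip _, le_rfl⟩
  | setWord b e v => exact ⟨_, .setWord h, le_rfl⟩
  | setReal b e r => exact ⟨_, .setReal, le_rfl⟩
  | seq p q ih1 ih2 =>
    obtain ⟨t1, h1, l1⟩ := ih1 h.1; obtain ⟨t2, h2, l2⟩ := ih2 h.2
    exact ⟨_, .seq h1 h2, Nat.add_le_add l1 l2⟩
  | ite c p q ih1 ih2 =>
    by_cases hc : c.holds s
    · obtain ⟨t1, h1, l1⟩ := ih1 (h.1 hc); refine ⟨_, .ite_true hc (by simpa [hc] using h1), ?_⟩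
      simp only [Program.cost]; omega
    · obtain ⟨t1, h1, l1⟩ := ih2 (h.2 hc); refine ⟨_, .ite_false hc (by simpa [hc] using h1), ?_⟩
      simp only [Program.cost]; omega
  | loop c p => exact h.elim

/-! ### Total correctness with time bounds -/

/-- Started in `s`, with all words below `B`, the program halts within `T` time units in a state
satisfying `Q`. -/
def Tri (B : ℕ) (p : Program) (s : State) (T : ℕ) (Q : State → Prop) : Prop :=
  s.Bdd B → ∃ t s', p.Exec B s t s' ∧ t ≤ T ∧ Q s'

section Rules

variable {B T T1 T2 : ℕ} {p q : Program} {s : State} {Q R : State → Prop}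

theorem Tri.of_bdd (h : s.Bdd B → Tri B p s T Q) : Tri B p s T Q := fun hs => h hs hs

theorem Tri.mono (h : Tri B p s T1 R) (hT : T1 ≤ T) (hQ : ∀ s', p.Frame s s' → R s' → Q s') :
    Tri B p s T Q := fun hs =>
  let ⟨t, s', he, ht, hr⟩ := h hs
  ⟨t, s', he, ht.trans hT, hQ s' he.frame hr⟩

theorem Tri.block (hs : s.Bdd B → p.Safe B s) (hQ : Q (p.exec s)) (hT : p.cost ≤ T) :
    Tri B p s T Q := fun hb =>
  let ⟨t, he, ht⟩ := (hs hb).exec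
  ⟨t, _, he, ht.trans hT, hQ⟩

theorem Tri.seq (h1 : Tri B p s T1 R) (h2 : ∀ s', p.Frame s s' → R s' → Tri B q s' T2 Q)
    (hT : T1 + T2 ≤ T) : Tri B (.seq p q) s T Q := fun hs => by
  obtain ⟨t1, s1, he1, ht1, hr⟩ := h1 hs
  obtain ⟨t2, s2, he2, ht2, hq⟩ := h2 s1 he1.frame hr (he1.bdd hs)
  exact ⟨_, s2, .seq he1 he2, by omega, hq⟩

theorem Tri.ite {c : Test} (h1 : c.holds s → Tri B p s T1 Q) (h2 : ¬ c.holds s → Tri B q s T1 Q)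
    (hT : c.cost + T1 ≤ T) : Tri B (.ite c p q) s T Q := fun hs => by
  by_cases hc : c.holds s
  · obtain ⟨t, s', he, ht, hq⟩ := h1 hc hs; exact ⟨_, s', .ite_true hc he, by omega, hq⟩
  · obtain ⟨t, s', he, ht, hq⟩ := h2 hc hs; exact ⟨_, s', .ite_false hc he, by omega, hq⟩

/-- The index of the invariant is fuel: a bound on the remaining iterations, which need not be exact
because the loop may stop early. The frame from the initial state is supplied to `zero` and `step`,
so unchanged banks can be left out of the invariant. -/
theorem Tri.loop {c : Test} {f : ℕ} (I : ℕ → State → Prop) (h0 : I f s)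
    (zero : ∀ s', (Program.loop c p).Frame s s' → I 0 s' → ¬ c.holds s')
    (step : ∀ f s', (Program.loop c p).Frame s s' → I (f + 1) s' → c.holds s' → Tri B p s' T1 (I f))
    (hT : f * (T1 + c.cost) + c.cost ≤ T) (hQ : ∀ f s', I f s' → ¬ c.holds s' → Q s') :
    Tri B (.loop c p) s T Q := fun hs => by
  suffices H : ∀ f s', (Program.loop c p).Frame s s' → s'.Bdd B → I f s' →
      ∃ t s'', (Program.loop c p).Exec B s' t s'' ∧ t ≤ f * (T1 + c.cost) + c.cost ∧ Q s'' by
    obtain ⟨t, s', he, ht, hq⟩ := H f s (.refl _ _) hs h0; exact ⟨t, s', he, ht.trans hT, hq⟩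
  intro f
  induction f with
  | zero => exact fun s' hf hb hI => ⟨_, s', .loop_false (zero s' hf hI), by omega,
      hQ 0 s' hI (zero s' hf hI)⟩
  | succ f ih =>
    intro s' hf hb hI; by_cases hc : c.holds s'
    · obtain ⟨t, s1, he, ht, h1⟩ := step f s' hf hI hc hb
      have hf1 : (Program.loop c p).Frame s' s1 := he.frame.mono (by simp) (by simp)
      obtain ⟨t', s2, he', ht', hq⟩ := ih s1 (hf.trans hf1) (he.bdd hb) h1
      refine ⟨_, s2, .loop_true hc he he', ?_, hq⟩; rw [Nat.succ_mul]; omega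
    · exact ⟨_, s', .loop_false hc, by omega, hQ _ s' hI hc⟩

/-! ### Notation for programs -/

instance : Add Expr := ⟨.op .add⟩
instance : Sub Expr := ⟨.op .sub⟩
instance : Mul Expr := ⟨.op .mul⟩
instance : Div Expr := ⟨.op .div⟩
instance : Mod Expr := ⟨.op .mod⟩
instance (k : ℕ) : OfNat Expr k := ⟨.lit k⟩

@[simp] theorem Expr.val_add (e1 e2 : Expr) : (e1 + e2).val s = e1.val s + e2.val s := rfl
@[simp] theorem Expr.val_sub (e1 e2 : Expr) : (e1 - e2).val s = e1.val s - e2.val s := rfl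
@[simp] theorem Expr.val_mul (e1 e2 : Expr) : (e1 * e2).val s = e1.val s * e2.val s := rfl
@[simp] theorem Expr.val_div (e1 e2 : Expr) : (e1 / e2).val s = e1.val s / e2.val s := rfl
@[simp] theorem Expr.val_mod (e1 e2 : Expr) : (e1 % e2).val s = e1.val s % e2.val s := rfl
@[simp] theorem Expr.val_ofNat (k : ℕ) : Expr.val s (OfNat.ofNat k) = k := rfl

end Rules

/-- The variable held in cell `0` of word bank `b`. -/
abbrev var (b : ℕ) : Expr := .get b 0

/-- Assignment to the variable held in cell `0` of word bank `b`. -/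
abbrev assign (b : ℕ) (v : Expr) : Program := .setWord b 0 v

abbrev Test.lt (e1 e2 : Expr) : Test := .not (.wordLe e2 e1)

abbrev Test.eq (e1 e2 : Expr) : Test := .and (.wordLe e1 e2) (.wordLe e2 e1)

theorem Test.holds_lt {s : State} {e1 e2 : Expr} : (Test.lt e1 e2).holds s ↔ e1.val s < e2.val s := by
  simp

theorem Test.holds_eq {s : State} {e1 e2 : Expr} : (Test.eq e1 e2).holds s ↔ e1.val s = e2.val s := by
  simp [le_antisymm_iff]

infixr:60 " ;; " => Program.seq

/-- `for v = 0, …, e - 1 do p`, with the loop variable in cell `0` of word bank `v`. -/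
def forLoop (v : ℕ) (e : Expr) (p : Program) : Program :=
  assign v 0 ;; .loop (.lt (var v) e) (p ;; assign v (var v + 1))

@[simp] theorem forLoop_wr {v : ℕ} {e : Expr} {p : Program} {b : ℕ} :
    (forLoop v e p).wr b ↔ b = v ∨ p.wr b := by simp [forLoop]; tauto

@[simp] theorem forLoop_wrR {v : ℕ} {e : Expr} {p : Program} {b : ℕ} :
    (forLoop v e p).wrR b ↔ p.wrR b := by simp [forLoop]

/-- The counter changes between two iterations, so the invariant has to be insensitive to writes to
the loop variable (`hI`); the bound is evaluated anew each time, so its value must be constant on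
the frame (`he`). -/
theorem Tri.forLoop {B T Tb N v : ℕ} {e : Expr} {p : Program} {s : State} {Q : State → Prop}
    (I : ℕ → State → Prop) (hv : ¬ p.wr v) (hN : N < B)
    (he : ∀ s', (forLoop v e p).Frame s s' → e.val s' = N)
    (h0 : I 0 s) (hI : ∀ i s' x, I i s' → I i (s'.writeWord v 0 x))
    (step : ∀ i s', i < N → s'.words v 0 = i → (RAM.forLoop v e p).Frame s s' → I i s' →
      Tri B p s' Tb (I (i + 1))) (hT : N * (Tb + (e.cost + 10)) + (e.cost + 8) ≤ T)
    (hQ : ∀ s', (RAM.forLoop v e p).Frame s s' → s'.words v 0 = N → I N s' → Q s') :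
    Tri B (forLoop v e p) s T Q := by
  have hc : (Test.lt (var v) e).cost = e.cost + 4 := by simp [Test.cost, Expr.cost, OfNat.ofNat]
  have hca : (assign v (var v + 1)).cost = 6 := rfl
  have hf0 : (RAM.forLoop v e p).Frame s (s.writeWord v 0 0) :=
    ⟨fun b hb => State.words_of_ne _ (by simp at hb; tauto) _ _, fun b hb => rfl⟩
  refine Tri.seq (R := fun s' => s' = s.writeWord v 0 0) (T1 := 3)
    (T2 := N * (Tb + 6 + (e.cost + 4)) + (e.cost + 4))
    (Tri.block (by intro; simp; omega) (by simp) (le_of_eq rfl)) ?_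
    (le_trans (by rw [show Tb + 6 + (e.cost + 4) = Tb + (e.cost + 10) by ring]; omega) hT)
  rintro s' - rfl
  refine Tri.loop (T1 := Tb + 6) (f := N)
    -- The fuel is the number N - i of iterations still to come.
    (fun f s' => ∃ i, i + f = N ∧ s'.words v 0 = i ∧ I i s' ∧ (RAM.forLoop v e p).Frame s s')
    ⟨0, by omega, by simp, hI _ _ _ h0, hf0⟩ ?_ ?_ (by rw [hc]) ?_
  · rintro s' hf ⟨i, hi, hvi, hIi, hfi⟩; rw [Test.holds_lt, he _ hfi]; simp [hvi]; omega
  · rintro f s' hf ⟨i, hi, hvi, hIi, hfi⟩ -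
    have hi' : i < N := by omega
    refine Tri.seq (step i s' hi' hvi hfi hIi) ?_ le_rfl; intro s1 hf1 h1
    have hv1 : s1.words v 0 = i := by rw [hf1.w v hv, hvi]
    refine Tri.block (by intro; simp [hv1]; omega) ?_ hca.le
    refine ⟨i + 1, by omega, by simp [hv1], ?_, ?_⟩
    · exact hI _ _ _ h1
    · refine hfi.trans ((hf1.mono (by simp +contextual) (by simp)).trans ⟨?_, ?_⟩)
      · intro b hb; exact State.words_of_ne _ (by simp at hb; tauto) _ _
      · intro b hb; rfl
  · rintro f s' ⟨i, hi, hvi, hIi, hfi⟩ hc; rw [Test.holds_lt, he _ hfi] at hc; simp [hvi] at hc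
    obtain rfl : i = N := by omega
    exact hQ s' hfi hvi hIi

/-- `p.Steps B c s t s'`: some iterations of the loop `while c do p` lead from `s` to `s'`. -/
inductive Program.Steps (B : ℕ) (c : Test) (p : Program) : State → ℕ → State → Prop
  | refl (s : State) : Steps B c p s 0 s
  | step {s s' s'' : State} {t t' : ℕ} (hc : c.holds s) (hp : p.Exec B s t s')
      (hs : Steps B c p s' t' s'') : Steps B c p s (c.cost + t + t') s''

/-- The elimination carries out a recursion inside a single loop. A recursive call is a segment of
consecutive iterations, and segments are concatenated here. -/
theorem Program.Steps.trans {B : ℕ} {c : Test} {p : Program} {s s' s'' : State} {t t' : ℕ}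
    (h : p.Steps B c s t s') (h' : p.Steps B c s' t' s'') : p.Steps B c s (t + t') s'' := by
  induction h with
  | refl => simpa using h'
  | step hc hp _ ih => rw [Nat.add_assoc]; exact .step hc hp (ih h')

theorem Program.Steps.exec {B : ℕ} {c : Test} {p : Program} {s s' : State} {t : ℕ}
    (h : p.Steps B c s t s') (hc : ¬ c.holds s') : (Program.loop c p).Exec B s (t + c.cost) s' := by
  induction h with
  | refl => simpa using Exec.loop_false hc
  | step h hp _ ih => rw [Nat.add_assoc]; exact .loop_true h hp (ih hc)

theorem Program.Steps.bdd {B : ℕ} {c : Test} {p : Program} {s s' : State} {t : ℕ}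
    (h : p.Steps B c s t s') (hs : s.Bdd B) : s'.Bdd B := by
  induction h with
  | refl => exact hs
  | step _ hp _ ih => exact ih (hp.bdd hs)

end RAM

/-! ## Calling a program on a fresh part of the memory -/

namespace RAM

theorem eval_get {W : ℕ} {s : State} {b : ℕ} {e : Expr} {v : ℕ}
    (h : (Expr.get b e).eval W s = some v) : ∃ a, e.eval W s = some a ∧ s.words b a = v := by
  simp only [Expr.eval, Option.bind_eq_some_iff, word] at h; obtain ⟨a, ha, hv⟩ := h
  split_ifs at hv; exact ⟨a, ha, by simpa using hv⟩

theorem eval_op {W : ℕ} {s : State} {o : Op} {e1 e2 : Expr} {v : ℕ}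
    (h : (Expr.op o e1 e2).eval W s = some v) :
    ∃ x y, e1.eval W s = some x ∧ e2.eval W s = some y ∧ o.apply x y = v := by
  simp only [Expr.eval, Option.bind_eq_some_iff, word] at h; obtain ⟨x, hx, y, hy, hv⟩ := h
  split_ifs at hv; exact ⟨x, y, hx, hy, by simpa using hv⟩

theorem eval_lt {W : ℕ} {s : State} {e : Expr} {v : ℕ} (h : e.eval W s = some v) : v < W := by
  cases e <;> simp only [Expr.eval, Option.bind_eq_some_iff, word] at h
  · split_ifs at h with h'; simp at h; omega
  · obtain ⟨a, -, hv⟩ := h; split_ifs at hv with h'; simp at hv; omega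
  · obtain ⟨x, -, y, -, hv⟩ := h; split_ifs at hv with h'; simp at hv; omega

theorem word_mono {W W' : ℕ} (hW : W ≤ W') {k v : ℕ} (h : word W k = some v) :
    word W' k = some v := by unfold word at h ⊢; split_ifs at h with h'; rw [if_pos (by omega), h]

theorem Expr.eval_mono {W W' : ℕ} (hW : W ≤ W') {s : State} {e : Expr} {v : ℕ}
    (h : e.eval W s = some v) : e.eval W' s = some v := by
  induction e generalizing v with
  | lit k => exact word_mono hW h
  | get b e ih =>
    simp only [Expr.eval, Option.bind_eq_some_iff] at h ⊢; obtain ⟨a, ha, hv⟩ := h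
    exact ⟨a, ih ha, word_mono hW hv⟩
  | op o e1 e2 ih1 ih2 =>
    simp only [Expr.eval, Option.bind_eq_some_iff] at h ⊢; obtain ⟨x, hx, y, hy, hv⟩ := h
    exact ⟨x, ih1 hx, y, ih2 hy, word_mono hW hv⟩

theorem RExpr.eval_mono {W W' : ℕ} (hW : W ≤ W') {s : State} {r : RExpr} {v : ℝ}
    (h : r.eval W s = some v) : r.eval W' s = some v := by
  induction r generalizing v with
  | get b e =>
    simp only [RExpr.eval, Option.map_eq_some_iff] at h ⊢; obtain ⟨a, ha, hv⟩ := h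
    exact ⟨a, Expr.eval_mono hW ha, hv⟩
  | add r1 r2 ih1 ih2 =>
    simp only [RExpr.eval, Option.bind_eq_some_iff, Option.map_eq_some_iff] at h ⊢
    obtain ⟨x, hx, y, hy, hv⟩ := h; exact ⟨x, ih1 hx, y, ih2 hy, hv⟩

theorem Test.eval_mono {W W' : ℕ} (hW : W ≤ W') {s : State} {c : Test} {v : Bool}
    (h : c.eval W s = some v) : c.eval W' s = some v := by
  induction c generalizing v with
  | wordLe e1 e2 =>
    simp only [Test.eval, Option.bind_eq_some_iff, Option.map_eq_some_iff] at h ⊢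
    obtain ⟨x, hx, y, hy, hv⟩ := h; exact ⟨x, Expr.eval_mono hW hx, y, Expr.eval_mono hW hy, hv⟩
  | realLe e1 e2 =>
    simp only [Test.eval, Option.bind_eq_some_iff, Option.map_eq_some_iff] at h ⊢
    obtain ⟨x, hx, y, hy, hv⟩ := h; exact ⟨x, RExpr.eval_mono hW hx, y, RExpr.eval_mono hW hy, hv⟩
  | not c ih =>
    simp only [Test.eval, Option.map_eq_some_iff] at h ⊢; obtain ⟨x, hx, hv⟩ := h
    exact ⟨x, ih hx, hv⟩
  | and c1 c2 ih1 ih2 =>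
    simp only [Test.eval, Option.bind_eq_some_iff, Option.map_eq_some_iff] at h ⊢
    obtain ⟨x, hx, y, hy, hv⟩ := h; exact ⟨x, ih1 hx, y, ih2 hy, hv⟩

theorem Program.Run.mono {W W' : ℕ} (hW : W ≤ W') {p : Program} {s s' : State} {t : ℕ}
    (h : p.Run W s t s') : p.Run W' s t s' := by
  induction h with
  | skip s => exact .skip s
  | setWord he hv => exact .setWord (Expr.eval_mono hW he) (Expr.eval_mono hW hv)
  | setReal he hr => exact .setReal (Expr.eval_mono hW he) (RExpr.eval_mono hW hr)
  | seq _ _ ih1 ih2 => exact .seq ih1 ih2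
  | ite_true hc _ ih => exact .ite_true (Test.eval_mono hW hc) ih
  | ite_false hc _ ih => exact .ite_false (Test.eval_mono hW hc) ih
  | loop_true hc _ _ ih1 ih2 => exact .loop_true (Test.eval_mono hW hc) ih1 ih2
  | loop_false hc => exact .loop_false (Test.eval_mono hW hc)

/-- A run with words below `W` does not touch the cells from address `W` on. -/
theorem Program.Run.words_of_le {W : ℕ} {p : Program} {s s' : State} {t : ℕ}
    (h : p.Run W s t s') : ∀ b a, W ≤ a →
      s'.words b a = s.words b a ∧ s'.reals b a = s.reals b a := by
  induction h with
  | skip s => simp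
  | @setWord s b e v a x he hv =>
    intro b' a' ha; have := eval_lt he; rw [State.words_writeWord, if_neg (by omega)]; simp
  | @setReal s b e r a x he hr =>
    intro b' a' ha; have := eval_lt he; rcases eq_or_ne b' b with rfl | hb
    · simp [show a' ≠ a by omega]
    · simp [hb]
  | seq _ _ ih1 ih2 =>
    intro b a ha; simp [(ih1 b a ha).1, (ih2 b a ha).1, (ih1 b a ha).2, (ih2 b a ha).2]
  | ite_true hc _ ih => exact ih
  | ite_false hc _ ih => exact ih
  | loop_true hc _ _ ih1 ih2 =>
    intro b a ha; simp [(ih1 b a ha).1, (ih2 b a ha).1, (ih1 b a ha).2, (ih2 b a ha).2]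
  | loop_false hc => simp

/-! ### Relocation

`shift o v` moves all banks by `o`, and all addresses by the content of the variable `v`. -/

def Expr.shift (o v : ℕ) : Expr → Expr
  | .lit k => .lit k
  | .get b e => .get (b + o) (var v + e.shift o v)
  | .op p e1 e2 => .op p (e1.shift o v) (e2.shift o v)

def RExpr.shift (o v : ℕ) : RExpr → RExpr
  | .get b e => .get (b + o) (var v + e.shift o v)
  | .add r1 r2 => .add (r1.shift o v) (r2.shift o v)

def Test.shift (o v : ℕ) : Test → Test
  | .wordLe e1 e2 => .wordLe (e1.shift o v) (e2.shift o v)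
  | .realLe r1 r2 => .realLe (r1.shift o v) (r2.shift o v)
  | .not c => .not (c.shift o v)
  | .and c1 c2 => .and (c1.shift o v) (c2.shift o v)

def Program.shift (o v : ℕ) : Program → Program
  | .skip => .skip
  | .setWord b e x => .setWord (b + o) (var v + e.shift o v) (x.shift o v)
  | .setReal b e r => .setReal (b + o) (var v + e.shift o v) (r.shift o v)
  | .seq p q => .seq (p.shift o v) (q.shift o v)
  | .ite c p q => .ite (c.shift o v) (p.shift o v) (q.shift o v)
  | .loop c p => .loop (c.shift o v) (p.shift o v)

theorem Program.le_of_shift_wr {o v : ℕ} {p : Program} {b : ℕ} (h : (p.shift o v).wr b) : o ≤ b := by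
  induction p <;> simp_all [Program.shift] <;> tauto

theorem Program.le_of_shift_wrR {o v : ℕ} {p : Program} {b : ℕ} (h : (p.shift o v).wrR b) :
    o ≤ b := by
  induction p <;> simp_all [Program.shift] <;> tauto

/-- `S` holds a copy of `s`, relocated by the bank offset `o` and the address offset `a0`. -/
def Relocated (o a0 : ℕ) (s S : State) : Prop :=
  ∀ b a, S.words (b + o) (a0 + a) = s.words b a ∧ S.reals (b + o) (a0 + a) = s.reals b a

section Shift

variable {W o v a0 : ℕ} {s S : State}

theorem Expr.val_shift (h : Relocated o a0 s S) (hv : S.words v 0 = a0) {e : Expr} {x : ℕ}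
    (he : e.eval W s = some x) : (e.shift o v).val S = x := by
  induction e generalizing x with
  | lit k =>
    simp only [Expr.eval, word] at he; split_ifs at he; simpa [Expr.shift] using he
  | get b e ih =>
    obtain ⟨a, ha, rfl⟩ := eval_get he; simp [Expr.shift, ih ha, hv, (h b a).1]
  | op p e1 e2 ih1 ih2 =>
    obtain ⟨x, y, hx, hy, rfl⟩ := eval_op he; simp [Expr.shift, ih1 hx, ih2 hy]

/-- A relocated access pays three extra units: two to read the variable `v` and one to add it to the
address. -/
theorem Expr.cost_shift (e : Expr) : (e.shift o v).cost ≤ 4 * e.cost := by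
  induction e <;> simp only [Expr.shift, Expr.cost] <;> omega

theorem RExpr.val_shift (h : Relocated o a0 s S) (hv : S.words v 0 = a0) {e : RExpr} {x : ℝ}
    (he : e.eval W s = some x) : (e.shift o v).val S = x := by
  induction e generalizing x with
  | get b e =>
    simp only [RExpr.eval, Option.map_eq_some_iff] at he; obtain ⟨a, ha, rfl⟩ := he
    simp [RExpr.shift, Expr.val_shift h hv ha, hv, (h b a).2]
  | add e1 e2 ih1 ih2 =>
    simp only [RExpr.eval, Option.bind_eq_some_iff, Option.map_eq_some_iff] at he
    obtain ⟨x, hx, y, hy, rfl⟩ := he; simp [RExpr.shift, ih1 hx, ih2 hy]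

theorem RExpr.cost_shift (e : RExpr) : (e.shift o v).cost ≤ 4 * e.cost := by
  induction e with
  | get b e =>
    have := e.cost_shift (o := o) (v := v); simp only [RExpr.shift, RExpr.cost]
    change (1 + 1 + _ + 1) + 1 ≤ _; omega
  | add e1 e2 ih1 ih2 => simp only [RExpr.shift, RExpr.cost]; omega

theorem Test.holds_shift (h : Relocated o a0 s S) (hv : S.words v 0 = a0) {c : Test} {x : Bool}
    (hc : c.eval W s = some x) : (c.shift o v).holds S ↔ x = true := by
  induction c generalizing x with
  | wordLe e1 e2 =>
    simp only [Test.eval, Option.bind_eq_some_iff, Option.map_eq_some_iff] at hc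
    obtain ⟨x, hx, y, hy, rfl⟩ := hc
    simp [Test.shift, Expr.val_shift h hv hx, Expr.val_shift h hv hy]
  | realLe e1 e2 =>
    simp only [Test.eval, Option.bind_eq_some_iff, Option.map_eq_some_iff] at hc
    obtain ⟨x, hx, y, hy, rfl⟩ := hc
    simp [Test.shift, RExpr.val_shift h hv hx, RExpr.val_shift h hv hy]
  | not c ih =>
    simp only [Test.eval, Option.map_eq_some_iff] at hc; obtain ⟨x, hx, rfl⟩ := hc
    simp [Test.shift, ih hx]
  | and c1 c2 ih1 ih2 =>
    simp only [Test.eval, Option.bind_eq_some_iff, Option.map_eq_some_iff] at hc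
    obtain ⟨x, hx, y, hy, rfl⟩ := hc; simp [Test.shift, ih1 hx, ih2 hy]

theorem Test.cost_shift (c : Test) : (c.shift o v).cost ≤ 4 * c.cost := by
  induction c with
  | wordLe e1 e2 =>
    have := e1.cost_shift (o := o) (v := v); have := e2.cost_shift (o := o) (v := v)
    simp only [Test.shift, Test.cost]; omega
  | realLe e1 e2 =>
    have := e1.cost_shift (o := o) (v := v); have := e2.cost_shift (o := o) (v := v)
    simp only [Test.shift, Test.cost]; omega
  | not c ih => simp only [Test.shift, Test.cost]; omega
  | and c1 c2 ih1 ih2 => simp only [Test.shift, Test.cost]; omega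

/-- The run is simulated step by step. The offset variable lives in a bank below `o`, which
relocated code never writes (`Program.le_of_shift_wr`), so the offset stays constant throughout. -/
theorem Program.Run.shift {B : ℕ} (hW : W ≤ B) (hvo : v < o) {p : Program} {s' : State} {t : ℕ}
    (hp : p.Run W s t s') (h : Relocated o a0 s S) (hv : S.words v 0 = a0) :
    ∃ t' S', (p.shift o v).Exec B S t' S' ∧ t' ≤ 4 * t ∧ Relocated o a0 s' S' ∧
      ∀ b a, a < a0 → S'.words b a = S.words b a ∧ S'.reals b a = S.reals b a := by
  induction hp generalizing S with
  | skip s => exact ⟨1, S, .skip _, by omega, h, by simp⟩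
  | @setWord s b e x a y he hx =>
    have he' := e.val_shift h hv he; have hx' := x.val_shift h hv hx
    refine ⟨_, _, .setWord ?_, ?_, ?_, ?_⟩
    · rw [hx']; exact (eval_lt hx).trans_le hW
    · have := e.cost_shift (o := o) (v := v); have := x.cost_shift (o := o) (v := v)
      change (1 + 1 + _ + 1) + _ + 1 ≤ _; omega
    · intro b' a'; simp only [Expr.val_add, he', hx', State.words_writeWord, State.reals_writeWord]
      simp [hv, h b' a']
    · intro b' a' ha'
      simp only [Expr.val_add, he', hx', State.words_writeWord, State.reals_writeWord]
      simp [hv]; omega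
  | @setReal s b e r a y he hr =>
    have he' := e.val_shift h hv he; have hx' := r.val_shift h hv hr
    refine ⟨_, _, .setReal, ?_, ?_, ?_⟩
    · have := e.cost_shift (o := o) (v := v); have := r.cost_shift (o := o) (v := v)
      change (1 + 1 + _ + 1) + _ + 1 ≤ _; omega
    · intro b' a'; simp only [Expr.val_add, he', hx', State.words_writeReal]
      refine ⟨(h b' a').1, ?_⟩; rcases eq_or_ne b' b with rfl | hb
      · simp [hv, h b' a']
      · simp [hb, h b' a']
    · intro b' a' ha'; simp only [Expr.val_add, he', hx', State.words_writeReal, true_and]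
      rcases eq_or_ne b' (b + o) with rfl | hb
      · simp [hv]; omega
      · simp [hb]
  | seq _ _ ih1 ih2 =>
    obtain ⟨t1, S1, e1, l1, r1, f1⟩ := ih1 h hv
    have hv1 : S1.words v 0 = a0 := by
      rw [e1.frame.w v (fun hw => by have := Program.le_of_shift_wr hw; omega), hv]
    obtain ⟨t2, S2, e2, l2, r2, f2⟩ := ih2 r1 hv1
    exact ⟨_, S2, .seq e1 e2, by omega, r2, fun b a ha =>
      ⟨(f2 b a ha).1.trans (f1 b a ha).1, (f2 b a ha).2.trans (f1 b a ha).2⟩⟩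
  | @ite_true c _ _ _ _ _ hc _ ih =>
    obtain ⟨t1, S1, e1, l1, r1⟩ := ih h hv; have := c.cost_shift (o := o) (v := v)
    exact ⟨_, S1, .ite_true (by rw [Test.holds_shift h hv hc]) e1, by omega, r1⟩
  | @ite_false c _ _ _ _ _ hc _ ih =>
    obtain ⟨t1, S1, e1, l1, r1⟩ := ih h hv; have := c.cost_shift (o := o) (v := v)
    exact ⟨_, S1, .ite_false (by rw [Test.holds_shift h hv hc]; simp) e1, by omega, r1⟩
  | @loop_true c _ _ _ _ _ _ hc _ _ ih1 ih2 =>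
    have := c.cost_shift (o := o) (v := v); obtain ⟨t1, S1, e1, l1, r1, f1⟩ := ih1 h hv
    have hv1 : S1.words v 0 = a0 := by
      rw [e1.frame.w v (fun hw => by have := Program.le_of_shift_wr hw; omega), hv]
    obtain ⟨t2, S2, e2, l2, r2, f2⟩ := ih2 r1 hv1
    exact ⟨_, S2, .loop_true (by rw [Test.holds_shift h hv hc]) e1 e2, by omega, r2, fun b a ha =>
      ⟨(f2 b a ha).1.trans (f1 b a ha).1, (f2 b a ha).2.trans (f1 b a ha).2⟩⟩
  | @loop_false c _ _ hc =>
    have := c.cost_shift (o := o) (v := v)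
    exact ⟨_, S, .loop_false (by rw [Test.holds_shift h hv hc]; simp), by omega, h, by simp⟩

end Shift

/-- `P` multiplies `n × n` matrices over `ℤ/2` in `τ n` time units, with words below
`(n + 2) ^ c`. -/
def Multiplies (P : Program) (c : ℕ) (τ : ℕ → ℕ) : Prop :=
  ∀ (n : ℕ), 1 ≤ n → ∀ A B : Matrix (Fin n) (Fin n) (ZMod 2), ∃ (t : ℕ) (s : State),
    P.Run ((n + 2) ^ c) (State.input [[n], rowMajor A, rowMajor B] []) t s ∧ t ≤ τ n ∧
      ∀ i j : Fin n, s.words 3 (i * n + j) = ((A * B) i j).val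

theorem MatMulIn.multiplies {ω : ℝ} (h : MatMulIn ω) :
    ∃ (P : Program) (c : ℕ) (C : ℝ), 0 ≤ C ∧ 2 ≤ c ∧
      Multiplies P c (fun n => ⌊C * (n : ℝ) ^ ω⌋₊) := by
  obtain ⟨P, c, C, h⟩ := h
  refine ⟨P, max c 2, max C 0, le_max_right _ _, le_max_right _ _, fun n hn A B => ?_⟩
  obtain ⟨t, s, hr, ht, ho⟩ := h n hn A B
  refine ⟨t, s, hr.mono (Nat.pow_le_pow_right (by omega) (le_max_left _ _)), Nat.le_floor ?_, ho⟩
  exact ht.trans (mul_le_mul_of_nonneg_right (le_max_left _ _) (by positivity))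

theorem getD_rowMajor {n : ℕ} (A : Matrix (Fin n) (Fin n) (ZMod 2)) (a : ℕ) :
    (rowMajor A).getD a 0 = if h : a < n * n then (A ⟨a / n, Nat.div_lt_of_lt_mul h⟩
        ⟨a % n, Nat.mod_lt _ (Nat.pos_of_ne_zero (by rintro rfl; simp at h))⟩).val else 0 := by
  have hlen : ∀ l : List (Fin n), (l.flatMap fun i => (List.finRange n).map fun j => (A i j).val).length
      = l.length * n := by intro l; simp [List.length_flatMap]
  have key : ∀ (l : List (Fin n)) (a : ℕ) (ha : a < l.length * n) (hn : 0 < n),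
      (l.flatMap fun i => (List.finRange n).map fun j => (A i j).val).getD a 0 =
        (A (l[a / n]'(Nat.div_lt_of_lt_mul (by rwa [mul_comm]))) ⟨a % n, Nat.mod_lt _ hn⟩).val := by
    intro l
    induction l with
    | nil => intro a ha; simp at ha
    | cons x l ih =>
      intro a ha hn; rw [List.flatMap_cons]; by_cases h : a < n
      · rw [List.getD_append _ _ _ _ (by simpa using h)]; have h0 : a / n = 0 := Nat.div_eq_of_lt h
        simp [h, Nat.mod_eq_of_lt h, h0]
      · rw [List.getD_append_right _ _ _ _ (by simpa using h)]
        push Not at h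
        have e1 : a / n = (a - n) / n + 1 := Nat.div_eq_sub_div hn h
        simp only [List.length_map, List.length_finRange]
        rw [ih (a - n) (by simp [Nat.succ_mul] at ha; omega) hn]; simp [e1, Nat.mod_eq_sub_mod h]
  split_ifs with h
  · have hn : 0 < n := Nat.pos_of_ne_zero (by rintro rfl; simp at h); unfold rowMajor
    rw [key _ a (by simpa using h) hn]; simp
  · rw [List.getD_eq_default]; unfold rowMajor; rw [hlen]; simp; omega

/-- The call of a matrix multiplication program on a fresh part of the memory. -/
theorem Multiplies.call {P : Program} {c : ℕ} {τ : ℕ → ℕ} (hP : Multiplies P c τ) {B n o v a0 : ℕ}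
    {S : State} (hn : 1 ≤ n) (hvo : v < o) (hv : S.words v 0 = a0) (hB : (n + 2) ^ c ≤ B)
    (X Y : Matrix (Fin n) (Fin n) (ZMod 2))
    (hX : ∀ i j : Fin n, S.words (1 + o) (a0 + (i * n + j)) = (X i j).val)
    (hY : ∀ i j : Fin n, S.words (2 + o) (a0 + (i * n + j)) = (Y i j).val)
    (h0 : S.words (0 + o) a0 = n)
    (hz : ∀ b a, (b = 0 → 1 ≤ a) → (b = 1 ∨ b = 2 → n * n ≤ a) → S.words (b + o) (a0 + a) = 0)
    (hr : ∀ b a, S.reals (b + o) (a0 + a) = 0) : Tri B (P.shift o v) S (4 * τ n) (fun S' =>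
      (∀ i j : Fin n, S'.words (3 + o) (a0 + (i * n + j)) = ((X * Y) i j).val) ∧
      (∀ b a, a0 + (n + 2) ^ c ≤ a → S'.words (b + o) a = S.words (b + o) a ∧
        S'.reals (b + o) a = S.reals (b + o) a)) := by
  intro _; obtain ⟨t, s, hrun, ht, ho⟩ := hP n hn X Y
  have hm : ∀ (f : Matrix (Fin n) (Fin n) (ZMod 2)) (b : ℕ), (b = 1 ∨ b = 2) →
      (∀ i j : Fin n, S.words (b + o) (a0 + (i * n + j)) = (f i j).val) →
      ∀ a, S.words (b + o) (a0 + a) = (rowMajor f).getD a 0 := by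
    intro f b hb hf a; rw [getD_rowMajor]; split_ifs with ha
    · rw [← hf]; simp [Nat.div_add_mod' a n]
    · exact hz b a (by omega) (fun _ => by omega)
  have hrel : Relocated o a0 (State.input [[n], rowMajor X, rowMajor Y] []) S := by
    intro b a; refine ⟨?_, by simpa [State.input] using hr b a⟩
    match b with
    | 0 =>
      rcases Nat.eq_zero_or_pos a with rfl | ha
      · simpa [State.input] using h0
      · rw [hz 0 a (fun _ => ha) (by omega)]; simp [State.input]
        rw [List.getElem?_eq_none (by simpa using Nat.succ_le_of_lt ha)]; rfl
    | 1 => simpa [State.input] using hm X 1 (by simp) hX a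
    | 2 => simpa [State.input] using hm Y 2 (by simp) hY a
    | b + 3 =>
      rw [hz (b + 3) a (by omega) (by omega)]; simp [State.input]
  obtain ⟨t', S', he, ht', hrel', -⟩ := hrun.shift hB hvo hrel hv
  refine ⟨t', S', he, by omega, ?_, ?_⟩
  · intro i j; rw [(hrel' 3 _).1, ho]
  -- A cell from `a0 + (n + 2) ^ c` on corresponds to an address that does not fit into a word of
  -- the original run, so the run cannot have touched it.
  · intro b a ha; obtain ⟨a, rfl⟩ := Nat.exists_eq_add_of_le (show a0 ≤ a by omega)
    have := hrun.words_of_le b a (by omega)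
    rw [(hrel' b a).1, (hrel' b a).2, this.1, this.2, (hrel b a).1, (hrel b a).2]; simp

end RAM

/-! ## Gauss–Jordan elimination over `ℤ/2` -/

namespace GaussJordan

/-- Vectors over `ℤ/2`. -/
abbrev Vec := ℕ → ZMod 2

/-- The transformation `v ↦ v + ∑ v (p t) • U t`, the sum over the columns `t` from `a` to `b - 1`
with a pivot row `p t`, where `piv t = p t + 1`, and `piv t = 0` for columns without pivot row. -/
noncomputable def blk (piv : ℕ → ℕ) (U : ℕ → Vec) (a b : ℕ) : Vec →ₗ[ZMod 2] Vec :=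
  LinearMap.id + ∑ t ∈ Finset.Ico a b,
    if piv t = 0 then 0 else (LinearMap.proj (piv t - 1)).smulRight (U t)

variable {N a m b : ℕ} {piv : ℕ → ℕ} {U M0 : ℕ → Vec} {used : ℕ → Prop}

theorem blk_apply (v : Vec) : blk piv U a b v =
    v + ∑ t ∈ Finset.Ico a b, if piv t = 0 then 0 else v (piv t - 1) • U t := by
  simp only [blk, LinearMap.add_apply, LinearMap.id_apply, LinearMap.sum_apply]
  congr 1
  refine Finset.sum_congr rfl fun t _ => ?_; split_ifs <;> simp

theorem blk_congr {piv' : ℕ → ℕ} {U' : ℕ → Vec} (hp : ∀ t, a ≤ t → t < b → piv t = piv' t)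
    (hU : ∀ t, a ≤ t → t < b → U t = U' t) : blk piv U a b = blk piv' U' a b := by
  ext1 v; rw [blk_apply, blk_apply]
  congr 1
  refine Finset.sum_congr rfl fun t ht => ?_; rw [Finset.mem_Ico] at ht
  rw [hp t ht.1 ht.2, hU t ht.1 ht.2]

theorem blk_eq_self {v : Vec} (h : ∀ t, a ≤ t → t < b → piv t ≠ 0 → v (piv t - 1) = 0) :
    blk piv U a b v = v := by
  rw [blk_apply, Finset.sum_eq_zero, add_zero]; intro t ht; rw [Finset.mem_Ico] at ht
  split_ifs with h0
  · rfl
  · rw [h t ht.1 ht.2 h0, zero_smul]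

/-- By linearity, the second transformation acts on v and on each stored column U1 t, while the
coefficients v (p t) remain those of the original v. Thus a composite has the same form once the
left columns are passed through the right block, and it can be kept in the same storage. -/
theorem blk_comp {U1 U2 : ℕ → Vec} (ham : a ≤ m) (hmb : m ≤ b)
    (hL : ∀ t, a ≤ t → t < m → U t = blk piv U2 m b (U1 t))
    (hR : ∀ t, m ≤ t → t < b → U t = U2 t) (v : Vec) :
    blk piv U a b v = blk piv U2 m b (blk piv U1 a m v) := by
  have h1 : blk piv U m b v = blk piv U2 m b v := by rw [blk_congr (fun _ _ _ => rfl) hR]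
  rw [blk_apply (a := a) (b := m), map_add, ← h1, map_sum, blk_apply, blk_apply,
    ← Finset.sum_Ico_consecutive _ ham hmb, add_assoc]
  congr 1
  rw [add_comm]
  congr 1
  refine Finset.sum_congr rfl fun t ht => ?_; rw [Finset.mem_Ico] at ht; split_ifs with h0
  · simp
  · rw [map_smul, hL t ht.1 ht.2]

/-- The outcome of the elimination of the columns `M0 t` for `a ≤ t < b`, with pivot rows outside
of `used`. -/
structure Elim (N : ℕ) (used : ℕ → Prop) (a b : ℕ) (M0 U : ℕ → Vec) (piv : ℕ → ℕ) : Prop where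
  injective : Function.Injective (blk piv U a b)
  le : ∀ t, a ≤ t → t < b → piv t ≤ N
  not_used : ∀ t, a ≤ t → t < b → piv t ≠ 0 → ¬ used (piv t - 1)
  unique : ∀ t t', a ≤ t → t < b → a ≤ t' → t' < b → piv t ≠ 0 → piv t = piv t' → t = t'
  pivot : ∀ t, a ≤ t → t < b → piv t ≠ 0 → blk piv U a b (M0 t) = Pi.single (piv t - 1) 1
  dep : ∀ t, a ≤ t → t < b → piv t = 0 → ∀ r, blk piv U a b (M0 t) r ≠ 0 →
    used r ∨ ∃ t', a ≤ t' ∧ t' < t ∧ piv t' = r + 1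
  zero : ∀ i, (∀ t, a ≤ t → t < b → M0 t i = 0) → ∀ t, a ≤ t → t < b → U t i = 0

theorem Elim.congr {used' : ℕ → Prop} {M0' U' : ℕ → Vec} {piv' : ℕ → ℕ}
    (h : Elim N used a b M0 U piv) (hu : ∀ r, used' r ↔ used r)
    (hM : ∀ t, a ≤ t → t < b → M0' t = M0 t) (hU : ∀ t, a ≤ t → t < b → U' t = U t)
    (hp : ∀ t, a ≤ t → t < b → piv' t = piv t) : Elim N used' a b M0' U' piv' := by
  have hb : blk piv' U' a b = blk piv U a b := blk_congr hp hU
  refine ⟨hb ▸ h.injective, ?_, ?_, ?_, ?_, ?_, ?_⟩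
  · intro t h1 h2; rw [hp t h1 h2]; exact h.le t h1 h2
  · intro t h1 h2; rw [hp t h1 h2, hu]; exact h.not_used t h1 h2
  · intro t t' h1 h2 h3 h4; rw [hp t h1 h2, hp t' h3 h4]; exact h.unique t t' h1 h2 h3 h4
  · intro t h1 h2; rw [hp t h1 h2, hb, hM t h1 h2]; exact h.pivot t h1 h2
  · intro t h1 h2; rw [hp t h1 h2, hb, hM t h1 h2]; intro h0 r hr
    rcases h.dep t h1 h2 h0 r hr with h | ⟨t', h3, h4, h5⟩
    · exact Or.inl ((hu r).2 h)
    · exact Or.inr ⟨t', h3, h4, (hp t' h3 (h4.trans h2)).trans h5⟩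
  · intro i hi t h1 h2; rw [hU t h1 h2]
    exact h.zero i (fun t h1 h2 => by rw [← hM t h1 h2]; exact hi t h1 h2) t h1 h2

theorem Elim.single_none (hp : piv a = 0) (hM : ∀ r, ¬ used r → M0 a r = 0) (hU : U a = M0 a) :
    Elim N used a (a + 1) M0 U piv := by
  have hb : ∀ v, blk piv U a (a + 1) v = v := fun v => blk_eq_self fun t h1 h2 h => by
    obtain rfl : t = a := by omega
    exact absurd hp h
  have key : ∀ t, a ≤ t → t < a + 1 → t = a := by omega
  refine ⟨fun v w h => by simpa [hb] using h, ?_, ?_, ?_, ?_, ?_, ?_⟩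
  · intro t h1 h2; obtain rfl := key t h1 h2; simp [hp]
  · intro t h1 h2; obtain rfl := key t h1 h2; simp [hp]
  · intros; omega
  · intro t h1 h2; obtain rfl := key t h1 h2; simp [hp]
  · intro t h1 h2; obtain rfl := key t h1 h2; intro _ r hr; rw [hb] at hr
    exact Or.inl (by_contra fun h => hr (hM r h))
  · intro i hi t h1 h2; obtain rfl := key t h1 h2; rw [hU]; exact hi t h1 h2

/-- Clearing the pivot entry stores U = M0 - e_i. In characteristic two M0 + U = e_i, and since U
has no entry in row i, the map does not change row i and is injective. -/
theorem Elim.single_some {i : ℕ} (hp : piv a = i + 1) (hi : i < N) (hu : ¬ used i)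
    (hM : M0 a i = 1) (hU : U a = Function.update (M0 a) i 0) : Elim N used a (a + 1) M0 U piv := by
  have hb : ∀ v, blk piv U a (a + 1) v = v + v i • U a := fun v => by rw [blk_apply]; simp [hp]
  have key : ∀ t, a ≤ t → t < a + 1 → t = a := by omega
  refine ⟨?_, ?_, ?_, ?_, ?_, ?_, ?_⟩
  · rw [injective_iff_map_eq_zero]; intro v hv; rw [hb] at hv
    have h1 : v i = 0 := by simpa [hU] using congrFun hv i
    simpa [h1] using hv
  · intro t h1 h2; obtain rfl := key t h1 h2; omega
  · intro t h1 h2; obtain rfl := key t h1 h2; simpa [hp] using hu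
  · intros; omega
  · intro t h1 h2; obtain rfl := key t h1 h2; intro _; rw [hb, hM, one_smul, hp, Nat.add_sub_cancel]
    ext r; by_cases h : r = i
    · subst h; simp [hM, hU]
    · simp [hU, h, CharTwo.add_self_eq_zero]
  · intro t h1 h2; obtain rfl := key t h1 h2; simp [hp]
  · intro r hr t h1 h2; obtain rfl := key t h1 h2; rw [hU, Function.update_apply, hr t h1 h2]; simp

/-- The right half treats the pivot rows of the left half as used, so its own pivot rows avoid them.
Hence its transformation fixes everything already achieved on the left: the unit vectors at left
pivots, and the dependent columns, which are supported on used rows and left pivot rows. -/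
theorem Elim.comp {U1 U2 M1 : ℕ → Vec} (ham : a ≤ m) (hmb : m ≤ b) (h₁ : Elim N used a m M0 U1 piv)
    (h₂ : Elim N (fun r => used r ∨ ∃ t, a ≤ t ∧ t < m ∧ piv t = r + 1) m b M1 U2 piv)
    (hM : ∀ t, m ≤ t → t < b → M1 t = blk piv U1 a m (M0 t))
    (hL : ∀ t, a ≤ t → t < m → U t = blk piv U2 m b (U1 t))
    (hR : ∀ t, m ≤ t → t < b → U t = U2 t) : Elim N used a b M0 U piv := by
  have hb := blk_comp ham hmb hL hR; refine ⟨?_, ?_, ?_, ?_, ?_, ?_, ?_⟩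
  · intro v w h; rw [hb, hb] at h; exact h₁.injective (h₂.injective h)
  · intro t h1 h2; rcases lt_or_ge t m with h | h
    · exact h₁.le t h1 h
    · exact h₂.le t h h2
  · intro t h1 h2 h0; rcases lt_or_ge t m with h | h
    · exact h₁.not_used t h1 h h0
    · exact fun h' => h₂.not_used t h h2 h0 (Or.inl h')
  · have key : ∀ t t', a ≤ t → t < m → m ≤ t' → t' < b → piv t ≠ 0 → piv t = piv t' → False := by
      intro t t' h1 h2 h3 h4 h5 h6
      exact h₂.not_used t' h3 h4 (h6 ▸ h5) (Or.inr ⟨t, h1, h2, by omega⟩)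
    intro t t' h1 h2 h3 h4 h5 h6
    rcases lt_or_ge t m with h | h <;> rcases lt_or_ge t' m with h' | h'
    · exact h₁.unique t t' h1 h h3 h' h5 h6
    · exact (key t t' h1 h h' h4 h5 h6).elim
    · exact (key t' t h3 h' h h2 (h6 ▸ h5) h6.symm).elim
    · exact h₂.unique t t' h h2 h' h4 h5 h6
  · intro t h1 h2 h0; rw [hb]; rcases lt_or_ge t m with h | h
    · rw [h₁.pivot t h1 h h0]; refine blk_eq_self fun t' h3 h4 h5 => ?_
      rw [Pi.single_apply, if_neg]; intro h6
      exact h₂.not_used t' h3 h4 h5 (Or.inr ⟨t, h1, h, by omega⟩)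
    · rw [← hM t h h2]; exact h₂.pivot t h h2 h0
  · intro t h1 h2 h0 r hr; rw [hb] at hr; rcases lt_or_ge t m with h | h
    · rw [blk_eq_self] at hr
      · exact h₁.dep t h1 h h0 r hr
      · intro t' h3 h4 h5
        by_contra h6
        refine h₂.not_used t' h3 h4 h5 ?_; rcases h₁.dep t h1 h h0 _ h6 with h7 | ⟨t'', h7, h8, h9⟩
        · exact Or.inl h7
        · exact Or.inr ⟨t'', h7, h8.trans h, h9⟩
    · rw [← hM t h h2] at hr
      rcases h₂.dep t h h2 h0 r hr with (h3 | ⟨t', h4, h5, h6⟩) | ⟨t', h4, h5, h6⟩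
      · exact Or.inl h3
      · exact Or.inr ⟨t', h4, by omega, h6⟩
      · exact Or.inr ⟨t', by omega, h5, h6⟩
  · intro i hi; have hU1 := h₁.zero i fun t h1 h2 => hi t h1 (by omega)
    have hM1 : ∀ t, m ≤ t → t < b → M1 t i = 0 := by
      intro t h1 h2
      rw [hM t h1 h2, blk_apply, Pi.add_apply, hi t (by omega) h2, Finset.sum_apply,
        Finset.sum_eq_zero, add_zero]
      intro t' ht'; rw [Finset.mem_Ico] at ht'; split_ifs
      · rfl
      · simp [hU1 t' ht'.1 ht'.2]
    have hU2 := h₂.zero i hM1; intro t h1 h2; rcases lt_or_ge t m with h | h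
    · rw [hL t h1 h, blk_apply, Pi.add_apply, hU1 t h1 h, Finset.sum_apply,
        Finset.sum_eq_zero, add_zero]
      intro t' ht'; rw [Finset.mem_Ico] at ht'; split_ifs
      · rfl
      · simp [hU2 t' ht'.1 ht'.2]
    · rw [hR t h h2, hU2 t h h2]

section Final

variable (h : Elim N (fun _ => False) 0 N M0 U piv)
include h

/-- The transformation sends the pivot columns to distinct unit vectors. -/
theorem Elim.linearIndependent :
    LinearIndependent (ZMod 2) (fun t : {t : ℕ // t < N ∧ piv t ≠ 0} => M0 t) := by
  refine LinearIndependent.of_comp (blk piv U 0 N) ?_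
  have : (blk piv U 0 N ∘ fun t : {t : ℕ // t < N ∧ piv t ≠ 0} => M0 t) =
      (fun r : ℕ => (Pi.single r 1 : Vec)) ∘ fun t : {t : ℕ // t < N ∧ piv t ≠ 0} => piv t - 1 := by
    ext1 t; exact h.pivot t (Nat.zero_le _) t.2.1 t.2.2
  rw [this]; refine (Pi.linearIndependent_single_one ℕ (ZMod 2)).comp _ ?_; intro t t' e
  have h1 := t.2.2; have h2 := t'.2.2
  exact Subtype.ext (h.unique t t' (Nat.zero_le _) t.2.1 (Nat.zero_le _) t'.2.1 h1
    (by simp only at e; omega))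

/-- The entries of the transform in the pivot rows are the coefficients: the combination of pivot
columns with these coefficients has the same transform as v, and the transformation is injective. -/
theorem Elim.mem_span_of_lt {c : ℕ} (hc : c ≤ N) {v : Vec}
    (hv : ∀ r, blk piv U 0 N v r ≠ 0 → ∃ t < c, piv t = r + 1) :
    v ∈ Submodule.span (ZMod 2) (M0 '' {t | t < c ∧ piv t ≠ 0}) := by
  set x := blk piv U 0 N v with hx
  have hsum : blk piv U 0 N v = blk piv U 0 N (∑ t ∈ Finset.range c,
      if piv t = 0 then 0 else x (piv t - 1) • M0 t) := by
    rw [map_sum, ← hx]; ext r; rw [Finset.sum_apply]; by_cases hr : x r = 0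
    · rw [hr, Finset.sum_eq_zero]; intro t ht; rw [Finset.mem_range] at ht; split_ifs with h1
      · simp
      · rw [map_smul, h.pivot t (Nat.zero_le _) (by omega) h1, Pi.smul_apply, Pi.single_apply]
        split_ifs with h2
        · rw [← h2, hr, zero_smul]
        · simp
    · obtain ⟨t, ht, hpt⟩ := hv r hr; rw [Finset.sum_eq_single t]
      · rw [if_neg (by omega), map_smul, h.pivot t (Nat.zero_le _) (by omega) (by omega), hpt]; simp
      · intro t' ht' hne; rw [Finset.mem_range] at ht'; split_ifs with h1
        · simp
        · rw [map_smul, h.pivot t' (Nat.zero_le _) (by omega) h1, Pi.smul_apply, Pi.single_apply,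
            if_neg, smul_zero]
          exact fun h2 => hne (h.unique t' t (Nat.zero_le _) (by omega) (Nat.zero_le _) (by omega) h1
            (by omega))
      · intro h'; exact absurd (Finset.mem_range.2 ht) h'
  rw [h.injective hsum]; refine Submodule.sum_mem _ fun t ht => ?_; rw [Finset.mem_range] at ht
  split_ifs with h1
  · exact Submodule.zero_mem _
  · exact Submodule.smul_mem _ _ (Submodule.subset_span ⟨t, ⟨ht, h1⟩, rfl⟩)

/-- The restriction `t ≤ c` comes from `Elim.dep`. It makes the pivot columns the basis found by
scanning the columns from left to right, which is what the greedy algorithm needs. -/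
theorem Elim.mem_span {c : ℕ} (hc : c < N) :
    M0 c ∈ Submodule.span (ZMod 2) (M0 '' {t | t < N ∧ piv t ≠ 0 ∧ t ≤ c}) := by
  by_cases h0 : piv c = 0
  · refine Submodule.span_mono (Set.image_mono ?_)
      (h.mem_span_of_lt hc.le fun r hr => by simpa using h.dep c (Nat.zero_le _) hc h0 r hr)
    exact fun t ht => ⟨ht.1.trans hc, ht.2, ht.1.le⟩
  · exact Submodule.subset_span ⟨c, ⟨hc, h0, le_rfl⟩, rfl⟩

/-- A vector whose transform is supported on pivot rows is a combination of the columns. -/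
theorem Elim.mem_span_of_support {v : Vec}
    (hv : ∀ r, blk piv U 0 N v r ≠ 0 → ∃ t < N, piv t = r + 1) :
    v ∈ Submodule.span (ZMod 2) (M0 '' {t | t < N}) :=
  Submodule.span_mono (Set.image_mono fun t (ht : t < N ∧ piv t ≠ 0) => ht.1) (h.mem_span_of_lt le_rfl hv)

end Final

end GaussJordan

/-! ## The elimination program -/

namespace RAM

theorem mul_add_le {N a b c d : ℕ} (h : a ≤ b) (h' : c ≤ d) : N * a + c ≤ N * b + d :=
  Nat.add_le_add (Nat.mul_le_mul_left _ h) h'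

/-- The hypothesis `hev` may use that cells not yet visited are unchanged. This covers loops whose
values are read from the very bank that they write. -/
theorem Tri.fillLoop {B T N x b : ℕ} {bd e v : Expr} {s : State} {Q : State → Prop}
    (addr value : ℕ → ℕ) (hx : x ≠ b) (hN : N < B)
    (hbd : ∀ s', (RAM.forLoop x bd (.setWord b e v)).Frame s s' → bd.val s' = N)
    (hev : ∀ i s', i < N → (RAM.forLoop x bd (.setWord b e v)).Frame s s' → s'.words x 0 = i →
      (∀ a, (∀ j < i, a ≠ addr j) → s'.words b a = s.words b a) →
      e.val s' = addr i ∧ v.val s' = value i) (inj : ∀ i j, i < j → j < N → addr i ≠ addr j)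
    (hv : s.Bdd B → ∀ i < N, value i < B)
    (hT : N * (e.cost + v.cost + bd.cost + 11) + (bd.cost + 8) ≤ T)
    (hQ : ∀ s', (RAM.forLoop x bd (.setWord b e v)).Frame s s' → s'.words x 0 = N →
      (∀ i < N, s'.words b (addr i) = value i) →
      (∀ a, (∀ i < N, a ≠ addr i) → s'.words b a = s.words b a) → Q s') :
    Tri B (RAM.forLoop x bd (.setWord b e v)) s T Q := by
  refine Tri.of_bdd fun hb => ?_
  refine Tri.forLoop (Tb := e.cost + v.cost + 1) (fun i s' =>
      (∀ j < i, s'.words b (addr j) = value j) ∧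
      ∀ a, (∀ j < i, a ≠ addr j) → s'.words b a = s.words b a)
    (by simpa using hx) hN hbd (by simp) ?_ ?_
    (by rw [show e.cost + v.cost + 1 + (bd.cost + 10) = e.cost + v.cost + bd.cost + 11 by ring]
        exact hT) ?_
  · intro i s' y h; simpa [hx.symm] using h
  · rintro i s' hi hxi hf ⟨h1, h2⟩; obtain ⟨he, hv'⟩ := hev i s' hi hf hxi h2
    refine Tri.block (fun _ => by simpa [hv'] using hv hb i hi) ?_ le_rfl
    simp only [Program.exec, he, hv', State.words_same]; refine ⟨fun j hj => ?_, fun a ha => ?_⟩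
    · rcases Nat.lt_succ_iff_lt_or_eq.1 hj with h | rfl
      · rw [if_neg (inj j i h hi), h1 j h]
      · simp
    · rw [if_neg (ha i (by omega)), h2 a fun j hj => ha j (by omega)]
  · rintro s' hf hN' ⟨h1, h2⟩; exact hQ s' hf hN' h1 h2

/-- Powers of word expressions with constant exponents. -/
def Expr.pow (e : Expr) : ℕ → Expr
  | 0 => 1
  | k + 1 => e.pow k * e

@[simp] theorem Expr.val_pow (e : Expr) (k : ℕ) (s : State) : (e.pow k).val s = e.val s ^ k := by
  induction k with
  | zero => simp [Expr.pow]
  | succ k ih => simp [Expr.pow, ih, pow_succ]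

theorem Expr.cost_pow (e : Expr) (k : ℕ) : (e.pow k).cost = k * (e.cost + 1) + 1 := by
  induction k with
  | zero => simp [Expr.pow]; rfl
  | succ k ih =>
    change (e.pow k).cost + e.cost + 1 = _; rw [ih]; ring

theorem idx_lt {a b i j : ℕ} (hi : i < a) (hj : j < b) : i * b + j < a * b := by
  nlinarith [Nat.mul_le_mul_right b (Nat.succ_le_of_lt hi)]

theorem idx_inj {b i j i' j' : ℕ} (hj : j < b) (hj' : j' < b) (h : i * b + j = i' * b + j') :
    i = i' ∧ j = j' := by
  have h1 := congrArg (· / b) h; have h2 := congrArg (· % b) h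
  simp only [mul_comm _ b, Nat.mul_add_div (by omega : 0 < b), Nat.mul_add_mod,
    Nat.div_eq_of_lt hj, Nat.div_eq_of_lt hj', Nat.mod_eq_of_lt hj, Nat.mod_eq_of_lt hj'] at h1 h2
  omega

end RAM

namespace GaussJordan

open RAM

notation "bkN" => 40
notation "bkMat" => 41
notation "bkPiv" => 42
notation "bkUsed" => 43
notation "bkJ" => 44
notation "bkS" => 45
notation "bkT" => 46
notation "bkBuf" => 47
notation "bkX" => 48
notation "bkRow" => 49
notation "bkPv" => 50
notation "bkR" => 51
notation "bkBase" => 52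

/-- Search for a pivot in the column `bkJ` and record it. -/
def factorColumn : Program := assign bkPv 0 ;;
  forLoop bkR (var bkN)
    (.ite (.and (.wordLe (.get bkUsed (var bkR)) 0)
        (.wordLe 1 (.get bkMat (var bkR * var bkN + var bkJ))))
      (assign bkPv (var bkR + 1)) .skip) ;;
  .setWord bkPiv (var bkJ) (var bkPv) ;;
  .ite (.wordLe 1 (var bkPv))
    (.setWord bkUsed (var bkPv - 1) 1 ;; .setWord bkMat ((var bkPv - 1) * var bkN + var bkJ) 0)
    .skip

/-- The column `c` of the `N × N` matrix in memory. -/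
def col (s : State) (N c : ℕ) : Vec := fun r =>
  if r < N then (s.words bkMat (r * N + c) : ZMod 2) else 0

theorem cast_eq_one_iff {x : ℕ} (hx : x < 2) : (x : ZMod 2) = 1 ↔ 1 ≤ x := by
  interval_cases x <;> decide

theorem cast_eq_zero_iff {x : ℕ} (hx : x < 2) : (x : ZMod 2) = 0 ↔ x = 0 := by
  interval_cases x <;> decide

theorem val_cast {x : ℕ} (hx : x < 2) : (x : ZMod 2).val = x := by
  rw [ZMod.val_natCast, Nat.mod_eq_of_lt hx]

/-- The two outcomes are tailored to `Elim.single_none` and `Elim.single_some`. The scan keeps the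
last eligible row, but any eligible row would serve. -/
theorem factorColumn_spec {B N J : ℕ} {s : State} (hNB : N + 1 < B) (hN : s.words bkN 0 = N)
    (hJ : s.words bkJ 0 = J) (hJN : J < N) (hbit : ∀ a, s.words bkMat a < 2) :
    Tri B factorColumn s (N * 60 + 60) (fun s' =>
      (∀ t, t ≠ J → s'.words bkPiv t = s.words bkPiv t) ∧ (∀ a, s'.words bkMat a < 2) ∧
      (∀ c < N, c ≠ J → col s' N c = col s N c) ∧
      ((s'.words bkPiv J = 0 ∧ (∀ r, s.words bkUsed r = 0 → col s N J r = 0) ∧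
          col s' N J = col s N J ∧ s'.words bkUsed = s.words bkUsed) ∨
        ∃ i < N, s'.words bkPiv J = i + 1 ∧ s.words bkUsed i = 0 ∧ col s N J i = 1 ∧
          col s' N J = Function.update (col s N J) i 0 ∧
          ∀ r, s'.words bkUsed r = if r = i then 1 else s.words bkUsed r)) := by
  refine Tri.seq (T1 := 3) (R := fun s' => s' = s.writeWord bkPv 0 0)
    (Tri.block (fun _ => by simp; omega) (by simp) (le_of_eq rfl)) ?_
    (T2 := N * 60 + 57) (by omega)
  rintro s1 - rfl
  refine Tri.seq (T1 := N * 40 + 20) (T2 := 37) (R := fun s' =>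
      (s'.words bkPv 0 = 0 ∧ ∀ r < N, s.words bkUsed r = 0 → col s N J r = 0) ∨
      ∃ i < N, s'.words bkPv 0 = i + 1 ∧ s.words bkUsed i = 0 ∧ col s N J i = 1) ?_ ?_ (by omega)
  · refine Tri.forLoop (N := N) (Tb := 27) (fun k s' =>
      (s'.words bkPv 0 = 0 ∧ ∀ r < k, s.words bkUsed r = 0 → col s N J r = 0) ∨
      ∃ i < N, s'.words bkPv 0 = i + 1 ∧ s.words bkUsed i = 0 ∧ col s N J i = 1)
      (by simp) (by omega) (fun s' hf => by simp [hf.w bkN (by simp), hN]) (by simp)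
      (by simp) ?_ (by rw [show (var bkN).cost = 2 from rfl]; omega) ?_
    · intro k s' hk hki hf hI
      have e1 : s'.words bkN 0 = N := by simp [hf.w bkN (by simp), hN]
      have e2 : s'.words bkJ 0 = J := by simp [hf.w bkJ (by simp), hJ]
      have e3 : s'.words bkMat = s.words bkMat := by simp [hf.w bkMat (by simp)]
      have e4 : s'.words bkUsed = s.words bkUsed := by simp [hf.w bkUsed (by simp)]
      have hcol : col s N J k = (s.words bkMat (k * N + J) : ZMod 2) := by simp [col, hk]
      refine Tri.block (fun _ => by simp [hki]; intros; omega) ?_ (by decide)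
      have hx : (Program.ite (.and (.wordLe (.get bkUsed (var bkR)) 0)
          (.wordLe 1 (.get bkMat (var bkR * var bkN + var bkJ))))
          (assign bkPv (var bkR + 1)) .skip).exec s' =
          if s.words bkUsed k = 0 ∧ 1 ≤ s.words bkMat (k * N + J) then s'.writeWord bkPv 0 (k + 1)
          else s' := by simp [e1, e2, e3, e4, hki]
      rw [hx]; split_ifs with h
      · right; refine ⟨k, hk, by simp, by omega, ?_⟩; rw [hcol, cast_eq_one_iff (hbit _)]; exact h.2
      · rcases hI with ⟨h0, hI⟩ | hI
        · left; refine ⟨h0, fun r hr hu => ?_⟩; rcases Nat.lt_succ_iff_lt_or_eq.1 hr with hr | rfl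
          · exact hI r hr hu
          · rw [hcol, cast_eq_zero_iff (hbit _)]; have := hbit (r * N + J); omega
        · exact Or.inr hI
    · exact fun s' _ _ h => h
  · intro s2 hf hR
    have e1 : s2.words bkN 0 = N := by simp [hf.w bkN (by simp), hN]
    have e2 : s2.words bkJ 0 = J := by simp [hf.w bkJ (by simp), hJ]
    have e3 : s2.words bkMat = s.words bkMat := by simp [hf.w bkMat (by simp)]
    have e4 : s2.words bkUsed = s.words bkUsed := by simp [hf.w bkUsed (by simp)]
    have e5 : s2.words bkPiv = s.words bkPiv := by simp [hf.w bkPiv (by simp)]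
    rcases hR with ⟨h0, hR⟩ | ⟨i, hi, h0, hu, hc⟩
    · refine Tri.block (fun _ => by simp [h0]; omega) (Q := fun s' => _) ?_ (by decide)
      have hx : (Program.setWord bkPiv (var bkJ) (var bkPv) ;; .ite (.wordLe 1 (var bkPv))
            (.setWord bkUsed (var bkPv - 1) 1 ;;
              .setWord bkMat ((var bkPv - 1) * var bkN + var bkJ) 0)
            .skip).exec s2 = s2.writeWord 42 J 0 := by simp [h0, e2]
      rw [hx]
      have hcol : ∀ c, col (s2.writeWord 42 J 0) N c = col s N c := by
        intro c; funext r; simp [col, e3]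
      refine ⟨fun t ht => by simp [ht, e5], fun a => by simpa [e3] using hbit a,
        fun c _ _ => hcol c, Or.inl ⟨by simp, ?_, hcol J, by simp [e4]⟩⟩
      intro r hr; by_cases hrN : r < N
      · exact hR r hrN hr
      · simp [col, hrN]
    · refine Tri.block (fun _ => by simp [h0]; omega) (Q := fun s' => _) ?_ (by decide)
      have hx : (Program.setWord bkPiv (var bkJ) (var bkPv) ;; .ite (.wordLe 1 (var bkPv))
            (.setWord bkUsed (var bkPv - 1) 1 ;;
              .setWord bkMat ((var bkPv - 1) * var bkN + var bkJ) 0) .skip).exec s2 =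
          ((s2.writeWord 42 J (i + 1)).writeWord 43 i 1).writeWord 41 (i * N + J) 0 := by
        simp [h0, e1, e2]
      rw [hx]
      refine ⟨fun t ht => by simp [ht, e5], fun a => ?_, fun c hc' hcJ => ?_,
        Or.inr ⟨i, hi, by simp, hu, hc, ?_, ?_⟩⟩
      · simp only [State.words_same]; split_ifs
        · omega
        · simpa [e3] using hbit a
      · ext r; by_cases hr : r < N
        · have : r * N + c ≠ i * N + J := fun h => hcJ (idx_inj hc' hJN h).2
          simp [col, hr, e3, this]
        · simp [col, hr]
      · ext r; by_cases hr : r < N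
        · rcases eq_or_ne r i with rfl | hri
          · simp [col, hr]
          · have : r * N + J ≠ i * N + J := fun h => hri (idx_inj hJN hJN h).1
            simp [col, hr, e3, hri, show N ≠ 0 by omega]
        · simp [col, hr, show r ≠ i by omega]
      · intro r; simp [e4]

end GaussJordan

/-! ### Applying a block transformation by matrix products. -/

namespace GaussJordan

open RAM

/-- Add to `bkS` rows of the target block the product of these rows of the source block with the
matrix in `bkBuf`. -/
def multiplyRows (P : Program) (c : ℕ) : Program :=
  forLoop bkX (var bkS * var bkS) (.setWord 101 (var bkBase + var bkX)
    (.get bkMat ((var bkRow * var bkS + var bkX / var bkS) * var bkN +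
      (var bkJ - var bkS + var bkX % var bkS)))) ;;
  forLoop bkX (var bkS * var bkS) (.setWord 102 (var bkBase + var bkX) (.get bkBuf (var bkX))) ;;
  .setWord 100 (var bkBase) (var bkS) ;;
  P.shift 100 bkBase ;;
  forLoop bkX (var bkS * var bkS) (.setWord bkMat
    ((var bkRow * var bkS + var bkX / var bkS) * var bkN + (var bkT + var bkX % var bkS))
    ((.get bkMat ((var bkRow * var bkS + var bkX / var bkS) * var bkN +
      (var bkT + var bkX % var bkS)) + .get 103 (var bkBase + var bkX)) % 2)) ;;
  assign bkBase (var bkBase + (var bkS + 2).pow c)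

/-- The part of the memory used by matrix multiplications from the address `bkBase` on is clear. -/
def Fresh (s : State) : Prop :=
  ∀ b a, 100 ≤ b → s.words bkBase 0 ≤ a → s.words b a = 0 ∧ s.reals b a = 0

theorem wr_shift {P : Program} {b : ℕ} (hb : b < 100) : (P.shift 100 bkBase).wr b ↔ False :=
  ⟨fun h => by have := Program.le_of_shift_wr h; omega, False.elim⟩

/-- The called program may leave anything in the `(S + 2) ^ c` cells from the base on. The base is
then moved past them, and this restores `Fresh` without the cost of cleaning up. -/
theorem multiplyRows_spec {P : Program} {c : ℕ} {τ : ℕ → ℕ} (hP : Multiplies P c τ) (hc : 2 ≤ c)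
    {B N S J T k a0 : ℕ} {s : State} (hN : s.words bkN 0 = N) (hS : s.words bkS 0 = S)
    (hJ : s.words bkJ 0 = J) (hT : s.words bkT 0 = T) (hk : s.words bkRow 0 = k)
    (ha0 : s.words bkBase 0 = a0) (h1S : 1 ≤ S) (hTN : T + S ≤ N)
    (hB : a0 + (S + 2) ^ c < B) (hbit : ∀ a, s.words bkMat a < 2) (hbuf : ∀ a < S * S, s.words bkBuf a < 2)
    (hfresh : Fresh s) :
    Tri B (multiplyRows P c) s (S * S * 200 + 4 * τ S + (100 + 10 * c)) (fun s' =>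
      (∀ a, s'.words bkMat a < 2) ∧
      (∀ i < S, ∀ j < S, (s'.words bkMat ((k * S + i) * N + (T + j)) : ZMod 2) =
        s.words bkMat ((k * S + i) * N + (T + j)) + ∑ t ∈ Finset.range S,
          (s.words bkMat ((k * S + i) * N + (J - S + t)) : ZMod 2) * s.words bkBuf (t * S + j)) ∧
      (∀ a, (∀ i < S, ∀ j < S, a ≠ (k * S + i) * N + (T + j)) →
        s'.words bkMat a = s.words bkMat a) ∧ Fresh s' ∧ s'.words bkBase 0 = a0 + (S + 2) ^ c) := by
  -- The copied factors fit into the region that is given up afterwards; this is the use of `2 ≤ c`.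
  have hsq : S * S + 4 ≤ (S + 2) ^ c := by
    calc S * S + 4 ≤ (S + 2) ^ 2 := by nlinarith
      _ ≤ (S + 2) ^ c := Nat.pow_le_pow_right (by omega) hc
  have hSS : S ≤ S * S := Nat.le_mul_self S
  have hdiv : ∀ x, x < S * S → x / S < S := fun x hx => Nat.div_lt_of_lt_mul hx
  have hmod : ∀ x, x % S < S := fun x => Nat.mod_lt _ (by omega)
  have hdm : ∀ x, x / S * S + x % S = x := fun x => Nat.div_add_mod' x S
  -- copy the first factor
  refine Tri.seq (T1 := S * S * 50 + 20) (T2 := S * S * 150 + 4 * τ S + (80 + 10 * c))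
    (R := fun s' => (∀ x < S * S, s'.words 101 (a0 + x) =
        s.words bkMat ((k * S + x / S) * N + (J - S + x % S))) ∧
      ∀ a, (∀ x < S * S, a ≠ a0 + x) → s'.words 101 a = s.words 101 a)
    (Tri.fillLoop (N := S * S) (fun x => a0 + x)
      (fun x => s.words bkMat ((k * S + x / S) * N + (J - S + x % S))) (by simp) (by omega)
      (fun s' hf => by simp [hf.w bkS (by simp), hS]) (fun x s' hx hf hx' _ => by
        simp [hf.w bkS (by simp), hf.w bkBase (by simp), hf.w bkMat (by simp), hf.w bkRow (by simp),
          hf.w bkN (by simp), hf.w bkJ (by simp), hx', hS, hN, hJ, hk, ha0])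
      (by intros; omega) (fun _ x _ => (hbit _).trans (by omega))
      (mul_add_le (by decide) (by decide)) fun s' _ _ h h' => ⟨h, h'⟩)
    ?_ (by omega)
  rintro s1 f1 ⟨hA, hA'⟩
  have e1 : ∀ b, b ≠ bkX ∧ b ≠ 101 → s1.words b = s.words b := fun b ⟨h, h'⟩ =>
    f1.w b (by simp; omega)
  have r1 : s1.reals = s.reals := funext fun b => f1.r b (by simp)
  -- copy the second factor
  refine Tri.seq (T1 := S * S * 30 + 20) (T2 := S * S * 120 + 4 * τ S + (60 + 10 * c))
    (R := fun s' => (∀ x < S * S, s'.words 102 (a0 + x) = s.words bkBuf x) ∧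
      ∀ a, (∀ x < S * S, a ≠ a0 + x) → s'.words 102 a = s1.words 102 a)
    (Tri.fillLoop (N := S * S) (fun x => a0 + x) (fun x => s.words bkBuf x) (by simp) (by omega)
      (fun s' hf => by simp [hf.w bkS (by simp), e1, hS]) (fun x s' hx hf hx' _ => by
        simp [hf.w bkBase (by simp), hf.w bkBuf (by simp), hx', e1, ha0])
      (by intros; omega) (fun _ x hx => (hbuf x hx).trans (by omega))
      (mul_add_le (by decide) (by decide)) fun s' _ _ h h' => ⟨h, h'⟩)
    ?_ (by omega)
  rintro s2 f2 ⟨hBf, hBf'⟩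
  have e2 : ∀ b, b ≠ bkX ∧ b ≠ 101 ∧ b ≠ 102 → s2.words b = s.words b := fun b ⟨h, h', h''⟩ =>
    (f2.w b (by simp; omega)).trans (e1 b ⟨h, h'⟩)
  have r2 : s2.reals = s.reals := (funext fun b => f2.r b (by simp)).trans r1
  have hA2 : s2.words 101 = s1.words 101 := f2.w 101 (by simp)
  -- the order of the factors
  refine Tri.seq (T1 := 10) (T2 := S * S * 120 + 4 * τ S + (50 + 10 * c))
    (R := fun s' => s' = s2.writeWord 100 a0 S)
    (Tri.block (fun _ => by simp [e2, hS]; omega) (by simp [e2, ha0, hS]) (by decide)) ?_ (by omega)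
  rintro s3 f3 hs3
  have e3 : ∀ b, b ≠ bkX ∧ b ≠ 100 ∧ b ≠ 101 ∧ b ≠ 102 → s3.words b = s.words b := by
    rintro b ⟨h, h', h'', h'''⟩; rw [hs3, State.words_of_ne _ h', e2 b ⟨h, h'', h'''⟩]
  have h100 : ∀ a, s3.words 100 a = if a = a0 then S else s.words 100 a := by
    intro a; rw [hs3, State.words_same, e2 _ (by decide)]
  have h101 : s3.words 101 = s1.words 101 := by rw [hs3, State.words_of_ne _ (by decide), hA2]
  have h102 : s3.words 102 = s2.words 102 := by rw [hs3, State.words_of_ne _ (by decide)]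
  have r3 : s3.reals = s.reals := by rw [hs3]; exact r2
  -- the product
  let X : Matrix (Fin S) (Fin S) (ZMod 2) := fun i j =>
    (s.words bkMat ((k * S + i) * N + (J - S + j)) : ZMod 2)
  let Y : Matrix (Fin S) (Fin S) (ZMod 2) := fun i j => (s.words bkBuf (i * S + j) : ZMod 2)
  have hdec : ∀ i j : Fin S, ((i : ℕ) * S + j) / S = i ∧ ((i : ℕ) * S + j) % S = j := by
    intro i j
    rw [mul_comm, Nat.mul_add_div (by omega), Nat.div_eq_of_lt j.2, Nat.mul_add_mod,
      Nat.mod_eq_of_lt j.2]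
    simp
  have hcall := hP.call (B := B) (o := 100) (v := bkBase) (a0 := a0) (S := s3) h1S (by decide)
    (by rw [e3 _ (by decide), ha0]) (by omega) X Y
    (fun i j => by
      rw [show 1 + 100 = 101 from rfl, h101, hA _ (idx_lt i.2 j.2), (hdec i j).1, (hdec i j).2]
      exact (val_cast (hbit _)).symm)
    (fun i j => by
      rw [show 2 + 100 = 102 from rfl, h102, hBf _ (idx_lt i.2 j.2)]
      exact (val_cast (hbuf _ (idx_lt i.2 j.2))).symm)
    (by rw [show 0 + 100 = 100 from rfl, h100, if_pos rfl])
    (fun b a h0 h12 => by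
      have hfr := (hfresh (b + 100) (a0 + a) (by omega) (by omega)).1
      rcases Nat.eq_zero_or_pos b with rfl | hb
      · rw [show 0 + 100 = 100 from rfl, h100, if_neg (by omega)]; exact hfr
      · by_cases hb1 : b = 1
        · subst hb1; rw [show 1 + 100 = 101 from rfl, h101, hA' _ (by intros; omega)]; exact hfr
        · by_cases hb2 : b = 2
          · subst hb2
            rw [show 2 + 100 = 102 from rfl, h102, hBf' _ (by intros; omega),
              e1 _ (by decide)]
            exact hfr
          · rw [e3 _ (by omega)]; exact hfr)
    (fun b a => by rw [r3]; exact (hfresh (b + 100) (a0 + a) (by omega) (by omega)).2)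
  refine Tri.seq (T2 := S * S * 120 + (50 + 10 * c)) hcall ?_ (by omega); rintro s4 f4 ⟨hprod, hold⟩
  have e4 : ∀ b, b ≠ bkX ∧ b < 100 → s4.words b = s.words b := fun b ⟨h, h'⟩ => by
    rw [f4.w b (by rw [wr_shift h']; simp), e3 b ⟨h, by omega, by omega, by omega⟩]
  have hprod' : ∀ x (hx : x < S * S), s4.words 103 (a0 + x) =
      ((X * Y) ⟨x / S, hdiv x hx⟩ ⟨x % S, hmod x⟩).val := by intro x hx; rw [← hprod]; simp [hdm]
  -- add the product
  have hadd := Tri.fillLoop (B := B) (s := s4) (N := S * S) (x := bkX) (b := bkMat)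
    (bd := var bkS * var bkS)
    (e := (var bkRow * var bkS + var bkX / var bkS) * var bkN + (var bkT + var bkX % var bkS))
    (v := (.get bkMat ((var bkRow * var bkS + var bkX / var bkS) * var bkN +
      (var bkT + var bkX % var bkS)) + .get 103 (var bkBase + var bkX)) % 2)
    (T := S * S * 120 + 20)
    (fun x => (k * S + x / S) * N + (T + x % S))
    (fun x => (s.words bkMat ((k * S + x / S) * N + (T + x % S)) + s4.words 103 (a0 + x)) % 2)
    (by simp) (by omega)
    (fun s' hf => by simp [hf.w bkS (by simp), e4, hS])
    (fun x s' hx hf hx' hu => by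
      -- Since `T + S ≤ N`, distinct x give distinct addresses, so the cell still holds its old
      -- value when it is updated.
      have hu' := hu ((k * S + x / S) * N + (T + x % S)) (fun y hy h => by
        have h1 := idx_inj (by have := hmod x; omega) (by have := hmod y; omega) h; have h4 := hdm x
        rw [show x / S = y / S by omega, show x % S = y % S by omega, hdm] at h4
        omega)
      simp [hf.w bkS (by simp), hf.w bkBase (by simp), hf.w bkRow (by simp), hf.w 103 (by simp),
          hf.w bkN (by simp), hf.w bkT (by simp), hx', e4, hS, hN, hT, hk, ha0, hu'])
    (fun x y hxy hy h => by
      have h1 := idx_inj (by have := hmod x; omega) (by have := hmod y; omega) h; have h4 := hdm x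
      rw [show x / S = y / S by omega, show x % S = y % S by omega, hdm] at h4
      omega)
    (fun _ x _ => (Nat.mod_lt _ (by decide)).trans (by omega))
    (mul_add_le (by decide) (by decide))
    (fun s' hf _ h h' => And.intro hf (And.intro h h'))
  refine Tri.seq (T2 := 30 + 10 * c) hadd ?_ (by omega); rintro s5 - ⟨f5, hM, hM'⟩
  have e5 : ∀ b, b ≠ bkX ∧ b ≠ bkMat ∧ b < 100 → s5.words b = s.words b := fun b ⟨h, h', h''⟩ => by
    rw [f5.w b (by simp; omega), e4 b ⟨h, h''⟩]
  have hcost : (assign bkBase (var bkBase + (var bkS + 2).pow c)).cost ≤ 30 + 10 * c := by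
    have h1 := Expr.cost_pow (var bkS + 2) c; have h2 : (var bkS + 2).cost = 4 := rfl
    change 1 + (2 + ((var bkS + 2).pow c).cost + 1) + 1 ≤ _; rw [h1, h2]; omega
  have hfin : (assign bkBase (var bkBase + (var bkS + 2).pow c)).exec s5 =
      s5.writeWord bkBase 0 (a0 + (S + 2) ^ c) := by simp [e5, ha0, hS]
  refine Tri.block (fun _ => by simp [e5, ha0, hS]; omega) ?_ hcost; rw [hfin]
  refine ⟨fun a => ?_, fun i hi j hj => ?_, fun a ha => ?_, ?_, by simp⟩
  · simp only [State.words_of_ne _ (show 41 ≠ 52 by decide)]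
    by_cases ha : ∃ x < S * S, a = (k * S + x / S) * N + (T + x % S)
    · obtain ⟨x, hx, rfl⟩ := ha; rw [hM x hx]; exact Nat.mod_lt _ (by decide)
    · push Not at ha
      rw [hM' a ha, e4 _ (by decide)]; exact hbit a
  · simp only [State.words_of_ne _ (show 41 ≠ 52 by decide)]
    have hx : i * S + j < S * S := idx_lt hi hj; have h := hM (i * S + j) hx
    have hd := hdec ⟨i, hi⟩ ⟨j, hj⟩; simp only at hd; rw [hd.1, hd.2] at h
    rw [h, hprod' _ hx, ZMod.natCast_mod, Nat.cast_add, ZMod.natCast_zmod_val]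
    simp only [hd.1, hd.2]; rw [Matrix.mul_apply, Finset.sum_range]
  · simp only [State.words_of_ne _ (show 41 ≠ 52 by decide)]
    rw [hM' a fun x hx => ha _ (hdiv x hx) _ (hmod x), e4 _ (by decide)]
  · intro b a hb ha; simp only [State.words_same, if_true] at ha
    have hb' : ∃ b', b = b' + 100 := ⟨b - 100, by omega⟩; obtain ⟨b', rfl⟩ := hb'
    have h0 := hfresh (b' + 100) a (by omega) (by omega)
    rw [State.words_of_ne _ (by omega), State.reals_writeWord,
      f5.w _ (by simp), f5.r _ (by simp), (hold b' a ha).1, (hold b' a ha).2, r3]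
    refine ⟨?_, h0.2⟩; by_cases h100' : b' = 0
    · subst h100'; rw [show 0 + 100 = 100 from rfl, h100, if_neg (by omega)]; exact h0.1
    · by_cases hb1 : b' = 1
      · subst hb1; rw [show 1 + 100 = 101 from rfl, h101, hA' _ (by intros; omega)]; exact h0.1
      · by_cases hb2 : b' = 2
        · subst hb2
          rw [show 2 + 100 = 102 from rfl, h102, hBf' _ (by intros; omega),
            e1 _ (by decide)]
          exact h0.1
        · rw [e3 _ (by omega)]; exact h0.1

/-- Apply the transformation of the block of `bkS` columns before `bkJ` to the `bkS` columns from
`bkT` on. -/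
def applyBlock (P : Program) (c : ℕ) : Program :=
  forLoop bkX (var bkS * var bkS) (.setWord bkBuf (var bkX)
    (.get bkMat ((.get bkPiv (var bkJ - var bkS + var bkX / var bkS) - 1) * var bkN +
      (var bkT + var bkX % var bkS)) *
      (1 - (1 - .get bkPiv (var bkJ - var bkS + var bkX / var bkS))))) ;;
  forLoop bkRow (var bkN / var bkS) (multiplyRows P c)

theorem multiplyRows_wr {P : Program} {c b : ℕ} (h : (multiplyRows P c).wr b) :
    b = bkX ∨ b = bkMat ∨ b = bkBase ∨ 100 ≤ b := by
  simp only [multiplyRows, Program.wr, forLoop_wr] at h; rcases h with h | h | h | h | h | h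
  · omega
  · omega
  · omega
  · exact Or.inr (Or.inr (Or.inr (Program.le_of_shift_wr h)))
  · omega
  · omega

theorem multiplyRows_wrR {P : Program} {c b : ℕ} (h : (multiplyRows P c).wrR b) : 100 ≤ b := by
  simp only [multiplyRows, Program.wrR, forLoop_wrR, false_or, or_false] at h
  exact Program.le_of_shift_wrR h

theorem applyBlock_wr {P : Program} {c b : ℕ} (h : (applyBlock P c).wr b) :
    b = bkX ∨ b = bkMat ∨ b = bkBase ∨ b = bkBuf ∨ b = bkRow ∨ 100 ≤ b := by
  simp only [applyBlock, Program.wr, forLoop_wr] at h; rcases h with h | h | h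
  · omega
  · omega
  · have := multiplyRows_wr h; omega

theorem applyBlock_wrR {P : Program} {c b : ℕ} (h : (applyBlock P c).wrR b) : 100 ≤ b := by
  simp only [applyBlock, Program.wrR, forLoop_wrR, false_or] at h; exact multiplyRows_wrR h

theorem cast_col {s : State} {N r c : ℕ} (hr : r < N) :
    (s.words bkMat (r * N + c) : ZMod 2) = col s N c r := by simp [col, hr]

/-- The coefficients v (p t) of the target columns v form an S × S matrix, which is saved in `bkBuf`
before the pivot rows themselves are overwritten. With truncated subtraction, `1 - (1 - piv)` is 0
for a column without pivot and 1 otherwise. The N rows are cut into q = N / S blocks, and each costs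
one product of the stored block with this matrix. -/
theorem applyBlock_spec {P : Program} {c : ℕ} {τ : ℕ → ℕ} (hP : Multiplies P c τ) (hc : 2 ≤ c)
    {B N S J T q a0 : ℕ} {s : State} (hN : s.words bkN 0 = N) (hS : s.words bkS 0 = S)
    (hJ : s.words bkJ 0 = J) (hT : s.words bkT 0 = T) (ha0 : s.words bkBase 0 = a0)
    (h1S : 1 ≤ S) (hq : N = q * S) (hSJ : S ≤ J) (hJN : J ≤ N) (hTN : T + S ≤ N)
    (hdisj : T + S ≤ J - S ∨ J ≤ T) (hpiv : ∀ t, J - S ≤ t → t < J → s.words bkPiv t ≤ N)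
    (hNB : N < B) (hB : a0 + q * (S + 2) ^ c < B) (hbit : ∀ a, s.words bkMat a < 2)
    (hfresh : Fresh s) :
    Tri B (applyBlock P c) s (q * (S * S * 200 + 4 * τ S + (200 + 10 * c)) + (S * S * 100 + 100))
      (fun s' =>
        (∀ a, s'.words bkMat a < 2) ∧ (∀ x < N, T ≤ x → x < T + S →
          col s' N x = blk (s.words bkPiv) (col s N) (J - S) J (col s N x)) ∧
        (∀ x < N, ¬ (T ≤ x ∧ x < T + S) → col s' N x = col s N x) ∧
        Fresh s' ∧ s'.words bkBase 0 = a0 + q * (S + 2) ^ c) := by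
  have hSN : S ≤ N := hSJ.trans hJN; have hq1 : 1 ≤ q := Nat.pos_of_ne_zero (by rintro rfl; omega)
  have hsq : S * S < B := by
    calc S * S ≤ (S + 2) ^ 2 := by nlinarith
      _ ≤ (S + 2) ^ c := Nat.pow_le_pow_right (by omega) hc
      _ ≤ q * (S + 2) ^ c := Nat.le_mul_of_pos_left _ hq1
      _ < B := by omega
  have hmod : ∀ x, x % S < S := fun x => Nat.mod_lt _ (by omega)
  refine Tri.seq (T1 := S * S * 100 + 100) (T2 := q * (S * S * 200 + 4 * τ S + (200 + 10 * c)))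
    (R := fun s' => (∀ x < S * S, s'.words bkBuf x =
        s.words bkMat ((s.words bkPiv (J - S + x / S) - 1) * N + (T + x % S)) *
          (1 - (1 - s.words bkPiv (J - S + x / S)))) ∧
      ∀ a, (∀ x < S * S, a ≠ x) → s'.words bkBuf a = s.words bkBuf a)
    (Tri.fillLoop (N := S * S) (fun x => x)
      (fun x => s.words bkMat ((s.words bkPiv (J - S + x / S) - 1) * N + (T + x % S)) *
          (1 - (1 - s.words bkPiv (J - S + x / S)))) (by simp) hsq
      (fun s' hf => by simp [hf.w bkS (by simp), hS]) (fun x s' hx hf hx' _ => by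
        simp [hf.w bkS (by simp), hf.w bkMat (by simp), hf.w bkPiv (by simp), hf.w bkT (by simp),
          hf.w bkN (by simp), hf.w bkJ (by simp), hx', hS, hN, hJ, hT])
      (by intros; omega) (fun _ x _ => ?_)
      (mul_add_le (by decide) (by decide)) fun s' _ _ h h' => ⟨h, h'⟩)
    ?_ (by omega)
  · have := hbit ((s.words bkPiv (J - S + x / S) - 1) * N + (T + x % S))
    have h2 : 1 - (1 - s.words bkPiv (J - S + x / S)) ≤ 1 := by omega
    calc _ ≤ 1 * 1 := Nat.mul_le_mul (by omega) h2
      _ < B := by omega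
  rintro s1 f1 ⟨hbuf, hbuf'⟩
  have e1 : ∀ b, b ≠ bkX ∧ b ≠ bkBuf → s1.words b = s.words b := fun b ⟨h, h'⟩ =>
    f1.w b (by simp; omega)
  have r1 : s1.reals = s.reals := funext fun b => f1.r b (by simp)
  have hcol1 : ∀ x, col s1 N x = col s N x := by intro x; funext r; simp [col, e1]
  -- the coefficients
  have hcoef : ∀ t < S, ∀ j < S, (s1.words bkBuf (t * S + j) : ZMod 2) =
      if s.words bkPiv (J - S + t) = 0 then 0
      else col s N (T + j) (s.words bkPiv (J - S + t) - 1) := by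
    intro t ht j hj; rw [hbuf _ (idx_lt ht hj)]
    have h1 : (t * S + j) / S = t := by
      rw [mul_comm, Nat.mul_add_div (by omega), Nat.div_eq_of_lt hj, add_zero]
    have h2 : (t * S + j) % S = j := by rw [mul_comm, Nat.mul_add_mod, Nat.mod_eq_of_lt hj]
    rw [h1, h2]; split_ifs with h0
    · simp [h0]
    · have := hpiv (J - S + t) (by omega) (by omega)
      rw [show 1 - (1 - s.words bkPiv (J - S + t)) = 1 by omega, mul_one, cast_col (by omega)]
  have hblk : ∀ x < N, T ≤ x → x < T + S → ∀ r,
      blk (s.words bkPiv) (col s N) (J - S) J (col s N x) r = col s N x r +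
        ∑ t ∈ Finset.range S, col s N (J - S + t) r * s1.words bkBuf (t * S + (x - T)) := by
    intro x hx hTx hxT r
    rw [blk_apply, Pi.add_apply, Finset.sum_apply, Finset.sum_Ico_eq_sum_range,
      show J - (J - S) = S by omega]
    congr 1
    refine Finset.sum_congr rfl fun t ht => ?_; rw [Finset.mem_range] at ht
    rw [hcoef t ht _ (by omega)]; split_ifs with h0
    · simp
    · rw [Pi.smul_apply, smul_eq_mul, mul_comm, show T + (x - T) = x by omega]
  -- all rows
  refine Tri.forLoop (N := q) (Tb := S * S * 200 + 4 * τ S + (100 + 10 * c)) (fun k s' =>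
      (∀ a, s'.words bkMat a < 2) ∧
      (∀ x < N, ∀ r < N, col s' N x r = if T ≤ x ∧ x < T + S ∧ r < k * S then
        blk (s.words bkPiv) (col s N) (J - S) J (col s N x) r else col s N x r) ∧
      Fresh s' ∧ s'.words bkBase 0 = a0 + k * (S + 2) ^ c)
    (fun h => by have := multiplyRows_wr h; omega) (by nlinarith) ?_ ?_ ?_ ?_ ?_ ?_
  · intro s' hf
    have hw : ∀ b, b = bkN ∨ b = bkS → s'.words b = s1.words b := fun b hb => hf.w b (by
      rw [forLoop_wr]; rintro (h | h)
      · omega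
      · have := multiplyRows_wr h; omega)
    simp only [Expr.val_div, Expr.val, hw _ (Or.inl rfl), hw _ (Or.inr rfl),
      e1 bkN (by decide), e1 bkS (by decide), hN, hS, hq]
    exact Nat.mul_div_cancel _ (by omega)
  · refine ⟨by simpa [e1] using hbit, ?_, ?_, by simp [e1, ha0]⟩
    · intro x hx r hr; simp [hcol1]
    · intro b a hb ha; rw [e1 _ (by omega), r1]
      exact hfresh b a hb (by rwa [e1 _ (by decide)] at ha)
  · rintro k s' y ⟨h1, h2, h3, h4⟩; refine ⟨by simpa using h1, ?_, ?_, by simpa using h4⟩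
    · intro x hx r hr; rw [← h2 x hx r hr]; simp [col]
    · intro b a hb ha; rw [State.words_of_ne _ (by omega)] at ha ⊢; exact h3 b a hb ha
  · rintro k s' hk hk' hf ⟨h1, h2, h3, h4⟩
    have hw : ∀ b, b ≠ bkX ∧ b ≠ bkBuf ∧ b ≠ bkRow ∧ b ≠ bkMat ∧ b ≠ bkBase ∧ b < 100 →
        s'.words b = s.words b := fun b ⟨g1, g2, g3, g4, g5, g6⟩ => (hf.w b (by
      rw [forLoop_wr]; rintro (h | h)
      · omega
      · have := multiplyRows_wr h; omega)).trans (e1 b ⟨g1, g2⟩)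
    have hwb : s'.words bkBuf = s1.words bkBuf := hf.w bkBuf (by
      rw [forLoop_wr]; rintro (h | h)
      · omega
      · have := multiplyRows_wr h; omega)
    have hkS : k * S + S ≤ N := by rw [hq]; nlinarith
    have hkq : (k + 1) * (S + 2) ^ c ≤ q * (S + 2) ^ c := Nat.mul_le_mul_right _ hk
    rw [Nat.succ_mul] at hkq
    have hbufbit : ∀ a < S * S, s'.words bkBuf a < 2 := by
      intro a ha; rw [hwb, hbuf a ha]
      have h1 := hbit ((s.words bkPiv (J - S + a / S) - 1) * N + (T + a % S))
      have h2 : 1 - (1 - s.words bkPiv (J - S + a / S)) ≤ 1 := by omega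
      have := Nat.mul_le_mul (Nat.le_of_lt_succ h1) h2; omega
    refine (multiplyRows_spec hP hc (N := N) (S := S) (J := J) (T := T) (k := k)
      (a0 := a0 + k * (S + 2) ^ c) (by rw [hw _ (by decide), hN]) (by rw [hw _ (by decide), hS])
      (by rw [hw _ (by decide), hJ]) (by rw [hw _ (by decide), hT])
      hk' h4 h1S hTN (by omega) h1 hbufbit h3).mono le_rfl ?_
    rintro s'' - ⟨g1, g2, g3, g4, g5⟩; refine ⟨g1, ?_, g4, by rw [g5]; ring⟩; intro x hx r hr
    by_cases hin : (T ≤ x ∧ x < T + S) ∧ k * S ≤ r ∧ r < k * S + S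
    · obtain ⟨⟨hx1, hx2⟩, hr1, hr2⟩ := hin
      rw [if_pos ⟨hx1, hx2, by rw [Nat.succ_mul]; exact hr2⟩, hblk x hx hx1 hx2, ← cast_col hr]
      have := g2 (r - k * S) (by omega) (x - T) (by omega)
      rw [show k * S + (r - k * S) = r by omega, show T + (x - T) = x by omega] at this
      rw [this, cast_col hr, h2 x hx r hr, if_neg (by omega)]
      congr 1
      refine Finset.sum_congr rfl fun t ht => ?_; rw [Finset.mem_range] at ht
      rw [cast_col hr, h2 _ (by omega) r hr, if_neg (by omega), hwb]
    · have : s''.words bkMat (r * N + x) = s'.words bkMat (r * N + x) := by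
        refine g3 _ fun i hi j hj h => hin ?_; have := idx_inj hx (by omega) h; omega
      rw [← cast_col hr, this, cast_col hr, h2 x hx r hr, Nat.succ_mul]
      by_cases hx1 : T ≤ x ∧ x < T + S
      · by_cases hr1 : r < k * S
        · rw [if_pos ⟨hx1.1, hx1.2, hr1⟩, if_pos ⟨hx1.1, hx1.2, by omega⟩]
        · rw [if_neg (by omega), if_neg (by omega)]
      · rw [if_neg (by omega), if_neg (by omega)]
  · have : (var bkN / var bkS).cost = 5 := rfl; rw [this]
    have : q * (S * S * 200 + 4 * τ S + (200 + 10 * c)) =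
      q * (S * S * 200 + 4 * τ S + (100 + 10 * c) + (5 + 10)) + q * 85 := by ring
    omega
  · rintro s' - - ⟨h1, h2, h3, h4⟩; refine ⟨h1, ?_, ?_, h3, h4⟩
    · intro x hx hx1 hx2; funext r; by_cases hr : r < N
      · rw [h2 x hx r hr, if_pos ⟨hx1, hx2, by rwa [← hq]⟩]
      · rw [hblk x hx hx1 hx2]; simp [col, hr]
    · intro x hx hx1; funext r; by_cases hr : r < N
      · rw [h2 x hx r hr, if_neg (by tauto)]
      · simp [col, hr]

end GaussJordan

/-! ### The recursion on dyadic blocks of columns. -/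

namespace GaussJordan

open RAM

/-- One step of the elimination: when the block of `bkS` columns before `bkJ` is complete, apply its
transformation to the sibling block.  If the block is a left sibling, continue with the column
`bkJ`, otherwise the parent block is complete. -/
def elimStep (P : Program) (c : ℕ) : Program := .ite (.eq (var bkJ / var bkS % 2) 1)
    (assign bkT (var bkJ) ;; applyBlock P c ;; factorColumn ;; assign bkJ (var bkJ + 1) ;;
      assign bkS 1)
    (assign bkT (var bkJ - 2 * var bkS) ;; applyBlock P c ;; assign bkS (2 * var bkS))

/-- Gauss–Jordan elimination of the `bkN × bkN` matrix in `bkMat`, where `bkN` is a power of two. -/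
def eliminate (P : Program) (c : ℕ) : Program :=
  forLoop bkR (var bkN) (.setWord bkUsed (var bkR) 0) ;;
  assign bkJ 0 ;; factorColumn ;; assign bkJ 1 ;; assign bkS 1 ;;
  .loop (.lt (var bkS) (var bkN)) (elimStep P c)

def applyTime (τ : ℕ → ℕ) (c q S : ℕ) : ℕ :=
  q * (S * S * 200 + 4 * τ S + (200 + 10 * c)) + (S * S * 100 + 100)

/-- A block of `2 ^ (k + 1)` columns takes two half blocks, one application in each direction
between them, and the pivot search in the first column of the right half. -/
def elimTime (τ : ℕ → ℕ) (c N : ℕ) : ℕ → ℕ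
  | 0 => 0
  | k + 1 => 2 * elimTime τ c N k + 2 * applyTime τ c (N / 2 ^ k) (2 ^ k) + N * 60 + 300

/-- Every application at level k uses up `N / 2 ^ k` regions of size `(2 ^ k + 2) ^ c`, and regions
are never reused. -/
def elimSpace (c N : ℕ) : ℕ → ℕ
  | 0 => 0
  | k + 1 => 2 * elimSpace c N k + 2 * ((N / 2 ^ k) * (2 ^ k + 2) ^ c)

theorem factorColumn_wr {b : ℕ} (h : factorColumn.wr b) :
    b = bkPv ∨ b = bkR ∨ b = bkPiv ∨ b = bkUsed ∨ b = bkMat := by simp [factorColumn] at h; omega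

theorem factorColumn_wrR {b : ℕ} : factorColumn.wrR b ↔ False := by simp [factorColumn]

/-- The part of the state that is preserved by the elimination. -/
structure Valid (N : ℕ) (s : State) : Prop where
  order : s.words bkN 0 = N
  bit : ∀ a, s.words bkMat a < 2
  fresh : Fresh s

theorem Valid.congr {N : ℕ} {s s' : State} (h : Valid N s) (h1 : s'.words bkN = s.words bkN)
    (h2 : s'.words bkMat = s.words bkMat) (h3 : s'.words bkBase = s.words bkBase)
    (h4 : ∀ b, 100 ≤ b → s'.words b = s.words b ∧ s'.reals b = s.reals b) : Valid N s' := by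
  refine ⟨by rw [h1, h.order], by rw [h2]; exact h.bit, fun b a hb ha => ?_⟩
  rw [(h4 b hb).1, (h4 b hb).2]; exact h.fresh b a hb (by rwa [h3] at ha)

theorem col_congr {s s' : State} (h : s'.words bkMat = s.words bkMat) (N x : ℕ) :
    col s' N x = col s N x := by unfold col; rw [h]

section

variable {P : Program} {c : ℕ} {τ : ℕ → ℕ} (hP : Multiplies P c τ) (hc : 2 ≤ c)
include hP hc

/-- The finished block is a left sibling. Its transformation must reach the right sibling before any
column there is eliminated; afterwards the column J is treated at once and forms a finished block of
size one. `M` stands for the transformed right columns, the input of the elimination of the right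
half. -/
theorem elimStep_odd
    {B N S J q : ℕ} {s : State} (hv : Valid N s) (hS : s.words bkS 0 = S)
    (hJ : s.words bkJ 0 = J) (h1S : 1 ≤ S) (hq : N = q * S) (hSJ : S ≤ J) (hJN : J + S ≤ N)
    (hodd : J / S % 2 = 1) (hpiv : ∀ t, J - S ≤ t → t < J → s.words bkPiv t ≤ N)
    (hNB : N + 1 < B) (hB : s.words bkBase 0 + q * (S + 2) ^ c < B)
    {used : ℕ → Prop} {M : ℕ → Vec} (hused : ∀ r, s.words bkUsed r ≠ 0 ↔ used r)
    (hM : ∀ x, J ≤ x → x < J + S → M x = blk (s.words bkPiv) (col s N) (J - S) J (col s N x)) :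
    Tri B (elimStep P c) s (applyTime τ c q S + N * 60 + 100) (fun s' =>
      Valid N s' ∧ s'.words bkS 0 = 1 ∧ s'.words bkJ 0 = J + 1 ∧
      (∀ x < N, ¬ (J ≤ x ∧ x < J + S) → col s' N x = col s N x) ∧
      (∀ x, x ≠ J → s'.words bkPiv x = s.words bkPiv x) ∧
      (∀ x, J < x → x < J + S → col s' N x = M x) ∧
      Elim N used J (J + 1) M (col s' N) (s'.words bkPiv) ∧
      (∀ r, s'.words bkUsed r ≠ 0 ↔ used r ∨ s'.words bkPiv J = r + 1) ∧
      s'.words bkBase 0 = s.words bkBase 0 + q * (S + 2) ^ c) := by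
  have hcost : (Test.eq (var bkJ / var bkS % 2) 1).cost = 19 := rfl
  refine Tri.ite (T1 := applyTime τ c q S + N * 60 + 80) (fun _ => ?_)
    (fun h => absurd (by rw [Test.holds_eq]; simpa [hS, hJ] using hodd) h) (by rw [hcost]; omega)
  refine Tri.seq (T1 := 4) (T2 := applyTime τ c q S + N * 60 + 76)
    (R := fun s' => s' = s.writeWord bkT 0 J)
    (Tri.block (fun _ => by simp [hJ]; omega) (by simp [hJ]) (by decide)) ?_ (by omega)
  rintro s1 - hs1
  have e1 : ∀ b, b ≠ bkT → s1.words b = s.words b := fun b h => by rw [hs1, State.words_of_ne _ h]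
  have hv1 : Valid N s1 := hv.congr (e1 _ (by decide)) (e1 _ (by decide)) (e1 _ (by decide))
    fun b hb => ⟨e1 b (by omega), by rw [hs1]; rfl⟩
  have hcol1 : ∀ x, col s1 N x = col s N x := col_congr (e1 _ (by decide)) N
  refine Tri.seq (T2 := N * 60 + 76)
    (applyBlock_spec hP hc (N := N) (S := S) (J := J) (T := J) (q := q) hv1.order
      (by rw [e1 _ (by decide), hS]) (by rw [e1 _ (by decide), hJ]) (by simp [hs1])
      (e1 bkBase (by decide) ▸ rfl) h1S hq hSJ (by omega) hJN (Or.inr le_rfl)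
      (by rwa [e1 _ (by decide)]) (by omega) hB hv1.bit hv1.fresh) ?_
      (by rw [applyTime]; omega)
  rintro s2 f2 ⟨hbit2, hin, hout, hfr2, hbase2⟩
  have e2 : ∀ b, b ≠ bkT ∧ b ≠ bkX ∧ b ≠ bkMat ∧ b ≠ bkBase ∧ b ≠ bkBuf ∧ b ≠ bkRow ∧ b < 100 →
      s2.words b = s.words b := fun b ⟨h1, h2, h3, h4, h5, h6, h7⟩ => by
    rw [f2.w b (fun h => by have := applyBlock_wr h; omega), e1 b h1]
  have hN2 : s2.words bkN 0 = N := by rw [e2 _ (by decide), hv.order]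
  have hJ2 : s2.words bkJ 0 = J := by rw [e2 _ (by decide), hJ]
  have hU2 : s2.words bkUsed = s.words bkUsed := e2 _ (by decide)
  have hP2 : s2.words bkPiv = s.words bkPiv := e2 _ (by decide)
  have hin' : ∀ x, J ≤ x → x < J + S → col s2 N x = M x := by
    intro x h1 h2; rw [hin x (by omega) h1 h2, hM x h1 h2, hcol1, e1 _ (by decide)]
    exact congrArg (fun f => f (col s N x)) (blk_congr (fun _ _ _ => rfl) fun t _ _ => hcol1 t)
  refine Tri.seq (T2 := 16) (factorColumn_spec hNB hN2 hJ2 (by omega) hbit2) ?_ (by omega)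
  rintro s3 f3 ⟨hpiv3, hbit3, hcol3, hcase⟩
  have e3 : ∀ b, b ≠ bkPv ∧ b ≠ bkR ∧ b ≠ bkPiv ∧ b ≠ bkUsed ∧ b ≠ bkMat →
      s3.words b = s2.words b := fun b ⟨h1, h2, h3, h4, h5⟩ =>
    f3.w b (fun h => by have := factorColumn_wr h; omega)
  have hJ3 : s3.words bkJ 0 = J := by rw [e3 _ (by decide), hJ2]
  have hb3 : s3.words bkBase = s2.words bkBase := e3 _ (by decide)
  refine Tri.block (fun _ => by simp [hJ3]; omega) ?_ (by decide)
  have hx : (assign bkJ (var bkJ + 1) ;; assign bkS 1).exec s3 =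
      (s3.writeWord bkJ 0 (J + 1)).writeWord bkS 0 1 := by simp [hJ3]
  rw [hx]
  have hcol4 : ∀ x, col ((s3.writeWord bkJ 0 (J + 1)).writeWord bkS 0 1) N x = col s3 N x :=
    col_congr (by simp) N
  refine ⟨⟨?_, ?_, ?_⟩, by simp, by simp, ?_, ?_, ?_, ?_, ?_, ?_⟩
  · simp [e3, hN2]
  · simpa using hbit3
  · intro b a hb ha; rw [State.words_of_ne _ (by omega), State.words_of_ne _ (by omega)]
    simp only [State.reals_writeWord]; rw [e3 _ (by omega), f3.r b (by rw [factorColumn_wrR]; simp)]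
    refine hfr2 b a hb ?_; simpa [hb3] using ha
  · intro x hx hx'; rw [hcol4, hcol3 x hx (by omega), hout x hx hx', hcol1]
  · intro x hx; simp [hpiv3 x hx, hP2]
  · intro x h1 h2; rw [hcol4, hcol3 x (by omega) (by omega), hin' x h1.le h2]
  · have hMJ := hin' J le_rfl (by omega); rw [hMJ] at hcase
    have hw : ((s3.writeWord bkJ 0 (J + 1)).writeWord bkS 0 1).words bkPiv = s3.words bkPiv := by
      simp
    rw [hw]; rcases hcase with ⟨h1, h2, h3, h4⟩ | ⟨i, hi, h1, h2, h3, h4, h5⟩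
    · refine Elim.single_none h1 (fun r hr => h2 r ?_) (by rw [hcol4]; exact h3); rw [hU2]
      exact by_contra fun h => hr ((hused r).1 h)
    · refine Elim.single_some h1 hi ?_ h3 (by rw [hcol4]; exact h4); rw [← hused, ← hU2]
      exact fun h => h h2
  · intro r
    have hw : ((s3.writeWord bkJ 0 (J + 1)).writeWord bkS 0 1).words bkPiv = s3.words bkPiv := by
      simp
    have hw' : ((s3.writeWord bkJ 0 (J + 1)).writeWord bkS 0 1).words bkUsed = s3.words bkUsed := by
      simp
    rw [hw, hw', ← hused]; rcases hcase with ⟨h1, h2, h3, h4⟩ | ⟨i, hi, h1, h2, h3, h4, h5⟩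
    · rw [h4, h1, hU2]; simp
    · rw [h5, h1, hU2]; by_cases hr : r = i
      · simp [hr]
      · simp [hr, Ne.symm hr]
  · simp [hb3, hbase2]

/-- The finished block is a right sibling. Passing the stored left columns through its
transformation is the requirement on left columns in `blk_comp`, so the two siblings become one
finished block of size 2S. -/
theorem elimStep_even
    {B N S J q : ℕ} {s : State} (hv : Valid N s) (hS : s.words bkS 0 = S)
    (hJ : s.words bkJ 0 = J) (h1S : 1 ≤ S) (hq : N = q * S) (hSJ : 2 * S ≤ J) (hJN : J ≤ N)
    (heven : J / S % 2 = 0) (hpiv : ∀ t, J - S ≤ t → t < J → s.words bkPiv t ≤ N)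
    (hNB : N + 1 < B) (hB : s.words bkBase 0 + q * (S + 2) ^ c < B) :
    Tri B (elimStep P c) s (applyTime τ c q S + 100) (fun s' =>
      Valid N s' ∧ s'.words bkS 0 = 2 * S ∧ s'.words bkJ 0 = J ∧
      (∀ x < N, ¬ (J - 2 * S ≤ x ∧ x < J - S) → col s' N x = col s N x) ∧
      (∀ x, J - 2 * S ≤ x → x < J - S → col s' N x =
        blk (s.words bkPiv) (col s N) (J - S) J (col s N x)) ∧
      s'.words bkPiv = s.words bkPiv ∧ s'.words bkUsed = s.words bkUsed ∧
      s'.words bkBase 0 = s.words bkBase 0 + q * (S + 2) ^ c) := by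
  have hcost : (Test.eq (var bkJ / var bkS % 2) 1).cost = 19 := rfl
  refine Tri.ite (T1 := applyTime τ c q S + 80) (fun h => ?_) (fun _ => ?_) (by rw [hcost]; omega)
  · rw [Test.holds_eq] at h; simp [hS, hJ] at h; omega
  refine Tri.seq (T1 := 10) (T2 := applyTime τ c q S + 70)
    (R := fun s' => s' = s.writeWord bkT 0 (J - 2 * S))
    (Tri.block (fun _ => by simp [hJ, hS]; omega) (by simp [hJ, hS]) (by decide)) ?_ (by omega)
  rintro s1 - hs1
  have e1 : ∀ b, b ≠ bkT → s1.words b = s.words b := fun b h => by rw [hs1, State.words_of_ne _ h]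
  have hv1 : Valid N s1 := hv.congr (e1 _ (by decide)) (e1 _ (by decide)) (e1 _ (by decide))
    fun b hb => ⟨e1 b (by omega), by rw [hs1]; rfl⟩
  have hcol1 : ∀ x, col s1 N x = col s N x := col_congr (e1 _ (by decide)) N
  refine Tri.seq (T2 := 70)
    (applyBlock_spec hP hc (N := N) (S := S) (J := J) (T := J - 2 * S) (q := q) hv1.order
      (by rw [e1 _ (by decide), hS]) (by rw [e1 _ (by decide), hJ]) (by simp [hs1])
      (e1 bkBase (by decide) ▸ rfl) h1S hq (by omega) (by omega) (by omega) (Or.inl (by omega))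
      (by rwa [e1 _ (by decide)]) (by omega) hB hv1.bit hv1.fresh) ?_
      (by rw [applyTime])
  rintro s2 f2 ⟨hbit2, hin, hout, hfr2, hbase2⟩
  have e2 : ∀ b, b ≠ bkT ∧ b ≠ bkX ∧ b ≠ bkMat ∧ b ≠ bkBase ∧ b ≠ bkBuf ∧ b ≠ bkRow ∧ b < 100 →
      s2.words b = s.words b := fun b ⟨h1, h2, h3, h4, h5, h6, h7⟩ => by
    rw [f2.w b (fun h => by have := applyBlock_wr h; omega), e1 b h1]
  have hS2 : s2.words bkS 0 = S := by simp [e2, hS]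
  refine Tri.block (fun _ => by simp [hS2]; omega) ?_ (by decide)
  have hx : (assign bkS (2 * var bkS)).exec s2 = s2.writeWord bkS 0 (2 * S) := by simp [hS2]
  rw [hx]
  have hcol3 : ∀ x, col (s2.writeWord bkS 0 (2 * S)) N x = col s2 N x := col_congr (by simp) N
  refine ⟨⟨?_, ?_, ?_⟩, by simp, ?_, ?_, ?_, ?_, ?_, ?_⟩
  · simp [e2, hv.order]
  · simpa using hbit2
  · intro b a hb ha; rw [State.words_of_ne _ (by omega), State.reals_writeWord]
    exact hfr2 b a hb (by simpa using ha)
  · simp [e2, hJ]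
  · intro x hx hx'; rw [hcol3, hout x hx (by omega), hcol1]
  · intro x h1 h2; rw [hcol3, hin x (by omega) h1 (by omega), hcol1, e1 _ (by decide)]
    exact congrArg (fun f => f (col s N x)) (blk_congr (fun _ _ _ => rfl) fun t _ _ => hcol1 t)
  · simp [e2]
  · simp [e2]
  · simp [hbase2]

/-- No stack is needed: the number J of finished columns and the size S of the last finished block
determine the next step. Induction on k: left half, application to the right, right half,
application to the left. The initial state has the first column of the block already eliminated,
because `elimStep` treats that column when it enters a right half. -/
theorem elimSteps
    {B N K : ℕ} (hNK : N = 2 ^ K) (hNB : N + 1 < B) (k : ℕ) (hk : k ≤ K) :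
    ∀ (a : ℕ) (s : State) (used : ℕ → Prop) (M : ℕ → Vec), s.Bdd B → 2 ^ k ∣ a → a + 2 ^ k ≤ N →
      Valid N s → s.words bkS 0 = 1 → s.words bkJ 0 = a + 1 →
      Elim N used a (a + 1) M (col s N) (s.words bkPiv) →
      (∀ x, a < x → x < a + 2 ^ k → col s N x = M x) →
      (∀ r, s.words bkUsed r ≠ 0 ↔ used r ∨ s.words bkPiv a = r + 1) →
      s.words bkBase 0 + elimSpace c N k < B →
      ∃ t s', (elimStep P c).Steps B (.lt (var bkS) (var bkN)) s t s' ∧ t ≤ elimTime τ c N k ∧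
        Valid N s' ∧ s'.words bkS 0 = 2 ^ k ∧ s'.words bkJ 0 = a + 2 ^ k ∧
        Elim N used a (a + 2 ^ k) M (col s' N) (s'.words bkPiv) ∧
        (∀ x < N, ¬ (a ≤ x ∧ x < a + 2 ^ k) →
          col s' N x = col s N x ∧ s'.words bkPiv x = s.words bkPiv x) ∧
        (∀ r, s'.words bkUsed r ≠ 0 ↔
          used r ∨ ∃ t, a ≤ t ∧ t < a + 2 ^ k ∧ s'.words bkPiv t = r + 1) ∧
        s'.words bkBase 0 ≤ s.words bkBase 0 + elimSpace c N k := by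
  induction k with
  | zero =>
    intro a s used M hb _ _ hv hS hJ hE _ hu _
    refine ⟨0, s, .refl s, by simp [elimTime], hv, by simpa using hS, by simpa using hJ,
      by simpa using hE, fun x _ _ => ⟨rfl, rfl⟩, fun r => ?_, by omega⟩
    rw [hu r]; constructor
    · rintro (h | h)
      · exact Or.inl h
      · exact Or.inr ⟨a, le_rfl, by simp, h⟩
    · rintro (h | ⟨t, h1, h2, h3⟩)
      · exact Or.inl h
      · obtain rfl : t = a := by simp at h2; omega
        exact Or.inr h3
  | succ k ih =>
    intro a s used M hb hdvd haN hv hS hJ hE hM hu hB; have ih := ih (by omega)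
    set S := 2 ^ k with hSdef; have h1S : 1 ≤ S := Nat.one_le_two_pow
    have h2S : 2 ^ (k + 1) = 2 * S := by rw [pow_succ]; ring
    rw [h2S] at hdvd haN hM ⊢; obtain ⟨d, hd⟩ := hdvd
    have hq : N = N / S * S := by rw [Nat.div_mul_cancel]; rw [hNK]; exact pow_dvd_pow 2 (by omega)
    simp only [elimSpace, ← hSdef] at hB ⊢; have hlt : (Test.lt (var bkS) (var bkN)).cost = 6 := rfl
    set q := N / S with hqdef; set Z := q * (S + 2) ^ c with hZ
    -- the left half
    obtain ⟨t1, s1, st1, ht1, hv1, hS1, hJ1, hE1, hout1, hu1, hb1⟩ :=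
      ih a s used M hb (by rw [hd]; exact ⟨2 * d, by ring⟩) (by omega) hv hS hJ hE
        (fun x h1 h2 => hM x h1 (by omega)) hu (by omega)
    have hbd1 := st1.bdd hb
    -- its transformation is applied to the right half
    have hM1 : ∀ x, a + S ≤ x → x < a + S + S → col s1 N x = M x := fun x h1 h2 => by
      rw [(hout1 x (by omega) (by omega)).1, hM x (by omega) (by omega)]
    obtain ⟨t2, s2, st2, ht2, hv2, hS2, hJ2, hout2, hpiv2, hin2, hE2, hu2, hb2⟩ :=
      elimStep_odd hP hc (q := q) (J := a + S) (S := S) hv1 hS1 hJ1 h1S hq (by omega) (by omega)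
        (by
          have : a + S = S * (2 * d + 1) := by rw [hd]; ring
          rw [this, Nat.mul_div_cancel_left _ (by omega)]; omega)
        (fun t h1 h2 => hE1.le t (by omega) h2) hNB (by omega)
        (used := fun r => used r ∨ ∃ t, a ≤ t ∧ t < a + S ∧ s1.words bkPiv t = r + 1)
        (M := fun x => blk (s1.words bkPiv) (col s1 N) a (a + S) (M x)) hu1
        (fun x h1 h2 => by simp only [Nat.add_sub_cancel, hM1 x h1 h2]) hbd1
    have hbd2 := st2.bdd hbd1
    -- the right half
    obtain ⟨t3, s3, st3, ht3, hv3, hS3, hJ3, hE3, hout3, hu3, hb3⟩ :=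
      ih (a + S) s2 _ _ hbd2 (by rw [hd]; exact ⟨2 * d + 1, by ring⟩) (by omega) hv2 hS2 hJ2 hE2
        hin2 hu2 (by omega)
    have hbd3 := st3.bdd hbd2
    -- its transformation is applied to the left half
    obtain ⟨t4, s4, st4, ht4, hv4, hS4, hJ4, hout4, hin4, hpiv4, hu4, hb4⟩ :=
      elimStep_even hP hc (q := q) (J := a + S + S) (S := S) hv3 hS3 hJ3 h1S hq (by omega)
        (by omega)
        (by
          have : a + S + S = S * (2 * d + 2) := by rw [hd]; ring
          rw [this, Nat.mul_div_cancel_left _ (by omega)]; omega)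
        (fun t h1 h2 => hE3.le t (by omega) h2) hNB (by omega) hbd3
    have hholds : ∀ s' : State, s'.words bkS 0 = S → Valid N s' →
        (Test.lt (var bkS) (var bkN)).holds s' := by
      intro s' h1 h2; rw [Test.holds_lt]; simp [h1, h2.order]; omega
    have hpiv3 : ∀ x < N, ¬ (a + S ≤ x ∧ x < a + S + S) → s3.words bkPiv x = s1.words bkPiv x :=
      fun x h1 h2 => by rw [(hout3 x h1 h2).2, hpiv2 x (by omega)]
    have hcol3 : ∀ x < N, ¬ (a + S ≤ x ∧ x < a + S + S) → col s3 N x = col s1 N x :=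
      fun x h1 h2 => by rw [(hout3 x h1 h2).1, hout2 x h1 h2]
    -- The two halves were certified in different states. Pivots outside the block being processed
    -- do not change, so both certificates can be read with the final pivots.
    have hE1' := hE1.congr (used' := used) (M0' := M) (U' := col s1 N) (piv' := s4.words bkPiv)
      (fun _ => Iff.rfl) (fun _ _ _ => rfl) (fun _ _ _ => rfl)
      (fun t h1 h2 => by rw [hpiv4]; exact hpiv3 t (by omega) (by omega))
    have hE3' := hE3.congr
      (used' := fun r => used r ∨ ∃ t, a ≤ t ∧ t < a + S ∧ s4.words bkPiv t = r + 1)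
      (M0' := fun x => blk (s4.words bkPiv) (col s1 N) a (a + S) (M x))
      (U' := col s3 N) (piv' := s4.words bkPiv)
      (fun r => by
        have : ∀ t, (a ≤ t ∧ t < a + S ∧ s4.words bkPiv t = r + 1) ↔
            (a ≤ t ∧ t < a + S ∧ s1.words bkPiv t = r + 1) := by
          intro t; by_cases h : a ≤ t ∧ t < a + S
          · rw [hpiv4, hpiv3 t (by omega) (by omega)]
          · tauto
        simp only [this])
      (fun t _ _ => by
        have : blk (s4.words bkPiv) (col s1 N) a (a + S) =
            blk (s1.words bkPiv) (col s1 N) a (a + S) :=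
          blk_congr (fun t h1 h2 => by rw [hpiv4]; exact hpiv3 t (by omega) (by omega))
            fun _ _ _ => rfl
        rw [this])
      (fun _ _ _ => rfl) (fun _ _ _ => by rw [hpiv4])
    have hcomp := Elim.comp (U := col s4 N) (by omega) (by omega) hE1' hE3' (fun _ _ _ => rfl)
      (fun t h1 h2 => by
        rw [hin4 t (by omega) (by omega), hpiv4, hcol3 t (by omega) (by omega),
          show a + S + S - S = a + S by omega])
      (fun t h1 h2 => hout4 t (by omega) (by omega))
    refine ⟨_, s4, st1.trans (.step (hholds s1 hS1 hv1) st2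
      (st3.trans (.step (hholds s3 hS3 hv3) st4 (.refl _)))), ?_, hv4, hS4, ?_, ?_, ?_, ?_, ?_⟩
    · rw [hlt, elimTime, ← hSdef, ← hqdef]; omega
    · rw [hJ4]; ring
    · rw [show a + 2 * S = a + S + S by ring]; exact hcomp
    · intro x h1 h2; rw [hout4 x h1 (by omega), hcol3 x h1 (by omega), hpiv4, hpiv3 x h1 (by omega)]
      exact hout1 x h1 (by omega)
    · intro r; rw [hu4, hu3 r, hpiv4]; constructor
      · rintro ((h | ⟨t, h1, h2, h3⟩) | ⟨t, h1, h2, h3⟩)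
        · exact Or.inl h
        · exact Or.inr ⟨t, h1, by omega, by rw [hpiv3 t (by omega) (by omega), h3]⟩
        · exact Or.inr ⟨t, by omega, by omega, h3⟩
      · rintro (h | ⟨t, h1, h2, h3⟩)
        · exact Or.inl (Or.inl h)
        · rcases lt_or_ge t (a + S) with h | h
          · exact Or.inl (Or.inr ⟨t, h1, h, by rw [← hpiv3 t (by omega) (by omega), h3]⟩)
          · exact Or.inr ⟨t, h, by omega, h3⟩
    · omega

end

/-- The slack `2 * (N * (N + 2) ^ c)` on the left doubles with the recursion and thereby pays for
the additive term of each level. -/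
theorem elimSpace_le {c N K : ℕ} (hN : N = 2 ^ K) (k : ℕ) (hk : k ≤ K) :
    elimSpace c N k + 2 * (N * (N + 2) ^ c) ≤ 2 * 2 ^ k * (N * (N + 2) ^ c) := by
  induction k with
  | zero => simp [elimSpace]
  | succ k ih =>
    have ih := ih (by omega); have h1 : 2 ^ k ≤ N := hN ▸ Nat.pow_le_pow_right (by omega) (by omega)
    have h2 : N / 2 ^ k * (2 ^ k + 2) ^ c ≤ N * (N + 2) ^ c :=
      Nat.mul_le_mul (Nat.div_le_self _ _) (Nat.pow_le_pow_left (by omega) _)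
    rw [elimSpace, pow_succ]
    have h3 : 2 * (2 ^ k * 2) * (N * (N + 2) ^ c) = 2 * (2 * 2 ^ k * (N * (N + 2) ^ c)) := by ring
    rw [h3]; omega

theorem elimStep_wr {P : Program} {c b : ℕ} (h : (elimStep P c).wr b) :
    (41 ≤ b ∧ b ≤ 52) ∨ 100 ≤ b := by
  simp only [elimStep, Program.wr] at h; rcases h with (h | h | h | h | h) | (h | h | h)
  all_goals first
    | omega
    | (have := applyBlock_wr h; omega)
    | (have := factorColumn_wr h; omega)

theorem elimStep_wrR {P : Program} {c b : ℕ} (h : (elimStep P c).wrR b) : 100 ≤ b := by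
  simp only [elimStep, Program.wrR, factorColumn_wrR, false_or, or_false] at h
  rcases h with h | h <;> exact applyBlock_wrR h

theorem eliminate_wr {P : Program} {c b : ℕ} (h : (eliminate P c).wr b) :
    (41 ≤ b ∧ b ≤ 52) ∨ 100 ≤ b := by
  simp only [eliminate, Program.wr, forLoop_wr] at h; rcases h with h | h | h | h | h | h
  all_goals first
    | omega
    | exact elimStep_wr h
    | (have := factorColumn_wr h; omega)

theorem eliminate_wrR {P : Program} {c b : ℕ} (h : (eliminate P c).wrR b) : 100 ≤ b := by
  simp only [eliminate, Program.wrR, factorColumn_wrR, forLoop_wrR, false_or] at h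
  exact elimStep_wrR h

/-- The marks of used rows are cleared only below N, so rows from N on may count as used. These rows
vanish in the matrix, hence also in every transform of a column, and the marks there are irrelevant.
-/
theorem Elim.of_zero {N : ℕ} {used : ℕ → Prop} {a b : ℕ} {M U : ℕ → Vec} {piv : ℕ → ℕ}
    (h : Elim N used a b M U piv) (hu : ∀ r, used r → N ≤ r) (hM : ∀ t r, N ≤ r → M t r = 0) :
    Elim N (fun _ => False) a b M U piv := by
  refine ⟨h.injective, h.le, fun _ _ _ _ h => h, h.unique, h.pivot, ?_, h.zero⟩
  intro t h1 h2 h0 r hr; rcases h.dep t h1 h2 h0 r hr with h3 | h3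
  · exfalso; apply hr
    rw [blk_apply, Pi.add_apply, hM t r (hu r h3), Finset.sum_apply, Finset.sum_eq_zero, add_zero]
    intro t' ht'; rw [Finset.mem_Ico] at ht'; split_ifs
    · rfl
    · simp [h.zero r (fun t _ _ => hM t r (hu r h3)) t' ht'.1 ht'.2]
  · exact Or.inr h3

theorem eliminate_spec {P : Program} {c : ℕ} {τ : ℕ → ℕ} (hP : Multiplies P c τ) (hc : 2 ≤ c)
    {B N K : ℕ} {s : State} (hNK : N = 2 ^ K) (hNB : N + 1 < B) (hv : Valid N s)
    (hB : s.words bkBase 0 + elimSpace c N K < B) :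
    Tri B (eliminate P c) s (elimTime τ c N K + N * 100 + 200) (fun s' =>
      Valid N s' ∧ Elim N (fun _ => False) 0 N (col s N) (col s' N) (s'.words bkPiv) ∧
      (∀ r < N, s'.words bkUsed r ≠ 0 ↔ ∃ t < N, s'.words bkPiv t = r + 1) ∧
      s'.words bkBase 0 ≤ s.words bkBase 0 + elimSpace c N K) := by
  subst hNK; set N := 2 ^ K with hN; have h1N : 1 ≤ N := Nat.one_le_two_pow
  have hcost : (var bkN).cost = 2 := rfl
  -- no row is used
  refine Tri.seq (T1 := N * 30 + 20) (T2 := elimTime τ c N K + N * 70 + 150)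
    (R := fun s' => ∀ r < N, s'.words bkUsed r = 0)
    (Tri.fillLoop (N := N) (fun x => x) (fun _ => 0) (by simp) (by omega)
      (fun s' hf => by simp [hf.w bkN (by simp), hv.order]) (fun x s' hx hf hx' _ => by simp [hx'])
      (by intros; omega) (fun _ x _ => by omega)
      (mul_add_le (by decide) (by decide)) fun s' _ _ h _ => h)
    ?_ (by omega)
  intro s1 f1 hu1
  have e1 : ∀ b, b ≠ bkR ∧ b ≠ bkUsed → s1.words b = s.words b := fun b ⟨h, h'⟩ =>
    f1.w b (by simp; omega)
  have hv1 : Valid N s1 := hv.congr (e1 _ (by decide)) (e1 _ (by decide))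
    (e1 _ (by decide)) fun b hb => ⟨e1 b (by omega), f1.r b (by simp)⟩
  have hcol1 : ∀ x, col s1 N x = col s N x := col_congr (e1 _ (by decide)) N
  -- the first column
  refine Tri.seq (T1 := 3) (T2 := elimTime τ c N K + N * 70 + 147)
    (R := fun s' => s' = s1.writeWord bkJ 0 0)
    (Tri.block (fun _ => by simp; omega) (by simp) (by decide)) ?_ (by omega)
  rintro s2 - hs2
  have e2 : ∀ b, b ≠ bkJ → s2.words b = s1.words b := fun b h => by rw [hs2, State.words_of_ne _ h]
  have hv2 : Valid N s2 := hv1.congr (e2 _ (by decide)) (e2 _ (by decide)) (e2 _ (by decide))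
    fun b hb => ⟨e2 b (by omega), by rw [hs2]; rfl⟩
  have hcol2 : ∀ x, col s2 N x = col s N x := fun x => by rw [col_congr (e2 _ (by decide)), hcol1]
  refine Tri.seq (T2 := elimTime τ c N K + 30)
    (factorColumn_spec hNB hv2.order (by simp [hs2]) h1N hv2.bit) ?_ (by omega)
  rintro s3 f3 ⟨hpiv3, hbit3, hcol3, hcase⟩
  have e3 : ∀ b, b ≠ bkPv ∧ b ≠ bkR ∧ b ≠ bkPiv ∧ b ≠ bkUsed ∧ b ≠ bkMat →
      s3.words b = s2.words b := fun b ⟨h1, h2, h3, h4, h5⟩ =>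
    f3.w b (fun h => by have := factorColumn_wr h; omega)
  refine Tri.seq (T1 := 3) (T2 := elimTime τ c N K + 27) (R := fun s' => s' = s3.writeWord bkJ 0 1)
    (Tri.block (fun _ => by simp; omega) (by simp) (by decide)) ?_ (by omega)
  rintro s4 - hs4
  refine Tri.seq (T1 := 3) (T2 := elimTime τ c N K + 24) (R := fun s' => s' = s4.writeWord bkS 0 1)
    (Tri.block (fun _ => by simp; omega) (by simp) (by decide)) ?_ (by omega)
  rintro s5 - hs5
  have e5 : ∀ b, b ≠ bkJ ∧ b ≠ bkS → s5.words b = s3.words b := fun b ⟨h, h'⟩ => by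
    rw [hs5, State.words_of_ne _ h', hs4, State.words_of_ne _ h]
  have hcol5 : ∀ x, col s5 N x = col s3 N x := col_congr (e5 _ (by decide)) N
  have hb5 : s5.words bkBase 0 = s.words bkBase 0 := by simp [e5, e3, e2, e1]
  have hP5 : s5.words bkPiv = s3.words bkPiv := e5 _ (by decide)
  have hU5 : s5.words bkUsed = s3.words bkUsed := e5 _ (by decide)
  have hv5 : Valid N s5 := by
    refine ⟨by simp [e5, e3, hv2.order], by simpa [e5] using hbit3, ?_⟩; intro b a hb ha
    rw [e5 _ (by omega), e3 _ (by omega)]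
    rw [hs5, State.reals_writeWord, hs4, State.reals_writeWord,
      f3.r b (by rw [factorColumn_wrR]; simp)]
    refine hv2.fresh b a hb ?_; rw [hb5] at ha; simpa [e2, e1] using ha
  have hE : Elim N (fun r => s2.words bkUsed r ≠ 0) 0 (0 + 1) (col s N) (col s5 N)
      (s5.words bkPiv) := by
    rw [hP5]; rw [hcol2] at hcase; rcases hcase with ⟨h1, h2, h3, h4⟩ | ⟨i, hi, h1, h2, h3, h4, h5⟩
    · refine Elim.single_none h1 (fun r hr => h2 r ?_) (by rw [hcol5]; exact h3); exact by_contra hr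
    · exact Elim.single_some h1 hi (fun h => h h2) h3 (by rw [hcol5]; exact h4)
  have hu5 : ∀ r, s5.words bkUsed r ≠ 0 ↔ s2.words bkUsed r ≠ 0 ∨ s5.words bkPiv 0 = r + 1 := by
    intro r; rw [hP5, hU5]; rcases hcase with ⟨h1, h2, h3, h4⟩ | ⟨i, hi, h1, h2, h3, h4, h5⟩
    · rw [h4, h1]; simp
    · rw [h5, h1]; by_cases hr : r = i
      · simp [hr]
      · simp [hr, Ne.symm hr]
  intro hbd
  obtain ⟨t, s', st, ht, hv', hS', -, hE', -, hu', hb'⟩ :=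
    elimSteps hP hc hN hNB K le_rfl 0 s5 _ (col s N) hbd ⟨0, by simp⟩ (by omega) hv5
      (by simp [hs5]) (by simp [hs5, hs4]) hE
      (fun x h1 h2 => by rw [hcol5, hcol3 x (by omega) (by omega), hcol2]) hu5 (by omega)
  have hlt : (Test.lt (var bkS) (var bkN)).cost = 6 := rfl; rw [← hN, Nat.zero_add] at hE' hu'
  have hU2 : ∀ r < N, s2.words bkUsed r = 0 := fun r hr => by rw [e2 _ (by decide), hu1 r hr]
  refine ⟨_, s', st.exec ?_, by rw [hlt]; omega, hv', hE'.of_zero (fun r hr => ?_) ?_, ?_,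
    by omega⟩
  · rw [Test.holds_lt]; simp [hS', hv'.order, ← hN]
  · by_contra h
    exact hr (hU2 r (by omega))
  · intro t r hr; simp [col, show ¬ r < N by omega]
  · intro r hr; rw [hu', hU2 r hr]; simp

end GaussJordan

/-! ## A priority queue -/

namespace Tournament

open RAM

notation "bkLeaves" => 60
notation "bkBest" => 61
notation "bkLeaf" => 62
notation "bkNode" => 63
notation "rbKey" => 1

/-- Recompute the winner at the node `bkNode`. -/
def selectChild : Program :=
  .ite (.wordLe (.get bkBest (2 * var bkNode)) 0)
  (.setWord bkBest (var bkNode) (.get bkBest (2 * var bkNode + 1)))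
  (.ite (.wordLe (.get bkBest (2 * var bkNode + 1)) 0)
    (.setWord bkBest (var bkNode) (.get bkBest (2 * var bkNode)))
    (.ite (.realLe (.get rbKey (.get bkBest (2 * var bkNode) - 1))
        (.get rbKey (.get bkBest (2 * var bkNode + 1) - 1)))
      (.setWord bkBest (var bkNode) (.get bkBest (2 * var bkNode)))
      (.setWord bkBest (var bkNode) (.get bkBest (2 * var bkNode + 1)))))

/-- Recompute the winners on the path from the node `bkNode` to the root. -/
def repair : Program := .loop (.wordLe 1 (var bkNode))
    (selectChild ;; assign bkNode (var bkNode / 2))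

/-- Make the leaf `bkLeaf` active. -/
def insertLeaf : Program := .setWord bkBest (var bkLeaves + var bkLeaf) (var bkLeaf + 1) ;;
  assign bkNode ((var bkLeaves + var bkLeaf) / 2) ;; repair

/-- Make the leaf `bkLeaf` inactive. -/
def removeLeaf : Program := .setWord bkBest (var bkLeaves + var bkLeaf) 0 ;;
  assign bkNode ((var bkLeaves + var bkLeaf) / 2) ;; repair

open Classical in
/-- The winner among the winners `x` and `y` of two subtrees. -/
noncomputable def pick (key : ℕ → ℝ) (x y : ℕ) : ℕ :=
  if x = 0 then y else if y = 0 then x else if key (x - 1) ≤ key (y - 1) then x else y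

/-- `s` holds a tournament tree with `2 ^ κ` leaves, of which those in `act` are active, where the
winners are correct at all nodes except possibly at the node `e`. -/
structure QueueExcept (κ : ℕ) (act : Finset ℕ) (e : ℕ) (s : State) : Prop where
  leaves : s.words bkLeaves 0 = 2 ^ κ
  lt : ∀ l ∈ act, l < 2 ^ κ
  leaf : ∀ l < 2 ^ κ, s.words bkBest (2 ^ κ + l) = if l ∈ act then l + 1 else 0
  node : ∀ i, 1 ≤ i → i < 2 ^ κ → i ≠ e →
    s.words bkBest i = pick (s.reals rbKey) (s.words bkBest (2 * i)) (s.words bkBest (2 * i + 1))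

/-- `s` holds a tournament tree with `2 ^ κ` leaves, of which those in `act` are active. -/
abbrev Queue (κ : ℕ) (act : Finset ℕ) (s : State) : Prop := QueueExcept κ act 0 s

variable {κ : ℕ} {act : Finset ℕ} {s : State}

/-- The leaf l is the node `2 ^ κ + l` and halving goes to the parent, so `(2 ^ κ + l) / 2 ^ t = i`
says that l lies below i. The induction on d runs through the nodes backwards, from the last leaf to
the root. -/
theorem Queue.subtree (h : Queue κ act s) (d : ℕ) : ∀ i, 1 ≤ i → i + d = 2 * 2 ^ κ - 1 →
    (s.words bkBest i = 0 ∧ ∀ l ∈ act, ∀ t, (2 ^ κ + l) / 2 ^ t ≠ i) ∨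
    ∃ l ∈ act, s.words bkBest i = l + 1 ∧
      ∀ l' ∈ act, (∃ t, (2 ^ κ + l') / 2 ^ t = i) → s.reals rbKey l ≤ s.reals rbKey l' := by
  induction d using Nat.strong_induction_on with
  | _ d ih =>
  intro i hi hd; have hκ : 1 ≤ 2 ^ κ := Nat.one_le_two_pow; rcases lt_or_ge i (2 ^ κ) with hiκ | hiκ
  · have hchild : ∀ l ∈ act, ∀ t, (2 ^ κ + l) / 2 ^ t = i →
        (∃ t, (2 ^ κ + l) / 2 ^ t = 2 * i) ∨ ∃ t, (2 ^ κ + l) / 2 ^ t = 2 * i + 1 := by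
      intro l hl t ht
      cases t with
      | zero => simp at ht; omega
      | succ t =>
        rw [pow_succ, ← Nat.div_div_eq_div_mul] at ht
        rcases Nat.mod_two_eq_zero_or_one ((2 ^ κ + l) / 2 ^ t) with h0 | h0
        · exact Or.inl ⟨t, by omega⟩
        · exact Or.inr ⟨t, by omega⟩
    have hup : ∀ l t j, (2 ^ κ + l) / 2 ^ t = j → j / 2 = i → (2 ^ κ + l) / 2 ^ (t + 1) = i := by
      intro l t j hj hji; rw [pow_succ, ← Nat.div_div_eq_div_mul, hj, hji]
    have hd2 : 2 * i + 1 + (2 * 2 ^ κ - 1 - (2 * i + 1)) = 2 * 2 ^ κ - 1 := by omega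
    have hd3 : 2 * 2 ^ κ - 1 - (2 * i + 1) < d := by omega
    have ih1 := ih (2 * 2 ^ κ - 1 - 2 * i) (by omega) (2 * i) (by omega) (by omega)
    have ih2 := ih (2 * 2 ^ κ - 1 - (2 * i + 1)) hd3 (2 * i + 1) (by omega) hd2
    rw [h.node i hi hiκ (by omega)]; rcases ih1 with ⟨x0, hx⟩ | ⟨l1, hl1, x1, hx⟩
    · rw [pick, if_pos x0]; rcases ih2 with ⟨y0, hy⟩ | ⟨l2, hl2, y1, hy⟩
      · left; refine ⟨y0, fun l hl t ht => ?_⟩; rcases hchild l hl t ht with ⟨t', ht'⟩ | ⟨t', ht'⟩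
        · exact hx l hl t' ht'
        · exact hy l hl t' ht'
      · right; refine ⟨l2, hl2, y1, fun l hl ⟨t, ht⟩ => ?_⟩
        rcases hchild l hl t ht with ⟨t', ht'⟩ | ht'
        · exact (hx l hl t' ht').elim
        · exact hy l hl ht'
    · rcases ih2 with ⟨y0, hy⟩ | ⟨l2, hl2, y1, hy⟩
      · right; rw [pick, if_neg (show s.words bkBest (2 * i) ≠ 0 by omega), if_pos y0]
        refine ⟨l1, hl1, x1, fun l hl ⟨t, ht⟩ => ?_⟩; rcases hchild l hl t ht with ht' | ⟨t', ht'⟩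
        · exact hx l hl ht'
        · exact (hy l hl t' ht').elim
      · right
        rw [pick, if_neg (show s.words bkBest (2 * i) ≠ 0 by omega),
          if_neg (show s.words bkBest (2 * i + 1) ≠ 0 by omega), x1, y1, Nat.add_sub_cancel,
          Nat.add_sub_cancel]
        split_ifs with hle
        · refine ⟨l1, hl1, rfl, fun l hl ⟨t, ht⟩ => ?_⟩; rcases hchild l hl t ht with ht' | ht'
          · exact hx l hl ht'
          · exact hle.trans (hy l hl ht')
        · refine ⟨l2, hl2, rfl, fun l hl ⟨t, ht⟩ => ?_⟩; rcases hchild l hl t ht with ht' | ht'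
          · exact (not_le.1 hle).le.trans (hx l hl ht')
          · exact hy l hl ht'
  · obtain ⟨l, rfl⟩ := Nat.exists_eq_add_of_le hiκ
    have hl : l < 2 ^ κ := by omega
    have huniq : ∀ l' t, (2 ^ κ + l') / 2 ^ t = 2 ^ κ + l → l' ∈ act → l' = l := by
      intro l' t ht hl'; have := h.lt l' hl'
      cases t with
      | zero => simpa using ht
      | succ t =>
        have : (2 ^ κ + l') / 2 ^ (t + 1) < 2 ^ κ := by
          rw [Nat.div_lt_iff_lt_mul (by positivity), pow_succ]
          have : 1 ≤ 2 ^ t := Nat.one_le_two_pow; nlinarith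
        omega
    rw [h.leaf l hl]; split_ifs with hla
    · right; refine ⟨l, hla, rfl, fun l' hl' ⟨t, ht⟩ => ?_⟩; rw [huniq l' t ht hl']
    · left; exact ⟨rfl, fun l' hl' t ht => hla (huniq l' t ht hl' ▸ hl')⟩

/-- The root holds an active leaf with minimal key. -/
theorem Queue.root (h : Queue κ act s) : (s.words bkBest 1 = 0 ∧ act = ∅) ∨
    ∃ l ∈ act, s.words bkBest 1 = l + 1 ∧ ∀ l' ∈ act, s.reals rbKey l ≤ s.reals rbKey l' := by
  have hκ : 1 ≤ 2 ^ κ := Nat.one_le_two_pow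
  have hroot : ∀ l ∈ act, (2 ^ κ + l) / 2 ^ κ = 1 := by
    intro l hl; rw [Nat.add_div_left _ (by positivity), Nat.div_eq_of_lt (h.lt l hl)]
  rcases h.subtree (2 * 2 ^ κ - 2) 1 le_rfl (by omega) with ⟨h0, h1⟩ | ⟨l, hl, h0, h1⟩
  · exact Or.inl ⟨h0, Finset.eq_empty_of_forall_notMem fun l hl => h1 l hl κ (hroot l hl)⟩
  · exact Or.inr ⟨l, hl, h0, fun l' hl' => h1 l' hl' ⟨κ, hroot l' hl'⟩⟩

theorem Queue.best_le (h : Queue κ act s) {i : ℕ} (hi : 1 ≤ i) (hiκ : i < 2 * 2 ^ κ)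
    (h0 : s.words bkBest i ≠ 0) : s.words bkBest i - 1 ∈ act := by
  rcases h.subtree (2 * 2 ^ κ - 1 - i) i hi (by omega) with ⟨h1, -⟩ | ⟨l, hl, h1, -⟩
  · exact absurd h1 h0
  · rwa [h1, Nat.add_sub_cancel]

theorem QueueExcept.congr {e : ℕ} {s' : State} (h : QueueExcept κ act e s)
    (h1 : s'.words bkLeaves = s.words bkLeaves) (h2 : s'.words bkBest = s.words bkBest)
    (h3 : s'.reals rbKey = s.reals rbKey) : QueueExcept κ act e s' := by
  refine ⟨by rw [h1, h.leaves], h.lt, ?_, ?_⟩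
  · rw [h2]; exact h.leaf
  · rw [h2, h3]; exact h.node

/-- Winners are active leaves (`Queue.best_le`), so no comparison reads the key of an inactive one.
This allows a key to be set before its leaf is inserted. -/
theorem Queue.writeKey (h : Queue κ act s) {l : ℕ} (hl : l ∉ act) (v : ℝ) :
    Queue κ act (s.writeReal rbKey l v) := by
  refine ⟨h.leaves, h.lt, h.leaf, fun i hi hiκ h0 => ?_⟩; simp only [State.words_writeReal]
  rw [h.node i hi hiκ h0]; have h1 := h.best_le (i := 2 * i) (by omega) (by omega)
  have h2 := h.best_le (i := 2 * i + 1) (by omega) (by omega)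
  have n1 : s.words bkBest (2 * i) ≠ 0 → s.words bkBest (2 * i) - 1 ≠ l :=
    fun h0 h3 => hl (h3 ▸ h1 h0)
  have n2 : s.words bkBest (2 * i + 1) ≠ 0 → s.words bkBest (2 * i + 1) - 1 ≠ l :=
    fun h0 h3 => hl (h3 ▸ h2 h0)
  unfold pick; split_ifs with c1 c2 c3 c4 c4
  · rfl
  · rfl
  · rfl
  · exfalso; apply c4
    rw [State.reals_writeReal_same, State.reals_writeReal_same, if_neg (n1 c1), if_neg (n2 c2)]
    exact c3
  · exfalso; apply c3
    rwa [State.reals_writeReal_same, State.reals_writeReal_same,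
      if_neg (n1 c1), if_neg (n2 c2)] at c4
  · rfl

/-- Recomputing the node e corrects it, and the only other node whose condition involves its winner
is the parent e / 2, which becomes the new exception. After at most κ halvings the exception is 0,
which is not a node. -/
theorem repair_spec {B e : ℕ} (h : QueueExcept κ act e s) (he : s.words bkNode 0 = e)
    (heκ : e < 2 ^ κ) : Tri B repair s (κ * 100 + 10) (Queue κ act) := by
  refine Tri.of_bdd fun hbdd => ?_
  refine Tri.loop (f := κ) (T1 := 96) (fun f s' => s'.words bkNode 0 < 2 ^ f ∧ f ≤ κ ∧
    QueueExcept κ act (s'.words bkNode 0) s') ⟨by rwa [he], le_rfl, by rwa [he]⟩ ?_ ?_ ?_ ?_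
  · rintro s' - ⟨h1, -, -⟩; simp at h1; simp [h1]
  · rintro f s' - ⟨h1, h2, h3⟩ hc; refine Tri.of_bdd fun hb => ?_
    simp only [Test.holds, Expr.val] at hc; set i := s'.words bkNode 0 with hi
    have hpow : 2 ^ (f + 1) = 2 * 2 ^ f := by rw [pow_succ]; ring
    have hle : 2 ^ (f + 1) ≤ 2 ^ κ := Nat.pow_le_pow_right (by omega) h2
    have hx : (selectChild ;; assign bkNode (var bkNode / 2)).exec s' =
        (s'.writeWord bkBest i (pick (s'.reals rbKey) (s'.words bkBest (2 * i))
          (s'.words bkBest (2 * i + 1)))).writeWord bkNode 0 (i / 2) := by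
      by_cases c1 : s'.words bkBest (2 * i) = 0
      · simp [selectChild, ← hi, pick, c1]
      by_cases c2 : s'.words bkBest (2 * i + 1) = 0
      · simp [selectChild, ← hi, pick, c1, c2]
      by_cases c3 : s'.reals rbKey (s'.words bkBest (2 * i) - 1) ≤
          s'.reals rbKey (s'.words bkBest (2 * i + 1) - 1)
      · simp [selectChild, ← hi, pick, c1, c2, c3]
      · simp [selectChild, ← hi, pick, c1, c2, c3]
    refine Tri.block (fun _ => ?_) ?_ (by decide)
    · have hs : selectChild.Safe B s' := ⟨fun _ => hb _ _, fun _ => ⟨fun _ => hb _ _,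
        fun _ => ⟨fun _ => hb _ _, fun _ => hb _ _⟩⟩⟩
      obtain ⟨t, ht, -⟩ := hs.exec
      refine ⟨hs, ((Nat.div_le_self _ _).trans (le_of_eq ?_)).trans_lt (hb bkNode 0)⟩
      exact congrFun (ht.frame.w bkNode (by simp [selectChild])) 0
    · rw [hx]
      have hnode : ((s'.writeWord bkBest i (pick (s'.reals rbKey) (s'.words bkBest (2 * i))
          (s'.words bkBest (2 * i + 1)))).writeWord bkNode 0 (i / 2)).words bkNode 0 = i / 2 := by
        simp
      rw [hnode]; refine ⟨by omega, by omega, ?_, h3.lt, ?_, ?_⟩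
      · simpa using h3.leaves
      · intro l hl; rw [State.words_of_ne _ (by decide), State.words_same, if_neg (by omega)]
        exact h3.leaf l hl
      · intro j hj hjκ hji
        rw [State.words_of_ne _ (by decide), State.words_same, State.words_same, State.words_same]
        simp only [State.reals_writeWord]
        rw [if_neg (show 2 * j ≠ i by omega), if_neg (show 2 * j + 1 ≠ i by omega)]
        split_ifs with hji'
        · rw [hji']
        · exact h3.node j hj hjκ hji'
  · have : (Test.wordLe 1 (var bkNode)).cost = 4 := rfl; rw [this]; omega
  · rintro f s' ⟨-, -, h3⟩ hc; simp at hc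
    rwa [hc] at h3

theorem insertLeaf_spec {B l : ℕ} (h : Queue κ act s) (hl : s.words bkLeaf 0 = l)
    (hlκ : l < 2 ^ κ) (hB : 2 * 2 ^ κ < B) :
    Tri B insertLeaf s (κ * 100 + 50) (Queue κ (insert l act)) := by
  refine Tri.seq (T1 := 15) (T2 := κ * 100 + 35) (R := fun s' =>
    s' = s.writeWord bkBest (2 ^ κ + l) (l + 1)) (Tri.block (fun _ => by simp [hl]; omega)
    (by simp [hl, h.leaves]) (by decide)) ?_ (by omega)
  rintro s1 - rfl
  refine Tri.seq (T1 := 25) (T2 := κ * 100 + 10) (R := fun s' =>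
    s' = (s.writeWord bkBest (2 ^ κ + l) (l + 1)).writeWord bkNode 0 ((2 ^ κ + l) / 2))
    (Tri.block (fun _ => by simp [hl, h.leaves]; omega)
    (by simp [hl, h.leaves]) (by decide)) ?_ (by omega)
  rintro s2 - rfl; refine repair_spec (e := (2 ^ κ + l) / 2) ?_ (by simp) (by omega)
  refine ⟨by simpa using h.leaves, ?_, ?_, ?_⟩
  · intro l' hl'; rcases Finset.mem_insert.1 hl' with rfl | hl'
    · exact hlκ
    · exact h.lt l' hl'
  · intro l' hl'; rw [State.words_of_ne _ (by decide), State.words_same]; by_cases hll : l' = l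
    · simp [hll]
    · rw [if_neg (by omega), h.leaf l' hl']; simp [hll]
  · intro i hi hiκ hie
    rw [State.words_of_ne _ (by decide), State.words_same, State.words_same, State.words_same]
    simp only [State.reals_writeWord]; rw [if_neg (by omega), if_neg (by omega), if_neg (by omega)]
    exact h.node i hi hiκ (by omega)

theorem removeLeaf_spec {B l : ℕ} (h : Queue κ act s) (hl : s.words bkLeaf 0 = l)
    (hlκ : l < 2 ^ κ) (hB : 2 * 2 ^ κ < B) :
    Tri B removeLeaf s (κ * 100 + 50) (Queue κ (act.erase l)) := by
  refine Tri.seq (T1 := 15) (T2 := κ * 100 + 35) (R := fun s' =>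
    s' = s.writeWord bkBest (2 ^ κ + l) 0) (Tri.block (fun _ => by simp; omega)
    (by simp [hl, h.leaves]) (by decide)) ?_ (by omega)
  rintro s1 - rfl
  refine Tri.seq (T1 := 25) (T2 := κ * 100 + 10) (R := fun s' =>
    s' = (s.writeWord bkBest (2 ^ κ + l) 0).writeWord bkNode 0 ((2 ^ κ + l) / 2))
    (Tri.block (fun _ => by simp [hl, h.leaves]; omega)
    (by simp [hl, h.leaves]) (by decide)) ?_ (by omega)
  rintro s2 - rfl; refine repair_spec (e := (2 ^ κ + l) / 2) ?_ (by simp) (by omega)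
  refine ⟨by simpa using h.leaves, ?_, ?_, ?_⟩
  · intro l' hl'; exact h.lt l' (Finset.mem_of_mem_erase hl')
  · intro l' hl'; rw [State.words_of_ne _ (by decide), State.words_same]; by_cases hll : l' = l
    · simp [hll]
    · rw [if_neg (by omega), h.leaf l' hl']; simp [hll]
  · intro i hi hiκ hie
    rw [State.words_of_ne _ (by decide), State.words_same, State.words_same, State.words_same]
    simp only [State.reals_writeWord]; rw [if_neg (by omega), if_neg (by omega), if_neg (by omega)]
    exact h.node i hi hiκ (by omega)

theorem insertLeaf_wr {b : ℕ} : insertLeaf.wr b ↔ b = bkBest ∨ b = bkNode := by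
  simp [insertLeaf, repair, selectChild]; tauto

theorem removeLeaf_wr {b : ℕ} : removeLeaf.wr b ↔ b = bkBest ∨ b = bkNode := by
  simp [removeLeaf, repair, selectChild]; tauto

theorem insertLeaf_wrR {b : ℕ} : insertLeaf.wrR b ↔ False := by simp [insertLeaf, repair, selectChild]

theorem removeLeaf_wrR {b : ℕ} : removeLeaf.wrR b ↔ False := by simp [removeLeaf, repair, selectChild]

/-- The empty queue. -/
theorem Queue.empty (h : s.words bkLeaves 0 = 2 ^ κ) (h0 : ∀ a, s.words bkBest a = 0) :
    Queue κ ∅ s := ⟨h, by simp, fun l _ => by simp [h0], fun i _ _ _ => by simp [h0, pick]⟩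

end Tournament

/-! ## Shortest paths -/

/-- A list of simplices with vertices `v0 i`, `v1 i`, `v2 i` and weights.  The simplices with two
vertices are the edges of a graph with vertices `0, …, m - 1`. -/
structure Net where
  m : ℕ
  n : ℕ
  card : ℕ → ℕ
  v0 : ℕ → ℕ
  v1 : ℕ → ℕ
  v2 : ℕ → ℕ
  w : ℕ → ℝ

namespace Net

variable (G : Net)

def IsEdge (i : ℕ) : Prop := i < G.n ∧ G.card i = 2

/-- The darts `2 * i` and `2 * i + 1` are the edge `i` with its two directions. -/
def IsDart (d : ℕ) : Prop := G.IsEdge (d / 2)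

def tail (d : ℕ) : ℕ := if d % 2 = 0 then G.v0 (d / 2) else G.v1 (d / 2)

def head (d : ℕ) : ℕ := if d % 2 = 0 then G.v1 (d / 2) else G.v0 (d / 2)

/-- The edges join distinct vertices, have nonnegative weights, and connect all vertices. -/
structure Good : Prop where
  lt : ∀ i, G.IsEdge i → G.v0 i < G.v1 i
  lt_m : ∀ i, G.IsEdge i → G.v1 i < G.m
  w_nonneg : ∀ i, 0 ≤ G.w i
  conn : ∀ (F : ℕ → Prop) (p : ℕ), p < G.m → F p →
    (∀ d, G.IsDart d → F (G.tail d) → F (G.head d)) → ∀ v < G.m, F v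
  m_le : G.m ≤ G.n

/-- The darts leaving `v` are `adj v k` for `k < deg v`. -/
structure Adjacency (deg : ℕ → ℕ) (adj : ℕ → ℕ → ℕ) : Prop where
  dart : ∀ v < G.m, ∀ k < deg v, G.IsDart (adj v k) ∧ G.tail (adj v k) = v
  surj : ∀ v < G.m, ∀ d, G.IsDart d → G.tail d = v → ∃ k < deg v, adj v k = d
  inj : ∀ v < G.m, ∀ k < deg v, ∀ k' < deg v, adj v k = adj v k' → k = k'
  sum_le : ∑ v ∈ Finset.range G.m, deg v ≤ 2 * G.n

/-- A shortest path tree with root `p`: `ord` lists the vertices, parents first, and `par` gives the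
dart from the parent. -/
structure SPTree (p : ℕ) (ord par : ℕ → ℕ) (dist : ℕ → ℝ) : Prop where
  ord_lt : ∀ j < G.m, ord j < G.m
  ord_surj : ∀ v < G.m, ∃ j < G.m, ord j = v
  ord_inj : ∀ i j, i < G.m → j < G.m → ord i = ord j → i = j
  ord_zero : ord 0 = p
  dist_root : dist p = 0
  tree : ∀ j, 0 < j → j < G.m → G.IsDart (par (ord j)) ∧ G.head (par (ord j)) = ord j ∧
    (∃ j' < j, G.tail (par (ord j)) = ord j') ∧
    dist (ord j) = dist (G.tail (par (ord j))) + G.w (par (ord j) / 2)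
  feasible : ∀ d, G.IsDart d → dist (G.head d) ≤ dist (G.tail d) + G.w (d / 2)

/-- The state of the search: `fin v ≠ 0` for the vertices with known distance, the latest of which is
`x`; the queue holds the darts `act`, and the first `k` darts at `x` have been inserted. -/
structure Search (deg : ℕ → ℕ) (adj : ℕ → ℕ → ℕ) (p : ℕ) (fin ord par : ℕ → ℕ) (dist key : ℕ → ℝ)
    (act : Finset ℕ) (x k cnt : ℕ) : Prop where
  x_lt : x < G.m
  fin_x : fin x ≠ 0
  k_le : k ≤ deg x
  cnt_pos : 0 < cnt
  cnt_le : cnt ≤ G.m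
  ord_lt : ∀ j < cnt, ord j < G.m ∧ fin (ord j) ≠ 0
  ord_surj : ∀ v < G.m, fin v ≠ 0 → ∃ j < cnt, ord j = v
  ord_inj : ∀ i j, i < cnt → j < cnt → ord i = ord j → i = j
  ord_zero : ord 0 = p
  dist_root : dist p = 0
  tree : ∀ j, 0 < j → j < cnt → G.IsDart (par (ord j)) ∧ G.head (par (ord j)) = ord j ∧
    (∃ j' < j, G.tail (par (ord j)) = ord j') ∧
    dist (ord j) = dist (G.tail (par (ord j))) + G.w (par (ord j) / 2)
  act_dart : ∀ d ∈ act, G.IsDart d ∧ fin (G.tail d) ≠ 0 ∧ key d = dist (G.tail d) + G.w (d / 2)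
  act_x : ∀ d ∈ act, G.tail d = x → ∃ k' < k, adj x k' = d
  handled : ∀ d, G.IsDart d → fin (G.tail d) ≠ 0 →
    (G.tail d = x ∧ ∃ k', k ≤ k' ∧ k' < deg x ∧ adj x k' = d) ∨ d ∈ act ∨
      (fin (G.head d) ≠ 0 ∧ dist (G.head d) ≤ dist (G.tail d) + G.w (d / 2))
  dist_le : ∀ v < G.m, fin v ≠ 0 → dist v ≤ dist x
  le_key : ∀ d ∈ act, dist x ≤ key d

variable {G} {deg : ℕ → ℕ} {adj : ℕ → ℕ → ℕ} {p : ℕ} {fin ord par : ℕ → ℕ} {dist key : ℕ → ℝ}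
  {act : Finset ℕ} {x k cnt d : ℕ}

theorem Good.tail_lt (hG : G.Good) (hd : G.IsDart d) : G.tail d < G.m := by
  have h1 := hG.lt _ hd; have h2 := hG.lt_m _ hd; unfold tail; split_ifs <;> omega

theorem Good.head_lt (hG : G.Good) (hd : G.IsDart d) : G.head d < G.m := by
  have h1 := hG.lt _ hd; have h2 := hG.lt_m _ hd; unfold head; split_ifs <;> omega

theorem Search.init (hp : p < G.m) (hfin : ∀ v < G.m, fin v = 0) (hord : ord 0 = p)
    (hdist : dist p = 0) (hA : G.Adjacency deg adj) (hG : G.Good) :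
    G.Search deg adj p (Function.update fin p 1) ord par dist key ∅ p 0 1 := by
  have hf : ∀ v < G.m, Function.update fin p 1 v ≠ 0 → v = p := by
    intro v hv h
    by_contra hvp
    rw [Function.update_of_ne hvp] at h; exact h (hfin v hv)
  refine ⟨hp, by simp, Nat.zero_le _, by omega, by omega, ?_, ?_, by omega, hord, hdist, by omega,
    by simp, by simp, ?_, ?_, by simp⟩
  · intro j hj
    obtain rfl : j = 0 := by omega
    simp [hord, hp]
  · intro v hv h; exact ⟨0, by omega, by rw [hord, hf v hv h]⟩
  · intro d hd h; have ht := hf _ (hG.tail_lt hd) h; obtain ⟨k', hk', h⟩ := hA.surj p hp d hd ht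
    exact Or.inl ⟨ht, k', Nat.zero_le _, hk', h⟩
  · intro v hv h; rw [hf v hv h]

theorem Search.notMem (h : G.Search deg adj p fin ord par dist key act x k cnt)
    (hA : G.Adjacency deg adj) (hk : k < deg x) : adj x k ∉ act := by
  intro hd; obtain ⟨k', hk', he⟩ := h.act_x _ hd (hA.dart x h.x_lt k hk).2
  have := hA.inj x h.x_lt k' (by omega) k hk he; omega

theorem Search.insert (h : G.Search deg adj p fin ord par dist key act x k cnt)
    (hA : G.Adjacency deg adj) (hG : G.Good) (hk : k < deg x) : G.Search deg adj p fin ord par dist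
      (Function.update key (adj x k) (dist x + G.w (adj x k / 2))) (insert (adj x k) act) x (k + 1)
      cnt := by
  have hn := h.notMem hA hk; have hd := hA.dart x h.x_lt k hk
  have hne : ∀ d ∈ act, d ≠ adj x k := fun d hd he => hn (he ▸ hd)
  refine ⟨h.x_lt, h.fin_x, hk, h.cnt_pos, h.cnt_le, h.ord_lt, h.ord_surj, h.ord_inj, h.ord_zero,
    h.dist_root, h.tree, ?_, ?_, ?_, h.dist_le, ?_⟩
  · intro d hd'; rcases Finset.mem_insert.1 hd' with rfl | hd'
    · refine ⟨hd.1, by rw [hd.2]; exact h.fin_x, by simp [hd.2]⟩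
    · rw [Function.update_of_ne (hne d hd')]; exact h.act_dart d hd'
  · intro d hd' ht; rcases Finset.mem_insert.1 hd' with rfl | hd'
    · exact ⟨k, by omega, rfl⟩
    · obtain ⟨k', hk', he⟩ := h.act_x d hd' ht; exact ⟨k', by omega, he⟩
  · intro d hd' hf; rcases h.handled d hd' hf with ⟨ht, k', h1, h2, h3⟩ | h' | h'
    · rcases Nat.eq_or_lt_of_le h1 with rfl | h1
      · exact Or.inr (Or.inl (by rw [← h3]; exact Finset.mem_insert_self _ _))
      · exact Or.inl ⟨ht, k', h1, h2, h3⟩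
    · exact Or.inr (Or.inl (Finset.mem_insert_of_mem h'))
    · exact Or.inr (Or.inr h')
  · intro d hd'; rcases Finset.mem_insert.1 hd' with rfl | hd'
    · simpa using hG.w_nonneg _
    · rw [Function.update_of_ne (hne d hd')]; exact h.le_key d hd'

/-- The head was settled no later than x, so its distance is at most that of x, which is at most the
key of d. Hence the inequality for the dart d holds and the dart need not be remembered. -/
theorem Search.discard (h : G.Search deg adj p fin ord par dist key act x k cnt) (hG : G.Good)
    (hd : d ∈ act) (hf : fin (G.head d) ≠ 0) :
    G.Search deg adj p fin ord par dist key (act.erase d) x k cnt := by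
  refine ⟨h.x_lt, h.fin_x, h.k_le, h.cnt_pos, h.cnt_le, h.ord_lt, h.ord_surj, h.ord_inj, h.ord_zero,
    h.dist_root, h.tree, fun d' hd' => h.act_dart d' (Finset.mem_of_mem_erase hd'),
    fun d' hd' => h.act_x d' (Finset.mem_of_mem_erase hd'), ?_, h.dist_le,
    fun d' hd' => h.le_key d' (Finset.mem_of_mem_erase hd')⟩
  intro d' hd' hf'; rcases h.handled d' hd' hf' with h' | h' | h'
  · exact Or.inl h'
  · rcases eq_or_ne d' d with rfl | hne
    · refine Or.inr (Or.inr ⟨hf, ?_⟩); obtain ⟨h1, h2, h3⟩ := h.act_dart d' hd; rw [← h3]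
      exact (h.dist_le _ (hG.head_lt hd') hf).trans (h.le_key d' hd)
    · exact Or.inr (Or.inl (Finset.mem_erase.2 ⟨hne, h'⟩))
  · exact Or.inr (Or.inr h')

theorem Search.cnt_lt (h : G.Search deg adj p fin ord par dist key act x k cnt) {v : ℕ}
    (hv : v < G.m) (hf : fin v = 0) : cnt < G.m := by
  by_contra hc
  have hsub : Finset.image ord (Finset.range cnt) ⊆ (Finset.range G.m).erase v := by
    intro y hy; simp only [Finset.mem_image, Finset.mem_range] at hy; obtain ⟨j, hj, rfl⟩ := hy
    refine Finset.mem_erase.2 ⟨fun he => (h.ord_lt j hj).2 (he ▸ hf), ?_⟩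
    exact Finset.mem_range.2 (h.ord_lt j hj).1
  have h1 := Finset.card_le_card hsub
  rw [Finset.card_image_of_injOn, Finset.card_erase_of_mem (Finset.mem_range.2 hv),
    Finset.card_range, Finset.card_range] at h1
  · omega
  · intro i hi j hj he; exact h.ord_inj i j (by simpa using hi) (by simpa using hj) he

/-- Dijkstra's step. The minimal key is at least the distance of x, so vertices are settled in
nondecreasing order of distance, and the remaining keys are at least the new distance. Nonnegative
weights preserve this when darts are inserted. Since the tail is settled earlier, `ord` lists
parents first even if edges of weight zero create ties. -/
theorem Search.settle (h : G.Search deg adj p fin ord par dist key act x k cnt)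
    (hA : G.Adjacency deg adj) (hG : G.Good) (hk : deg x ≤ k) (hd : d ∈ act)
    (hmin : ∀ d' ∈ act, key d ≤ key d') (hf : fin (G.head d) = 0) :
    G.Search deg adj p (Function.update fin (G.head d) 1) (Function.update ord cnt (G.head d))
      (Function.update par (G.head d) d) (Function.update dist (G.head d) (key d)) key
      (act.erase d) (G.head d) 0 (cnt + 1) := by
  obtain ⟨h1, h2, h3⟩ := h.act_dart d hd; have hhead := hG.head_lt h1
  have hcnt := h.cnt_lt hhead hf; set y := G.head d with hy
  have hne : ∀ v, fin v ≠ 0 → v ≠ y := fun v hv he => hv (he ▸ hf)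
  have hfin : ∀ v, Function.update fin y 1 v ≠ 0 → v = y ∨ fin v ≠ 0 := by
    intro v hv; by_cases he : v = y
    · exact Or.inl he
    · rw [Function.update_of_ne he] at hv; exact Or.inr hv
  have hfin' : ∀ v, fin v ≠ 0 → Function.update fin y 1 v ≠ 0 := by
    intro v hv
    rwa [Function.update_of_ne (hne v hv)]
  have hord : ∀ j < cnt, Function.update ord cnt y j = ord j := fun j hj =>
    Function.update_of_ne (by omega) _ _
  have hp : p ≠ y := by have := (h.ord_lt 0 h.cnt_pos).2; rw [h.ord_zero] at this; exact hne p this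
  refine ⟨hhead, by simp, Nat.zero_le _, by omega, by omega, ?_, ?_, ?_, ?_, ?_, ?_, ?_, ?_, ?_, ?_,
    ?_⟩
  · intro j hj; rcases Nat.lt_succ_iff_lt_or_eq.1 hj with hj | rfl
    · rw [hord j hj]; exact ⟨(h.ord_lt j hj).1, hfin' _ (h.ord_lt j hj).2⟩
    · simp [hhead]
  · intro v hv hv'; rcases hfin v hv' with rfl | hv'
    · exact ⟨cnt, by omega, by simp⟩
    · obtain ⟨j, hj, he⟩ := h.ord_surj v hv hv'; exact ⟨j, by omega, by rw [hord j hj, he]⟩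
  · intro i j hi hj he
    rcases Nat.lt_succ_iff_lt_or_eq.1 hi with hi | rfl <;>
      rcases Nat.lt_succ_iff_lt_or_eq.1 hj with hj | rfl
    · rw [hord i hi, hord j hj] at he; exact h.ord_inj i j hi hj he
    · rw [hord i hi, Function.update_self] at he; exact (hne _ (h.ord_lt i hi).2 he).elim
    · rw [hord j hj, Function.update_self] at he; exact (hne _ (h.ord_lt j hj).2 he.symm).elim
    · rfl
  · rw [hord 0 h.cnt_pos, h.ord_zero]
  · rw [Function.update_of_ne hp, h.dist_root]
  · intro j hj0 hj; rcases Nat.lt_succ_iff_lt_or_eq.1 hj with hj | rfl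
    · obtain ⟨g1, g2, ⟨j', g3, g4⟩, g5⟩ := h.tree j hj0 hj; have n1 := hne _ (h.ord_lt j hj).2
      have n2 := hne _ (h.ord_lt j' (by omega)).2; rw [← g4] at n2
      rw [hord j hj, Function.update_of_ne n1, Function.update_of_ne n1, Function.update_of_ne n2]
      exact ⟨g1, g2, ⟨j', g3, by rw [hord j' (by omega), g4]⟩, g5⟩
    · rw [Function.update_self, Function.update_self, Function.update_self,
        Function.update_of_ne (hne _ h2)]
      obtain ⟨j', hj', he⟩ := h.ord_surj _ (hG.tail_lt h1) h2
      exact ⟨h1, rfl, ⟨j', hj', by rw [hord j' hj', he]⟩, h3⟩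
  · intro d' hd'; obtain ⟨g1, g2, g3⟩ := h.act_dart d' (Finset.mem_of_mem_erase hd')
    exact ⟨g1, hfin' _ g2, by rw [Function.update_of_ne (hne _ g2), g3]⟩
  · intro d' hd' ht; obtain ⟨g1, g2, g3⟩ := h.act_dart d' (Finset.mem_of_mem_erase hd')
    exact (hne _ g2 ht).elim
  · intro d' hd' hf'; rcases hfin _ hf' with ht | hf''
    · obtain ⟨k', hk', he⟩ := hA.surj y hhead d' hd' ht
      exact Or.inl ⟨ht, k', Nat.zero_le _, hk', he⟩
    · rw [Function.update_of_ne (hne _ hf'')]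
      rcases h.handled d' hd' hf'' with ⟨-, k', g1, g2, -⟩ | g | ⟨g1, g2⟩
      · omega
      · rcases eq_or_ne d' d with rfl | hdd
        · refine Or.inr (Or.inr ?_); rw [← hy, Function.update_self, Function.update_self, h3]
          exact ⟨one_ne_zero, le_rfl⟩
        · exact Or.inr (Or.inl (Finset.mem_erase.2 ⟨hdd, g⟩))
      · exact Or.inr (Or.inr ⟨hfin' _ g1, by rwa [Function.update_of_ne (hne _ g1)]⟩)
  · intro v hv hv'; rw [Function.update_self]; rcases hfin v hv' with rfl | hv'
    · rw [Function.update_self]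
    · rw [Function.update_of_ne (hne v hv')]; exact (h.dist_le v hv hv').trans (h.le_key d hd)
  · intro d' hd'; rw [Function.update_self]; exact hmin d' (Finset.mem_of_mem_erase hd')

/-- With an empty queue and all darts at x inserted, `handled` says that the settled set is closed
under following darts and that every dart out of it is feasible. Connectivity makes the set
everything. -/
theorem Search.spTree (h : G.Search deg adj p fin ord par dist key ∅ x k cnt) (hG : G.Good)
    (hp : p < G.m) (hk : deg x ≤ k) : G.SPTree p ord par dist := by
  have hclosed : ∀ d, G.IsDart d → fin (G.tail d) ≠ 0 →
      fin (G.head d) ≠ 0 ∧ dist (G.head d) ≤ dist (G.tail d) + G.w (d / 2) := by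
    intro d hd hf; rcases h.handled d hd hf with ⟨-, k', h1, h2, -⟩ | h' | h'
    · omega
    · simp at h'
    · exact h'
  have hp' : fin p ≠ 0 := by
    have := (h.ord_lt 0 h.cnt_pos).2
    rwa [h.ord_zero] at this
  have hall : ∀ v < G.m, fin v ≠ 0 :=
    hG.conn (fun v => fin v ≠ 0) p hp hp' fun d hd hf => (hclosed d hd hf).1
  have hcnt : cnt = G.m := by
    refine le_antisymm h.cnt_le ?_
    have hsub : Finset.range G.m ⊆ Finset.image ord (Finset.range cnt) := by
      intro v hv; rw [Finset.mem_range] at hv; obtain ⟨j, hj, he⟩ := h.ord_surj v hv (hall v hv)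
      exact Finset.mem_image.2 ⟨j, Finset.mem_range.2 hj, he⟩
    have := (Finset.card_le_card hsub).trans Finset.card_image_le; simpa using this
  subst hcnt
  exact ⟨fun j hj => (h.ord_lt j hj).1, fun v hv => h.ord_surj v hv (hall v hv), h.ord_inj,
    h.ord_zero, h.dist_root, h.tree, fun d hd => (hclosed d hd (hall _ (hG.tail_lt hd))).2⟩

end Net

/-! ## Shortest paths from all vertices -/

namespace Net

open RAM Tournament

notation "bkCard" => 4
notation "bkFst" => 5
notation "bkSnd" => 6
notation "bkThd" => 11
notation "bkDeg" => 8
notation "bkAdj" => 9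
notation "bkSrc" => 70
notation "bkFin" => 71
notation "bkPar" => 72
notation "bkOrd" => 73
notation "bkCnt" => 74
notation "bkCur" => 75
notation "bkNext" => 76
notation "bkHead" => 79
notation "rbDist" => 2

/-- The number of vertices. -/
abbrev numV : Expr := .get 0 0

/-- The number of simplices. -/
abbrev numS : Expr := .get 0 1

/-- The memory `s` holds the net. -/
structure Holds (G : Net) (s : State) : Prop where
  m : s.words 0 0 = G.m
  n : s.words 0 1 = G.n
  card : s.words bkCard = G.card
  v0 : s.words bkFst = G.v0
  v1 : s.words bkSnd = G.v1
  v2 : s.words bkThd = G.v2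
  w : s.reals 0 = G.w

theorem Holds.congr {G : Net} {s s' : State} (h : G.Holds s)
    (hw : ∀ b, b = 0 ∨ b = bkCard ∨ b = bkFst ∨ b = bkSnd ∨ b = bkThd → s'.words b = s.words b)
    (hr : s'.reals 0 = s.reals 0) : G.Holds s' :=
  ⟨by rw [hw 0 (by simp), h.m], by rw [hw 0 (by simp), h.n], by rw [hw _ (by simp), h.card],
    by rw [hw _ (by simp), h.v0], by rw [hw _ (by simp), h.v1], by rw [hw _ (by simp), h.v2],
    by rw [hr, h.w]⟩

/-- Insert the dart `bkNext` at the vertex `bkCur` into the queue. -/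
def insertDart : Program := assign bkLeaf (.get bkAdj (var bkCur * numS + var bkNext)) ;;
  .setReal rbKey (var bkLeaf)
    (.add (.get rbDist (var bkSrc * numV + var bkCur)) (.get 0 (var bkLeaf / 2))) ;;
  assign bkNext (var bkNext + 1) ;; insertLeaf

/-- Extract the first dart from the queue. -/
def extractDart : Program := assign bkLeaf (.get bkBest 1 - 1) ;; removeLeaf ;;
  assign bkHead (.get bkSnd (var bkLeaf / 2) * (1 - var bkLeaf % 2) +
    .get bkFst (var bkLeaf / 2) * (var bkLeaf % 2)) ;;
  .ite (.wordLe (.get bkFin (var bkSrc * numV + var bkHead)) 0)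
    (.setWord bkFin (var bkSrc * numV + var bkHead) 1 ;;
      .setWord bkOrd (var bkSrc * numV + var bkCnt) (var bkHead) ;;
      .setWord bkPar (var bkSrc * numV + var bkHead) (var bkLeaf) ;;
      .setReal rbDist (var bkSrc * numV + var bkHead) (.get rbKey (var bkLeaf)) ;;
      assign bkCur (var bkHead) ;; assign bkNext 0 ;; assign bkCnt (var bkCnt + 1))
    .skip

/-- Start a search. -/
def startSearch : Program := .setWord bkFin (var bkSrc * numV + var bkSrc) 1 ;;
  .setWord bkOrd (var bkSrc * numV) (var bkSrc) ;;
  assign bkCur (var bkSrc) ;; assign bkNext 0 ;; assign bkCnt 1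

/-- Compute a shortest path tree with root `bkSrc`. -/
def searchFrom : Program := startSearch ;;
  .loop (.not (.and (.wordLe (.get bkDeg (var bkCur)) (var bkNext)) (.wordLe (.get bkBest 1) 0)))
    (.ite (.lt (var bkNext) (.get bkDeg (var bkCur))) insertDart extractDart)

/-- Compute shortest path trees from all vertices. -/
def searchAll : Program := forLoop bkSrc numV searchFrom

/-- The row of an array that starts at the address `o`. -/
def row {α : Type*} (f : ℕ → α) (o : ℕ) : ℕ → α := fun v => f (o + v)

theorem row_update {α : Type*} {f g : ℕ → α} {o y : ℕ} {x : α}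
    (h : ∀ a, g a = if a = o + y then x else f a) : row g o = Function.update (row f o) y x := by
  funext v; simp only [row, h, Function.update_apply]; by_cases hv : v = y
  · simp [hv]
  · rw [if_neg (by omega), if_neg hv]

/-- The arrays of the search agree outside the row that starts at the address `o`. -/
structure AgreeOff (o m : ℕ) (s s' : State) : Prop where
  words : ∀ b, b = bkFin ∨ b = bkPar ∨ b = bkOrd → ∀ a, a < o ∨ o + m ≤ a →
    s'.words b a = s.words b a
  dist : ∀ a, a < o ∨ o + m ≤ a → s'.reals rbDist a = s.reals rbDist a

/-- The memory `s` holds the darts leaving each vertex. -/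
def HoldsAdj (G : Net) (s : State) : Prop :=
  G.Adjacency (s.words bkDeg) (fun v k => s.words bkAdj (v * G.n + k))

/-- The memory `s` holds a shortest path tree with root `p`. -/
def HoldsTree (G : Net) (p : ℕ) (s : State) : Prop :=
  G.SPTree p (row (s.words bkOrd) (p * G.m)) (row (s.words bkPar) (p * G.m))
    (row (s.reals rbDist) (p * G.m))

/-- The memory `s` holds a state of the search with root `p`. -/
structure Searching (G : Net) (p κ : ℕ) (s : State) (act : Finset ℕ) (x k cnt : ℕ) : Prop where
  queue : Queue κ act s
  cur : s.words bkCur 0 = x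
  next : s.words bkNext 0 = k
  count : s.words bkCnt 0 = cnt
  search : G.Search (s.words bkDeg) (fun v k => s.words bkAdj (v * G.n + k)) p
    (row (s.words bkFin) (p * G.m)) (row (s.words bkOrd) (p * G.m)) (row (s.words bkPar) (p * G.m))
    (row (s.reals rbDist) (p * G.m)) (s.reals rbKey) act x k cnt

variable {G : Net} {p κ B : ℕ} {s : State} {act : Finset ℕ} {x k cnt : ℕ}

theorem HoldsAdj.congr {s' : State} (h : G.HoldsAdj s) (h1 : s'.words bkDeg = s.words bkDeg)
    (h2 : s'.words bkAdj = s.words bkAdj) : G.HoldsAdj s' := by rw [HoldsAdj, h1, h2]; exact h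

theorem IsDart.lt {d : ℕ} (h : G.IsDart d) : d < 2 * G.n := by have := h.1; omega

theorem insertDart_spec (hG : G.Good) (hB : 2 * 2 ^ κ < B) (hκ : 2 * G.n ≤ 2 ^ κ) (hh : G.Holds s)
    (hA : G.HoldsAdj s) (hp : s.words bkSrc 0 = p) (h : G.Searching p κ s act x k cnt)
    (hk : k < s.words bkDeg x) : Tri B insertDart s (κ * 100 + 100) (fun s' => ∃ d, d ∉ act ∧
      G.Searching p κ s' (insert d act) x (k + 1) cnt ∧ s'.reals rbDist = s.reals rbDist) := by
  refine Tri.of_bdd fun hb => ?_; set d := s.words bkAdj (x * G.n + k) with hd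
  have hdart := hA.dart x h.search.x_lt k hk; have hnot := h.search.notMem hA hk
  have hdlt : d < 2 ^ κ := (hdart.1.lt).trans_le hκ
  set v := s.reals rbDist (p * G.m + x) + s.reals 0 (d / 2) with hv
  refine Tri.seq (T1 := 12) (T2 := κ * 100 + 88) (R := fun s' => s' = s.writeWord bkLeaf 0 d)
    (Tri.block (fun _ => by simp; exact hb _ _) (by simp [h.cur, h.next, hh.n, hd]) (by decide)) ?_
    (by omega)
  rintro s1 - rfl
  refine Tri.seq (T1 := 20) (T2 := κ * 100 + 68)
    (R := fun s' => s' = (s.writeWord bkLeaf 0 d).writeReal rbKey d v)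
    (Tri.block (fun _ => by simp) (by simp [h.cur, hh.m, hp, hv]) (by decide)) ?_
    (by omega)
  rintro s2 - rfl
  refine Tri.seq (T1 := 10) (T2 := κ * 100 + 50)
    (R := fun s' => s' = ((s.writeWord bkLeaf 0 d).writeReal rbKey d v).writeWord bkNext 0 (k + 1))
    (Tri.block (fun _ => by simp [h.next]; have := hb bkDeg x; omega) (by simp [h.next])
    (by decide)) ?_ (by omega)
  rintro s3 - rfl
  refine Tri.mono (insertLeaf_spec (κ := κ) (act := act) (l := d) ?_ (by simp) hdlt hB) le_rfl ?_
  · refine QueueExcept.congr (Queue.writeKey (QueueExcept.congr h.queue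
      (s' := s.writeWord bkLeaf 0 d) (by simp) (by simp) (by simp)) hnot v) (by simp) (by simp) (by simp [hd])
  · intro s' hf hq
    have hR : ∀ b, s'.reals b = (((s.writeWord bkLeaf 0 d).writeReal rbKey d v).writeWord bkNext 0
        (k + 1)).reals b := fun b => hf.r b (by simp [insertLeaf_wrR])
    have hW : ∀ b, b ≠ bkBest ∧ b ≠ bkNode ∧ b ≠ bkNext ∧ b ≠ bkLeaf → s'.words b = s.words b := by
      rintro b ⟨h1, h2, h3, h4⟩; rw [hf.w b (by simp [insertLeaf_wr, h1, h2])]; simp [h3, h4]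
    refine ⟨d, hnot, ⟨hq, ?_, ?_, ?_, ?_⟩, ?_⟩
    · rw [hW _ (by decide), h.cur]
    · rw [hf.w _ (by simp [insertLeaf_wr])]; simp
    · rw [hW _ (by decide), h.count]
    · rw [hW bkDeg (by decide), hW bkAdj (by decide), hW bkFin (by decide), hW bkOrd (by decide),
        hW bkPar (by decide), hR, hR]
      have k1 : (((s.writeWord bkLeaf 0 d).writeReal rbKey d v).writeWord bkNext 0 (k + 1)).reals
          rbKey = Function.update (s.reals rbKey) d (row (s.reals rbDist) (p * G.m) x +
            G.w (d / 2)) := by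
        funext a; have : s.reals 0 = G.w := hh.w; simp [Function.update_apply, row, hv, this]
      have k2 : (((s.writeWord bkLeaf 0 d).writeReal rbKey d v).writeWord bkNext 0 (k + 1)).reals
          rbDist = s.reals rbDist := by simp
      rw [k1, k2]; exact h.search.insert hA hG hk
    · rw [hR]; simp

theorem extractDart_spec (hG : G.Good) (hB : 2 * 2 ^ κ < B) (hκ : 2 * G.n ≤ 2 ^ κ) (hh : G.Holds s)
    (hA : G.HoldsAdj s) (hp : s.words bkSrc 0 = p) (h : G.Searching p κ s act x k cnt)
    (hk : s.words bkDeg x ≤ k) (h0 : s.words bkBest 1 ≠ 0) :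
    Tri B extractDart s (κ * 100 + 200) (fun s' => ∃ d ∈ act, AgreeOff (p * G.m) G.m s s' ∧
      ((row (s.words bkFin) (p * G.m) (G.head d) ≠ 0 ∧
        row (s'.words bkFin) (p * G.m) = row (s.words bkFin) (p * G.m) ∧
        G.Searching p κ s' (act.erase d) x k cnt) ∨
      (row (s.words bkFin) (p * G.m) (G.head d) = 0 ∧ G.head d < G.m ∧
        row (s'.words bkFin) (p * G.m) =
          Function.update (row (s.words bkFin) (p * G.m)) (G.head d) 1 ∧
        G.Searching p κ s' (act.erase d) (G.head d) 0 (cnt + 1)))) := by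
  refine Tri.of_bdd fun hb => ?_
  obtain ⟨d, hd, hbest, hmin⟩ : ∃ d ∈ act, s.words bkBest 1 = d + 1 ∧
      ∀ d' ∈ act, s.reals rbKey d ≤ s.reals rbKey d' := by
    rcases h.queue.root with h' | h'
    · exact absurd h'.1 h0
    · exact h'
  have hdκ := h.queue.lt d hd; have hdart := (h.search.act_dart d hd).1
  have hhead := hG.head_lt hdart; have hmn := hG.m_le; set y := G.head d with hy
  refine Tri.seq (T1 := 8) (T2 := κ * 100 + 192) (R := fun s' => s' = s.writeWord bkLeaf 0 d)
    (Tri.block (fun _ => by simp [hbest]; omega) (by simp [hbest]) (by decide)) ?_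
    (by omega)
  rintro s1 - rfl
  refine Tri.seq (T1 := κ * 100 + 50) (T2 := 142) (removeLeaf_spec (act := act) (l := d)
    (QueueExcept.congr h.queue (by simp) (by simp) (by simp)) (by simp) hdκ hB) ?_ (by omega)
  intro s2 hf hq
  have hR : s2.reals = s.reals := by funext b; rw [hf.r b (by simp [removeLeaf_wrR])]; simp
  have hW : ∀ b, b ≠ bkBest ∧ b ≠ bkNode ∧ b ≠ bkLeaf → s2.words b = s.words b := by
    rintro b ⟨h1, h2, h4⟩; rw [hf.w b (by simp [removeLeaf_wr, h1, h2])]; simp [h4]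
  have hleaf : s2.words bkLeaf 0 = d := by rw [hf.w _ (by simp [removeLeaf_wr])]; simp
  have e5 := hW bkFst (by decide); have e6 := hW bkSnd (by decide); have e0 := hW 0 (by decide)
  have e70 := hW bkSrc (by decide); have e71 := hW bkFin (by decide)
  have e72 := hW bkPar (by decide); have e73 := hW bkOrd (by decide)
  have e74 := hW bkCnt (by decide); have e75 := hW bkCur (by decide)
  have e76 := hW bkNext (by decide); have e8 := hW bkDeg (by decide)
  have e9 := hW bkAdj (by decide)
  have hval : G.v1 (d / 2) * (1 - d % 2) + G.v0 (d / 2) * (d % 2) = y := by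
    rw [hy, head]; rcases Nat.mod_two_eq_zero_or_one d with h | h <;> simp [h]
  have hyB : y < B := by have := hdart.lt; omega
  refine Tri.seq (T1 := 40) (T2 := 102) (R := fun s' => s' = s2.writeWord bkHead 0 y)
    (Tri.block (fun _ => by simp [hleaf, e5, e6, hh.v0, hh.v1, hval]; exact hyB)
      (by simp [hleaf, e5, e6, hh.v0, hh.v1, hval]) (by decide)) ?_ (by omega)
  rintro s3 - rfl; refine Tri.ite (T1 := 80) (fun hc => ?_) (fun hc => ?_) (by decide)
  · have hc' : s.words bkFin (p * G.m + y) = 0 := by simpa [e71, e70, e0, hp, hh.m] using hc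
    have hcnt := h.search.cnt_lt hhead hc'; have hset := h.search.settle hA hG hk hd hmin hc'
    refine Tri.block (fun _ => ?_) ?_ (by decide)
    · have := hb bkCnt 0; have := h.count; have := hdart.lt
      simp [e70, e0, e74, hp, hh.m, hleaf, h.count]; omega
    · generalize hs' : Program.exec _ _ = s'
      have w : ∀ b, b ≠ bkFin ∧ b ≠ bkOrd ∧ b ≠ bkPar ∧ b ≠ bkCur ∧ b ≠ bkNext ∧ b ≠ bkCnt →
          s'.words b = (s2.writeWord bkHead 0 y).words b := by
        rintro b ⟨h1, h2, h3, h4, h5, h6⟩; rw [← hs']; simp [h1, h2, h3, h4, h5, h6]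
      have w1 : ∀ a, s'.words bkFin a = if a = p * G.m + y then 1 else s.words bkFin a := by
        intro a; rw [← hs']; simp [e71, e70, e0, hp, hh.m]
      have w2 : ∀ a, s'.words bkOrd a = if a = p * G.m + cnt then y else s.words bkOrd a := by
        intro a; rw [← hs']; simp [e73, e70, e0, e74, hp, hh.m, h.count]
      have w3 : ∀ a, s'.words bkPar a = if a = p * G.m + y then d else s.words bkPar a := by
        intro a; rw [← hs']; simp [e72, e70, e0, hp, hh.m, hleaf]
      have w4 : ∀ a, s'.reals rbDist a =
          if a = p * G.m + y then s.reals rbKey d else s.reals rbDist a := by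
        intro a; rw [← hs']; simp [e70, e0, hp, hh.m, hleaf, hR]
      have w5 : s'.reals rbKey = s.reals rbKey := by rw [← hs']; simp [hR]
      refine ⟨d, hd, ⟨?_, ?_⟩, Or.inr ⟨hc', hhead, row_update w1, ⟨?_, ?_, ?_, ?_, ?_⟩⟩⟩
      · rintro b (rfl | rfl | rfl) a ha
        · rw [w1, if_neg (by omega)]
        · rw [w3, if_neg (by omega)]
        · rw [w2, if_neg (by omega)]
      · intro a ha; rw [w4, if_neg (by omega)]
      · refine QueueExcept.congr hq ?_ ?_ (by rw [w5, hR])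
        · rw [w _ (by decide)]; simp
        · rw [w _ (by decide)]; simp
      · rw [← hs']; simp [← hy]
      · rw [← hs']; simp
      · rw [← hs']; simp [e74, h.count]
      · rw [w bkDeg (by decide), w bkAdj (by decide),
          row_update w1, row_update w2, row_update w3, row_update w4, w5]
        simpa [e8, e9] using hset
  · have hc' : s.words bkFin (p * G.m + y) ≠ 0 := by
      simpa [e71, e70, e0, hp, hh.m, Nat.pos_iff_ne_zero] using hc
    refine Tri.block (fun _ => by simp) ?_ (by decide); simp only [Program.exec]
    refine ⟨d, hd, ⟨?_, ?_⟩, Or.inl ⟨hc', ?_, ⟨?_, ?_, ?_, ?_, ?_⟩⟩⟩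
    · rintro b (rfl | rfl | rfl) a -
      · simp [e71]
      · simp [e72]
      · simp [e73]
    · simp [hR]
    · simp [e71]
    · exact QueueExcept.congr hq (by simp) (by simp) (by simp)
    · simp [e75, h.cur]
    · simp [e76, h.next]
    · simp [e74, h.count]
    · simpa [e8, e9, e71, e72, e73, hR] using h.search.discard hG hd hc'

theorem AgreeOff.trans {o m : ℕ} {s s' s'' : State} (h : AgreeOff o m s s')
    (h' : AgreeOff o m s' s'') : AgreeOff o m s s'' :=
  ⟨fun b hb a ha => (h'.words b hb a ha).trans (h.words b hb a ha),
    fun a ha => (h'.dist a ha).trans (h.dist a ha)⟩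

open Classical in
/-- The total degree of the vertices that have not been reached. -/
noncomputable def openDegree (G : Net) (deg fin : ℕ → ℕ) : ℕ :=
  ∑ v ∈ Finset.range G.m, if fin v = 0 then deg v else 0

theorem openDegree_update {deg fin : ℕ → ℕ} {y : ℕ} (hy : y < G.m) (hf : fin y = 0) :
    openDegree G deg (Function.update fin y 1) + deg y = openDegree G deg fin := by
  unfold openDegree
  rw [← Finset.sum_erase_add _ _ (Finset.mem_range.2 hy),
    ← Finset.sum_erase_add (Finset.range G.m) (fun v => if fin v = 0 then deg v else 0)
      (Finset.mem_range.2 hy)]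
  simp only [Function.update_self, one_ne_zero, if_false, add_zero, hf, if_true]
  congr 1
  refine Finset.sum_congr rfl fun v hv => ?_; rw [Function.update_of_ne (Finset.ne_of_mem_erase hv)]

theorem searchFrom_wr {b : ℕ} (h : searchFrom.wr b) : (61 ≤ b ∧ b ≤ 63) ∨ (71 ≤ b ∧ b ≤ 79) := by
  simp [searchFrom, startSearch, insertDart, extractDart, insertLeaf_wr, removeLeaf_wr] at h; omega

theorem searchFrom_wrR {b : ℕ} (h : searchFrom.wrR b) : b = rbKey ∨ b = rbDist := by
  simp [searchFrom, startSearch, insertDart, extractDart, insertLeaf_wrR, removeLeaf_wrR] at h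
  omega

/-- The fuel is twice the number of darts still to be inserted (those at unreached vertices and the
remaining ones at x) plus the size of the queue. An insertion trades 2 for 1, an extraction loses 1,
and settling a vertex only moves its degree between the two counts. Initially the fuel is at most 2
· 2n, the darts being twice the edges. -/
theorem searchFrom_spec (hG : G.Good) (hB : 2 * 2 ^ κ < B) (hκ : 2 * G.n ≤ 2 ^ κ) (hh : G.Holds s)
    (hA : G.HoldsAdj s) (hp : s.words bkSrc 0 = p) (hpm : p < G.m) (hq : Queue κ ∅ s)
    (hfin : ∀ v < G.m, s.words bkFin (p * G.m + v) = 0) (hdist : s.reals rbDist (p * G.m + p) = 0) :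
    Tri B searchFrom s (4 * G.n * (κ * 100 + 300) + 100) (fun s' =>
      Queue κ ∅ s' ∧ AgreeOff (p * G.m) G.m s s' ∧ G.HoldsTree p s') := by
  refine Tri.of_bdd fun hb => ?_; have hmn := hG.m_le
  refine Tri.seq (T1 := 40) (T2 := 4 * G.n * (κ * 100 + 300) + 60)
    (R := fun s' => AgreeOff (p * G.m) G.m s s' ∧ G.Searching p κ s' ∅ p 0 1 ∧
      row (s'.words bkFin) (p * G.m) = Function.update (row (s.words bkFin) (p * G.m)) p 1)
    (Tri.block (fun _ => by simp [startSearch, hp]; omega) ?_ (by decide)) ?_ (by omega)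
  · generalize hs' : Program.exec _ _ = s'
    have w1 : ∀ a, s'.words bkFin a = if a = p * G.m + p then 1 else s.words bkFin a := by
      intro a; rw [← hs']; simp [startSearch, hp, hh.m]
    have w2 : ∀ a, s'.words bkOrd a = if a = p * G.m + 0 then p else s.words bkOrd a := by
      intro a; rw [← hs']; simp [startSearch, hp, hh.m]
    have w : ∀ b, b ≠ bkFin ∧ b ≠ bkOrd ∧ b ≠ bkCur ∧ b ≠ bkNext ∧ b ≠ bkCnt →
        s'.words b = s.words b := by
      rintro b ⟨h1, h2, h3, h4, h5⟩; rw [← hs']; simp [startSearch, h1, h2, h3, h4, h5]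
    have hr : s'.reals = s.reals := by rw [← hs']; simp [startSearch]
    refine ⟨⟨?_, by simp [hr]⟩, ⟨?_, ?_, ?_, ?_, ?_⟩, row_update w1⟩
    · rintro b (rfl | rfl | rfl) a ha
      · rw [w1, if_neg (by omega)]
      · rw [w _ (by decide)]
      · rw [w2, if_neg (by omega)]
    · refine QueueExcept.congr hq (w _ (by decide)) (w _ (by decide)) (by rw [hr])
    · rw [← hs']; simp [startSearch, hp]
    · rw [← hs']; simp [startSearch, hp]
    · rw [← hs']; simp [startSearch, hp]
    · rw [row_update w1, hr, w bkDeg (by decide), w bkAdj (by decide)]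
      refine Search.init hpm hfin ?_ hdist hA hG; simp [row_update w2]
  · rintro s1 hf1 ⟨ho1, hs1, hfin1⟩
    have w₁ : ∀ b, ¬ startSearch.wr b → s1.words b = s.words b := fun b hb => hf1.w b hb
    refine Tri.loop (f := 4 * G.n) (T1 := κ * 100 + 220) (fun f s' => ∃ act x k cnt,
      G.Searching p κ s' act x k cnt ∧ AgreeOff (p * G.m) G.m s s' ∧
      2 * (openDegree G (s.words bkDeg) (row (s'.words bkFin) (p * G.m)) +
        (s.words bkDeg x - k)) + act.card ≤ f) ?_ ?_ ?_ ?_ ?_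
    · refine ⟨∅, p, 0, 1, hs1, ho1, ?_⟩
      have h1 := openDegree_update (G := G) (deg := s.words bkDeg)
        (fin := row (s.words bkFin) (p * G.m)) hpm (hfin p hpm)
      have h2 : openDegree G (s.words bkDeg) (row (s.words bkFin) (p * G.m)) ≤ 2 * G.n := by
        refine le_trans (Finset.sum_le_sum fun v _ => ?_) hA.sum_le; split_ifs <;> simp
      rw [hfin1]; simp only [Finset.card_empty, Nat.sub_zero]; omega
    · rintro s' hf ⟨act, x, k, cnt, h1, -, h3⟩
      have e1 : s'.words bkDeg = s.words bkDeg := by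
        rw [hf.w _ (by simp [insertDart, extractDart, insertLeaf_wr, removeLeaf_wr]),
          w₁ _ (by simp [startSearch])]
      have h4 : act = ∅ := Finset.card_eq_zero.1 (by omega)
      have h5 : s'.words bkBest 1 = 0 := by
        rcases h1.queue.root with h | ⟨l, hl, -⟩
        · exact h.1
        · simp [h4] at hl
      simp [h5, h1.cur, h1.next, e1]; omega
    · rintro f s' hf ⟨act, x, k, cnt, h1, h2, h3⟩ hc
      have hw : ∀ b, ¬ searchFrom.wr b → s'.words b = s.words b := by
        intro b hb
        have : ¬ startSearch.wr b ∧ ¬ insertDart.wr b ∧ ¬ extractDart.wr b := by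
          simpa [searchFrom, not_or] using hb
        rw [hf.w _ (by simpa using ⟨this.2.1, this.2.2⟩), w₁ _ this.1]
      have hw' : ∀ b, ¬ ((61 ≤ b ∧ b ≤ 63) ∨ (71 ≤ b ∧ b ≤ 79)) → s'.words b = s.words b :=
        fun b hb => hw b fun h => hb (searchFrom_wr h)
      have hr : ∀ b, ¬ searchFrom.wrR b → s'.reals b = s.reals b := by
        intro b hb
        have : ¬ startSearch.wrR b ∧ ¬ insertDart.wrR b ∧ ¬ extractDart.wrR b := by
          simpa [searchFrom, not_or] using hb
        rw [hf.r _ (by simpa using ⟨this.2.1, this.2.2⟩), hf1.r _ this.1]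
      have hh' : G.Holds s' := hh.congr (by
        intro b hb'
        exact hw' b (by omega)) (hr 0 fun h => by have := searchFrom_wrR h; omega)
      have hA' : G.HoldsAdj s' := hA.congr (hw' _ (by omega)) (hw' _ (by omega))
      have e8 : s'.words bkDeg = s.words bkDeg := hw' _ (by omega)
      have hp' : s'.words bkSrc 0 = p := by rw [hw' _ (by omega), hp]
      refine Tri.ite (T1 := κ * 100 + 200) (fun hk => ?_) (fun hk => ?_) ?_
      · rw [Test.holds_lt] at hk; simp only [Expr.val, h1.cur, h1.next] at hk
        refine Tri.mono (insertDart_spec hG hB hκ hh' hA' hp' h1 hk) (by omega) ?_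
        rintro s'' hf' ⟨d, hd, h4, h5⟩
        have e71 : s''.words bkFin = s'.words bkFin := hf'.w _ (by simp [insertDart, insertLeaf_wr])
        refine ⟨_, _, _, _, h4, h2.trans ⟨?_, by simp [h5]⟩, ?_⟩
        · rintro b hb a -; rw [hf'.w]
          rcases hb with rfl | rfl | rfl <;> simp [insertDart, insertLeaf_wr]
        · rw [e8] at hk; rw [e71, Finset.card_insert_of_notMem hd]; omega
      · rw [Test.holds_lt] at hk; simp only [Expr.val, h1.cur, h1.next, not_lt] at hk
        have h0 : s'.words bkBest 1 ≠ 0 := by intro h0; apply hc; simp [h0, h1.cur, h1.next, hk]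
        refine Tri.mono (extractDart_spec hG hB hκ hh' hA' hp' h1 hk h0) le_rfl ?_
        rintro s'' hf' ⟨d, hd, h4, h5⟩; have hcard := Finset.card_erase_add_one hd; rw [e8] at hk
        rcases h5 with ⟨h5, h6, h7⟩ | ⟨h5, h6, h7, h8⟩
        · refine ⟨_, _, _, _, h7, h2.trans h4, ?_⟩; rw [h6]; omega
        · refine ⟨_, _, _, _, h8, h2.trans h4, ?_⟩
          have := openDegree_update (deg := s.words bkDeg) h6 h5; rw [h7]; omega
      · have : (Test.lt (var bkNext) (.get bkDeg (var bkCur))).cost = 7 := rfl; omega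
    · have : (Test.not (.and (.wordLe (.get bkDeg (var bkCur)) (var bkNext))
        (.wordLe (.get bkBest 1) 0))).cost = 12 := rfl
      rw [this]; nlinarith
    · rintro f s' ⟨act, x, k, cnt, h1, h2, -⟩ hc
      have h3 : s'.words bkDeg x ≤ k ∧ s'.words bkBest 1 = 0 := by simpa [h1.cur, h1.next] using hc
      have h4 : act = ∅ := by
        rcases h1.queue.root with h | ⟨l, -, h, -⟩
        · exact h.2
        · omega
      subst h4; exact ⟨h1.queue, h2, h1.search.spTree hG hpm h3.1⟩

theorem HoldsTree.congr {s' : State} {q : ℕ} (h : G.HoldsTree q s)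
    (hw : ∀ b, b = bkPar ∨ b = bkOrd → ∀ j < G.m,
      s'.words b (q * G.m + j) = s.words b (q * G.m + j))
    (hr : ∀ j < G.m, s'.reals rbDist (q * G.m + j) = s.reals rbDist (q * G.m + j))
    (hG : G.Good) (hm : 0 < G.m) : G.HoldsTree q s' := by
  have eo : ∀ j < G.m, row (s'.words bkOrd) (q * G.m) j = row (s.words bkOrd) (q * G.m) j :=
    fun j hj => hw _ (Or.inr rfl) j hj
  have ep : ∀ j < G.m, row (s'.words bkPar) (q * G.m) j = row (s.words bkPar) (q * G.m) j :=
    fun j hj => hw _ (Or.inl rfl) j hj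
  have ed : ∀ j < G.m, row (s'.reals rbDist) (q * G.m) j = row (s.reals rbDist) (q * G.m) j :=
    fun j hj => hr j hj
  refine ⟨?_, ?_, ?_, ?_, ?_, ?_, ?_⟩
  · intro j hj; rw [eo j hj]; exact h.ord_lt j hj
  · intro v hv; obtain ⟨j, hj, he⟩ := h.ord_surj v hv; exact ⟨j, hj, by rw [eo j hj, he]⟩
  · intro i j hi hj he; rw [eo i hi, eo j hj] at he; exact h.ord_inj i j hi hj he
  · rw [eo 0 hm]; exact h.ord_zero
  · have hq : q < G.m := by rw [← h.ord_zero]; exact h.ord_lt 0 hm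
    rw [ed q hq]; exact h.dist_root
  · intro j hj0 hj; have h' := h.tree j hj0 hj; have hlt := h.ord_lt j hj
    obtain ⟨g1, g2, ⟨j', g3, g4⟩, g5⟩ := h'; rw [eo j hj, ep _ hlt, ed _ hlt, ed _ (hG.tail_lt g1)]
    exact ⟨g1, g2, ⟨j', g3, by rw [eo j' (by omega), g4]⟩, g5⟩
  · intro d hd; rw [ed _ (hG.head_lt hd), ed _ (hG.tail_lt hd)]; exact h.feasible d hd

theorem searchAll_spec (hG : G.Good) (hB : 2 * 2 ^ κ < B) (hκ : 2 * G.n ≤ 2 ^ κ) (hh : G.Holds s)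
    (hA : G.HoldsAdj s) (hq : Queue κ ∅ s) (hfin : ∀ a, s.words bkFin a = 0)
    (hdist : ∀ a, s.reals rbDist a = 0) :
    Tri B searchAll s (G.m * (4 * G.n * (κ * 100 + 300) + 130) + 20) (fun s' =>
      Queue κ ∅ s' ∧ ∀ p < G.m, G.HoldsTree p s') := by
  refine Tri.of_bdd fun hb => ?_; have hmn := hG.m_le
  refine Tri.forLoop (N := G.m) (Tb := 4 * G.n * (κ * 100 + 300) + 100) (fun p s' =>
      Queue κ ∅ s' ∧ (∀ q < p, G.HoldsTree q s') ∧ (∀ a, p * G.m ≤ a → s'.words bkFin a = 0) ∧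
      ∀ a, p * G.m ≤ a → s'.reals rbDist a = 0) ?_ ?_ ?_ ?_ ?_ ?_ ?_ ?_
  · intro h; have := searchFrom_wr h; omega
  · omega
  · intro s' hf; simp [hf.w 0 (by simp; intro h; have := searchFrom_wr h; omega), hh.m]
  · exact ⟨hq, by simp, fun a _ => hfin a, fun a _ => hdist a⟩
  · rintro p s' x ⟨h1, h2, h3, h4⟩
    exact ⟨QueueExcept.congr h1 (by simp) (by simp) (by simp),
      fun q hq => by have := h2 q hq; simpa [HoldsTree] using this, by simpa using h3,
      by simpa using h4⟩
  · rintro p s' hp hpv hf ⟨h1, h2, h3, h4⟩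
    have hw : ∀ b, b ≠ bkSrc → ¬ ((61 ≤ b ∧ b ≤ 63) ∨ (71 ≤ b ∧ b ≤ 79)) →
        s'.words b = s.words b := by
      intro b hb hb'; exact hf.w b (by simp [hb]; intro h; exact hb' (searchFrom_wr h))
    have hr : ∀ b, ¬ (b = rbKey ∨ b = rbDist) → s'.reals b = s.reals b := by
      intro b hb'; exact hf.r b (by simp; intro h; exact hb' (searchFrom_wrR h))
    refine Tri.mono (searchFrom_spec (p := p) hG hB hκ (hh.congr ?_ (hr _ (by omega)))
      (hA.congr (hw _ (by omega) (by omega)) (hw _ (by omega) (by omega))) hpv hp h1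
      (fun v hv => h3 _ (by omega)) (h4 _ (by omega))) le_rfl ?_
    · intro b hb'; exact hw b (by omega) (by omega)
    · rintro s'' - ⟨g1, g2, g3⟩
      have hm1 : (p + 1) * G.m = p * G.m + G.m := by ring
      refine ⟨g1, fun q hq => ?_, fun a ha => ?_, fun a ha => ?_⟩
      · rcases Nat.lt_succ_iff_lt_or_eq.1 hq with hq | rfl
        · have hqm : ∀ j < G.m, q * G.m + j < p * G.m := fun j hj => idx_lt hq hj
          refine (h2 q hq).congr ?_ ?_ hG (by omega)
          · intro b hb' j hj; exact g2.words b (by omega) _ (Or.inl (hqm j hj))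
          · intro j hj; exact g2.dist _ (Or.inl (hqm j hj))
        · exact g3
      · rw [g2.words _ (by simp) a (by omega), h3 a (by omega)]
      · rw [g2.dist a (by omega), h4 a (by omega)]
  · have : numV.cost = 2 := rfl; rw [this]
    generalize 4 * G.n * (κ * 100 + 300) = Z
    have : G.m * (Z + 100 + (2 + 10)) ≤ G.m * (Z + 130) := Nat.mul_le_mul_left _ (by omega); omega
  · rintro s' hf - ⟨h1, h2, -, -⟩; exact ⟨h1, h2⟩

theorem searchAll_wr {b : ℕ} (h : searchAll.wr b) : (61 ≤ b ∧ b ≤ 63) ∨ (70 ≤ b ∧ b ≤ 79) := by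
  rcases forLoop_wr.1 h with rfl | h
  · omega
  · have := searchFrom_wr h; omega

theorem searchAll_wrR {b : ℕ} (h : searchAll.wrR b) : b = rbKey ∨ b = rbDist :=
  searchFrom_wrR (forLoop_wrR.1 h)

end Net

/-! ## Cycles and shortest path trees -/

namespace Net

open GaussJordan (Vec)

/-- The sum of `F` over the boundary of a chain. -/
noncomputable def bdry (G : Net) (F : ℕ → ZMod 2) : Vec →ₗ[ZMod 2] ZMod 2 :=
  ∑ i ∈ Finset.range G.n, (F (G.v0 i) + F (G.v1 i)) • LinearMap.proj i

theorem bdry_apply (G : Net) (F : ℕ → ZMod 2) (z : Vec) :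
    G.bdry F z = ∑ i ∈ Finset.range G.n, (F (G.v0 i) + F (G.v1 i)) * z i := by simp [bdry]

theorem bdry_single (G : Net) (F : ℕ → ZMod 2) {e : ℕ} (he : e < G.n) :
    G.bdry F (Pi.single e 1) = F (G.v0 e) + F (G.v1 e) := by
  rw [bdry_apply, Finset.sum_eq_single e]
  · simp
  · intro i _ hi; simp [hi]
  · intro h; exact absurd (Finset.mem_range.2 he) h

/-- The space of cycles. -/
def cycles (G : Net) : Submodule (ZMod 2) Vec where
  carrier := {z | (∀ i, ¬ G.IsEdge i → z i = 0) ∧ ∀ F, G.bdry F z = 0}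
  add_mem' := fun ha hb => ⟨fun i hi => by simp [ha.1 i hi, hb.1 i hi],
    fun F => by rw [map_add, ha.2, hb.2, add_zero]⟩
  zero_mem' := ⟨fun _ _ => rfl, fun F => map_zero _⟩
  smul_mem' := fun c z hz => ⟨fun i hi => by simp [hz.1 i hi], fun F => by
    rw [map_smul, hz.2, smul_zero]⟩

variable {G : Net}

/-- In each coordinate r this is the cycle condition for the function v ↦ P v r on the vertices. -/
theorem cycles_telescope {z : Vec} (hz : z ∈ G.cycles) (P : ℕ → Vec) :
    ∑ i ∈ Finset.range G.n, z i • (P (G.v0 i) + P (G.v1 i)) = 0 := by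
  ext r; have := hz.2 fun v => P v r; rw [bdry_apply] at this
  rw [Finset.sum_apply, Pi.zero_apply, ← this]
  exact Finset.sum_congr rfl fun i _ => by simp [mul_comm]

theorem add_self (v : Vec) : v + v = 0 := by ext r; exact CharTwo.add_self_eq_zero _

/-- The chain of the first `f` edges on the way from a vertex to the root. -/
noncomputable def walk (G : Net) (p : ℕ) (par : ℕ → ℕ) : ℕ → ℕ → Vec
  | 0, _ => 0
  | f + 1, v => if v = p then 0 else Pi.single (par v / 2) 1 + walk G p par f (G.tail (par v))

/-- The chain of the edges on the way from a vertex to the root. -/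
noncomputable def path (G : Net) (p : ℕ) (par : ℕ → ℕ) (v : ℕ) : Vec := G.walk p par G.m v

/-- The cycle formed by an edge and the ways from its vertices to the root. -/
noncomputable def cand (G : Net) (p : ℕ) (par : ℕ → ℕ) (e : ℕ) : Vec :=
  Pi.single e 1 + (G.path p par (G.v0 e) + G.path p par (G.v1 e))

/-- The length of the closed walk from the root along an edge. -/
noncomputable def candKey (G : Net) (dist : ℕ → ℝ) (e : ℕ) : ℝ :=
  dist (G.v0 e) + G.w e + dist (G.v1 e)

/-- The weight of a chain. -/
noncomputable def wt (G : Net) (z : Vec) : ℝ := ∑ i ∈ Finset.range G.n, ((z i).val : ℝ) * G.w i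

theorem wt_add_le (hG : G.Good) (x y : Vec) : G.wt (x + y) ≤ G.wt x + G.wt y := by
  unfold wt; rw [← Finset.sum_add_distrib]; refine Finset.sum_le_sum fun i _ => ?_; rw [← add_mul]
  refine mul_le_mul_of_nonneg_right ?_ (hG.w_nonneg i)
  exact_mod_cast ZMod.val_add_le _ _

theorem wt_single {e : ℕ} (he : e < G.n) : G.wt (Pi.single e 1) = G.w e := by
  rw [wt, Finset.sum_eq_single e]
  · simp [ZMod.val_one]
  · intro i _ hi; simp [hi]
  · intro h; exact absurd (Finset.mem_range.2 he) h

theorem wt_zero : G.wt 0 = 0 := by simp [wt]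

section Tree

variable {p : ℕ} {ord par : ℕ → ℕ} {dist : ℕ → ℝ}

theorem walk_root (f : ℕ) : G.walk p par f p = 0 := by
  cases f <;> simp [walk]

theorem path_root : G.path p par p = 0 := walk_root _

theorem SPTree.ord_ne (h : G.SPTree p ord par dist) {j : ℕ} (hj0 : 0 < j) (hj : j < G.m) :
    ord j ≠ p := by intro he; rw [← h.ord_zero] at he; have := h.ord_inj j 0 hj (by omega) he; omega

/-- Each step to the parent lowers the position in `ord`, so fuel beyond that position is
irrelevant. -/
theorem SPTree.walk_eq (h : G.SPTree p ord par dist) (j : ℕ) : ∀ f f', j < G.m → j ≤ f → j ≤ f' →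
    G.walk p par f (ord j) = G.walk p par f' (ord j) := by
  induction j using Nat.strong_induction_on with
  | _ j ih =>
  intro f f' hj hf hf'; rcases Nat.eq_zero_or_pos j with rfl | hj0
  · rw [h.ord_zero, walk_root, walk_root]
  obtain ⟨f, rfl⟩ : ∃ k, f = k + 1 := ⟨f - 1, by omega⟩
  obtain ⟨f', rfl⟩ : ∃ k, f' = k + 1 := ⟨f' - 1, by omega⟩
  obtain ⟨-, -, ⟨j', hj', ht⟩, -⟩ := h.tree j hj0 hj; simp only [walk]
  rw [ht, ih j' hj' f f' (by omega) (by omega) (by omega)]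

theorem SPTree.path_ord (h : G.SPTree p ord par dist) {j : ℕ} (hj0 : 0 < j) (hj : j < G.m) :
    G.path p par (ord j) = Pi.single (par (ord j) / 2) 1 + G.path p par (G.tail (par (ord j))) := by
  obtain ⟨-, -, ⟨j', hj', ht⟩, -⟩ := h.tree j hj0 hj
  obtain ⟨f, hf⟩ : ∃ k, G.m = k + 1 := ⟨G.m - 1, by omega⟩
  rw [path, hf, walk, if_neg (h.ord_ne hj0 hj), path, ht,
    h.walk_eq j' f G.m (by omega) (by omega) (by omega)]

/-- Induction along the tree. -/
theorem SPTree.induction (h : G.SPTree p ord par dist) {R : ℕ → Prop} (h0 : R p)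
    (h1 : ∀ v, G.IsDart (par v) → G.head (par v) = v → R (G.tail (par v)) →
      G.path p par v = Pi.single (par v / 2) 1 + G.path p par (G.tail (par v)) →
      dist v = dist (G.tail (par v)) + G.w (par v / 2) → R v) : ∀ v < G.m, R v := by
  intro v hv; obtain ⟨j, hj, rfl⟩ := h.ord_surj v hv
  clear hv
  induction j using Nat.strong_induction_on with
  | _ j ih =>
  rcases Nat.eq_zero_or_pos j with rfl | hj0
  · rwa [h.ord_zero]
  obtain ⟨g1, g2, ⟨j', hj', ht⟩, g3⟩ := h.tree j hj0 hj
  exact h1 _ g1 g2 (ht ▸ ih j' hj' (by omega)) (h.path_ord hj0 hj) g3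

theorem dart_sum {M : Type*} [AddCommMonoid M] (F : ℕ → M) (d : ℕ) :
    F (G.v0 (d / 2)) + F (G.v1 (d / 2)) = F (G.tail d) + F (G.head d) := by
  unfold tail head; split_ifs
  · rfl
  · exact add_comm _ _

theorem SPTree.bdry_path (h : G.SPTree p ord par dist) (F : ℕ → ZMod 2) :
    ∀ v < G.m, G.bdry F (G.path p par v) = F p + F v := by
  refine h.induction ?_ ?_
  · rw [path_root, map_zero, CharTwo.add_self_eq_zero]
  · intro v h1 h2 h3 h4 _; rw [h4, map_add, h3, bdry_single _ _ h1.1, dart_sum, h2]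
    linear_combination F (G.tail (par v)) * (CharTwo.two_eq_zero (R := ZMod 2))

theorem SPTree.path_support (h : G.SPTree p ord par dist) {i : ℕ} (hi : ¬ G.IsEdge i) :
    ∀ v < G.m, G.path p par v i = 0 := by
  refine h.induction ?_ ?_
  · rw [path_root]; rfl
  · intro v h1 h2 h3 h4 _; have : i ≠ par v / 2 := fun he => hi (he ▸ h1)
    rw [h4, Pi.add_apply, h3, Pi.single_eq_of_ne this, add_zero]

/-- Subadditivity of the weight is enough here, so it need not be shown that tree paths repeat no
edge. -/
theorem SPTree.wt_path (h : G.SPTree p ord par dist) (hG : G.Good) :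
    ∀ v < G.m, G.wt (G.path p par v) ≤ dist v := by
  refine h.induction ?_ ?_
  · rw [path_root, wt_zero, h.dist_root]
  · intro v h1 h2 h3 h4 h5; rw [h4, h5]; refine (wt_add_le hG _ _).trans ?_; rw [wt_single h1.1]
    linarith

theorem SPTree.cand_mem (h : G.SPTree p ord par dist) (hG : G.Good) {e : ℕ} (he : G.IsEdge e) :
    G.cand p par e ∈ G.cycles := by
  have h0 := hG.lt e he; have h1 := hG.lt_m e he; refine ⟨fun i hi => ?_, fun F => ?_⟩
  · have : i ≠ e := fun h => hi (h ▸ he)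
    simp [cand, h.path_support hi _ (h0.trans h1), h.path_support hi _ h1, this]
  · rw [cand, map_add, map_add, bdry_single _ _ he.1, h.bdry_path F _ (h0.trans h1),
      h.bdry_path F _ h1]
    linear_combination (F (G.v0 e) + F (G.v1 e) + F p) * (CharTwo.two_eq_zero (R := ZMod 2))

/-- Only an inequality, since a common part of the two paths cancels modulo two. Candidates are
nevertheless sorted by key, which is available without forming the cycle. -/
theorem SPTree.wt_cand (h : G.SPTree p ord par dist) (hG : G.Good) {e : ℕ} (he : G.IsEdge e) :
    G.wt (G.cand p par e) ≤ G.candKey dist e := by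
  have h0 := hG.lt e he; have h1 := hG.lt_m e he; have h2 := h.wt_path hG _ (h0.trans h1)
  have h3 := h.wt_path hG _ h1
  have h4 := wt_add_le hG (Pi.single e 1) (G.path p par (G.v0 e) + G.path p par (G.v1 e))
  have h5 := wt_add_le hG (G.path p par (G.v0 e)) (G.path p par (G.v1 e)); rw [wt_single he.1] at h4
  unfold cand candKey; linarith

/-- The edges of the tree. -/
def treeEdges (G : Net) (ord par : ℕ → ℕ) : Set ℕ := {i | ∃ j, 0 < j ∧ j < G.m ∧ par (ord j) / 2 = i}

/-- For a tree edge e from the parent u to v, the path of v is e plus the path of u, and everything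
cancels. -/
theorem SPTree.cand_tree (h : G.SPTree p ord par dist) {e : ℕ} (he : e ∈ G.treeEdges ord par) :
    G.cand p par e = 0 := by
  obtain ⟨j, hj0, hj, rfl⟩ := he; have h1 := h.path_ord hj0 hj; obtain ⟨-, h2, -⟩ := h.tree j hj0 hj
  have h3 : G.path p par (G.v0 (par (ord j) / 2)) + G.path p par (G.v1 (par (ord j) / 2)) =
      G.path p par (G.tail (par (ord j))) + G.path p par (ord j) := by
    rw [dart_sum (G.path p par), h2]
  rw [cand, h3, ← add_assoc, ← h1, add_self]

/-- The paths in the candidates cancel by `cycles_telescope`, and the edges of z remain. Nothing is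
required of `p` and `par`, so the root can be chosen to suit the cycle. -/
theorem cycles_sum {z : Vec} (hz : z ∈ G.cycles) (p : ℕ) (par : ℕ → ℕ) :
    z = ∑ i ∈ Finset.range G.n, z i • G.cand p par i := by
  simp only [cand, smul_add (M := ZMod 2) _ (Pi.single _ 1 : Vec)]
  rw [Finset.sum_add_distrib, cycles_telescope hz, add_zero]; ext r; rw [Finset.sum_apply]
  by_cases hr : r < G.n
  · rw [Finset.sum_eq_single r]
    · simp
    · intro i _ hi; simp [hi.symm]
    · intro h; exact absurd (Finset.mem_range.2 hr) h
  · rw [hz.1 r fun h => hr h.1, Finset.sum_eq_zero]; intro i hi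
    have : r ≠ i := fun h => hr (h ▸ Finset.mem_range.1 hi); simp [this]

/-- A cycle in a tree vanishes. -/
theorem SPTree.eq_zero (h : G.SPTree p ord par dist) {z : Vec} (hz : z ∈ G.cycles)
    (ht : ∀ i, i ∉ G.treeEdges ord par → z i = 0) : z = 0 := by
  rw [cycles_sum hz p par]; refine Finset.sum_eq_zero fun i _ => ?_
  by_cases hi : i ∈ G.treeEdges ord par
  · rw [h.cand_tree hi, smul_zero]
  · rw [ht i hi, zero_smul]

/-- Outside of the tree, the chain `cand p par e` consists of `e`. -/
theorem SPTree.cand_apply (h : G.SPTree p ord par dist) (hG : G.Good) {e i : ℕ} (he : G.IsEdge e)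
    (hi : i ∉ G.treeEdges ord par) : G.cand p par e i = (Pi.single e 1 : Vec) i := by
  have key : ∀ v < G.m, G.path p par v i = 0 := by
    intro v hv; obtain ⟨j, hj, rfl⟩ := h.ord_surj v hv
    clear hv
    induction j using Nat.strong_induction_on with
    | _ j ih =>
    rcases Nat.eq_zero_or_pos j with rfl | hj0
    · rw [h.ord_zero, path_root]; rfl
    obtain ⟨-, -, ⟨j', hj', ht⟩, -⟩ := h.tree j hj0 hj
    have hne : i ≠ par (ord j) / 2 := fun he => hi ⟨j, hj0, hj, he.symm⟩
    rw [h.path_ord hj0 hj, Pi.add_apply, Pi.single_eq_of_ne hne, zero_add, ht, ih j' hj' (by omega)]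
  have h0 := hG.lt e he; have h1 := hG.lt_m e he
  rw [cand, Pi.add_apply, Pi.add_apply, key _ (h0.trans h1), key _ h1, add_zero, add_zero]

end Tree

/-! ### Short cycles span -/

/-- A walk without repeated edges, with edges in `A`, and its set of edges. -/
inductive Trail (G : Net) (A : Set ℕ) : ℕ → ℕ → Finset ℕ → Prop
  | nil (v : ℕ) : Trail G A v v ∅
  | cons {d u : ℕ} {E : Finset ℕ} (hd : G.IsDart d) (hA : d / 2 ∈ A) (hE : d / 2 ∉ E)
      (h : Trail G A (G.head d) u E) : Trail G A (G.tail d) u (insert (d / 2) E)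

/-- The chain with coefficient one at the elements of `E`. -/
noncomputable def indicator (E : Finset ℕ) : Vec := ∑ i ∈ E, Pi.single i 1

theorem indicator_apply (E : Finset ℕ) (i : ℕ) : indicator E i = if i ∈ E then 1 else 0 := by
  rw [indicator, Finset.sum_apply]; simp [Pi.single_apply]

variable {A : Set ℕ} {x u : ℕ} {E : Finset ℕ}

theorem Trail.subset (h : G.Trail A x u E) : ∀ i ∈ E, i ∈ A ∧ G.IsEdge i := by
  induction h with
  | nil => simp
  | cons hd hA hE h ih =>
    intro i hi; rcases Finset.mem_insert.1 hi with rfl | hi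
    · exact ⟨hA, hd⟩
    · exact ih i hi

/-- Both ends of an edge of the trail lie on the trail, and the rest of the trail from there is
again one. Hence prepending a dart never forces a repeated edge (`Trail.extend`), and the existence
of a trail to u propagates across every edge of A. -/
theorem Trail.suffix (h : G.Trail A x u E) : ∀ d, d / 2 ∈ E → ∃ E', G.Trail A (G.tail d) u E' := by
  induction h with
  | nil => simp
  | @cons d0 u E hd hA hE h ih =>
    intro d hdE; rcases Finset.mem_insert.1 hdE with he | hdE
    · rcases Nat.mod_two_eq_zero_or_one d with h1 | h1 <;>
        rcases Nat.mod_two_eq_zero_or_one d0 with h2 | h2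
      · obtain rfl : d = d0 := by omega
        exact ⟨_, .cons hd hA hE h⟩
      · have : G.tail d = G.head d0 := by simp [tail, head, h1, h2, he]
        exact ⟨_, this ▸ h⟩
      · have : G.tail d = G.head d0 := by simp [tail, head, h1, h2, he]
        exact ⟨_, this ▸ h⟩
      · obtain rfl : d = d0 := by omega
        exact ⟨_, .cons hd hA hE h⟩
    · exact ih d hdE

theorem Trail.extend {d : ℕ} (h : G.Trail A (G.head d) u E) (hd : G.IsDart d) (hA : d / 2 ∈ A) :
    ∃ E', G.Trail A (G.tail d) u E' := by
  by_cases hE : d / 2 ∈ E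
  · exact h.suffix d hE
  · exact ⟨_, .cons hd hA hE h⟩

theorem Trail.bdry (h : G.Trail A x u E) (F : ℕ → ZMod 2) : G.bdry F (indicator E) = F x + F u := by
  induction h with
  | nil => rw [CharTwo.add_self_eq_zero]; simp [indicator]
  | @cons d u E hd hA hE h ih =>
    rw [indicator, Finset.sum_insert hE, map_add, bdry_single _ _ hd.1, dart_sum]
    rw [indicator] at ih; rw [ih]
    linear_combination F (G.head d) * (CharTwo.two_eq_zero (R := ZMod 2))

theorem reverse_dist {δ : ℕ → ℝ}
    (hδ : ∀ d, G.IsDart d → δ (G.head d) ≤ δ (G.tail d) + G.w (d / 2)) {d : ℕ} (hd : G.IsDart d) :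
    δ (G.tail d) ≤ δ (G.head d) + G.w (d / 2) := by
  rcases Nat.mod_two_eq_zero_or_one d with h | h
  · have e : (d + 1) / 2 = d / 2 := by omega
    have h0 : (d + 1) % 2 = 1 := by omega
    have h1 := hδ (d + 1) (by unfold IsDart; rwa [e]); simpa [head, tail, h0, h, e] using h1
  · have e : (d - 1) / 2 = d / 2 := by omega
    have h0 : (d - 1) % 2 = 0 := by omega
    have h1 := hδ (d - 1) (by unfold IsDart; rwa [e]); simpa [head, tail, h0, h, e] using h1

theorem Trail.dist_le (h : G.Trail A x u E) {δ : ℕ → ℝ}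
    (hδ : ∀ d, G.IsDart d → δ (G.head d) ≤ δ (G.tail d) + G.w (d / 2)) :
    δ x ≤ ∑ i ∈ E, G.w i + δ u := by
  induction h with
  | nil => simp
  | cons hd hA hE h ih =>
    have := reverse_dist hδ hd; rw [Finset.sum_insert hE]; linarith

/-- One end of f is reached from x along the trail up to f, the other end from u along the trail
after f; together with f itself the whole trail is used once. -/
theorem Trail.candKey_le (h : G.Trail A x u E) {δ : ℕ → ℝ}
    (hδ : ∀ d, G.IsDart d → δ (G.head d) ≤ δ (G.tail d) + G.w (d / 2)) (hu : δ u = 0) :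
    ∀ f ∈ E, G.candKey δ f ≤ ∑ i ∈ E, G.w i + δ x := by
  induction h with
  | nil => simp
  | @cons d u E hd hA hE h ih =>
    intro f hf; rw [Finset.sum_insert hE]; rcases Finset.mem_insert.1 hf with rfl | hf
    · have h1 := h.dist_le hδ
      have h2 : G.candKey δ (d / 2) = δ (G.tail d) + G.w (d / 2) + δ (G.head d) := by
        unfold candKey tail head; split_ifs <;> ring
      linarith
    · have h1 := ih hu f hf; have h2 := hδ d hd; linarith

theorem wt_mono (hG : G.Good) {x y : Vec} (h : ∀ i, x i ≠ 0 → y i ≠ 0) : G.wt x ≤ G.wt y := by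
  refine Finset.sum_le_sum fun i _ => mul_le_mul_of_nonneg_right ?_ (hG.w_nonneg i)
  have key : ∀ a b : ZMod 2, (a ≠ 0 → b ≠ 0) → a.val ≤ b.val := by decide
  exact_mod_cast key _ _ (h i)

theorem wt_indicator (hE : ∀ i ∈ E, i < G.n) : G.wt (indicator E) = ∑ i ∈ E, G.w i := by
  have hsub : E ⊆ Finset.range G.n := fun i hi => Finset.mem_range.2 (hE i hi)
  rw [wt, ← Finset.sum_subset hsub]
  · refine Finset.sum_congr rfl fun i hi => ?_; rw [indicator_apply, if_pos hi]; simp [ZMod.val_one]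
  · intro i _ hi; simp [indicator_apply, hi]

/-- Every nonzero cycle contains a nonzero cycle that is the sum of short candidates. -/
theorem exists_short_cycle (hG : G.Good) {ord par : ℕ → ℕ → ℕ} {dist : ℕ → ℕ → ℝ}
    (hT : ∀ p < G.m, G.SPTree p (ord p) (par p) (dist p)) {z : Vec} (hz : z ∈ G.cycles)
    (h0 : z ≠ 0) : ∃ c ∈ G.cycles, c ≠ 0 ∧ (∀ i, c i ≠ 0 → z i ≠ 0) ∧
      c ∈ Submodule.span (ZMod 2) {y | ∃ p < G.m, ∃ e, G.IsEdge e ∧ y = G.cand p (par p) e ∧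
        G.candKey (dist p) e ≤ G.wt z} := by
  obtain ⟨e, hze⟩ := Function.ne_iff.1 h0; have he : G.IsEdge e := by_contra fun h => hze (hz.1 e h)
  have hv0 := hG.lt e he; have hv1 := hG.lt_m e he; set A : Set ℕ := {i | z i ≠ 0 ∧ i ≠ e} with hA
  set p := G.v0 e with hp; have hpm : p < G.m := hv0.trans hv1; classical
  -- Removing e from the support of z does not separate its ends. Otherwise let F be the indicator
  -- of the vertices with a trail to p inside the support without e: F agrees at the two ends of
  -- every other edge of z, so the boundary pairing of z with F is the coefficient of e, which is
  -- not zero.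
  have htrail : ∃ E, G.Trail A (G.v1 e) p E := by
    by_contra hno
    have h1 := hz.2 fun v => if ∃ E, G.Trail A v p E then 1 else 0
    rw [bdry_apply, Finset.sum_eq_single e] at h1
    · rw [if_neg hno, if_pos ⟨∅, .nil _⟩, add_zero, one_mul] at h1; exact hze h1
    · intro i _ hie; by_cases hzi : z i = 0
      · rw [hzi, mul_zero]
      have hi : G.IsEdge i := by_contra fun h => hzi (hz.1 i h)
      have hiff : (∃ E, G.Trail A (G.v0 i) p E) ↔ ∃ E, G.Trail A (G.v1 i) p E := by
        have e0 : (2 * i) / 2 = i := by omega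
        have e1 : (2 * i + 1) / 2 = i := by omega
        have e2 : (2 * i + 1) % 2 = 1 := by omega
        have d0 : G.IsDart (2 * i) := by unfold IsDart; rwa [e0]
        have d1 : G.IsDart (2 * i + 1) := by unfold IsDart; rwa [e1]
        have t0 : G.tail (2 * i) = G.v0 i ∧ G.head (2 * i) = G.v1 i := by simp [tail, head]
        have t1 : G.tail (2 * i + 1) = G.v1 i ∧ G.head (2 * i + 1) = G.v0 i := by
          simp [tail, head, e1, e2]
        constructor
        · rintro ⟨E, hE⟩; rw [← t1.1]
          exact (t1.2.symm ▸ hE : G.Trail A (G.head (2 * i + 1)) p E).extend d1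
            (by rw [e1]; exact ⟨hzi, hie⟩)
        · rintro ⟨E, hE⟩; rw [← t0.1]
          exact (t0.2.symm ▸ hE : G.Trail A (G.head (2 * i)) p E).extend d0
            (by rw [e0]; exact ⟨hzi, hie⟩)
      simp only [hiff]; rw [CharTwo.add_self_eq_zero, zero_mul]
    · intro h; exact absurd (Finset.mem_range.2 he.1) h
  obtain ⟨E, hE⟩ := htrail; have hEsub := hE.subset
  have heE : e ∉ E := fun h => (hEsub e h).1.2 rfl
  have hcapp : ∀ i, indicator (insert e E) i ≠ 0 → i = e ∨ i ∈ E := by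
    intro i hi; rw [indicator_apply] at hi
    by_contra hc
    rw [if_neg (by simpa using hc)] at hi; exact hi rfl
  have hsub : ∀ i, indicator (insert e E) i ≠ 0 → z i ≠ 0 := by
    intro i hi; rcases hcapp i hi with rfl | hi
    · exact hze
    · exact (hEsub i hi).1.1
  have hcyc : indicator (insert e E) ∈ G.cycles := by
    refine ⟨fun i hi => by_contra fun h => ?_, fun F => ?_⟩
    · rcases hcapp i h with rfl | h
      · exact hi he
      · exact hi (hEsub i h).2
    · have := hE.bdry F; rw [indicator] at this ⊢
      rw [Finset.sum_insert heE, map_add, bdry_single _ _ he.1, this]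
      linear_combination (F p + F (G.v1 e)) * (CharTwo.two_eq_zero (R := ZMod 2))
  have hwt : G.w e + ∑ i ∈ E, G.w i ≤ G.wt z := by
    rw [← Finset.sum_insert heE, ← wt_indicator]
    · exact wt_mono hG hsub
    · intro i hi; rcases Finset.mem_insert.1 hi with rfl | hi
      · exact he.1
      · exact (hEsub i hi).2.1
  have hTp := hT p hpm; have hδ := hTp.feasible
  -- The arc of the closed trail that consists of e alone bounds the distance at the start of the
  -- complementary trail E.
  have hδe : dist p (G.v1 e) ≤ G.w e := by
    have e0 : (2 * e) / 2 = e := by omega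
    have := hδ (2 * e) (by unfold IsDart; rwa [e0])
    simpa [head, tail, ← hp, hTp.dist_root] using this
  refine ⟨_, hcyc, ?_, hsub, ?_⟩
  · intro h; have := congrFun h e; rw [indicator_apply] at this; simp at this
  -- Expand the closed trail at the root p lying on it. For the edge e the key is bounded by w(e)
  -- plus the length of E, for the other edges by `Trail.candKey_le` together with `hδe`.
  · rw [cycles_sum hcyc p (par p)]; refine Submodule.sum_mem _ fun i _ => ?_
    by_cases hi : indicator (insert e E) i = 0
    · rw [hi, zero_smul]; exact Submodule.zero_mem _
    refine Submodule.smul_mem _ _ (Submodule.subset_span ?_); rcases hcapp i hi with rfl | hi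
    · refine ⟨p, hpm, i, he, rfl, ?_⟩; have h1 := hE.dist_le hδ; unfold candKey; rw [← hp]
      have := hTp.dist_root; linarith
    · refine ⟨p, hpm, i, (hEsub i hi).2, rfl, ?_⟩; have h1 := hE.candKey_le hδ hTp.dist_root i hi
      linarith

/-- Every cycle is a sum of candidates that are not longer than the cycle. -/
theorem mem_span_short (hG : G.Good) {ord par : ℕ → ℕ → ℕ} {dist : ℕ → ℕ → ℝ}
    (hT : ∀ p < G.m, G.SPTree p (ord p) (par p) (dist p)) {z : Vec} (hz : z ∈ G.cycles) :
    z ∈ Submodule.span (ZMod 2) {y | ∃ p < G.m, ∃ e, G.IsEdge e ∧ y = G.cand p (par p) e ∧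
        G.candKey (dist p) e ≤ G.wt z} := by
  have key : ∀ k, ∀ z : Vec, z ∈ G.cycles → ((Finset.range G.n).filter fun i => z i ≠ 0).card = k →
      z ∈ Submodule.span (ZMod 2) {y | ∃ p < G.m, ∃ e, G.IsEdge e ∧ y = G.cand p (par p) e ∧
        G.candKey (dist p) e ≤ G.wt z} := by
    intro k
    induction k using Nat.strong_induction_on with
    | _ k ih =>
    intro z hz hk; by_cases h0 : z = 0
    · rw [h0]; exact Submodule.zero_mem _
    obtain ⟨c, hc, hc0, hcz, hspan⟩ := exists_short_cycle hG hT hz h0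
    -- As the support of c is contained in that of z, adding c deletes exactly the support of c, so
    -- both the support and the weight decrease.
    have hsub : ∀ i, (c + z) i ≠ 0 → z i ≠ 0 ∧ c i = 0 := by
      intro i
      have key : ∀ a b : ZMod 2, (a ≠ 0 → b ≠ 0) → a + b ≠ 0 → b ≠ 0 ∧ a = 0 := by decide
      exact key _ _ (hcz i)
    have hlt : ((Finset.range G.n).filter fun i => (c + z) i ≠ 0).card < k := by
      rw [← hk]; refine Finset.card_lt_card ((Finset.ssubset_iff_of_subset ?_).2 ?_)
      · intro i hi; rw [Finset.mem_filter] at hi ⊢; exact ⟨hi.1, (hsub i hi.2).1⟩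
      · obtain ⟨i, hi⟩ := Function.ne_iff.1 hc0
        have hi' : G.IsEdge i := by_contra fun h => hi (hc.1 i h)
        refine ⟨i, Finset.mem_filter.2 ⟨Finset.mem_range.2 hi'.1, hcz i hi⟩, fun h => ?_⟩
        exact hi (hsub i (Finset.mem_filter.1 h).2).2
    have h1 := ih _ hlt (c + z) (Submodule.add_mem _ hc hz) rfl
    have hle : G.wt (c + z) ≤ G.wt z := wt_mono hG fun i hi => (hsub i hi).1
    have h2 : z = c + (c + z) := by rw [← add_assoc, add_self, zero_add]
    refine (congrArg (· ∈ Submodule.span (ZMod 2) _) h2).mpr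
      (Submodule.add_mem _ hspan (Submodule.span_mono ?_ h1))
    rintro y ⟨p, hp, e, he, hy, hk⟩; exact ⟨p, hp, e, he, hy, hk.trans hle⟩
  exact key _ z hz rfl

end Net

/-! ## Annotations -/

namespace Net

open GaussJordan

def IsTri (G : Net) (t : ℕ) : Prop := t < G.n ∧ G.card t = 3

/-- The edge with vertices `u < v` has the number `idx u v`. -/
structure Faces (G : Net) (idx : ℕ → ℕ → ℕ) : Prop where
  face01 : ∀ t, G.IsTri t → G.IsEdge (idx (G.v0 t) (G.v1 t)) ∧
    G.v0 (idx (G.v0 t) (G.v1 t)) = G.v0 t ∧ G.v1 (idx (G.v0 t) (G.v1 t)) = G.v1 t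
  face02 : ∀ t, G.IsTri t → G.IsEdge (idx (G.v0 t) (G.v2 t)) ∧
    G.v0 (idx (G.v0 t) (G.v2 t)) = G.v0 t ∧ G.v1 (idx (G.v0 t) (G.v2 t)) = G.v2 t
  face12 : ∀ t, G.IsTri t → G.IsEdge (idx (G.v1 t) (G.v2 t)) ∧
    G.v0 (idx (G.v1 t) (G.v2 t)) = G.v1 t ∧ G.v1 (idx (G.v1 t) (G.v2 t)) = G.v2 t

/-- The boundary of a triangle. -/
noncomputable def tri (G : Net) (idx : ℕ → ℕ → ℕ) (t : ℕ) : Vec :=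
  Pi.single (idx (G.v0 t) (G.v1 t)) 1 + Pi.single (idx (G.v0 t) (G.v2 t)) 1 +
    Pi.single (idx (G.v1 t) (G.v2 t)) 1

/-- The space of boundaries. -/
noncomputable def boundaries (G : Net) (idx : ℕ → ℕ → ℕ) : Submodule (ZMod 2) Vec :=
  Submodule.span (ZMod 2) {y | ∃ t, G.IsTri t ∧ y = G.tri idx t}

variable {G : Net} {idx : ℕ → ℕ → ℕ}

theorem tri_mem (hF : G.Faces idx) {t : ℕ} (ht : G.IsTri t) : G.tri idx t ∈ G.cycles := by
  obtain ⟨a1, a2, a3⟩ := hF.face01 t ht; obtain ⟨b1, b2, b3⟩ := hF.face02 t ht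
  obtain ⟨c1, c2, c3⟩ := hF.face12 t ht; refine ⟨fun i hi => ?_, fun F => ?_⟩
  · have h1 : i ≠ idx (G.v0 t) (G.v1 t) := fun h => hi (h ▸ a1)
    have h2 : i ≠ idx (G.v0 t) (G.v2 t) := fun h => hi (h ▸ b1)
    have h3 : i ≠ idx (G.v1 t) (G.v2 t) := fun h => hi (h ▸ c1); simp [tri, h1, h2, h3]
  · rw [tri, map_add, map_add, bdry_single _ _ a1.1, bdry_single _ _ b1.1, bdry_single _ _ c1.1,
      a2, a3, b2, b3, c2, c3]
    linear_combination (F (G.v0 t) + F (G.v1 t) + F (G.v2 t)) * (CharTwo.two_eq_zero (R := ZMod 2))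

theorem boundaries_le (hF : G.Faces idx) : G.boundaries idx ≤ G.cycles := by
  refine Submodule.span_le.2 ?_; rintro y ⟨t, ht, rfl⟩; exact tri_mem hF ht

open Classical in
/-- The boundary of a triangle, restricted to the edges outside of a tree. -/
noncomputable def triOff (G : Net) (idx : ℕ → ℕ → ℕ) (T : Set ℕ) (t : ℕ) : Vec := fun i =>
  if G.IsTri t ∧ i ∉ T then G.tri idx t i else 0

/-- The edges `r a` for `a < g` are the edges outside of the tree that are not pivots. -/
structure Coords (G : Net) (T : Set ℕ) (N : ℕ) (piv : ℕ → ℕ) (g : ℕ) (r : ℕ → ℕ) : Prop where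
  edge : ∀ a < g, G.IsEdge (r a)
  notMem : ∀ a < g, r a ∉ T
  unused : ∀ a < g, ∀ t < N, piv t ≠ r a + 1
  inj : ∀ a b, a < g → b < g → r a = r b → a = b
  surj : ∀ i, G.IsEdge i → i ∉ T → (∀ t < N, piv t ≠ i + 1) → ∃ a < g, r a = i

/-- The coordinates of the homology class of a cycle. -/
noncomputable def coords (N : ℕ) (U : ℕ → Vec) (piv : ℕ → ℕ) (g : ℕ) (r : ℕ → ℕ) :
    Vec →ₗ[ZMod 2] (Fin g → ZMod 2) :=
  LinearMap.pi fun a => (LinearMap.proj (r a)).comp (blk piv U 0 N)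

variable {T : Set ℕ} {N g : ℕ} {piv r ord par : ℕ → ℕ} {U : ℕ → Vec} {dist : ℕ → ℝ} {p : ℕ}

theorem coords_apply (z : Vec) (a : Fin g) : coords N U piv g r z a = blk piv U 0 N z (r a) := rfl

section

variable (hE : Elim N (fun _ => False) 0 N (G.triOff idx T) U piv)
include hE

/-- Rows in T vanish in the matrix, hence in the stored columns by `Elim.zero`, hence in all
transforms of columns; but the transform of a pivot column is 1 in its pivot row. -/
theorem pivot_notMem {t : ℕ} (ht : t < N) (h0 : piv t ≠ 0) : piv t - 1 ∉ T := by
  intro hT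
  have h1 : ∀ t', 0 ≤ t' → t' < N → G.triOff idx T t' (piv t - 1) = 0 := by
    intro t' _ _; simp [triOff, hT]
  have h2 := hE.zero _ h1; have h3 := congrFun (hE.pivot t (Nat.zero_le _) ht h0) (piv t - 1)
  rw [blk_apply, Pi.add_apply, h1 t (Nat.zero_le _) ht, Finset.sum_apply, Finset.sum_eq_zero] at h3
  · simp at h3
  · intro t' ht'; rw [Finset.mem_Ico] at ht'; split_ifs
    · rfl
    · simp [h2 t' ht'.1 ht'.2]

/-- The transformation does not depend on the values in `T`. -/
theorem blk_restrict {v v' : Vec} (h : ∀ i, i ∉ T → v i = v' i) {i : ℕ} (hi : i ∉ T) :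
    blk piv U 0 N v i = blk piv U 0 N v' i := by
  rw [blk_apply, blk_apply, Pi.add_apply, Pi.add_apply, h i hi, Finset.sum_apply, Finset.sum_apply]
  congr 1
  refine Finset.sum_congr rfl fun t ht => ?_; rw [Finset.mem_Ico] at ht; split_ifs with h0
  · rfl
  · rw [h _ (pivot_notMem hE ht.2 h0)]

variable (hC : G.Coords T N piv g r)
include hC

/-- After elimination each column is supported on pivot rows: it is a unit vector there, or
dependent with no used rows. The rows `r a` are not pivot rows, and the part of the triangle inside
T has no influence by `blk_restrict`. -/
theorem coords_tri (hN : G.n ≤ N) {t : ℕ} (ht : G.IsTri t) :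
    coords N U piv g r (G.tri idx t) = 0 := by
  ext a
  rw [coords_apply, blk_restrict hE (v' := G.triOff idx T t) (fun i hi => by simp [triOff, ht, hi])
    (hC.notMem a a.2)]
  have htN : t < N := ht.1.trans_le hN; have hu := hC.unused a a.2; by_cases h0 : piv t = 0
  · by_contra h
    rcases hE.dep t (Nat.zero_le _) htN h0 _ h with h | ⟨t', -, h1, h2⟩
    · exact h
    · exact hu t' (by omega) h2
  · rw [hE.pivot t (Nat.zero_le _) htN h0, Pi.single_eq_of_ne, Pi.zero_apply]; have := hu t htN
    omega

theorem coords_boundaries (hN : G.n ≤ N) {z : Vec} (hz : z ∈ G.boundaries idx) :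
    coords N U piv g r z = 0 := by
  have : G.boundaries idx ≤ LinearMap.ker (coords N U piv g r) := by
    refine Submodule.span_le.2 ?_; rintro y ⟨t, ht, rfl⟩; exact coords_tri hE hC hN ht
  exact this hz

/-- Vanishing coordinates mean that the transform of z, restricted off T, lives on pivot rows, so
this restriction is a combination of the columns. The same combination of full triangles is a
boundary b that agrees with z off T. Then z + b is a cycle inside the tree and vanishes. -/
theorem mem_boundaries (hF : G.Faces idx) (hT : T = G.treeEdges ord par)
    (hS : G.SPTree p ord par dist) {z : Vec} (hz : z ∈ G.cycles)
    (h0 : coords N U piv g r z = 0) : z ∈ G.boundaries idx := by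
  classical
  set z' : Vec := fun i => if i ∈ T then 0 else z i with hz'
  have hrow : ∀ i, (i ∈ T ∨ ¬ G.IsEdge i) → z' i = 0 ∧ ∀ t, G.triOff idx T t i = 0 := by
    rintro i hi; by_cases hiT : i ∈ T
    · simp [hz', triOff, hiT]
    · have hi : ¬ G.IsEdge i := by tauto
      refine ⟨by simp [hz', hz.1 i hi], fun t => ?_⟩; unfold triOff; split_ifs with h
      · exact (tri_mem hF h.1).1 i hi
      · rfl
  have hsupp : ∀ i, blk piv U 0 N z' i ≠ 0 → ∃ t < N, piv t = i + 1 := by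
    intro i hi
    by_contra hno
    have hno' : ∀ t < N, piv t ≠ i + 1 := fun t ht he => hno ⟨t, ht, he⟩
    by_cases hie : i ∈ T ∨ ¬ G.IsEdge i
    · obtain ⟨h1, h2⟩ := hrow i hie; have h3 := hE.zero i fun t _ _ => h2 t; apply hi
      rw [blk_apply, Pi.add_apply, h1, Finset.sum_apply, Finset.sum_eq_zero, add_zero]; intro t ht
      rw [Finset.mem_Ico] at ht; split_ifs
      · rfl
      · simp [h3 t ht.1 ht.2]
    · rw [not_or, not_not] at hie; obtain ⟨a, ha, rfl⟩ := hC.surj i hie.2 hie.1 hno'; apply hi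
      rw [← blk_restrict hE (v := z) (fun j hj => by simp [hz', hj]) hie.1]
      exact congrFun h0 ⟨a, ha⟩
  have hspan := hE.mem_span_of_support hsupp
  have hlift : ∀ y ∈ Submodule.span (ZMod 2) (G.triOff idx T '' {t | t < N}),
      ∃ b ∈ G.boundaries idx, ∀ i, i ∉ T → b i = y i := by
    intro y hy
    induction hy using Submodule.span_induction with
    | mem y hy =>
      obtain ⟨t, -, rfl⟩ := hy; by_cases ht : G.IsTri t
      · exact ⟨_, Submodule.subset_span ⟨t, ht, rfl⟩, fun i hi => by simp [triOff, ht, hi]⟩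
      · exact ⟨0, Submodule.zero_mem _, fun i hi => by simp [triOff, ht]⟩
    | zero => exact ⟨0, Submodule.zero_mem _, fun _ _ => rfl⟩
    | add x y _ _ hx hy =>
      obtain ⟨b, hb, hb'⟩ := hx; obtain ⟨c, hc, hc'⟩ := hy
      exact ⟨b + c, Submodule.add_mem _ hb hc, fun i hi => by simp [hb' i hi, hc' i hi]⟩
    | smul k x _ hx =>
      obtain ⟨b, hb, hb'⟩ := hx
      exact ⟨k • b, Submodule.smul_mem _ _ hb, fun i hi => by simp [hb' i hi]⟩
  obtain ⟨b, hb, hb'⟩ := hlift _ hspan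
  have hzb : z + b = 0 := by
    refine hS.eq_zero (Submodule.add_mem _ hz (boundaries_le hF hb)) fun i hi => ?_; rw [← hT] at hi
    rw [Pi.add_apply, hb' i hi]; simp only [hz', if_neg hi]; exact CharTwo.add_self_eq_zero _
  have : z = b := by have := congrArg (· + b) hzb; simpa [add_assoc, add_self] using this
  exact this ▸ hb

/-- The fundamental cycle of the edge `r a` is a unit vector off the tree, and the transformation
fixes it because `r a` is not a pivot row. -/
theorem exists_coords_eq (hT : T = G.treeEdges ord par) (hG : G.Good)
    (hS : G.SPTree p ord par dist) (a : Fin g) :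
    ∃ z ∈ G.cycles, coords N U piv g r z = Pi.single a 1 := by
  have hea := hC.edge a a.2; refine ⟨_, hS.cand_mem hG hea, ?_⟩; ext b; have hrb := hC.notMem b b.2
  rw [coords_apply, blk_restrict hE (v' := Pi.single (r a) 1) ?_ hrb, blk_eq_self]
  · by_cases hab : b = a
    · subst hab; simp
    · rw [Pi.single_eq_of_ne hab, Pi.single_eq_of_ne]; intro h
      exact hab (Fin.ext (hC.inj _ _ b.2 a.2 h))
  · intro t _ ht h0; have := hC.unused a a.2 t ht; rw [Pi.single_eq_of_ne]; omega
  · intro i hi; rw [hT] at hi; exact hS.cand_apply hG hea hi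

/-- Every vector is the vector of coordinates of a cycle. -/
theorem coords_surjective (hT : T = G.treeEdges ord par) (hG : G.Good)
    (hS : G.SPTree p ord par dist) (x : Fin g → ZMod 2) :
    ∃ z ∈ G.cycles, coords N U piv g r z = x := by
  choose y hy hy' using exists_coords_eq hE hC hT hG hS
  refine ⟨∑ a, x a • y a, Submodule.sum_mem _ fun a _ => Submodule.smul_mem _ _ (hy a), ?_⟩
  rw [map_sum]; ext b; rw [Finset.sum_apply, Finset.sum_eq_single b]
  · rw [map_smul, hy']; simp
  · intro a _ hab; rw [map_smul, hy']; simp [hab.symm]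
  · simp

end

end Net

/-! ## The greedy algorithm -/

section Greedy

variable {V : Type*} [AddCommGroup V] [Module (ZMod 2) V]

/-- A family of vectors chosen by the greedy algorithm is lighter than every independent family. -/
theorem sum_le_sum_of_mem_span {k : ℕ} {lab x : Fin k → V} {κ wt : Fin k → ℝ} (hκ : Monotone κ)
    (hx : LinearIndependent (ZMod 2) x)
    (hspan : ∀ j, x j ∈ Submodule.span (ZMod 2) (lab '' {i | κ i ≤ wt j})) :
    ∑ i, κ i ≤ ∑ i, wt i := by
  classical
  -- Compare termwise after sorting `wt`. If the i-th smallest weight were below `κ i`, the first i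
  -- + 1 vectors in the sorted order would be independent and yet lie in the span of the i vectors
  -- `lab i'` with i' < i.
  rw [← Equiv.sum_comp (Tuple.sort wt) wt]; refine Finset.sum_le_sum fun i _ => ?_
  by_contra! hlt
  have hmono : Monotone (wt ∘ Tuple.sort wt) := Tuple.monotone_sort wt
  have hi : LinearIndependent (ZMod 2) fun j : Finset.Iic i => x (Tuple.sort wt j) :=
    hx.comp (fun j : Finset.Iic i => Tuple.sort wt j)
      ((Tuple.sort wt).injective.comp Subtype.val_injective)
  have := linearIndependent_le_span_aux' _ hi ((Finset.Iio i).image lab : Finset V) ?_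
  · have h1 : ((Finset.Iio i).image lab).card ≤ (Finset.Iio i).card := Finset.card_image_le
    simp only [Fintype.card_coe, Finset.coe_sort_coe, Fin.card_Iic, Fin.card_Iio] at this h1; omega
  · rintro y ⟨j, rfl⟩; have hj : j.1 ≤ i := Finset.mem_Iic.1 j.2
    refine Submodule.span_mono ?_ (hspan (Tuple.sort wt j)); rintro y ⟨i', hi', rfl⟩
    have h1 : wt (Tuple.sort wt j) ≤ wt (Tuple.sort wt i) := hmono hj
    have h2 : i' < i := by
      by_contra! h
      have := hκ h; have h3 : κ i' ≤ wt (Tuple.sort wt j) := hi'; linarith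
    simp only [Finset.coe_image, Set.mem_image, Finset.mem_coe, Finset.mem_Iio]; exact ⟨i', h2, rfl⟩

/-- The greedy algorithm has processed the vectors `lab q` for `q < P` and chosen `lab (ch j)` for
`j < k`. -/
structure IsGreedy (lab : ℕ → V) (P k : ℕ) (ch : ℕ → ℕ) : Prop where
  lt : ∀ j < k, ch j < P
  mono : ∀ i j, i < j → j < k → ch i < ch j
  indep : LinearIndependent (ZMod 2) fun j : Fin k => lab (ch j)
  span : ∀ q < P, lab q ∈ Submodule.span (ZMod 2) (lab '' {x | ∃ j < k, ch j = x ∧ x ≤ q})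

theorem IsGreedy.zero (lab : ℕ → V) (ch : ℕ → ℕ) : IsGreedy lab 0 0 ch :=
  ⟨by omega, by omega, linearIndependent_empty_type, by omega⟩

open GaussJordan in
/-- One round of the greedy algorithm: eliminate a matrix whose columns are the chosen vectors and the
next vectors, and choose the columns with a pivot. -/
theorem IsGreedy.step {lab : ℕ → V} {P k N k' : ℕ} {ch ch' f piv : ℕ → ℕ} {M0 U : ℕ → Vec}
    (h : IsGreedy lab P k ch) (hkN : k ≤ N) (hE : Elim N (fun _ => False) 0 N M0 U piv)
    (ι : V →ₗ[ZMod 2] Vec) (hι : Function.Injective ι)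
    (hM : ∀ t < N, M0 t = ι (lab (if t < k then ch t else P + (t - k))))
    (hf : ∀ j < k', f j < N ∧ piv (f j) ≠ 0) (hmono : ∀ i j, i < j → j < k' → f i < f j)
    (hsurj : ∀ t < N, piv t ≠ 0 → ∃ j < k', f j = t)
    (hch : ∀ j < k', ch' j = if f j < k then ch (f j) else P + (f j - k)) :
    IsGreedy lab (P + (N - k)) k' ch' := by
  set c : ℕ → ℕ := fun t => if t < k then ch t else P + (t - k) with hc
  -- The columns stand in the order of their indices in the list: chosen indices below P, then P, P
  -- + 1 and so on. So a pivot column further left is an earlier vector, and `Elim.mem_span` becomes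
  -- the greedy condition.
  have hcmono : ∀ t t', t < t' → t' < N → c t < c t' := by
    intro t t' h1 h2; simp only [hc]; split_ifs with h3 h4 h4
    · exact h.mono t t' h1 h4
    · have := h.lt t h3; omega
    · omega
    · omega
  have hcle : ∀ t t', t ≤ t' → t' < N → c t ≤ c t' := by
    intro t t' h1 h2; rcases Nat.eq_or_lt_of_le h1 with rfl | h1
    · exact le_rfl
    · exact (hcmono t t' h1 h2).le
  have hcol : ∀ t < N, ∀ q, c t ≤ q →
      lab (c t) ∈ Submodule.span (ZMod 2) (lab '' {x | ∃ j < k', ch' j = x ∧ x ≤ q}) := by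
    intro t ht q hq; have h1 := hE.mem_span ht
    have h2 : M0 '' {t' | t' < N ∧ piv t' ≠ 0 ∧ t' ≤ t} ⊆
        ι '' (lab '' {x | ∃ j < k', ch' j = x ∧ x ≤ q}) := by
      rintro y ⟨t', ⟨h3, h4, h5⟩, rfl⟩; obtain ⟨j, hj, rfl⟩ := hsurj t' h3 h4
      refine ⟨_, ⟨c (f j), ⟨j, hj, hch j hj, (hcle _ _ h5 ht).trans hq⟩, rfl⟩, (hM _ h3).symm⟩
    have h3 := Submodule.span_mono h2 h1; rw [hM t ht, Submodule.span_image] at h3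
    obtain ⟨y, hy, he⟩ := h3; exact hι he ▸ hy
  refine ⟨?_, ?_, ?_, ?_⟩
  · intro j hj; obtain ⟨h1, -⟩ := hf j hj; rw [hch j hj]; split_ifs with h2
    · have := h.lt _ h2; omega
    · omega
  · intro i j hij hj; rw [hch i (hij.trans hj), hch j hj]
    exact hcmono _ _ (hmono i j hij hj) (hf j hj).1
  · have h1 := hE.linearIndependent.comp
      (fun j : Fin k' => (⟨f j, hf j j.2⟩ : {t : ℕ // t < N ∧ piv t ≠ 0})) ?_
    · refine LinearIndependent.of_comp ι ?_
      convert h1 using 1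
      ext1 j; simp only [Function.comp]; rw [hM _ (hf j j.2).1, hch j j.2]
    · intro i j he; have he : f i = f j := congrArg Subtype.val he
      rcases lt_trichotomy i j with h2 | h2 | h2
      · have := hmono i j h2 j.2; omega
      · exact h2
      · have := hmono j i h2 i.2; omega
  -- An old vector lies in the span of old choices not after it, and each of these is a column of
  -- the matrix, hence in the span of new choices not after it. A vector of this batch is itself a
  -- column.
  · intro q hq; rcases lt_or_ge q P with hqP | hqP
    · refine (Submodule.span_le.2 ?_) (h.span q hqP); rintro y ⟨x, ⟨j, hj, rfl, hx⟩, rfl⟩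
      have := hcol j (hj.trans_le hkN) q (by simpa [hc, hj] using hx); simpa [hc, hj] using this
    · have hcq : c (k + (q - P)) = q := by simp only [hc]; rw [if_neg (by omega)]; omega
      have := hcol (k + (q - P)) (by omega) q hcq.le
      rwa [hcq] at this

end Greedy

/-! ## The net of a simplicial complex -/

namespace AbstractSimplicialComplex

open GaussJordan (Vec)

variable {m n : ℕ} {K : AbstractSimplicialComplex (Fin m)}
  {S : Fin n ≃ {s : Finset (Fin m) // s ∈ K}} {w : K.Simplex 1 → ℝ} {G : Net}

/-- The net `G` lists the simplices of `K`. -/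
structure Represents (K : AbstractSimplicialComplex (Fin m))
    (S : Fin n ≃ {s : Finset (Fin m) // s ∈ K}) (w : K.Simplex 1 → ℝ) (G : Net) : Prop where
  m_eq : G.m = m
  n_eq : G.n = n
  card : ∀ i : Fin n, G.card i = (S i).1.card
  v0 : ∀ i : Fin n, G.v0 i = ((S i).1.sort.map fun v => (v : ℕ)).getD 0 0
  v1 : ∀ i : Fin n, 2 ≤ (S i).1.card → G.v1 i = ((S i).1.sort.map fun v => (v : ℕ)).getD 1 0
  v2 : ∀ i : Fin n, 3 ≤ (S i).1.card → G.v2 i = ((S i).1.sort.map fun v => (v : ℕ)).getD 2 0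
  w : ∀ i : Fin n, G.w i = K.atEdge S w i
  w_out : ∀ i, n ≤ i → G.w i = 0

theorem exists_of_card_two {s : Finset (Fin m)} (h : s.card = 2) :
    ∃ a b : Fin m, a < b ∧ s = {a, b} ∧ s.sort = [a, b] := by
  have hl : s.sort.length = 2 := by rw [Finset.length_sort, h]
  obtain ⟨a, b, hab⟩ := List.length_eq_two.1 hl; have h1 := s.sort_toFinset (r := (· ≤ ·))
  have h2 := s.pairwise_sort (r := (· ≤ ·)); have h3 := s.sort_nodup (r := (· ≤ ·))
  rw [hab] at h1 h2 h3
  refine ⟨a, b, lt_of_le_of_ne (by simpa using h2) (by simpa using h3), ?_, hab⟩; rw [← h1]; simp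

theorem exists_of_card_three {s : Finset (Fin m)} (h : s.card = 3) :
    ∃ a b c : Fin m, a < b ∧ b < c ∧ s = {a, b, c} ∧ s.sort = [a, b, c] := by
  have hl : s.sort.length = 3 := by rw [Finset.length_sort, h]
  obtain ⟨a, b, c, habc⟩ := List.length_eq_three.1 hl; have h1 := s.sort_toFinset (r := (· ≤ ·))
  have h2 := s.pairwise_sort (r := (· ≤ ·)); have h3 := s.sort_nodup (r := (· ≤ ·))
  rw [habc] at h1 h2 h3
  simp only [List.pairwise_cons, List.mem_cons, List.not_mem_nil, or_false, forall_eq_or_imp,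
    forall_eq, List.nodup_cons, not_or] at h2 h3
  refine ⟨a, b, c, lt_of_le_of_ne h2.1.1 h3.1.1, lt_of_le_of_ne h2.2.1 h3.2.1, ?_, habc⟩
  rw [← h1]; simp

variable (hR : K.Represents S w G)
include hR

theorem Represents.isEdge (i : Fin n) : G.IsEdge i ↔ (S i).1.card = 2 := by
  unfold Net.IsEdge; rw [hR.card, hR.n_eq]; simp

theorem Represents.isTri (i : Fin n) : G.IsTri i ↔ (S i).1.card = 3 := by
  unfold Net.IsTri; rw [hR.card, hR.n_eq]; simp

theorem Represents.edge {i : Fin n} (h : (S i).1.card = 2) :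
    ∃ a b : Fin m, a < b ∧ (S i).1 = {a, b} ∧ G.v0 i = a ∧ G.v1 i = b := by
  obtain ⟨a, b, hab, hs, hl⟩ := exists_of_card_two h; refine ⟨a, b, hab, hs, ?_, ?_⟩
  · rw [hR.v0, hl]; rfl
  · rw [hR.v1 i h.ge, hl]; rfl

theorem Represents.tri {i : Fin n} (h : (S i).1.card = 3) :
    ∃ a b c : Fin m, a < b ∧ b < c ∧ (S i).1 = {a, b, c} ∧ G.v0 i = a ∧ G.v1 i = b ∧ G.v2 i = c := by
  obtain ⟨a, b, c, hab, hbc, hs, hl⟩ := exists_of_card_three h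
  refine ⟨a, b, c, hab, hbc, hs, ?_, ?_, ?_⟩
  · rw [hR.v0, hl]; rfl
  · rw [hR.v1 i (by omega), hl]; rfl
  · rw [hR.v2 i h.ge, hl]; rfl

theorem Represents.exists_edge {a b : Fin m} (hab : a < b) (h : ({a, b} : Finset (Fin m)) ∈ K) :
    ∃ i : Fin n, (S i).1 = {a, b} ∧ G.IsEdge i ∧ G.v0 i = a ∧ G.v1 i = b := by
  have hc : (S (S.symm ⟨_, h⟩)).1.card = 2 := by simp [Finset.card_pair hab.ne]
  obtain ⟨a', b', hab', hs, h0, h1⟩ := hR.edge hc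
  have hs' : ({a, b} : Finset (Fin m)) = {a', b'} := by simpa using hs
  have e1 : a ∈ ({a', b'} : Finset (Fin m)) := hs' ▸ by simp
  have e2 : b ∈ ({a', b'} : Finset (Fin m)) := hs' ▸ by simp
  have e3 : a' ∈ ({a, b} : Finset (Fin m)) := hs' ▸ by simp
  simp only [Finset.mem_insert, Finset.mem_singleton] at e1 e2 e3
  have ha : a' = a := by
    rcases e3 with e3 | e3
    · exact e3
    · rcases e1 with e1 | e1
      · exact e1.symm
      · exact absurd (e3 ▸ e1 ▸ hab') (lt_asymm hab)
  subst ha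
  have hb : b' = b := by
    rcases e2 with e2 | e2
    · exact absurd e2.symm hab.ne
    · exact e2.symm
  subst hb; exact ⟨_, by simp, (hR.isEdge _).2 hc, h0, h1⟩

theorem Represents.good (hK : K.IsConnected) (hw : ∀ e, 0 ≤ w e) : G.Good := by
  have hidx : ∀ i, G.IsEdge i → ∃ j : Fin n, (j : ℕ) = i ∧ (S j).1.card = 2 := by
    intro i hi; have hin : i < n := hR.n_eq ▸ hi.1; exact ⟨⟨i, hin⟩, rfl, (hR.isEdge ⟨i, hin⟩).1 hi⟩
  refine ⟨?_, ?_, ?_, ?_, ?_⟩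
  · intro i hi; obtain ⟨j, rfl, hj⟩ := hidx i hi; obtain ⟨a, b, hab, -, h0, h1⟩ := hR.edge hj
    rw [h0, h1]; exact hab
  · intro i hi; obtain ⟨j, rfl, hj⟩ := hidx i hi; obtain ⟨a, b, hab, -, h0, h1⟩ := hR.edge hj
    rw [h1, hR.m_eq]; exact b.2
  · intro i; rcases lt_or_ge i n with hi | hi
    · have := hR.w ⟨i, hi⟩; simp only at this; rw [this]; unfold atEdge; split_ifs
      · exact hw _
      · exact le_rfl
    · rw [hR.w_out i hi]
  · intro F p hp hFp hF v hv; rw [hR.m_eq] at hp hv; obtain ⟨W⟩ := hK.preconnected ⟨p, hp⟩ ⟨v, hv⟩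
    have key : ∀ (x y : Fin m), K.edgeGraph.Walk x y → F x → F y := by
      intro x y W
      induction W with
      | nil => exact id
      | @cons x y z hadj _ ih =>
        intro hx; refine ih ?_; obtain ⟨hne, hmem⟩ := hadj; rcases lt_or_gt_of_ne hne with hlt | hlt
        · obtain ⟨i, -, h1, h2, h3⟩ := hR.exists_edge hlt hmem
          have e : 2 * (i : ℕ) / 2 = i := by omega
          have := hF (2 * i) (by unfold Net.IsDart; rwa [e])
          simpa [Net.tail, Net.head, h2, h3, hx] using this
        · rw [Finset.pair_comm] at hmem; obtain ⟨i, -, h1, h2, h3⟩ := hR.exists_edge hlt hmem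
          have e : (2 * (i : ℕ) + 1) / 2 = i := by omega
          have e' : (2 * (i : ℕ) + 1) % 2 = 1 := by omega
          have := hF (2 * i + 1) (by unfold Net.IsDart; rwa [e])
          simpa [Net.tail, Net.head, h2, h3, hx, e, e'] using this
    exact key _ _ W hFp
  · rw [hR.m_eq, hR.n_eq]
    have := Fintype.card_le_of_injective
      (fun v : Fin m => S.symm ⟨{v}, K.singleton_mem v⟩) (fun v v' h => by simpa using h)
    simpa using this

/-- The complex is closed under passing to faces, so the three pairs of vertices of a triangle occur
in the list as edges, and `idx` inverts the listing on edges. -/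
theorem Represents.faces {idx : ℕ → ℕ → ℕ} (hidx : ∀ i, G.IsEdge i → idx (G.v0 i) (G.v1 i) = i) :
    G.Faces idx := by
  have key : ∀ t, G.IsTri t → ∃ a b c : Fin m, G.v0 t = a ∧ G.v1 t = b ∧ G.v2 t = c ∧
      (∃ i : Fin n, G.IsEdge i ∧ G.v0 i = a ∧ G.v1 i = b) ∧
      (∃ i : Fin n, G.IsEdge i ∧ G.v0 i = a ∧ G.v1 i = c) ∧
      ∃ i : Fin n, G.IsEdge i ∧ G.v0 i = b ∧ G.v1 i = c := by
    intro t ht; have htn : t < n := hR.n_eq ▸ ht.1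
    obtain ⟨a, b, c, hab, hbc, hs, h0, h1, h2⟩ := hR.tri ((hR.isTri ⟨t, htn⟩).1 ht)
    have hmem := (S ⟨t, htn⟩).2; rw [hs] at hmem
    have hsub : ∀ x y : Fin m, ({x, y} : Finset (Fin m)) ⊆ {a, b, c} →
        ({x, y} : Finset (Fin m)) ∈ K := fun x y h =>
      (K.isRelLowerSet_faces hmem).2 h ⟨x, by simp⟩
    refine ⟨a, b, c, h0, h1, h2, ?_, ?_, ?_⟩
    · obtain ⟨i, -, hi⟩ := hR.exists_edge hab (hsub a b (by intro x; simp; tauto)); exact ⟨i, hi⟩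
    · obtain ⟨i, -, hi⟩ := hR.exists_edge (hab.trans hbc) (hsub a c (by intro x; simp; tauto))
      exact ⟨i, hi⟩
    · obtain ⟨i, -, hi⟩ := hR.exists_edge hbc (hsub b c (by intro x; simp; tauto)); exact ⟨i, hi⟩
  refine ⟨?_, ?_, ?_⟩ <;> intro t ht <;> obtain ⟨a, b, c, h0, h1, h2, g1, g2, g3⟩ := key t ht
  · obtain ⟨i, hi, e0, e1⟩ := g1; have := hidx i hi; rw [h0, h1, ← e0, ← e1, this]
    exact ⟨hi, rfl, rfl⟩
  · obtain ⟨i, hi, e0, e1⟩ := g2; have := hidx i hi; rw [h0, h2, ← e0, ← e1, this]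
    exact ⟨hi, rfl, rfl⟩
  · obtain ⟨i, hi, e0, e1⟩ := g3; have := hidx i hi; rw [h1, h2, ← e0, ← e1, this]
    exact ⟨hi, rfl, rfl⟩

end AbstractSimplicialComplex

/-! ## Chains as vectors -/

namespace AbstractSimplicialComplex

open GaussJordan (Vec)

variable {m n : ℕ} {K : AbstractSimplicialComplex (Fin m)}
  {S : Fin n ≃ {s : Finset (Fin m) // s ∈ K}} {w : K.Simplex 1 → ℝ} {G : Net}

/-- The number of a simplex in the list. -/
def num (S : Fin n ≃ {s : Finset (Fin m) // s ∈ K}) {p : ℕ} (e : K.Simplex p) : Fin n :=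
  S.symm ⟨e.face, e.mem⟩

theorem num_injective {p : ℕ} : Function.Injective (num S (p := p)) := by
  intro e e' h; have := S.symm.injective h; exact Simplex.ext (congrArg Subtype.val this)

theorem apply_num {p : ℕ} (e : K.Simplex p) : (S (num S e)).1 = e.face := by simp [num]

theorem atEdge_num {R : Type*} [Zero R] (f : K.Simplex 1 → R) (e : K.Simplex 1) :
    K.atEdge S f (num S e) = f e := by
  have h : (S (num S e)).1.card = 2 := by rw [apply_num, e.card_eq]
  rw [atEdge, dif_pos h]
  congr 1
  exact Simplex.ext (apply_num e)

/-- A chain as a vector. -/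
noncomputable def toVec (S : Fin n ≃ {s : Finset (Fin m) // s ∈ K}) : K.Chain 1 →ₗ[ZMod 2] Vec where
  toFun z i := if h : i < n then K.atEdge S z ⟨i, h⟩ else 0
  map_add' x y := by ext i; simp only [Pi.add_apply, atEdge]; split_ifs <;> simp
  map_smul' c x := by ext i; simp only [Pi.smul_apply, atEdge, RingHom.id_apply]; split_ifs <;> simp

theorem toVec_fin (z : K.Chain 1) (i : Fin n) : toVec S z i = K.atEdge S z i := by simp [toVec]

theorem toVec_num (z : K.Chain 1) (e : K.Simplex 1) : toVec S z (num S e) = z e := by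
  rw [toVec_fin, atEdge_num]

theorem toVec_injective : Function.Injective (toVec S) := by
  intro x y h; ext e; rw [← toVec_num (S := S) x, h, toVec_num]

variable (hR : K.Represents S w G)
include hR

theorem Represents.exists_num {i : ℕ} (hi : G.IsEdge i) : ∃ e : K.Simplex 1, (num S e : ℕ) = i := by
  have hin : i < n := hR.n_eq ▸ hi.1
  exact ⟨⟨(S ⟨i, hin⟩).1, (S ⟨i, hin⟩).2, (hR.isEdge ⟨i, hin⟩).1 hi⟩, by simp [num]⟩

theorem Represents.toVec_eq_zero (z : K.Chain 1) {i : ℕ} (hi : ¬ G.IsEdge i) : toVec S z i = 0 := by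
  by_cases h : i < n
  · have := toVec_fin (S := S) z ⟨i, h⟩; simp only at this; rw [this, atEdge, dif_neg]
    exact fun hc => hi ((hR.isEdge ⟨i, h⟩).2 hc)
  · simp [toVec, h]

theorem Represents.exists_toVec_eq {y : Vec} (hy : ∀ i, ¬ G.IsEdge i → y i = 0) :
    ∃ z : K.Chain 1, toVec S z = y := by
  refine ⟨fun e => y (num S e), ?_⟩; ext i; by_cases hi : G.IsEdge i
  · obtain ⟨e, rfl⟩ := hR.exists_num hi; rw [toVec_num]
  · rw [hy i hi, hR.toVec_eq_zero _ hi]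

theorem Represents.sum_eq {M : Type*} [AddCommMonoid M] {h : ℕ → M}
    (h0 : ∀ i, ¬ G.IsEdge i → h i = 0) : ∑ i ∈ Finset.range G.n, h i = ∑ e : K.Simplex 1, h (num S e) := by
  rw [hR.n_eq, ← Fin.sum_univ_eq_sum_range]
  symm
  refine Finset.sum_of_injOn (num S) num_injective.injOn (by simp) ?_ (fun _ _ => rfl); intro i _ hi
  refine h0 _ fun hie => hi ?_; obtain ⟨e, he⟩ := hR.exists_num hie; exact ⟨e, by simp, Fin.ext he⟩

/-- Interchange the sums over edges and vertices: the vertices contained in an edge {a, b} are a and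
b. -/
theorem Represents.bdry_toVec (F : ℕ → ZMod 2) (z : K.Chain 1) :
    G.bdry F (toVec S z) = ∑ v : Fin m, F v * K.boundary 0 z ⟨{v}, K.singleton_mem v, rfl⟩ := by
  rw [Net.bdry_apply, hR.sum_eq]
  · simp only [boundary, Matrix.mulVecLin_apply, Matrix.mulVec, dotProduct, Matrix.of_apply,
      Finset.mul_sum]
    rw [Finset.sum_comm]; refine Finset.sum_congr rfl fun e _ => ?_; rw [toVec_num]
    have hc : (S (num S e)).1.card = 2 := by rw [apply_num, e.card_eq]
    obtain ⟨a, b, hab, hs, h0, h1⟩ := hR.edge hc; rw [apply_num] at hs; rw [h0, h1, hs]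
    simp only [ite_mul, one_mul, zero_mul, mul_ite, mul_zero]; rw [← Finset.sum_filter]
    have : Finset.univ.filter (fun v : Fin m => ({v} : Finset (Fin m)) ⊆ {a, b}) = {a, b} := by
      ext v; simp
    rw [this, Finset.sum_pair hab.ne, add_mul]
  · intro i hi; rw [hR.toVec_eq_zero _ hi, mul_zero]

/-- Indicator functions of single vertices, taken for F, recover the coefficients of the boundary.
-/
theorem Represents.mem_cycles (z : K.Chain 1) : toVec S z ∈ G.cycles ↔ z ∈ K.oneCycles := by
  constructor
  · rintro ⟨-, h⟩; refine LinearMap.mem_ker.2 ?_; ext e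
    obtain ⟨v, hv⟩ := Finset.card_eq_one.1 e.card_eq
    have := h fun x => if x = v then 1 else 0
    rw [hR.bdry_toVec, Finset.sum_eq_single v] at this
    · rw [if_pos rfl, one_mul] at this
      have he : e = ⟨{v}, K.singleton_mem v, rfl⟩ := Simplex.ext hv; rw [he, this]; rfl
    · intro v' _ hv'; rw [if_neg fun h => hv' (Fin.ext h), zero_mul]
    · simp
  · intro h; refine ⟨fun i hi => hR.toVec_eq_zero z hi, fun F => ?_⟩
    rw [hR.bdry_toVec, LinearMap.mem_ker.1 h]; simp

-- An edge is contained in {a, b, c} only if it is one of the three pairs. These pairs are distinct,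
-- so the sum of three unit vectors has no cancellation and equals the column of the containment
-- matrix.
open Classical in
theorem Represents.toVec_boundary_single {idx : ℕ → ℕ → ℕ} (hF : G.Faces idx) (t : K.Simplex 2) :
    toVec S (K.boundary 1 (Pi.single t 1)) = G.tri idx (num S t) := by
  have hc : (S (num S t)).1.card = 3 := by rw [apply_num, t.card_eq]
  have ht := (hR.isTri _).2 hc; obtain ⟨a, b, c, hab, hbc, hs, h0, h1, h2⟩ := hR.tri hc
  rw [apply_num] at hs; obtain ⟨p1, p2, p3⟩ := hF.face01 _ ht; obtain ⟨q1, q2, q3⟩ := hF.face02 _ ht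
  obtain ⟨r1, r2, r3⟩ := hF.face12 _ ht
  have huniq : ∀ e : K.Simplex 1, ∀ i (x y : Fin m), G.IsEdge i → G.v0 i = x → G.v1 i = y →
      ((num S e : ℕ) = i ↔ e.face = {x, y}) := by
    intro e i x y hi hx hy; obtain ⟨e', rfl⟩ := hR.exists_num hi
    have hc' : (S (num S e')).1.card = 2 := by rw [apply_num, e'.card_eq]
    obtain ⟨a', b', -, hs', h0', h1'⟩ := hR.edge hc'; rw [apply_num] at hs'
    obtain rfl : a' = x := Fin.ext (by rw [← h0', hx])
    obtain rfl : b' = y := Fin.ext (by rw [← h1', hy]); rw [← hs']; constructor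
    · intro h; rw [num_injective (Fin.ext h)]
    · intro h; rw [Simplex.ext h]
  ext i; by_cases hi : G.IsEdge i
  · obtain ⟨e, rfl⟩ := hR.exists_num hi; have k1 := huniq e _ a b p1 (p2.trans h0) (p3.trans h1)
    have k2 := huniq e _ a c q1 (q2.trans h0) (q3.trans h2)
    have k3 := huniq e _ b c r1 (r2.trans h1) (r3.trans h2)
    rw [toVec_num, boundary, Matrix.mulVecLin_apply, Matrix.mulVec_single_one]
    simp only [Matrix.col_apply, Matrix.of_apply, Net.tri, Pi.add_apply, Pi.single_apply, k1, k2, k3]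
    rw [hs]; obtain ⟨x, y, hxy, he⟩ := Finset.card_eq_two.1 e.card_eq; rw [he]
    have n1 : ({a, b} : Finset (Fin m)) ≠ {a, c} := fun h => by
      have : b ∈ ({a, c} : Finset (Fin m)) := h ▸ by simp
      simp only [Finset.mem_insert, Finset.mem_singleton] at this; rcases this with h | h
      · exact hab.ne' h
      · exact hbc.ne h
    have n2 : ({a, b} : Finset (Fin m)) ≠ {b, c} := fun h => by
      have : a ∈ ({b, c} : Finset (Fin m)) := h ▸ by simp
      simp only [Finset.mem_insert, Finset.mem_singleton] at this; rcases this with h | h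
      · exact hab.ne h
      · exact (hab.trans hbc).ne h
    have n3 : ({a, c} : Finset (Fin m)) ≠ {b, c} := fun h => by
      have : a ∈ ({b, c} : Finset (Fin m)) := h ▸ by simp
      simp only [Finset.mem_insert, Finset.mem_singleton] at this; rcases this with h | h
      · exact hab.ne h
      · exact (hab.trans hbc).ne h
    by_cases c1 : ({x, y} : Finset (Fin m)) = {a, b}
    · rw [c1, if_pos (by intro v; simp; tauto), if_pos rfl, if_neg n1, if_neg n2]; rfl
    by_cases c2 : ({x, y} : Finset (Fin m)) = {a, c}
    · rw [c2, if_pos (by intro v; simp; tauto), if_neg n1.symm, if_pos rfl, if_neg n3]; rfl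
    by_cases c3 : ({x, y} : Finset (Fin m)) = {b, c}
    · rw [c3, if_pos (by intro v; simp; tauto), if_neg n2.symm, if_neg n3.symm, if_pos rfl]; rfl
    rw [if_neg c1, if_neg c2, if_neg c3, if_neg]
    · rfl
    intro hsub; have hx := hsub (show x ∈ ({x, y} : Finset (Fin m)) by simp)
    have hy := hsub (show y ∈ ({x, y} : Finset (Fin m)) by simp)
    simp only [Finset.mem_insert, Finset.mem_singleton] at hx hy
    rcases hx with rfl | rfl | rfl <;> rcases hy with rfl | rfl | rfl <;>
      simp_all [Finset.pair_comm]
  · rw [hR.toVec_eq_zero _ hi, (Net.tri_mem hF ht).1 i hi]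

theorem Represents.mem_boundaries {idx : ℕ → ℕ → ℕ} (hF : G.Faces idx) (z : K.Chain 1) :
    toVec S z ∈ G.boundaries idx ↔ z ∈ K.oneBoundaries := by
  have key : (K.oneBoundaries).map (toVec S) = G.boundaries idx := by
    apply le_antisymm
    · rintro y ⟨z, ⟨x, rfl⟩, rfl⟩; classical
      have hx : x = ∑ t, x t • Pi.single t 1 := by
        ext t; rw [Finset.sum_apply, Finset.sum_eq_single t] <;> simp +contextual
      rw [hx, map_sum, map_sum]; refine Submodule.sum_mem _ fun t _ => ?_
      rw [map_smul, map_smul, hR.toVec_boundary_single hF]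
      refine Submodule.smul_mem _ _ (Submodule.subset_span ⟨_, ?_, rfl⟩)
      rw [hR.isTri, apply_num, t.card_eq]
    · refine Submodule.span_le.2 ?_; rintro y ⟨t, ht, rfl⟩; have htn : t < n := hR.n_eq ▸ ht.1
      have hc := (hR.isTri ⟨t, htn⟩).1 ht
      have hnum : (num S (⟨(S ⟨t, htn⟩).1, (S ⟨t, htn⟩).2, hc⟩ : K.Simplex 2) : ℕ) = t := by simp [num]
      rw [← hnum, ← hR.toVec_boundary_single hF]; exact ⟨_, ⟨_, rfl⟩, rfl⟩
  rw [← key]; constructor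
  · rintro ⟨z', hz', he⟩; exact toVec_injective he ▸ hz'
  · exact fun h => ⟨z, h, rfl⟩

theorem Represents.cycleWeight_eq (z : K.oneCycles) : K.cycleWeight w z = G.wt (toVec S z.1) := by
  rw [Net.wt, hR.sum_eq, cycleWeight]
  · refine Finset.sum_congr rfl fun e _ => ?_; rw [toVec_num, hR.w, atEdge_num]
    have key : ∀ a : ZMod 2, a = 1 ∧ a.val = 1 ∨ a ≠ 1 ∧ a.val = 0 := by decide
    rcases key (z.1 e) with ⟨h1, h2⟩ | ⟨h1, h2⟩
    · rw [if_pos h1, h2]; simp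
    · rw [if_neg h1, h2]; simp
  · intro i hi; rw [hR.toVec_eq_zero _ hi]; simp

end AbstractSimplicialComplex

/-! ## The greedy cycles are a shortest homology basis -/

namespace AbstractSimplicialComplex

open GaussJordan (Vec Elim)
open Net

variable {m n : ℕ} {K : AbstractSimplicialComplex (Fin m)}
  {S : Fin n ≃ {s : Finset (Fin m) // s ∈ K}} {w : K.Simplex 1 → ℝ} {G : Net}

/-- Shortest path trees and coordinates for homology classes. -/
structure CoordData (G : Net) (idx : ℕ → ℕ → ℕ) (ord par : ℕ → ℕ → ℕ) (dist : ℕ → ℕ → ℝ) (N : ℕ)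
    (U : ℕ → Vec) (piv : ℕ → ℕ) (g : ℕ) (r : ℕ → ℕ) : Prop where
  pos : 0 < G.m
  good : G.Good
  faces : G.Faces idx
  tree : ∀ p < G.m, G.SPTree p (ord p) (par p) (dist p)
  elim : Elim N (fun _ => False) 0 N (G.triOff idx (G.treeEdges (ord 0) (par 0))) U piv
  le : G.n ≤ N
  isCoords : G.Coords (G.treeEdges (ord 0) (par 0)) N piv g r

/-- Shortest path trees, coordinates for homology classes, and the list of all candidates in the
order of their lengths, where `cp x` is the root and `ce x` the edge of the candidate `x`. -/
structure CycleData (G : Net) (idx : ℕ → ℕ → ℕ) (ord par : ℕ → ℕ → ℕ) (dist : ℕ → ℕ → ℝ) (N : ℕ)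
    (U : ℕ → Vec) (piv : ℕ → ℕ) (g : ℕ) (r : ℕ → ℕ) (M : ℕ) (cp ce : ℕ → ℕ)
    (lab : ℕ → Fin g → ZMod 2) : Prop extends CoordData G idx ord par dist N U piv g r where
  code : ∀ x < M, cp x < G.m ∧ G.IsEdge (ce x)
  surj : ∀ p < G.m, ∀ e, G.IsEdge e → ∃ x < M, cp x = p ∧ ce x = e
  sorted : ∀ x y, x ≤ y → y < M →
    G.candKey (dist (cp x)) (ce x) ≤ G.candKey (dist (cp y)) (ce y)
  lab_eq : ∀ x < M, lab x = Net.coords N U piv g r (G.cand (cp x) (par (cp x)) (ce x))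
  lab_out : ∀ x, M ≤ x → lab x = 0

variable {idx : ℕ → ℕ → ℕ} {ord par : ℕ → ℕ → ℕ} {dist : ℕ → ℕ → ℝ} {N g M P k : ℕ} {U : ℕ → Vec}
  {piv r cp ce ch : ℕ → ℕ} {lab : ℕ → Fin g → ZMod 2}

section

variable (hD : CycleData G idx ord par dist N U piv g r M cp ce lab) (hgr : IsGreedy lab P k ch)
include hD hgr

/-- Labels beyond the list are zero, and an independent family contains no zero vector; so padding
is never chosen. -/
theorem CycleData.ch_lt {j : ℕ} (hj : j < k) : ch j < M := by
  by_contra! h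
  exact hgr.indep.ne_zero ⟨j, hj⟩ (hD.lab_out _ h)

/-- The link between the two halves of the argument: z is a sum of candidates with keys at most its
weight, and the label of each of these is spanned by choices not after it in the list, whose keys
are not larger. -/
theorem CycleData.mem_span (hP : M ≤ P) {z : Vec} (hz : z ∈ G.cycles) :
    coords N U piv g r z ∈ Submodule.span (ZMod 2) ((fun j : Fin k => lab (ch j)) ''
      {j | G.candKey (dist (cp (ch j))) (ce (ch j)) ≤ G.wt z}) := by
  have h1 := Submodule.mem_map_of_mem (f := coords N U piv g r) (mem_span_short hD.good hD.tree hz)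
  rw [Submodule.map_span] at h1; refine (Submodule.span_le.2 ?_) h1
  rintro y ⟨c, ⟨p, hp, e, he, rfl, hle⟩, rfl⟩; obtain ⟨x, hx, rfl, rfl⟩ := hD.surj p hp e he
  rw [← hD.lab_eq x hx]; refine Submodule.span_mono ?_ (hgr.span x (hx.trans_le hP))
  rintro y ⟨x', ⟨j, hj, rfl, hjx⟩, rfl⟩; exact ⟨⟨j, hj⟩, (hD.sorted _ _ hjx hx).trans hle, rfl⟩

theorem CycleData.card_eq (hP : M ≤ P) : k = g := by
  have htop : Submodule.span (ZMod 2) (Set.range fun j : Fin k => lab (ch j)) = ⊤ := by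
    rw [eq_top_iff]; rintro x -
    obtain ⟨z, hz, rfl⟩ := coords_surjective hD.elim hD.isCoords rfl hD.good (hD.tree 0 hD.pos) x
    exact Submodule.span_mono (Set.image_subset_range _ _) (hD.mem_span hgr hP hz)
  have h1 := finrank_span_eq_card hgr.indep
  rw [htop, finrank_top, Module.finrank_fin_fun, Fintype.card_fin] at h1; exact h1.symm

end

/-- The coordinates of a cycle. -/
noncomputable def cycleCoords (S : Fin n ≃ {s : Finset (Fin m) // s ∈ K}) (N : ℕ)
    (U : ℕ → Vec) (piv : ℕ → ℕ) (g : ℕ) (r : ℕ → ℕ) : K.oneCycles →ₗ[ZMod 2] (Fin g → ZMod 2) :=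
  (coords N U piv g r).comp ((toVec S).comp K.oneCycles.subtype)

/-- On cycles, the kernel of the coordinate map is exactly the space of boundaries, and the map is
onto; so it descends to an isomorphism. -/
theorem CoordData.exists_equiv (hR : K.Represents S w G)
    (hD : CoordData G idx ord par dist N U piv g r) :
    ∃ e : K.H1 ≃ₗ[ZMod 2] (Fin g → ZMod 2), ∀ z, e (K.homologyClass z) =
      cycleCoords S N U piv g r z := by
  have hker : K.oneBoundaries.submoduleOf K.oneCycles =
      LinearMap.ker (cycleCoords S N U piv g r) := by
    ext z
    rw [Submodule.submoduleOf, Submodule.mem_comap, LinearMap.mem_ker, Submodule.subtype_apply,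
      ← hR.mem_boundaries hD.faces]
    refine ⟨fun h => coords_boundaries hD.elim hD.isCoords hD.le h, fun h => ?_⟩
    exact mem_boundaries hD.elim hD.isCoords hD.faces rfl (hD.tree 0 hD.pos)
      ((hR.mem_cycles _).2 z.2) h
  refine ⟨LinearEquiv.ofBijective ((K.oneBoundaries.submoduleOf K.oneCycles).liftQ
    (cycleCoords S N U piv g r) hker.le) ⟨?_, ?_⟩, fun z => ?_⟩
  · rw [← LinearMap.ker_eq_bot]; exact Submodule.ker_liftQ_eq_bot _ _ _ hker.ge
  · intro x
    obtain ⟨z, hz, rfl⟩ := coords_surjective hD.elim hD.isCoords rfl hD.good (hD.tree 0 hD.pos) x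
    obtain ⟨y, rfl⟩ := hR.exists_toVec_eq hz.1
    exact ⟨K.homologyClass ⟨y, (hR.mem_cycles y).1 hz⟩, rfl⟩
  · rfl

theorem CoordData.eq_betti1 (hR : K.Represents S w G)
    (hD : CoordData G idx ord par dist N U piv g r) : g = K.betti1 := by
  obtain ⟨e, -⟩ := hD.exists_equiv hR; rw [betti1, e.finrank_eq, Module.finrank_fin_fun]

/-- The cycles chosen by the greedy algorithm are a shortest homology basis. -/
theorem CycleData.shortest (hR : K.Represents S w G)
    (hD : CycleData G idx ord par dist N U piv g r M cp ce lab) (hgr : IsGreedy lab P k ch)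
    (hP : M ≤ P) : k = K.betti1 ∧ g = K.betti1 ∧ ∃ z : Fin K.betti1 → K.oneCycles,
      K.IsShortestHomologyBasis w z ∧
      ∀ j, toVec S (z j).1 = G.cand (cp (ch j)) (par (cp (ch j))) (ce (ch j)) := by
  obtain rfl := hD.card_eq hgr hP; obtain ⟨e, he⟩ := hD.exists_equiv hR
  have hb : k = K.betti1 := hD.eq_betti1 hR; refine ⟨hb, hb, ?_⟩
  have hfd : FiniteDimensional (ZMod 2) K.H1 := Module.Finite.equiv e.symm; subst hb
  have hmem : ∀ j : Fin K.betti1, ∃ z : K.oneCycles,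
      toVec S z.1 = G.cand (cp (ch j)) (par (cp (ch j))) (ce (ch j)) := by
    intro j; obtain ⟨h1, h2⟩ := hD.code _ (hD.ch_lt hgr j.2)
    have h3 := (hD.tree _ h1).cand_mem hD.good h2; obtain ⟨y, hy⟩ := hR.exists_toVec_eq h3.1
    exact ⟨⟨y, (hR.mem_cycles y).1 (hy ▸ h3)⟩, hy⟩
  choose z hz using hmem
  have hcoord : ∀ j, e (K.homologyClass (z j)) = lab (ch j) := by
    intro j; rw [he, hD.lab_eq _ (hD.ch_lt hgr j.2), ← hz]; rfl
  have hind : LinearIndependent (ZMod 2) fun j => K.homologyClass (z j) := by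
    refine LinearIndependent.of_comp e.toLinearMap ?_
    have : (e.toLinearMap ∘ fun j => K.homologyClass (z j)) = fun j : Fin K.betti1 => lab (ch j) :=
      funext hcoord
    rw [this]; exact hgr.indep
  refine ⟨z, ⟨⟨hind, ?_⟩, fun z' hz' => ?_⟩, hz⟩
  · exact hind.span_eq_top_of_card_eq_finrank' (by rw [Fintype.card_fin]; rfl)
  -- The coordinates of a competing basis are independent, and `CycleData.mem_span` provides the
  -- span condition of the exchange argument.
  · have hx : LinearIndependent (ZMod 2) fun j => coords N U piv K.betti1 r (toVec S (z' j).1) := by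
      have h1 := hz'.1.map' e.toLinearMap e.ker
      have : (e.toLinearMap ∘ fun j => K.homologyClass (z' j)) =
          fun j => coords N U piv K.betti1 r (toVec S (z' j).1) := funext fun j => he (z' j)
      rw [this] at h1; exact h1
    have hκ : Monotone fun j : Fin K.betti1 => G.candKey (dist (cp (ch j))) (ce (ch j)) := by
      intro i j hij; refine hD.sorted _ _ ?_ (hD.ch_lt hgr j.2)
      rcases eq_or_lt_of_le hij with rfl | h
      · exact le_rfl
      · exact (hgr.mono i j h j.2).le
    have := sum_le_sum_of_mem_span (lab := fun j => lab (ch j)) hκ hx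
      (wt := fun j => G.wt (toVec S (z' j).1))
      (fun j => hD.mem_span hgr hP ((hR.mem_cycles _).2 (z' j).2))
    -- The chosen cycles weigh at most their keys, and the sum of these keys is at most the weight
    -- of the competing basis.
    simp only [hR.cycleWeight_eq]; refine le_trans (Finset.sum_le_sum fun j _ => ?_) this
    obtain ⟨h1, h2⟩ := hD.code _ (hD.ch_lt hgr j.2); rw [hz]
    exact (hD.tree _ h1).wt_cand hD.good h2

end AbstractSimplicialComplex

/-! ## Reading the input -/

namespace RAM

/-- Set the variable `b` to the least power of two that is at least `e`. -/
def powLoop (b : ℕ) (e : Expr) : Program :=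
  assign b 1 ;; .loop (.lt (var b) e) (assign b (2 * var b))

theorem powLoop_spec {B b x : ℕ} {e : Expr} {s : State} (hB : 2 * x + 1 < B)
    (he : ∀ s', (powLoop b e).Frame s s' → e.val s' = x) :
    Tri B (powLoop b e) s (x * (e.cost + 10) + (e.cost + 10)) (fun s' => ∃ κ,
      s'.words b 0 = 2 ^ κ ∧ x ≤ 2 ^ κ ∧ 2 ^ κ ≤ 2 * x + 1 ∧ (2 ^ κ < 2 * x ∨ κ = 0)) := by
  have hc : (Test.lt (var b) e).cost = e.cost + 4 := by simp [Test.cost, Expr.cost, OfNat.ofNat]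
  refine Tri.seq (T1 := 3) (T2 := x * (6 + (e.cost + 4)) + (e.cost + 4)) (R := fun s' =>
    s' = s.writeWord b 0 1) (Tri.block (fun _ => by simp; omega) (by simp) (le_of_eq rfl)) ?_
    (by rw [show 6 + (e.cost + 4) = e.cost + 10 by ring]; omega)
  rintro s1 f1 rfl
  have hf1 : (powLoop b e).Frame s (s.writeWord b 0 1) := f1.mono (by simp [powLoop]) (by simp)
  -- Each doubling raises the power by at least one, so x iterations suffice. This crude linear
  -- bound is affordable for every use of the loop.
  refine Tri.loop (f := x) (T1 := 6) (fun f s' => (powLoop b e).Frame s s' ∧ ∃ κ,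
    s'.words b 0 = 2 ^ κ ∧ 2 ^ κ ≤ 2 * x + 1 ∧ (2 ^ κ < 2 * x ∨ κ = 0) ∧ x ≤ 2 ^ κ - 1 + f) ?_ ?_ ?_
    (by rw [hc]) ?_
  · exact ⟨hf1, 0, by simp, by omega, Or.inr rfl, by omega⟩
  · rintro s' - ⟨hf, κ, h1, h2, h3, h4⟩; have := Nat.one_le_two_pow (n := κ); simp [he s' hf, h1]
    omega
  · rintro f s' - ⟨hf, κ, h1, h2, h3, h4⟩ hc; have := Nat.one_le_two_pow (n := κ)
    simp only [Test.holds_lt, he s' hf, Expr.val, h1] at hc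
    refine Tri.block (fun _ => by simp [h1]; omega) ⟨hf.trans ?_, κ + 1, by simp [h1]; ring, ?_⟩
      (le_of_eq rfl)
    · exact ⟨fun b' hb => State.words_of_ne _ (by simp [powLoop] at hb; exact hb) _ _,
        fun _ _ => rfl⟩
    · rw [pow_succ]; omega
  · rintro f s' ⟨hf, κ, h1, h2, h3, h4⟩ hc; simp only [Test.holds_lt, he s' hf, Expr.val, h1] at hc
    exact ⟨κ, h1, by omega, h2, h3⟩

theorem powLoop_wr {b b' : ℕ} {e : Expr} : (powLoop b e).wr b' ↔ b' = b := by simp [powLoop]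

theorem powLoop_wrR {b b' : ℕ} {e : Expr} : (powLoop b e).wrR b' ↔ False := by simp [powLoop]

/-- Blocks of a concatenation of lists start at the sums of the lengths. -/
theorem getD_flatMap {α : Type*} (f : α → List ℕ) (l : List α) (i k : ℕ) (hi : i < l.length)
    (hk : k < (f l[i]).length) :
    (l.flatMap f).getD (((l.map fun a => (f a).length).take i).sum + k) 0 = (f l[i]).getD k 0 := by
  induction l generalizing i with
  | nil => simp at hi
  | cons a l ih =>
    rw [List.flatMap_cons]
    cases i with
    | zero =>
      simp only [List.getElem_cons_zero] at hk ⊢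
      rw [List.take_zero, List.sum_nil, Nat.zero_add, List.getD_append _ _ _ _ hk]
    | succ i =>
      simp only [List.getElem_cons_succ] at hk ⊢
      rw [List.map_cons, List.take_succ_cons, List.sum_cons, List.getD_append_right _ _ _ _ (by omega),
        show (f a).length + ((l.map fun a => (f a).length).take i).sum + k - (f a).length =
          ((l.map fun a => (f a).length).take i).sum + k by omega]
      exact ih i (by simpa using hi) hk

end RAM

/-! ### The input stream as a net. -/

namespace AbstractSimplicialComplex

open RAM

variable {m n : ℕ} (K : AbstractSimplicialComplex (Fin m))
  (S : Fin n ≃ {s : Finset (Fin m) // s ∈ K}) (w : K.Simplex 1 → ℝ)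

/-- The position in the input of the simplex with number `i`. -/
def offset (i : ℕ) : ℕ := (((List.finRange n).map fun i => (S i).1.card + 1).take i).sum

/-- The net of `K`, with all simplices having three vertices, as read from the input. -/
noncomputable def net : Net where
  m := m
  n := n
  card i := if i < n then (K.simplexStream S).getD (offset K S i) 0 else 0
  v0 i := if i < n then (K.simplexStream S).getD (offset K S i + 1) 0 else 0
  v1 i := if i < n then (K.simplexStream S).getD (offset K S i + 2) 0 else 0
  v2 i := if i < n then (K.simplexStream S).getD (offset K S i + 3) 0 else 0
  w i := ((List.finRange n).map (K.atEdge S w)).getD i 0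

variable {K S w}

theorem offset_zero : offset K S 0 = 0 := by simp [offset]

theorem offset_succ (i : Fin n) : offset K S (i + 1) = offset K S i + ((S i).1.card + 1) := by
  rw [offset, offset, List.sum_take_succ _ _ (by simp)]; simp

theorem offset_le (i : ℕ) (hi : i ≤ n) : offset K S i ≤ i * (m + 1) := by
  induction i with
  | zero => simp [offset]
  | succ i ih =>
    have h1 := ih (by omega); have h2 := offset_succ (K := K) (S := S) ⟨i, by omega⟩
    have h3 := Finset.card_le_univ (S ⟨i, by omega⟩).1; rw [Fintype.card_fin] at h3; simp only at h2
    rw [h2, Nat.succ_mul]; omega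

theorem stream_getD (i : Fin n) (k : ℕ) (hk : k < (S i).1.card + 1) :
    (K.simplexStream S).getD (offset K S i + k) 0 =
      ((S i).1.card :: ((S i).1.sort).map fun v => (v : ℕ)).getD k 0 := by
  have := getD_flatMap (fun i : Fin n => (S i).1.card :: ((S i).1.sort).map fun v => (v : ℕ))
    (List.finRange n) i k (by simp) (by simpa using hk)
  simpa [simplexStream, offset] using this

/-- For a simplex with fewer than three vertices, the missing vertices are read from whatever
follows in the stream. This is harmless, because `Represents` constrains only vertices that exist.
-/
theorem net_represents : K.Represents S w (net K S w) := by
  have hc : ∀ i : Fin n, 1 ≤ (S i).1.card := fun i =>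
    Finset.card_pos.2 (K.isRelLowerSet_faces (S i).2).1
  refine ⟨rfl, rfl, ?_, ?_, ?_, ?_, ?_, ?_⟩
  · intro i; simpa [net] using stream_getD (S := S) i 0 (by omega)
  · intro i; have := stream_getD (S := S) i 1 (by have := hc i; omega); simpa [net] using this
  · intro i hi; have := stream_getD (S := S) i 2 (by omega); simpa [net] using this
  · intro i hi; have := stream_getD (S := S) i 3 (by omega); simpa [net] using this
  · intro i; simp [net]
  · intro i hi; simp only [net]; rw [List.getD_eq_default]; simpa using hi

end AbstractSimplicialComplex

/-! ### Reading simplices, the edge table and the adjacency lists. -/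

namespace Net

open RAM

notation "bkPos" => 12
notation "bkItem" => 13
notation "bkIdx" => 7

variable {G : Net}

/-- The darts in `D` that leave `v` are `adj v k` for `k < deg v`. -/
structure Lists (G : Net) (D : ℕ → Prop) (deg : ℕ → ℕ) (adj : ℕ → ℕ → ℕ) : Prop where
  dart : ∀ v < G.m, ∀ k < deg v, D (adj v k) ∧ G.tail (adj v k) = v
  surj : ∀ v < G.m, ∀ d, D d → G.tail d = v → ∃ k < deg v, adj v k = d
  inj : ∀ v < G.m, ∀ k < deg v, ∀ k' < deg v, adj v k = adj v k' → k = k'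

theorem Lists.push {D D' : ℕ → Prop} {deg deg' : ℕ → ℕ} {adj adj' : ℕ → ℕ → ℕ} {d u : ℕ}
    (h : G.Lists D deg adj) (hd : ¬ D d) (hu : G.tail d = u) (hum : u < G.m)
    (hD : ∀ x, D' x ↔ D x ∨ x = d) (hdeg : ∀ v, deg' v = if v = u then deg u + 1 else deg v)
    (hadj : ∀ v < G.m, ∀ k, k < deg v ∨ (v = u ∧ k = deg u) →
      adj' v k = if v = u ∧ k = deg u then d else adj v k) : G.Lists D' deg' adj' := by
  have hold : ∀ v < G.m, ∀ k < deg v, adj' v k = adj v k := fun v hv k hk => by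
    rw [hadj v hv k (Or.inl hk), if_neg]; rintro ⟨rfl, rfl⟩; omega
  have hnew : adj' u (deg u) = d := by rw [hadj u hum _ (Or.inr ⟨rfl, rfl⟩), if_pos ⟨rfl, rfl⟩]
  have hcase : ∀ v < G.m, ∀ k < deg' v, k < deg v ∨ (v = u ∧ k = deg u) := by
    intro v _ k hk; rw [hdeg] at hk; split_ifs at hk with hv
    · subst hv; omega
    · exact Or.inl hk
  have hne : ∀ v < G.m, ∀ k < deg v, adj v k ≠ d := fun v hv k hk he =>
    hd (he ▸ (h.dart v hv k hk).1)
  refine ⟨?_, ?_, ?_⟩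
  · intro v hv k hk; rcases hcase v hv k hk with hk | ⟨rfl, rfl⟩
    · rw [hold v hv k hk, hD]; exact ⟨Or.inl (h.dart v hv k hk).1, (h.dart v hv k hk).2⟩
    · rw [hnew, hD]; exact ⟨Or.inr rfl, hu⟩
  · intro v hv x hx ht; rcases (hD x).1 hx with hx | rfl
    · obtain ⟨k, hk, he⟩ := h.surj v hv x hx ht; refine ⟨k, ?_, by rw [hold v hv k hk, he]⟩
      rw [hdeg]; split_ifs with hv'
      · subst hv'; omega
      · exact hk
    · rw [hu] at ht; subst ht; exact ⟨deg u, by rw [hdeg, if_pos rfl]; omega, hnew⟩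
  · intro v hv k hk k' hk' he
    rcases hcase v hv k hk with hk | ⟨rfl, rfl⟩ <;> rcases hcase v hv k' hk' with hk' | ⟨h1, rfl⟩
    · rw [hold v hv k hk, hold v hv k' hk'] at he; exact h.inj v hv k hk k' hk' he
    · subst h1; rw [hold v hv k hk, hnew] at he; exact (hne v hv k hk he).elim
    · rw [hold _ hv k' hk', hnew] at he; exact (hne _ hv k' hk' he.symm).elim
    · rfl

/-- Append the dart `d` to the list of its tail `u`. -/
def pushDart (u d : Expr) : Program :=
  .setWord bkAdj (u * numS + .get bkDeg u) d ;; .setWord bkDeg u (.get bkDeg u + 1)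

/-- Read the next simplex. -/
def readItem : Program := .setWord bkCard (var bkItem) (.get 1 (var bkPos)) ;;
  .setWord bkFst (var bkItem) (.get 1 (var bkPos + 1)) ;;
  .setWord bkSnd (var bkItem) (.get 1 (var bkPos + 2)) ;;
  .setWord bkThd (var bkItem) (.get 1 (var bkPos + 3)) ;;
  assign bkPos (var bkPos + .get 1 (var bkPos) + 1)

/-- Register the edge that has been read. -/
def addEdge : Program :=
  .setWord bkIdx (.get bkFst (var bkItem) * numV + .get bkSnd (var bkItem)) (var bkItem + 1) ;;
  pushDart (.get bkFst (var bkItem)) (2 * var bkItem) ;;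
  pushDart (.get bkSnd (var bkItem)) (2 * var bkItem + 1)

/-- Read the simplices. -/
def parse : Program := forLoop bkItem numS
    (readItem ;; .ite (.eq (.get bkCard (var bkItem)) 2) addEdge .skip)

/-- The memory after reading `i` simplices, at the position `q` of the stream. -/
structure Parsed (G : Net) (i q : ℕ) (s : State) : Prop where
  pos : s.words bkPos 0 = q
  card : s.words bkCard = fun j => if j < i then G.card j else 0
  v0 : s.words bkFst = fun j => if j < i then G.v0 j else 0
  v1 : s.words bkSnd = fun j => if j < i then G.v1 j else 0
  v2 : s.words bkThd = fun j => if j < i then G.v2 j else 0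
  idx : ∀ j < i, G.IsEdge j → s.words bkIdx (G.v0 j * G.m + G.v1 j) = j + 1
  lists : G.Lists (fun d => G.IsDart d ∧ d / 2 < i) (s.words bkDeg)
    (fun v k => s.words bkAdj (v * G.n + k))
  deg_le : ∀ v < G.m, s.words bkDeg v ≤ i
  sum_le : ∑ v ∈ Finset.range G.m, s.words bkDeg v ≤ 2 * i

theorem sum_update {m u : ℕ} {f g : ℕ → ℕ} (hu : u < m)
    (h : ∀ v, g v = if v = u then f u + 1 else f v) :
    ∑ v ∈ Finset.range m, g v = ∑ v ∈ Finset.range m, f v + 1 := by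
  have : ∀ v ∈ Finset.range m, g v = f v + if v = u then 1 else 0 := by
    intro v _; rw [h]; split_ifs with hv
    · rw [hv]
    · rfl
  rw [Finset.sum_congr rfl this, Finset.sum_add_distrib, Finset.sum_ite_eq', if_pos]; simpa using hu

theorem fill_succ {i : ℕ} {f h h' : ℕ → ℕ} (h1 : h = fun j => if j < i then f j else 0)
    (h2 : ∀ j, h' j = if j = i then f i else h j) : h' = fun j => if j < i + 1 then f j else 0 := by
  funext j; rw [h2, h1]; rcases lt_trichotomy j i with h | rfl | h
  · simp [h, h.ne, h.trans (Nat.lt_succ_self i)]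
  · simp
  · rw [if_neg (by omega)]; simp only; rw [if_neg (by omega), if_neg (by omega)]

/-- The table stores i + 1, so that a lookup later subtracts one. Distinct edges have distinct pairs
of vertices, hence no entry is overwritten. A degree is at most the number of simplices read, so
adjacency lists placed at distance n do not collide. -/
theorem parse_step {B i q : ℕ} {s : State} (hG : G.Good) (hB : 2 * G.n < B) (hqB : q + G.n + 1 < B)
    (hm : s.words 0 0 = G.m) (hn : s.words 0 1 = G.n) (hi : i < G.n) (hv : s.words bkItem 0 = i)
    (h0 : s.words 1 q = G.card i) (h1 : s.words 1 (q + 1) = G.v0 i)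
    (h2 : s.words 1 (q + 2) = G.v1 i) (h3 : s.words 1 (q + 3) = G.v2 i)
    (hc : G.card i ≤ G.n) (huniq : ∀ i j, G.IsEdge i → G.IsEdge j →
      G.v0 i = G.v0 j → G.v1 i = G.v1 j → i = j) (h : G.Parsed i q s) :
    Tri B (readItem ;; .ite (.eq (.get bkCard (var bkItem)) 2) addEdge .skip) s 200
      (G.Parsed (i + 1) (q + G.card i + 1)) := by
  have hP := h.pos
  refine Tri.seq (T1 := 60) (T2 := 140) (R := fun s' => s'.words bkPos 0 = q + G.card i + 1 ∧
      (s'.words bkCard = fun j => if j < i + 1 then G.card j else 0) ∧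
      (s'.words bkFst = fun j => if j < i + 1 then G.v0 j else 0) ∧
      (s'.words bkSnd = fun j => if j < i + 1 then G.v1 j else 0) ∧
      s'.words bkThd = fun j => if j < i + 1 then G.v2 j else 0)
    (Tri.block (fun hb => ?_) ?_ (by decide)) ?_ (by omega)
  · have b2 := hb 1 (q + 1); have b3 := hb 1 (q + 2); have b4 := hb 1 (q + 3)
    simp [readItem, hP, hv, b2, b3, b4, h0]; omega
  · refine ⟨?_, fill_succ h.card ?_, fill_succ h.v0 ?_, fill_succ h.v1 ?_, fill_succ h.v2 ?_⟩ <;>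
      simp [readItem, hP, hv, h0, h1, h2, h3]
  rintro s1 f1 ⟨g1, g2, g3, g4, g5⟩; have w : ∀ b, ¬ readItem.wr b → s1.words b = s.words b := f1.w
  have e0 := w 0 (by simp [readItem]); have ei := w bkItem (by simp [readItem])
  have ed := w bkDeg (by simp [readItem]); have ea := w bkAdj (by simp [readItem])
  have ex := w bkIdx (by simp [readItem])
  have hiff : ∀ j, j < i + 1 ↔ j < i ∨ j = i := by omega
  have c1 : s1.words bkCard i = G.card i := by rw [g2]; simp
  have c2 : s1.words bkFst i = G.v0 i := by rw [g3]; simp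
  have c3 : s1.words bkSnd i = G.v1 i := by rw [g4]; simp
  refine Tri.ite (T1 := 110) (fun hc2 => ?_) (fun hc2 => ?_) (by decide)
  · have hcard : G.card i = 2 := by rw [Test.holds_eq] at hc2; simpa [ei, hv, c1] using hc2
    have hie : G.IsEdge i := ⟨hi, hcard⟩; have hlt := hG.lt i hie; have hltm := hG.lt_m i hie
    have hmn := hG.m_le; have d1 := h.deg_le (G.v0 i) (hlt.trans hltm)
    have d2 := h.deg_le (G.v1 i) hltm; refine Tri.block (fun hb => ?_) ?_ (by decide)
    · simp [addEdge, pushDart, ei, hv, e0, hm, hn, c2, c3, ed, hlt.ne']; omega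
    · generalize hs' : Program.exec _ _ = s'
      have x1 : ∀ b, b ≠ bkIdx ∧ b ≠ bkAdj ∧ b ≠ bkDeg → s'.words b = s1.words b := by
        rintro b ⟨n1, n2, n3⟩; rw [← hs']; simp [addEdge, pushDart, n1, n2, n3]
      have x2 : ∀ a, s'.words bkIdx a =
          if a = G.v0 i * G.m + G.v1 i then i + 1 else s.words bkIdx a := by
        intro a; rw [← hs']; simp [addEdge, pushDart, ei, hv, e0, hm, c2, c3, ex]
      set deg1 : ℕ → ℕ := fun v => if v = G.v0 i then s.words bkDeg (G.v0 i) + 1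
        else s.words bkDeg v with hdeg1
      have x3 : ∀ v, s'.words bkDeg v = if v = G.v1 i then deg1 (G.v1 i) + 1 else deg1 v := by
        intro v; rw [← hs']
        simp [addEdge, pushDart, ei, hv, e0, hm, hn, c2, c3, ed, hdeg1, hlt.ne']
      have x4 : ∀ a, s'.words bkAdj a = if a = G.v1 i * G.n + s.words bkDeg (G.v1 i) then 2 * i + 1
          else if a = G.v0 i * G.n + s.words bkDeg (G.v0 i) then 2 * i else s.words bkAdj a := by
        intro a; rw [← hs']; simp [addEdge, pushDart, ei, hv, e0, hm, hn, c2, c3, ed, ea, hlt.ne']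
      have hinj : ∀ v v' k k', k < G.n → k' < G.n → (v * G.n + k = v' * G.n + k' ↔
          v = v' ∧ k = k') := fun v v' k k' hk hk' =>
        ⟨fun h => idx_inj hk hk' h, fun h => by rw [h.1, h.2]⟩
      have t0 : G.tail (2 * i) = G.v0 i := by simp [tail]
      have t1 : G.tail (2 * i + 1) = G.v1 i := by
        simp [tail, show (2 * i + 1) / 2 = i by omega, show (2 * i + 1) % 2 = 1 by omega]
      have l1 : G.Lists (fun d => (G.IsDart d ∧ d / 2 < i) ∨ d = 2 * i) deg1 (fun v k =>
          if v * G.n + k = G.v0 i * G.n + s.words bkDeg (G.v0 i) then 2 * i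
          else s.words bkAdj (v * G.n + k)) := by
        refine h.lists.push (by rintro ⟨-, h⟩; omega) t0 (hlt.trans hltm) (fun x => Iff.rfl)
          (fun v => rfl) ?_
        intro v hv k hk; have := h.deg_le v hv
        simp only [hinj v _ k _ (by omega) (show s.words bkDeg (G.v0 i) < G.n by omega)]
      have l2 := l1.push (d := 2 * i + 1) (D' := fun d => G.IsDart d ∧ d / 2 < i + 1)
        (deg' := s'.words bkDeg) (adj' := fun v k => s'.words bkAdj (v * G.n + k))
        (by rintro (⟨-, h⟩ | h) <;> omega) t1 hltm (fun x => ?_) x3 ?_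
      · refine ⟨by rw [x1 _ (by decide), g1],
          by rw [x1 _ (by decide), g2],
          by rw [x1 _ (by decide), g3],
          by rw [x1 _ (by decide), g4],
          by rw [x1 _ (by decide), g5], ?_, l2, ?_, ?_⟩
        · intro j hj hje; rw [x2]; rcases (hiff j).1 hj with hj | rfl
          · split_ifs with he
            · exfalso; obtain ⟨h4, h5⟩ := idx_inj (hG.lt_m j hje) hltm he
              have := huniq j i hje hie h4 h5; omega
            · exact h.idx j hj hje
          · rw [if_pos rfl]
        · intro v hv; have := h.deg_le v hv; rw [x3]; simp only [hdeg1]; split_ifs <;> omega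
        · rw [sum_update hltm x3, sum_update (hlt.trans hltm) (fun v => rfl)]; have := h.sum_le
          omega
      · unfold IsDart; constructor
        · rintro ⟨h4, h5⟩; rcases (hiff _).1 h5 with h5 | h5
          · exact Or.inl (Or.inl ⟨h4, h5⟩)
          · omega
        · rintro ((⟨h4, h5⟩ | rfl) | rfl)
          · exact ⟨h4, by omega⟩
          · rw [show 2 * i / 2 = i by omega]; exact ⟨hie, by omega⟩
          · rw [show (2 * i + 1) / 2 = i by omega]; exact ⟨hie, by omega⟩
      · intro v hv k hk
        have h4 : k ≤ i := by
          have := h.deg_le v hv; simp only [hdeg1] at hk; split_ifs at hk <;> omega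
        have h5 : deg1 (G.v1 i) = s.words bkDeg (G.v1 i) := by simp [hdeg1, hlt.ne']
        simp only [x4, hinj v _ k _ (show k < G.n by omega)
          (show s.words bkDeg (G.v1 i) < G.n by omega), h5]
  · have hcard : G.card i ≠ 2 := by rw [Test.holds_eq] at hc2; simpa [ei, hv, c1] using hc2
    have hnd : ∀ d, G.IsDart d → d / 2 ≠ i := fun d hd he => hcard (he ▸ hd.2)
    refine Tri.block (fun _ => by simp) ?_ (by decide); refine ⟨g1, g2, g3, g4, g5, ?_, ?_, ?_, ?_⟩
    · intro j hj hje; rcases (hiff j).1 hj with hj | rfl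
      · simpa [ex] using h.idx j hj hje
      · exact absurd hje.2 hcard
    · have : (fun d => G.IsDart d ∧ d / 2 < i + 1) = fun d => G.IsDart d ∧ d / 2 < i := by
        funext d; refine propext ⟨fun ⟨h4, h5⟩ => ⟨h4, ?_⟩, fun ⟨h4, h5⟩ => ⟨h4, by omega⟩⟩
        have := hnd d h4; omega
      rw [this]; simpa [ed, ea] using h.lists
    · intro v hv; have := h.deg_le v hv; simp [ed]; omega
    · have := h.sum_le; simp [ed]; omega

theorem parse_wr {b : ℕ} (h : parse.wr b) : 4 ≤ b ∧ b ≤ 13 := by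
  simp [parse, readItem, addEdge, pushDart] at h; omega

theorem parse_wrR {b : ℕ} : parse.wrR b ↔ False := by simp [parse, readItem, addEdge, pushDart]

end Net

/-! ### Correctness of reading a complex. -/

namespace AbstractSimplicialComplex

open RAM Net

variable {m n : ℕ} {K : AbstractSimplicialComplex (Fin m)}
  {S : Fin n ≃ {s : Finset (Fin m) // s ∈ K}} {w : K.Simplex 1 → ℝ} {B : ℕ} {s : State} {G : Net}

theorem Represents.edge_unique (hR : K.Represents S w G) (i j : ℕ) (hi : G.IsEdge i)
    (hj : G.IsEdge j) (h0 : G.v0 i = G.v0 j) (h1 : G.v1 i = G.v1 j) : i = j := by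
  have hin : i < n := hR.n_eq ▸ hi.1; have hjn : j < n := hR.n_eq ▸ hj.1
  obtain ⟨a, b, -, hs, e0, e1⟩ := hR.edge ((hR.isEdge ⟨i, hin⟩).1 hi)
  obtain ⟨a', b', -, hs', e0', e1'⟩ := hR.edge ((hR.isEdge ⟨j, hjn⟩).1 hj)
  simp only at e0 e1 e0' e1'; obtain rfl : a = a' := Fin.ext (by omega)
  obtain rfl : b = b' := Fin.ext (by omega); have := S.injective (Subtype.ext (hs.trans hs'.symm))
  simpa using this

theorem parse_spec (hG : (net K S w).Good) (hB : (n + 1) * (n + 2) + n < B)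
    (hs0 : s.words 0 = (K.inputState S w).words 0) (hs1 : s.words 1 = (K.inputState S w).words 1)
    (hr : s.reals 0 = (K.inputState S w).reals 0) (hz : ∀ b, 4 ≤ b → b ≤ 13 → ∀ a, s.words b a = 0) :
    Tri B parse s (n * 220 + 20) (fun s' => (net K S w).Holds s' ∧ (net K S w).HoldsAdj s' ∧
      ∀ i, (net K S w).IsEdge i →
        s'.words bkIdx ((net K S w).v0 i * m + (net K S w).v1 i) = i + 1) := by
  set G := net K S w with hGdef; have hR : K.Represents S w G := net_represents
  have hmn : m ≤ n := hG.m_le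
  have hm : s.words 0 0 = m := by rw [hs0]; rfl
  have hn : s.words 0 1 = n := by rw [hs0]; rfl
  have hst : ∀ a, s.words 1 a = (K.simplexStream S).getD a 0 := fun a => by rw [hs1]; rfl
  refine Tri.forLoop (N := n) (Tb := 200) (fun i s' => G.Parsed i (offset K S i) s') ?_ (by nlinarith)
    ?_ ?_ ?_ ?_ (mul_add_le (by decide) (by decide)) ?_
  · simp [readItem, addEdge, pushDart]
  · intro s' hf; simp [hf.w 0 (fun h => by have := parse_wr h; omega), hn]
  · have hz' := fun b h1 h2 => funext (hz b h1 h2)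
    have hdeg : ∀ v, s.words bkDeg v = 0 := hz _ (by omega) (by omega)
    refine ⟨by rw [hz' _ (by omega) (by omega), offset_zero], ?_, ?_, ?_, ?_, by omega,
      ⟨fun v _ k hk => ?_, fun v _ d hd => by omega, fun v _ k hk => ?_⟩, fun v _ => ?_, ?_⟩
    · rw [hz' _ (by omega) (by omega)]; simp
    · rw [hz' _ (by omega) (by omega)]; simp
    · rw [hz' _ (by omega) (by omega)]; simp
    · rw [hz' _ (by omega) (by omega)]; simp
    · rw [hdeg] at hk; omega
    · rw [hdeg] at hk; omega
    · rw [hdeg]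
    · simp [hdeg]
  · rintro i s' x ⟨h1, h2, h3, h4, h5, h6, h7, h8, h9⟩
    exact ⟨by simpa using h1, by simpa using h2, by simpa using h3, by simpa using h4,
      by simpa using h5, by simpa using h6, by simpa using h7, by simpa using h8, by simpa using h9⟩
  · intro i s' hi hv hf hI
    have e0 : s'.words 0 = s.words 0 := hf.w 0 fun h => by have := parse_wr h; omega
    have e1 : s'.words 1 = s.words 1 := hf.w 1 fun h => by have := parse_wr h; omega
    have hci := hR.card ⟨i, hi⟩; simp only at hci; have hcm := Finset.card_le_univ (S ⟨i, hi⟩).1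
    rw [Fintype.card_fin] at hcm; have hoff := offset_le (K := K) (S := S) i hi.le
    have hle : i * (m + 1) ≤ n * (n + 1) := Nat.mul_le_mul hi.le (by omega)
    have hsucc := offset_succ (K := K) (S := S) ⟨i, hi⟩; simp only at hsucc
    have hGn : G.n = n := rfl
    refine Tri.mono (parse_step (q := offset K S i) hG ?_ ?_ (by rw [e0, hm]; rfl)
      (by rw [e0, hn]; rfl) hi hv ?_ ?_ ?_ ?_ ?_ hR.edge_unique hI) le_rfl ?_
    · rw [hGn]; nlinarith
    · rw [hGn]; nlinarith
    · rw [e1, hst, hGdef]; simp [net, hi]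
    · rw [e1, hst, hGdef]; simp [net, hi]
    · rw [e1, hst, hGdef]; simp [net, hi]
    · rw [e1, hst, hGdef]; simp [net, hi]
    · rw [hci, hGn]; omega
    · intro s'' _ h; rw [hsucc, ← hci]; exact h
  · rintro s' hf - h
    refine ⟨⟨?_, ?_, ?_, ?_, ?_, ?_, ?_⟩, ⟨?_, ?_, h.lists.inj, h.sum_le⟩, fun i hi =>
      h.idx i hi.1 hi⟩
    · rw [hf.w 0 fun h => by have := parse_wr h; omega, hm]; rfl
    · rw [hf.w 0 fun h => by have := parse_wr h; omega, hn]; rfl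
    · rw [h.card]; funext j; simp [hGdef, net]; intro h1 h2; omega
    · rw [h.v0]; funext j; simp [hGdef, net]; intro h1 h2; omega
    · rw [h.v1]; funext j; simp [hGdef, net]; intro h1 h2; omega
    · rw [h.v2]; funext j; simp [hGdef, net]; intro h1 h2; omega
    · rw [hf.r 0 (by simp [readItem, addEdge, pushDart]), hr]; rfl
    · intro v hv k hk; exact ⟨(h.lists.dart v hv k hk).1.1, (h.lists.dart v hv k hk).2⟩
    · intro v hv d hd ht; exact h.lists.surj v hv d ⟨hd, hd.1⟩ ht

end AbstractSimplicialComplex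

/-! ## Elimination of the boundary matrix -/

namespace Net

open RAM GaussJordan

notation "bkTree" => 80
notation "bkEdge" => 82

variable {G : Net} {B N K p : ℕ} {s : State}

/-- The order of the vertices in the shortest path tree with root `p`. -/
def ordOf (G : Net) (s : State) (p : ℕ) : ℕ → ℕ := row (s.words bkOrd) (p * G.m)

/-- The parents in the shortest path tree with root `p`. -/
def parOf (G : Net) (s : State) (p : ℕ) : ℕ → ℕ := row (s.words bkPar) (p * G.m)

/-- The distances from `p`. -/
def distOf (G : Net) (s : State) (p : ℕ) : ℕ → ℝ := row (s.reals rbDist) (p * G.m)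

/-- The edges of the shortest path tree with root `0`. -/
def treeOf (G : Net) (s : State) : Set ℕ := G.treeEdges (G.ordOf s 0) (G.parOf s 0)

/-- The numbers of the edges. -/
def idxOf (G : Net) (s : State) (u v : ℕ) : ℕ := s.words bkIdx (u * G.m + v) - 1

/-- Mark the edges of the shortest path tree with root `0`. -/
def markTree : Program :=
  forLoop bkItem (numV - 1) (.setWord bkTree (.get bkPar (.get bkOrd (var bkItem + 1)) / 2) 1)

theorem markTree_spec (hh : G.Holds s) (hmB : G.m < B) (hz : ∀ i, s.words bkTree i = 0) :
    Tri B markTree s (G.m * 30 + 20) (fun s' =>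
      ∀ i, s'.words bkTree i ≠ 0 ↔ i ∈ G.treeOf s) := by
  have hT : ∀ i, i ∈ G.treeOf s ↔ ∃ j < G.m - 1, s.words bkPar (s.words bkOrd (j + 1)) / 2 = i := by
    intro i; simp only [treeOf, treeEdges, ordOf, parOf, row, zero_mul, zero_add, Set.mem_ofPred_eq]
    constructor
    · rintro ⟨j, h0, h1, h2⟩; exact ⟨j - 1, by omega, by rwa [show j - 1 + 1 = j by omega]⟩
    · rintro ⟨j, h0, h1⟩; exact ⟨j + 1, by omega, by omega, h1⟩
  refine Tri.forLoop (N := G.m - 1) (Tb := 12) (fun k s' => ∀ i, s'.words bkTree i ≠ 0 ↔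
    ∃ j < k, s.words bkPar (s.words bkOrd (j + 1)) / 2 = i) (by simp) (by omega) ?_ ?_ ?_ ?_
    ((Nat.add_le_add (Nat.mul_le_mul_right _ (Nat.sub_le _ _)) le_rfl).trans
      (mul_add_le (by decide) (by decide))) ?_
  · intro s' hf; simp [hf.w 0 (by simp), hh.m]
  · simp [hz]
  · intro k s' x h; simpa using h
  · intro k s' hk hv hf h; have e1 := hf.w bkPar (by simp); have e2 := hf.w bkOrd (by simp)
    refine Tri.block (fun _ => by simp; omega) ?_ (by decide); intro i
    simp only [Program.exec, Expr.val, Expr.val_div, hv, e1, e2, State.words_same]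
    split_ifs with hi
    · simp only [ne_eq, one_ne_zero, not_false_eq_true, true_iff]; exact ⟨k, by omega, hi.symm⟩
    · rw [h]; constructor
      · rintro ⟨j, hj, he⟩; exact ⟨j, by omega, he⟩
      · rintro ⟨j, hj, he⟩; rcases Nat.lt_succ_iff_lt_or_eq.1 hj with hj | rfl
        · exact ⟨j, hj, he⟩
        · exact absurd he.symm hi
  · intro s' hf _ h i; rw [h, hT]

/-- Toggle the entry at the edge `bkEdge` in the column `bkItem`, unless the edge is in the tree. -/
def toggleOff : Program := .ite (.wordLe (.get bkTree (var bkEdge)) 0)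
    (.setWord bkMat (var bkEdge * var bkN + var bkItem)
      (1 - .get bkMat (var bkEdge * var bkN + var bkItem))) .skip

/-- The matrix after adding to its column `t` the vector `v`. -/
structure AddCol (N t : ℕ) (v : Vec) (s s' : State) : Prop where
  bit : ∀ a, s'.words bkMat a < 2
  same : col s' N t = col s N t + v
  other : ∀ c < N, c ≠ t → col s' N c = col s N c

theorem AddCol.trans {t : ℕ} {v v' : Vec} {s' s'' : State} (h : AddCol N t v s s')
    (h' : AddCol N t v' s' s'') : AddCol N t (v + v') s s'' :=
  ⟨h'.bit, by rw [h'.same, h.same, add_assoc], fun c hc hne => by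
    rw [h'.other c hc hne, h.other c hc hne]⟩

theorem AddCol.congr {t : ℕ} {v : Vec} {s' s'' : State} (h : AddCol N t v s s')
    (hw : s''.words bkMat = s.words bkMat) : AddCol N t v s'' s' :=
  ⟨h.bit, by rw [h.same, col_congr hw], fun c hc hne => by rw [h.other c hc hne, col_congr hw]⟩

open Classical in
/-- The edge `e` outside of `T` as a chain. -/
noncomputable def singleOff (T : Set ℕ) (e : ℕ) : Vec := if e ∈ T then 0 else Pi.single e 1

theorem toggleOff_spec {T : Set ℕ} {e t : ℕ} (hN : s.words bkN 0 = N) (he : s.words bkEdge 0 = e)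
    (ht : s.words bkItem 0 = t) (heN : e < N) (htN : t < N) (h1B : 1 < B)
    (hT : s.words bkTree e ≠ 0 ↔ e ∈ T) (hbit : ∀ a, s.words bkMat a < 2) :
    Tri B toggleOff s 40 (AddCol N t (singleOff T e) s) := by
  refine Tri.ite (T1 := 20) (fun hc => ?_) (fun hc => ?_) (by decide)
  · have hc' : s.words bkTree e = 0 := by simpa [he] using hc
    refine Tri.block (fun _ => by simp; omega) ?_ (by decide)
    have hx : ∀ a, ((Program.setWord bkMat (var bkEdge * var bkN + var bkItem)
        (1 - .get bkMat (var bkEdge * var bkN + var bkItem))).exec s).words bkMat a =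
        if a = e * N + t then 1 - s.words bkMat (e * N + t) else s.words bkMat a := by
      intro a; simp [hN, he, ht]
    have hcol : ∀ c < N, ∀ r, col ((Program.setWord bkMat (var bkEdge * var bkN + var bkItem)
        (1 - .get bkMat (var bkEdge * var bkN + var bkItem))).exec s) N c r =
        if r = e ∧ c = t then ((1 - s.words bkMat (e * N + t) : ℕ) : ZMod 2) else col s N c r := by
      intro c hc r; simp only [col, hx]; by_cases hr : r < N
      · simp only [if_pos hr]; by_cases hrc : r = e ∧ c = t
        · rw [if_pos hrc, if_pos (by rw [hrc.1, hrc.2])]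
        · rw [if_neg hrc, if_neg fun h => hrc (idx_inj hc htN h)]
      · rw [if_neg hr, if_neg (fun h : r = e ∧ c = t => hr (h.1 ▸ heN)), if_neg hr]
    have hnT : e ∉ T := fun h => hT.2 h hc'; refine ⟨fun a => ?_, ?_, fun c hc hne => ?_⟩
    · rw [hx]; split_ifs
      · omega
      · exact hbit a
    · ext r; rw [hcol t htN, singleOff, if_neg hnT, Pi.add_apply]; by_cases hr : r = e
      · subst hr; rw [if_pos ⟨rfl, rfl⟩, Pi.single_eq_same, col, if_pos heN]
        have := hbit (r * N + t)
        interval_cases s.words bkMat (r * N + t) <;> decide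
      · rw [if_neg fun h => hr h.1, Pi.single_eq_of_ne hr, add_zero]
    · ext r; rw [hcol c hc, if_neg fun h => hne h.2]
  · have hc' : e ∈ T := hT.1 (by simpa [he, Nat.pos_iff_ne_zero] using hc)
    refine Tri.block (fun _ => by simp) ?_ (by decide)
    exact ⟨hbit, by simp [singleOff, hc'], fun _ _ _ => rfl⟩

/-- Add the edge with the number stored at the address `e` to the boundary. -/
def addFace (e : Expr) : Program := assign bkEdge (.get bkIdx e - 1) ;; toggleOff

/-- Write the boundaries of the triangles into the matrix. -/
def fillBoundary : Program := forLoop bkItem numS (.ite (.eq (.get bkCard (var bkItem)) 3)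
    (addFace (.get bkFst (var bkItem) * numV + .get bkSnd (var bkItem)) ;;
      addFace (.get bkFst (var bkItem) * numV + .get bkThd (var bkItem)) ;;
      addFace (.get bkSnd (var bkItem) * numV + .get bkThd (var bkItem))) .skip)

theorem addFace_spec {T : Set ℕ} {e : Expr} {x t : ℕ} (hN : s.words bkN 0 = N)
    (he : e.val s = x) (ht : s.words bkItem 0 = t) (heN : s.words bkIdx x - 1 < N) (htN : t < N)
    (h1B : 1 < B) (hT : ∀ i, s.words bkTree i ≠ 0 ↔ i ∈ T) (hbit : ∀ a, s.words bkMat a < 2) :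
    Tri B (addFace e) s (e.cost + 50) (AddCol N t (singleOff T (s.words bkIdx x - 1)) s) := by
  refine Tri.seq (T1 := e.cost + 5) (T2 := 40)
    (R := fun s' => s' = s.writeWord bkEdge 0 (s.words bkIdx x - 1))
    (Tri.block (fun hb => by
      have := hb bkIdx x
      simp [he]; omega) (by simp [he]) (by
        change 1 + (e.cost + 1 + 1 + 1) + 1 ≤ e.cost + 5; omega)) ?_ (by omega)
  rintro s' - rfl
  exact Tri.mono (toggleOff_spec (T := T) (e := s.words bkIdx x - 1) (t := t) (by simpa using hN)
    (by simp) (by simpa using ht) heN htN h1B (by simpa using hT _) (by simpa using hbit)) le_rfl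
    fun s'' _ h => h.congr (by simp)

theorem fillBoundary_spec {T : Set ℕ} (hF : G.Faces (G.idxOf s)) (hh : G.Holds s)
    (hnN : G.n ≤ N) (hNB : N < B) (h1B : 1 < B) (hN : s.words bkN 0 = N)
    (hT : ∀ i, s.words bkTree i ≠ 0 ↔ i ∈ T) (hz : ∀ a, s.words bkMat a = 0) :
    Tri B fillBoundary s (G.n * 250 + 20) (fun s' => (∀ a, s'.words bkMat a < 2) ∧
      ∀ c < N, col s' N c = G.triOff (G.idxOf s) T c) := by
  refine Tri.forLoop (N := G.n) (Tb := 200) (fun k s' => (∀ a, s'.words bkMat a < 2) ∧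
      ∀ c < N, col s' N c = if c < k then G.triOff (G.idxOf s) T c else 0) ?_ (by omega) ?_ ?_ ?_ ?_
    (mul_add_le (by decide) (by decide)) ?_
  · simp [addFace, toggleOff]
  · intro s' hf; simp [hf.w 0 (by simp [addFace, toggleOff]), hh.n]
  · simp only [hz]; refine ⟨by simp, fun c _ => ?_⟩; ext r; simp [col, hz]
  · rintro k s' x ⟨h1, h2⟩; refine ⟨by simpa using h1, fun c hc => ?_⟩; rw [← h2 c hc]
    exact col_congr (by simp) _ _
  · rintro k s' hk hv hf ⟨h1, h2⟩
    have w : ∀ b, b ≠ bkMat ∧ b ≠ bkEdge ∧ b ≠ bkItem → s'.words b = s.words b := fun b ⟨n1, n2, n3⟩ =>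
      hf.w b (by simp [addFace, toggleOff, n1, n2, n3])
    have hh' : G.Holds s' := hh.congr (fun b hb => w b (by omega))
      (hf.r _ (by simp [addFace, toggleOff]))
    have hiff : ∀ c, c < k + 1 ↔ c < k ∨ c = k := by omega
    have key : ∀ s'' v, AddCol N k v s' s'' → v = G.triOff (G.idxOf s) T k →
        (∀ a, s''.words bkMat a < 2) ∧
        ∀ c < N, col s'' N c = if c < k + 1 then G.triOff (G.idxOf s) T c else 0 := by
      rintro s'' v h hv; refine ⟨h.bit, fun c hc => ?_⟩; by_cases hck : c = k
      · subst hck; rw [h.same, h2 c hc, if_neg (by omega), zero_add, if_pos (by omega), hv]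
      · rw [h.other c hc hck, h2 c hc]
        have : c < k + 1 ↔ c < k := by omega
        simp only [this]
    refine Tri.ite (T1 := 180) (fun hc => ?_) (fun hc => ?_) (by decide)
    · have hcard : G.card k = 3 := by rw [Test.holds_eq] at hc; simpa [hv, hh'.card] using hc
      have htri : G.IsTri k := ⟨hk, hcard⟩; obtain ⟨⟨p1, -⟩, -, -⟩ := hF.face01 k htri
      obtain ⟨⟨q1, -⟩, -, -⟩ := hF.face02 k htri; obtain ⟨⟨r1, -⟩, -, -⟩ := hF.face12 k htri
      have hface : ∀ (s1 : State) (e : Expr) (u v : ℕ), e.val s1 = u * G.m + v →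
          (∀ b, b ≠ bkMat ∧ b ≠ bkEdge → s1.words b = s'.words b) → (∀ a, s1.words bkMat a < 2) →
          G.idxOf s u v < G.n → Tri B (addFace e) s1 (e.cost + 50)
            (AddCol N k (singleOff T (G.idxOf s u v)) s1) := by
        intro s1 e u v he hs1 hbit hlt
        have h3 : s1.words bkIdx (u * G.m + v) - 1 = G.idxOf s u v := by
          rw [hs1 _ (by decide), w _ (by decide)]; rfl
        rw [← h3]
        refine addFace_spec (by rw [hs1 _ (by decide), w _ (by decide), hN]) he (by rw [hs1 _ (by decide), hv]) (by omega) (by omega)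
          h1B (fun i => ?_) hbit
        rw [hs1 _ (by decide), w _ (by decide)]; exact hT i
      refine Tri.seq (T1 := 60) (T2 := 120) (hface s' _ (G.v0 k) (G.v1 k) (by
        simp [hv, hh'.v0, hh'.v1, hh'.m]) (fun _ _ => rfl) h1 p1) ?_ (by omega)
      intro s1 f1 a1
      have w1 : ∀ b, b ≠ bkMat ∧ b ≠ bkEdge → s1.words b = s'.words b := fun b ⟨n1, n2⟩ =>
        f1.w b (by simp [addFace, toggleOff, n1, n2])
      refine Tri.seq (T1 := 60) (T2 := 60) (hface s1 _ (G.v0 k) (G.v2 k) (by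
        simp [w1, hv, hh'.v0, hh'.v2, hh'.m]) w1 a1.bit q1) ?_ (by omega)
      intro s2 f2 a2
      have w2 : ∀ b, b ≠ bkMat ∧ b ≠ bkEdge → s2.words b = s'.words b := fun b ⟨n1, n2⟩ =>
        (f2.w b (by simp [addFace, toggleOff, n1, n2])).trans (w1 b ⟨n1, n2⟩)
      refine Tri.mono (hface s2 _ (G.v1 k) (G.v2 k) (by
        simp [w2, hv, hh'.v1, hh'.v2, hh'.m]) w2 a2.bit r1) (by decide) ?_
      intro s3 f3 a3; refine key s3 _ (((a1.trans a2).trans a3)) ?_; ext i; classical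
      have hs : ∀ e, singleOff T e i = if i ∉ T then (Pi.single e 1 : Vec) i else 0 := by
        intro e; unfold singleOff; by_cases heT : e ∈ T <;> by_cases hie : i = e
        · subst hie; simp [heT]
        · simp [heT, hie]
        · subst hie; simp [heT]
        · simp [heT, hie]
      simp only [Pi.add_apply, hs, triOff, tri]; by_cases hiT : i ∈ T <;> simp [hiT, htri]
    · have hcard : G.card k ≠ 3 := by rw [Test.holds_eq] at hc; simpa [hv, hh'.card] using hc
      refine Tri.block (fun _ => by simp) (key _ 0 ⟨h1, by simp, fun _ _ _ => rfl⟩ ?_) (by decide)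
      ext i; have : ¬ G.IsTri k := fun h => hcard h.2; simp [triOff, this]
  -- The columns from n to N - 1 only pad the order to a power of two. They are zero, and so is
  -- `triOff` there.
  · rintro s' hf _ ⟨h1, h2⟩; refine ⟨h1, fun c hc => ?_⟩; rw [h2 c hc]; split_ifs with h
    · rfl
    · ext i; have : ¬ G.IsTri c := fun h' => h h'.1; simp [triOff, this]

/-- Eliminate the boundary matrix. -/
def boundaryElim (P : Program) (c : ℕ) : Program :=
  markTree ;; powLoop bkN numS ;; fillBoundary ;; eliminate P c

theorem boundaryElim_wr {P : Program} {c b : ℕ} (h : (boundaryElim P c).wr b) :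
    b = bkItem ∨ b = bkTree ∨ b = bkEdge ∨ (40 ≤ b ∧ b ≤ 52) ∨ 100 ≤ b := by
  simp only [boundaryElim, markTree, fillBoundary, addFace, toggleOff, Program.wr, forLoop_wr,
    powLoop_wr] at h
  by_cases he : (eliminate P c).wr b
  · have := eliminate_wr he; omega
  · simp only [he, or_false] at h; omega

theorem boundaryElim_wrR {P : Program} {c b : ℕ} (h : (boundaryElim P c).wrR b) : 100 ≤ b := by
  simp [boundaryElim, markTree, fillBoundary, addFace, toggleOff, powLoop_wrR] at h
  exact eliminate_wrR h

theorem boundaryElim_spec {P : Program} {c Tel : ℕ} {τ : ℕ → ℕ} (hP : Multiplies P c τ)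
    (hc : 2 ≤ c) (hG : G.Good) (hF : G.Faces (G.idxOf s)) (hh : G.Holds s)
    (hB : 2 * (2 * G.n + 1) * ((2 * G.n + 1) * (2 * G.n + 3) ^ c) < B)
    (hTel : ∀ K, 2 ^ K ≤ 2 * G.n + 1 → elimTime τ c (2 ^ K) K ≤ Tel)
    (hz : ∀ b, b = bkTree ∨ b = bkMat ∨ b = bkBase → ∀ a, s.words b a = 0) (hfresh : Fresh s) :
    Tri B (boundaryElim P c) s (Tel + G.n * 1000 + 1000) (fun s' => ∃ N, G.n ≤ N ∧
      N ≤ 2 * G.n + 1 ∧ Valid N s' ∧ (∀ i, s'.words bkTree i ≠ 0 ↔ i ∈ G.treeOf s) ∧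
      Elim N (fun _ => False) 0 N (G.triOff (G.idxOf s) (G.treeOf s)) (col s' N) (s'.words bkPiv) ∧
      (∀ r < N, s'.words bkUsed r ≠ 0 ↔ ∃ t < N, s'.words bkPiv t = r + 1) ∧
      s'.words bkBase 0 ≤ 2 * N * (N * (N + 2) ^ c)) := by
  set L := (2 * G.n + 1) * (2 * G.n + 3) ^ c with hL
  have hL1 : 2 * G.n + 1 ≤ L := Nat.le_mul_of_pos_right _ (by positivity)
  have hnB : 2 * G.n + 2 < B := by nlinarith
  refine Tri.seq (T1 := G.m * 30 + 20) (T2 := Tel + G.n * 900 + 900)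
    (markTree_spec hh (by have := hG.m_le; omega) (hz _ (Or.inl rfl))) ?_
    (by have := hG.m_le; omega)
  intro s1 f1 h1
  have w1 : ∀ b, b ≠ bkItem ∧ b ≠ bkTree → s1.words b = s.words b := fun b ⟨n1, n2⟩ =>
    f1.w b (by simp [markTree, n1, n2])
  refine Tri.seq (T1 := G.n * 20 + 20) (T2 := Tel + G.n * 800 + 800)
    (Tri.mono (powLoop_spec (x := G.n) (by omega) fun s' hf => ?_) (by
      change G.n * (2 + 10) + (2 + 10) ≤ _; omega) fun _ _ h => h) ?_ (by omega)
  · simp [hf.w 0 (by simp [powLoop]), w1, hh.n]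
  rintro s2 f2 ⟨κ, hN, hnN, hNn, -⟩
  have w2 : ∀ b, b ≠ bkItem ∧ b ≠ bkTree ∧ b ≠ bkN → s2.words b = s.words b := fun b ⟨n1, n2, n3⟩ =>
    (f2.w b (by simp [powLoop_wr, n3])).trans (w1 b ⟨n1, n2⟩)
  have r2 : s2.reals = s.reals := by
    funext b; rw [f2.r b (by simp [powLoop_wrR]), f1.r b (by simp [markTree])]
  have hidx : G.idxOf s2 = G.idxOf s := by funext u v; simp only [idxOf]; rw [w2 _ (by decide)]
  have hspace : elimSpace c (2 ^ κ) κ ≤ 2 * 2 ^ κ * (2 ^ κ * (2 ^ κ + 2) ^ c) :=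
    (Nat.le_add_right _ _).trans (elimSpace_le rfl κ le_rfl)
  have hbase : s.words bkBase 0 = 0 := hz _ (by simp) 0
  have hLe : 2 * 2 ^ κ * (2 ^ κ * (2 ^ κ + 2) ^ c) ≤ 2 * (2 * G.n + 1) * L :=
    Nat.mul_le_mul (by omega) (Nat.mul_le_mul hNn (Nat.pow_le_pow_left (by omega) _))
  refine Tri.seq (T1 := G.n * 250 + 20) (T2 := Tel + G.n * 500 + 700)
    (fillBoundary_spec (N := 2 ^ κ) (T := G.treeOf s) (hidx ▸ hF)
      (hh.congr (fun b hb => w2 b (by omega)) (by rw [r2])) hnN (by omega)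
      (by omega) hN (fun i => by rw [f2.w _ (by simp [powLoop_wr]), h1])
      (fun a => by rw [w2 _ (by decide), hz _ (by simp)])) ?_ (by omega)
  rintro s3 f3 ⟨hbit, hcol⟩; rw [hidx] at hcol
  have w3 : ∀ b, b ≠ bkItem ∧ b ≠ bkMat ∧ b ≠ bkEdge → s3.words b = s2.words b := fun b ⟨n1, n2, n3⟩ =>
    f3.w b (by simp [fillBoundary, addFace, toggleOff, n1, n2, n3])
  have b3 : s3.words bkBase = s.words bkBase := by rw [w3 _ (by decide), w2 _ (by decide)]
  refine Tri.mono (eliminate_spec hP hc (N := 2 ^ κ) (K := κ) rfl (by omega) ⟨?_, hbit, ?_⟩ ?_) ?_ ?_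
  · rw [w3 _ (by decide), hN]
  · intro b a hb ha; rw [b3] at ha
    rw [w3 _ (by omega), w2 _ (by omega), f3.r _ (by simp [fillBoundary, addFace, toggleOff]), r2]
    exact hfresh b a hb ha
  · rw [b3, hbase]; omega
  · have := hTel κ hNn; omega
  · rintro s4 f4 ⟨hv, hE, hu, hb⟩
    refine ⟨2 ^ κ, hnN, hNn, hv, fun i => ?_, hE.congr (fun _ => Iff.rfl)
      (fun t _ ht => (hcol t ht).symm) (fun _ _ _ => rfl) (fun _ _ _ => rfl), hu, ?_⟩
    · rw [f4.w _ fun h => by have := eliminate_wr h; omega,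
        w3 _ (by decide), f2.w _ (by simp [powLoop_wr]), h1]
    · rw [b3, hbase] at hb; omega

end Net

/-! ## Annotations of the edges -/

namespace Net

open RAM GaussJordan

notation "bkRows" => 81
notation "bkAnn" => 84

variable {G : Net} {B N g : ℕ} {s : State} {T : Set ℕ} {r piv : ℕ → ℕ} {U : ℕ → Vec}

/-- Collect the edges outside of the tree that are not pivots. -/
def collect : Program := forLoop bkItem numS (.ite (.and (.eq (.get bkCard (var bkItem)) 2)
    (.and (.wordLe (.get bkTree (var bkItem)) 0) (.wordLe (.get bkUsed (var bkItem)) 0)))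
    (.setWord bkRows (var 2) (var bkItem) ;; assign 2 (var 2 + 1)) .skip)

theorem collect_spec (hh : G.Holds s) (hnN : G.n ≤ N) (hnB : G.n + 1 < B) (h0 : s.words 2 0 = 0)
    (hT : ∀ i, s.words bkTree i ≠ 0 ↔ i ∈ T)
    (hu : ∀ i < N, s.words bkUsed i ≠ 0 ↔ ∃ t < N, s.words bkPiv t = i + 1) :
    Tri B collect s (G.n * 60 + 20) (fun s' => s'.words 2 0 ≤ G.n ∧
      G.Coords T N (s.words bkPiv) (s'.words 2 0) (s'.words bkRows)) := by
  set sel : ℕ → Prop := fun i => G.card i = 2 ∧ i ∉ T ∧ ∀ t < N, s.words bkPiv t ≠ i + 1 with hsel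
  refine Tri.forLoop (N := G.n) (Tb := 40) (fun k s' => s'.words 2 0 ≤ k ∧
      (∀ a < s'.words 2 0, s'.words bkRows a < k ∧ sel (s'.words bkRows a)) ∧
      (∀ a b, a < s'.words 2 0 → b < s'.words 2 0 → s'.words bkRows a = s'.words bkRows b → a = b) ∧
      ∀ i < k, sel i → ∃ a < s'.words 2 0, s'.words bkRows a = i) (by simp) (by omega) ?_ ?_ ?_ ?_
    (mul_add_le (by decide) (by decide)) ?_
  · intro s' hf; simp [hf.w 0 (by simp), hh.n]
  · simp [h0]
  · intro k s' x h; simpa using h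
  · rintro k s' hk hv hf ⟨h1, h2, h3, h4⟩; have e1 := hf.w bkCard (by simp)
    have e2 := hf.w bkTree (by simp); have e3 := hf.w bkUsed (by simp)
    have hcond : (G.card k = 2 ∧ s.words bkTree k = 0 ∧ s.words bkUsed k = 0) ↔ sel k := by
      rw [hsel]; refine and_congr_right fun _ => and_congr ?_ ?_
      · rw [← hT]; simp
      · rw [← not_iff_not, ← ne_eq, hu k (by omega)]; simp
    have hc' : (Test.and (.eq (.get bkCard (var bkItem)) 2) (.and (.wordLe (.get bkTree (var bkItem))
        0) (.wordLe (.get bkUsed (var bkItem)) 0))).holds s' ↔ sel k := by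
      rw [← hcond]; simp [hv, e1, e2, e3, hh.card, ← le_antisymm_iff]
    refine Tri.ite (T1 := 15) (fun hs => ?_) (fun hs => ?_) (by decide)
    · rw [hc'] at hs
      refine Tri.mono (R := fun s'' => s''.words 2 0 = s'.words 2 0 + 1 ∧ ∀ a, s''.words bkRows a =
        if a = s'.words 2 0 then k else s'.words bkRows a) (Tri.block (fun _ => by simp [hv]; omega)
        (by simp [hv]) (by decide)) le_rfl ?_
      rintro s'' - ⟨hg, hr⟩; simp only [hg, hr]
      refine ⟨by omega, fun a ha => ?_, fun a b ha hb => ?_, fun i hi hsi => ?_⟩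
      · split_ifs with hag
        · exact ⟨by omega, hs⟩
        · have := h2 a (by omega); exact ⟨by omega, this.2⟩
      · split_ifs with hag hbg hbg
        · omega
        · intro h; have := h2 b (by omega); omega
        · intro h; have := h2 a (by omega); omega
        · exact h3 a b (by omega) (by omega)
      · rcases Nat.lt_succ_iff_lt_or_eq.1 hi with hi | rfl
        · obtain ⟨a, ha, he⟩ := h4 i hi hsi; exact ⟨a, by omega, by rw [if_neg (by omega), he]⟩
        · exact ⟨_, Nat.lt_succ_self _, if_pos rfl⟩
    · rw [hc'] at hs
      refine Tri.block (fun _ => by simp) ⟨(Nat.le_succ_of_le h1 :), fun a ha =>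
        ⟨(h2 a ha).1.trans (Nat.lt_succ_self k), (h2 a ha).2⟩, h3, fun i hi hsi => ?_⟩ (by decide)
      rcases Nat.lt_succ_iff_lt_or_eq.1 hi with hi | rfl
      · exact h4 i hi hsi
      · exact absurd hsi hs
  · rintro s' hf - ⟨h1, h2, h3, h4⟩
    exact ⟨h1, fun a ha => ⟨(h2 a ha).1, (h2 a ha).2.1⟩, fun a ha => (h2 a ha).2.2.1,
      fun a ha => (h2 a ha).2.2.2, h3, fun i hi hiT hp => h4 i hi.1 ⟨hi.2, hiT, hp⟩⟩

/-- Compute the coordinates of all edges. -/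
def annotate : Program :=
  forLoop bkItem (var 2) (.setWord bkAnn (.get bkRows (var bkItem) * var 2 + var bkItem) 1) ;;
  forLoop bkItem (var bkN) (.ite (.wordLe 1 (.get bkPiv (var bkItem)))
    (forLoop bkEdge (var 2) (.setWord bkAnn ((.get bkPiv (var bkItem) - 1) * var 2 + var bkEdge)
      (.get bkMat (.get bkRows (var bkEdge) * var bkN + var bkItem)))) .skip)

/-- The coordinates of the edges. -/
structure HoldsAnn (g : ℕ) (f : Vec →ₗ[ZMod 2] (Fin g → ZMod 2)) (s : State) : Prop where
  num : s.words 2 0 = g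
  bit : ∀ e, ∀ a < g, s.words bkAnn (e * g + a) < 2
  coord : ∀ e, ∀ a : Fin g, (s.words bkAnn (e * g + a) : ZMod 2) = f (Pi.single e 1) a

/-- The transform of the unit vector at an edge e is that vector itself if e is not a pivot row, and
gains the stored column t if e is the pivot row of t. Read off at the rows `r a`, this is a unit
vector for e = `r a`, a part of column t for a pivot row, and zero for all other e. -/
theorem annotate_spec (hC : G.Coords T N (s.words bkPiv) g (s.words bkRows)) (hnN : G.n ≤ N)
    (hB : N + g + 1 < B) (hv : Valid N s) (hg : s.words 2 0 = g) (hz : ∀ a, s.words bkAnn a = 0)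
    (huniq : ∀ t t', t < N → t' < N → s.words bkPiv t ≠ 0 → s.words bkPiv t = s.words bkPiv t' →
      t = t') : Tri B annotate s (g * 40 + N * (g * 40 + 40) + 40)
      (HoldsAnn g (coords N (col s N) (s.words bkPiv) g (s.words bkRows))) := by
  refine Tri.seq (T1 := g * 40 + 20) (T2 := N * (g * 40 + 40) + 20) (R := fun s' => ∀ e, ∀ a < g,
    s'.words bkAnn (e * g + a) = if e = s.words bkRows a then 1 else 0)
    (Tri.fillLoop (N := g) (fun x => s.words bkRows x * g + x) (fun _ => 1) (by decide) (by omega)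
      ?_ ?_ ?_ (by intros; omega) (mul_add_le (by decide) (by decide)) ?_) ?_ (by omega)
  · intro s' hf; simp [hf.w 2 (by simp), hg]
  · intro i s' hi hf hv _; simp [hf.w 2 (by simp), hf.w bkRows (by simp), hv, hg]
  · intro i j hij hj h; have := (idx_inj (by omega) hj h).2; omega
  · intro s' _ _ h1 h2 e a ha; split_ifs with he
    · rw [he, h1 a ha]
    · rw [h2, hz]; intro i hi h; obtain ⟨h3, h4⟩ := idx_inj ha hi h; exact he (h4 ▸ h3)
  intro s1 f1 h₁
  have w1 : ∀ b, b ≠ bkItem ∧ b ≠ bkAnn → s1.words b = s.words b := fun b ⟨n1, n2⟩ =>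
    f1.w b (by simp [n1, n2])
  have hkey : ∀ t < N, ∀ a : Fin g, s.words bkPiv t ≠ 0 →
      coords N (col s N) (s.words bkPiv) g (s.words bkRows)
        (Pi.single (s.words bkPiv t - 1) 1) a = s.words bkMat (s.words bkRows a * N + t) := by
    intro t ht a h0
    have hne : s.words bkRows a ≠ s.words bkPiv t - 1 := fun h =>
      hC.unused a a.2 t ht (by omega)
    rw [coords_apply, blk_apply, Pi.add_apply, Pi.single_eq_of_ne hne, zero_add, Finset.sum_apply,
      Finset.sum_eq_single t]
    · rw [if_neg h0, Pi.single_eq_same, one_smul, col, if_pos ((hC.edge a a.2).1.trans_le hnN)]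
    · intro t' ht' hne; rw [Finset.mem_Ico] at ht'; split_ifs with h0'
      · rfl
      · rw [Pi.single_eq_of_ne, zero_smul]; · rfl
        intro h; exact hne (huniq t' t ht'.2 ht h0' (by omega))
    · intro h; exact absurd (Finset.mem_Ico.2 ⟨Nat.zero_le _, ht⟩) h
  refine Tri.forLoop (N := N) (Tb := g * 40 + 25) (fun k s' =>
    (∀ t < k, s.words bkPiv t ≠ 0 → ∀ a < g, s'.words bkAnn ((s.words bkPiv t - 1) * g + a) =
      s.words bkMat (s.words bkRows a * N + t)) ∧ ∀ e, (∀ t < k, s.words bkPiv t ≠ e + 1) → ∀ a < g,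
      s'.words bkAnn (e * g + a) = if e = s.words bkRows a then 1 else 0) (by simp) (by omega)
    ?_ ?_ ?_ ?_ (Nat.add_le_add (Nat.mul_le_mul_left _ (by
      rw [show (var bkN).cost = 2 from rfl]; omega)) (by decide)) ?_
  · intro s' hf; rw [← hv.order, ← w1 bkN (by decide)]; exact congrFun (hf.w bkN (by simp)) 0
  · exact ⟨by omega, fun e _ => h₁ e⟩
  · intro k s' x h; simpa using h
  · rintro k s' hk hvk hf ⟨h1, h2⟩
    have w2 : ∀ b, b ≠ bkItem ∧ b ≠ bkAnn ∧ b ≠ bkEdge → s'.words b = s.words b := fun b ⟨n1, n2, n3⟩ =>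
      (hf.w b (by simp [n1, n2, n3])).trans (w1 b ⟨n1, n2⟩)
    have e1 := w2 bkPiv (by decide)
    refine Tri.ite (T1 := g * 40 + 20) (fun hc => ?_) (fun hc => ?_)
      (by rw [show (Test.wordLe 1 (.get bkPiv (var bkItem))).cost = 5 from rfl]; omega)
    · have hp : 1 ≤ s.words bkPiv k := by simpa [hvk, e1] using hc
      refine Tri.fillLoop (N := g) (fun a => (s.words bkPiv k - 1) * g + a)
        (fun a => s.words bkMat (s.words bkRows a * N + k)) (by decide) (by omega) ?_ ?_ ?_ ?_
        (mul_add_le (by decide) (by decide)) ?_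
      · intro s'' hf'; simp [hf'.w 2 (by simp), w2, hg]
      · intro i s'' hi hf' hvi _
        simp [hf'.w 2 (by simp), hf'.w bkPiv (by simp), hf'.w bkRows (by simp),
          hf'.w bkMat (by simp), hf'.w bkN (by simp), hf'.w bkItem (by simp), w2, hvk, hvi, hg,
          hv.order]
      · intro i j hij hj h; omega
      · intro _ i hi; have := hv.bit (s.words bkRows i * N + k); omega
      · intro s'' hf' _ h3 h4; refine ⟨fun t ht h0 a ha => ?_, fun e he a ha => ?_⟩
        · rcases Nat.lt_succ_iff_lt_or_eq.1 ht with ht' | rfl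
          · rw [h4, h1 t ht' h0 a ha]; intro i hi h; have h5 := (idx_inj ha hi h).1
            have := huniq t k (by omega) hk h0 (by omega); omega
          · exact h3 a ha
        · rw [h4, h2 e (fun t ht => he t (by omega)) a ha]; intro i hi h
          have h5 := (idx_inj ha hi h).1; exact he k (by omega) (by omega)
    · have hp : s.words bkPiv k = 0 := by simpa [hvk, e1] using hc
      refine Tri.block (fun _ => by simp) ⟨fun t ht h0 => ?_, fun e he => h2 e fun t ht =>
        he t (by omega)⟩ (by change 1 ≤ _; omega)
      rcases Nat.lt_succ_iff_lt_or_eq.1 ht with ht' | rfl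
      · exact h1 t ht' h0
      · exact absurd hp h0
  · rintro s' hf - ⟨h1, h2⟩; have hbit := hv.bit; refine ⟨?_, fun e a ha => ?_, fun e a => ?_⟩
    · rw [hf.w 2 (by simp), w1 2 (by decide), hg]
    · by_cases he : ∃ t < N, s.words bkPiv t = e + 1
      · obtain ⟨t, ht, he⟩ := he; have := h1 t ht (by omega) a ha
        rw [he, Nat.add_sub_cancel] at this; rw [this]; exact hbit _
      · push Not at he
        rw [h2 e he a ha]; split_ifs <;> omega
    · by_cases he : ∃ t < N, s.words bkPiv t = e + 1
      · obtain ⟨t, ht, he⟩ := he; have h3 := h1 t ht (by omega) a a.2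
        have h4 := hkey t ht a (by omega); rw [he, Nat.add_sub_cancel] at h3 h4; rw [h3, h4]
      · push Not at he
        rw [h2 e he a a.2, coords_apply, blk_eq_self, Pi.single_apply]
        · simp only [eq_comm]; split_ifs <;> simp
        · intro t _ ht h0; rw [Pi.single_eq_of_ne]; have := he t ht; omega

end Net

/-! ## Labels of the paths -/

namespace Net

open RAM GaussJordan

notation "bkLab" => 85
notation "bkVert" => 91
notation "bkDart" => 92
notation "bkTail" => 93

variable {G : Net} {B g : ℕ} {s : State} {f : Vec →ₗ[ZMod 2] (Fin g → ZMod 2)}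

/-- The tail of the dart `d`. -/
def tailExpr (d : Expr) : Expr := .get bkFst (d / 2) * (1 - d % 2) + .get bkSnd (d / 2) * (d % 2)

theorem tailExpr_val (hh : G.Holds s) {d : Expr} {x : ℕ} (hd : d.val s = x) :
    (tailExpr d).val s = G.tail x := by
  have : x % 2 = 0 ∨ x % 2 = 1 := by omega
  rcases this with h | h <;> simp [tailExpr, tail, hd, hh.v0, hh.v1, h]

/-- Compute the coordinates of the path from the root `bkSrc` to the vertex with the number
`bkItem + 1` in the order of the tree. -/
def labelStep : Program := (assign bkVert (.get bkOrd (var bkSrc * numV + (var bkItem + 1))) ;;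
  assign bkDart (.get bkPar (var bkSrc * numV + var bkVert)) ;;
  assign bkTail (tailExpr (var bkDart))) ;;
  forLoop bkEdge (var 2) (.setWord bkLab ((var bkSrc * numV + var bkVert) * var 2 + var bkEdge)
    ((.get bkLab ((var bkSrc * numV + var bkTail) * var 2 + var bkEdge) +
      .get bkAnn (var bkDart / 2 * var 2 + var bkEdge)) % 2))

/-- Compute the coordinates of all paths. -/
def labelAll : Program := forLoop bkSrc numV (forLoop bkItem (numV - 1) labelStep)

theorem labelAll_wr {b : ℕ} (h : labelAll.wr b) :
    b = bkSrc ∨ b = bkItem ∨ b = bkVert ∨ b = bkDart ∨ b = bkTail ∨ b = bkEdge ∨ b = bkLab := by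
  simp [labelAll, labelStep] at h; omega

theorem labelAll_wrR {b : ℕ} : labelAll.wrR b ↔ False := by simp [labelAll, labelStep]

/-- The row `x` of the labels holds the coordinates of `v`. -/
def HoldsLab (f : Vec →ₗ[ZMod 2] (Fin g → ZMod 2)) (s : State) (x : ℕ) (v : Vec) : Prop :=
  ∀ a : Fin g, s.words bkLab (x * g + a) < 2 ∧ (s.words bkLab (x * g + a) : ZMod 2) = f v a

theorem labelStep_spec {p j v d : ℕ} {z : Vec} (hh : G.Holds s) (ha : HoldsAnn g f s)
    (hgB : g < B) (hp : s.words bkSrc 0 = p) (hj : s.words bkItem 0 = j)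
    (hv : s.words bkOrd (p * G.m + (j + 1)) = v) (hd : s.words bkPar (p * G.m + v) = d)
    (htB : G.tail d < B) (hl : HoldsLab f s (p * G.m + G.tail d) z) :
    Tri B labelStep s (g * 70 + 100) (fun s' =>
      HoldsLab f s' (p * G.m + v) (Pi.single (d / 2) 1 + z) ∧
      ∀ x, (∀ a < g, x ≠ (p * G.m + v) * g + a) → s'.words bkLab x = s.words bkLab x) := by
  refine Tri.of_bdd fun hb => ?_
  refine Tri.seq (T1 := 60) (T2 := g * 70 + 30) (R := fun s' => s'.words bkVert 0 = v ∧
    s'.words bkDart 0 = d ∧ s'.words bkTail 0 = G.tail d) (Tri.block (fun _ => ?_) ?_ (by decide)) ?_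
    (by omega)
  · have h1 := hb bkOrd (p * G.m + (j + 1)); have h2 := hb bkPar (p * G.m + v); rw [hv] at h1
    rw [hd] at h2; simp only [Program.Safe, Program.exec]
    refine ⟨by simp [hp, hj, hh.m, hv, h1], by simp [hp, hj, hh.m, hv, hd, h2], ?_⟩
    rw [tailExpr_val (x := d) ?_ (by simp [hp, hj, hh.m, hv, hd])]
    · exact htB
    · exact hh.congr (fun b hb' => by
        rw [State.words_of_ne _ (by omega), State.words_of_ne _ (by omega)]) rfl
  · simp only [Program.exec]
    refine ⟨by simp [hp, hj, hh.m, hv], by simp [hp, hj, hh.m, hv, hd], ?_⟩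
    rw [State.words_same, if_pos (by rfl), tailExpr_val (x := d) ?_
      (by simp [hp, hj, hh.m, hv, hd])]
    exact hh.congr (fun b hb' => by
        rw [State.words_of_ne _ (by omega), State.words_of_ne _ (by omega)]) rfl
  rintro s1 f1 ⟨e1, e2, e3⟩
  have w1 : ∀ b, b ≠ bkVert ∧ b ≠ bkDart ∧ b ≠ bkTail → s1.words b = s.words b := fun b ⟨n1, n2, n3⟩ =>
    f1.w b (by simp [n1, n2, n3])
  refine Tri.fillLoop (N := g) (fun a => (p * G.m + v) * g + a) (fun a =>
    (s.words bkLab ((p * G.m + G.tail d) * g + a) + s.words bkAnn (d / 2 * g + a)) % 2) (by decide)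
    hgB ?_ ?_ (fun i j hij _ h => by omega) (fun _ i _ => by omega)
    (mul_add_le (by decide) (by decide)) ?_
  · intro s' hf; simp [hf.w 2 (by simp), w1, ha.num]
  · intro i s' hi hf hvi hun
    have := hun ((p * G.m + G.tail d) * g + i) fun k hk h =>
      absurd (idx_inj hi (hk.trans hi) h).2 (by omega)
    simp [hf.w 2 (by simp), hf.w bkSrc (by simp), hf.w 0 (by simp), hf.w bkAnn (by simp),
      hf.w bkVert (by simp), hf.w bkTail (by simp), hf.w bkDart (by simp), w1, ha.num, hvi, hp, e1,
      e2, e3, hh.m, this]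
  · intro s' hf _ h1 h2; refine ⟨fun a => ?_, fun x hx => ?_⟩
    · rw [h1 a a.2]; refine ⟨by omega, ?_⟩
      rw [ZMod.natCast_mod, Nat.cast_add, (hl a).2, ha.coord, map_add, Pi.add_apply, add_comm]
    · rw [h2 x hx, w1 _ (by decide)]

theorem HoldsAnn.congr {s' : State} (h : HoldsAnn g f s) (h1 : s'.words 2 = s.words 2)
    (h2 : s'.words bkAnn = s.words bkAnn) : HoldsAnn g f s' :=
  ⟨by rw [h1, h.num], by rw [h2]; exact h.bit, by rw [h2]; exact h.coord⟩

/-- In the order of the tree, the parent's label is present when a vertex is treated, and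
`SPTree.path_ord` adds the label of one edge. The root keeps the zero label that it has in the
cleared memory. -/
theorem labelAll_spec (hG : G.Good) (hh : G.Holds s) (ha : HoldsAnn g f s) (hB : G.m + 1 < B)
    (hgB : g < B) (hT : ∀ p < G.m, G.HoldsTree p s) (hz : ∀ x, s.words bkLab x = 0) :
    Tri B labelAll s (G.m * (G.m * (g * 70 + 120) + 40) + 20) (fun s' =>
      ∀ p < G.m, ∀ v < G.m, HoldsLab f s' (p * G.m + v) (G.path p (G.parOf s p) v)) := by
  refine Tri.forLoop (N := G.m) (Tb := G.m * (g * 70 + 120) + 20) (fun p s' =>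
    (∀ q < p, ∀ v < G.m, HoldsLab f s' (q * G.m + v) (G.path q (G.parOf s q) v)) ∧
    ∀ q, p ≤ q → ∀ v < G.m, ∀ a < g, s'.words bkLab ((q * G.m + v) * g + a) = 0)
    (by simp [labelStep]) (by omega) ?_ ?_ ?_ ?_
    (Nat.add_le_add (Nat.mul_le_mul_left _ (by
      rw [show numV.cost = 2 from rfl]; omega)) (by decide)) ?_
  · intro s' hf; simp [hf.w 0 fun h => by have := labelAll_wr h; omega, hh.m]
  · exact ⟨by omega, fun q _ v _ a _ => hz _⟩
  · rintro p s' x h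
    simpa only [HoldsLab, State.words_of_ne _ (show (bkLab : ℕ) ≠ bkSrc by decide)] using h
  · rintro p s' hp hv hf ⟨h1, h2⟩; have hS := hT p hp
    have w' : ∀ b, ¬ labelAll.wr b → s'.words b = s.words b := hf.w
    refine Tri.forLoop (N := G.m - 1) (Tb := g * 70 + 100) (fun j s'' =>
      (∀ i ≤ j, i < G.m → HoldsLab f s'' (p * G.m + G.ordOf s p i)
        (G.path p (G.parOf s p) (G.ordOf s p i))) ∧ ∀ q ≠ p, ∀ v < G.m, ∀ a < g,
        s''.words bkLab ((q * G.m + v) * g + a) = s'.words bkLab ((q * G.m + v) * g + a))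
      (by simp [labelStep]) (by omega) ?_ ?_ ?_ ?_
      ((Nat.add_le_add (Nat.mul_le_mul_left _ (by
        rw [show (numV - 1).cost = 4 from rfl])) (by decide)).trans
        (Nat.add_le_add_right (Nat.mul_le_mul (Nat.sub_le _ _)
          (show g * 70 + 100 + (4 + 10) ≤ g * 70 + 120 by omega)) _)) ?_
    · intro s'' hf'
      simp [hf'.w 0 (by simp [labelStep]), w' 0 (fun h => by have := labelAll_wr h; omega), hh.m]
    · refine ⟨fun i hi _ a => ?_, fun _ _ _ _ _ _ => rfl⟩
      obtain rfl : i = 0 := by omega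
      have h0 : G.ordOf s p 0 = p := hS.ord_zero; rw [h0, h2 p le_rfl p hp a a.2, path_root]; simp
    · rintro j s'' x h
      simpa only [HoldsLab, State.words_of_ne _ (show (bkLab : ℕ) ≠ bkItem by decide)] using h
    · rintro j s'' hj hvj hf' ⟨h3, h4⟩
      have w'' : ∀ b, ¬ labelAll.wr b → s''.words b = s.words b := fun b hb =>
        (hf'.w b fun h => hb (Or.inr (Or.inl (by simpa using h)))).trans (w' b hb)
      have hnw : ∀ b, b ≠ bkSrc ∧ b ≠ bkItem ∧ b ≠ bkVert ∧ b ≠ bkDart ∧ b ≠ bkTail ∧ b ≠ bkEdge ∧ b ≠ bkLab → s''.words b = s.words b := fun b ⟨_, _, _, _, _, _, _⟩ => w'' b fun h => by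
        have := labelAll_wr h; omega
      obtain ⟨t1, t2, ⟨j', hj', t3⟩, t4⟩ := hS.tree (j + 1) (by omega) (by omega)
      have hpath := hS.path_ord (j := j + 1) (by omega) (by omega)
      refine Tri.mono (labelStep_spec (G := G) (p := p) (j := j) (v := G.ordOf s p (j + 1))
        (d := G.parOf s p (G.ordOf s p (j + 1)))
        (z := G.path p (G.parOf s p) (G.tail (G.parOf s p (G.ordOf s p (j + 1)))))
        (hh.congr (fun b hb => w'' b fun h => by have := labelAll_wr h; omega) ?_) (ha.congr
          (w'' _ fun h => by have := labelAll_wr h; omega)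
          (w'' _ fun h => by have := labelAll_wr h; omega)) hgB ?_ hvj ?_ ?_ ?_ ?_) le_rfl ?_
      · rw [hf'.r 0 (by simp [labelStep]), hf.r 0 (by simp [labelStep])]
      · rw [hf'.w _ (by simp [labelStep]), hv]
      · rw [w'' _ fun h => by have := labelAll_wr h; omega]; rfl
      · rw [w'' _ fun h => by have := labelAll_wr h; omega]; rfl
      · exact (hG.tail_lt t1).trans (by omega)
      · exact t3 ▸ h3 j' (by omega) (by omega)
      · rintro s3 f3 ⟨h5, h6⟩; refine ⟨fun i hi him => ?_, fun q hq v hv a ha => ?_⟩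
        · by_cases hij : i = j + 1
          · subst hij; exact hpath ▸ h5
          · intro a; rw [h6]
            · exact h3 i (by omega) him a
            · intro b hb h; have := (idx_inj a.2 hb h).1
              exact hij (hS.ord_inj i (j + 1) him (by omega)
                (show G.ordOf s p i = G.ordOf s p (j + 1) by omega))
        · rw [h6, h4 q hq v hv a ha]; intro b hb h
          exact hq (idx_inj hv (hS.ord_lt _ (by omega)) (idx_inj ha hb h).1).1
    · rintro s'' hf' - ⟨h3, h4⟩; refine ⟨fun q hq v hvm a => ?_, fun q hq v hv a ha => ?_⟩
      · by_cases hqp : q = p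
        · subst hqp; obtain ⟨i, hi, rfl⟩ := hS.ord_surj v hvm; exact h3 i (by omega) hi a
        · rw [h4 q hqp v hvm a a.2]; exact h1 q (by omega) v hvm a
      · rw [h4 q (by omega) v hv a ha, h2 q (by omega) v hv a ha]
  · rintro s' hf _ ⟨h1, -⟩; exact h1

end Net

/-! ## Sorting the candidates -/

namespace Net

open RAM Tournament

notation "bkList" => 86
notation "bkLen" => 87

variable {G : Net} {B κ : ℕ} {s : State}

/-- The number `p * n + e` stands for the candidate with the root `p` and the edge `e`.  Insert all
candidates into the queue. -/
def insertCands : Program :=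
  forLoop bkItem (numV * numS) (.ite (.eq (.get bkCard (var bkItem % numS)) 2)
    (.setReal rbKey (var bkItem) (.add (.add
      (.get rbDist (var bkItem / numS * numV + .get bkFst (var bkItem % numS)))
      (.get 0 (var bkItem % numS)))
      (.get rbDist (var bkItem / numS * numV + .get bkSnd (var bkItem % numS)))) ;;
    assign bkLeaf (var bkItem) ;; insertLeaf) .skip)

/-- Move the candidates from the queue to the list. -/
def extractCands : Program :=
  .loop (.wordLe 1 (.get bkBest 1)) ((.setWord bkList (var bkLen) (.get bkBest 1) ;;
    assign bkLeaf (.get bkBest 1 - 1) ;; assign bkLen (var bkLen + 1)) ;; removeLeaf)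

/-- The numbers of the candidates. -/
def candCodes (G : Net) (k : ℕ) : Finset ℕ := (Finset.range k).filter fun q => G.card (q % G.n) = 2

/-- The length of the candidate `q`. -/
noncomputable def codeKey (G : Net) (s : State) (q : ℕ) : ℝ :=
  G.candKey (G.distOf s (q / G.n)) (q % G.n)

theorem insertCands_spec (hh : G.Holds s) (hκ : G.m * G.n < 2 ^ κ) (hB : 2 * 2 ^ κ < B)
    (hq : Queue κ ∅ s) : Tri B insertCands s (G.m * G.n * (κ * 100 + 200) + 20) (fun s' =>
      Queue κ (G.candCodes (G.m * G.n)) s' ∧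
      ∀ q ∈ G.candCodes (G.m * G.n), s'.reals rbKey q = G.codeKey s q) := by
  have hwr : ∀ b, insertCands.wr b → b = bkItem ∨ b = bkLeaf ∨ b = bkBest ∨ b = bkNode := by
    intro b h; simp [insertCands, insertLeaf_wr] at h; omega
  have hwrR : ∀ b, insertCands.wrR b → b = rbKey := by
    intro b h; simpa [insertCands, insertLeaf_wrR] using h
  refine Tri.forLoop (N := G.m * G.n) (Tb := κ * 100 + 180) (fun k s' =>
      Queue κ (G.candCodes k) s' ∧ ∀ q ∈ G.candCodes k, s'.reals rbKey q = G.codeKey s q)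
    (by simp [insertLeaf_wr]) (by omega) ?_ ?_ ?_ ?_
    (Nat.add_le_add (Nat.mul_le_mul_left _ (by
      rw [show (numV * numS).cost = 5 from rfl]; omega)) (by decide)) (fun _ _ _ h => h)
  · intro s' hf; simp [hf.w 0 fun h => by have := hwr 0 h; omega, hh.m, hh.n]
  · exact ⟨by simpa [candCodes] using hq, by simp [candCodes]⟩
  · rintro k s' x ⟨h1, h2⟩; exact ⟨h1.congr (by simp) (by simp) rfl, h2⟩
  · rintro k s' hk hv hf ⟨h1, h2⟩
    have w' : ∀ b, b ≠ bkItem ∧ b ≠ bkLeaf ∧ b ≠ bkBest ∧ b ≠ bkNode → s'.words b = s.words b :=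
      fun b ⟨_, _, _, _⟩ => hf.w b fun h => by have := hwr b h; omega
    have hd := hf.r rbDist fun h => by have := hwrR _ h; omega
    have hw := hf.r 0 fun h => by have := hwrR _ h; omega
    have hh' : G.Holds s' := hh.congr (fun b hb => w' b (by omega)) hw
    refine Tri.ite (T1 := κ * 100 + 150) (fun hc => ?_) (fun hc => ?_) (by
      rw [show (Test.eq (.get bkCard (var bkItem % numS)) 2).cost = 17 from rfl]; omega)
    · have hc' : G.card (k % G.n) = 2 := by
        rw [Test.holds_eq] at hc; simpa [hv, hh'.n, hh'.card] using hc
      have hins : G.candCodes (k + 1) = insert k (G.candCodes k) := by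
        rw [candCodes, Finset.range_add_one, Finset.filter_insert, if_pos hc', candCodes]
      have hkn : k ∉ G.candCodes k := by simp [candCodes]
      refine Tri.seq (T1 := 60) (T2 := κ * 100 + 60) (R := fun s'' => s'' =
        s'.writeReal rbKey k (G.codeKey s k)) (Tri.block (fun _ => by simp) ?_ (by decide)) ?_
        (by omega)
      · simp [hv, hh'.n, hh'.m, hh'.v0, hh'.v1, hh'.w, hd, codeKey, candKey, distOf, row]
      rintro s1 - rfl
      refine Tri.seq (T1 := 5) (T2 := κ * 100 + 50) (R := fun s'' => s'' =
        (s'.writeReal rbKey k (G.codeKey s k)).writeWord bkLeaf 0 k) (Tri.block (fun _ => by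
        simp [hv]; omega) (by simp [hv]) (by decide)) ?_ (by omega)
      rintro s2 - rfl
      refine Tri.mono (insertLeaf_spec (l := k) (act := G.candCodes k) ((h1.writeKey hkn (G.codeKey s k)).congr
        (by simp) (by simp) (by simp)) (by simp) (by omega) hB) le_rfl ?_
      intro s3 f3 h3; refine ⟨hins ▸ h3, fun q hq => ?_⟩
      rw [f3.r _ (by simp [insertLeaf_wrR]), State.reals_writeWord, State.reals_writeReal_same]
      split_ifs with hqk
      · rw [hqk]
      · rw [hins, Finset.mem_insert] at hq; exact h2 q (hq.resolve_left hqk)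
    · have hc' : ¬ G.card (k % G.n) = 2 := by
        rw [Test.holds_eq] at hc; simpa [hv, hh'.n, hh'.card] using hc
      have hins : G.candCodes (k + 1) = G.candCodes k := by
        rw [candCodes, Finset.range_add_one, Finset.filter_insert, if_neg hc', candCodes]
      exact Tri.block (fun _ => by simp) (by rw [hins]; exact ⟨h1, h2⟩) (by change 1 ≤ _; omega)

/-- The memory `s` holds the list of all candidates, in the order of the lengths `key`. -/
structure HoldsList (key : ℕ → ℝ) (act : Finset ℕ) (s : State) : Prop where
  mem : ∀ x < s.words bkLen 0, 1 ≤ s.words bkList x ∧ s.words bkList x - 1 ∈ act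
  surj : ∀ q ∈ act, ∃ x < s.words bkLen 0, s.words bkList x = q + 1
  sorted : ∀ x y, x ≤ y → y < s.words bkLen 0 →
    key (s.words bkList x - 1) ≤ key (s.words bkList y - 1)
  out : ∀ x, s.words bkLen 0 ≤ x → s.words bkList x = 0
  le : s.words bkLen 0 ≤ act.card

theorem HoldsList.congr {key : ℕ → ℝ} {act : Finset ℕ} {s' : State} (h : HoldsList key act s)
    (h1 : s'.words bkLen = s.words bkLen) (h2 : s'.words bkList = s.words bkList) :
    HoldsList key act s' := by
  constructor <;> rw [h1]
  · rw [h2]; exact h.mem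
  · rw [h2]; exact h.surj
  · rw [h2]; exact h.sorted
  · rw [h2]; exact h.out
  · exact h.le

/-- Heap sort; the invariant is that no listed key exceeds a key still in the queue. Codes are
stored increased by one, so that the zeros beyond the end of the list denote no candidate. -/
theorem extractCands_spec {act : Finset ℕ} (hB : 2 * 2 ^ κ < B) (hq : Queue κ act s)
    (hlen : s.words bkLen 0 = 0) (hlist : ∀ x, s.words bkList x = 0) (hc : act.card + 1 < B) :
    Tri B extractCands s (act.card * (κ * 100 + 100) + 20) (HoldsList (s.reals rbKey) act) := by
  have hcost : (Test.wordLe 1 (.get bkBest 1)).cost = 4 := rfl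
  refine Tri.loop (f := act.card) (T1 := κ * 100 + 90) (fun f s' => ∃ act' ⊆ act, act'.card = f ∧
    Queue κ act' s' ∧ s'.words bkLen 0 + f = act.card ∧
    (∀ x < s'.words bkLen 0, 1 ≤ s'.words bkList x ∧ s'.words bkList x - 1 ∈ act ∧
      ∀ q ∈ act', s.reals rbKey (s'.words bkList x - 1) ≤ s.reals rbKey q) ∧
    (∀ q ∈ act, q ∉ act' → ∃ x < s'.words bkLen 0, s'.words bkList x = q + 1) ∧
    (∀ x y, x ≤ y → y < s'.words bkLen 0 →
      s.reals rbKey (s'.words bkList x - 1) ≤ s.reals rbKey (s'.words bkList y - 1)) ∧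
    ∀ x, s'.words bkLen 0 ≤ x → s'.words bkList x = 0) ?_ ?_ ?_ (by
      rw [hcost]
      exact Nat.add_le_add (Nat.mul_le_mul_left _ (by omega)) (by omega)) ?_
  · exact ⟨act, subset_rfl, rfl, hq, by omega, by omega, fun q h h' => absurd h h', by omega,
      fun x _ => hlist x⟩
  · rintro s' - ⟨act', -, h0, h1, -⟩; rcases h1.root with ⟨h, -⟩ | ⟨l, hl, -⟩
    · simp [h]
    · rw [Finset.card_eq_zero.1 h0] at hl; simp at hl
  · rintro f s' hf ⟨act', hsub, h0, h1, h2, h3, h4, h5, h6⟩ hc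
    have hkey : s'.reals rbKey = s.reals rbKey := hf.r _ (by simp [removeLeaf_wrR])
    rcases h1.root with ⟨h, -⟩ | ⟨l, hl, hb, hmin⟩
    · simp [h] at hc
    rw [hkey] at hmin; have hlκ := h1.lt l hl
    refine Tri.seq (T1 := 40) (T2 := κ * 100 + 50) (R := fun s'' =>
      s''.words bkLeaf 0 = l ∧ s''.words bkLen 0 = s'.words bkLen 0 + 1 ∧
      ∀ x, s''.words bkList x = if x = s'.words bkLen 0 then l + 1 else s'.words bkList x)
      (Tri.block (fun _ => by simp [hb]; omega) (by simp [hb]) (by decide)) ?_ (by omega)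
    rintro s1 f1 ⟨e1, e2, e3⟩
    refine Tri.mono (removeLeaf_spec (l := l) (h1.congr (f1.w _ (by simp)) (f1.w _ (by simp))
      (f1.r _ (by simp))) e1 hlκ hB) le_rfl ?_
    intro s2 f2 h₂; have e4 : s2.words bkLen = s1.words bkLen := f2.w _ (by simp [removeLeaf_wr])
    have e5 : s2.words bkList = s1.words bkList := f2.w _ (by simp [removeLeaf_wr])
    refine ⟨act'.erase l, (Finset.erase_subset _ _).trans hsub, by
      rw [Finset.card_erase_of_mem hl]; omega, h₂, by rw [e4]; omega, ?_⟩
    simp only [e4, e5, e2, e3]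
    refine ⟨fun x hx => ?_, fun q hq hq' => ?_, fun x y hxy hy => ?_, fun x hx => ?_⟩
    · split_ifs with hxl
      · exact ⟨by omega, by simpa using hsub hl, fun q hq => hmin q (Finset.mem_of_mem_erase hq)⟩
      · obtain ⟨a1, a2, a3⟩ := h3 x (by omega)
        exact ⟨a1, a2, fun q hq => a3 q (Finset.mem_of_mem_erase hq)⟩
    · by_cases hql : q = l
      · exact ⟨_, Nat.lt_succ_self _, by rw [if_pos rfl, hql]⟩
      · obtain ⟨x, hx, he⟩ := h4 q hq fun h => hq' (Finset.mem_erase.2 ⟨hql, h⟩)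
        exact ⟨x, by omega, by rw [if_neg (by omega), he]⟩
    · split_ifs with hx hy' hy'
      · exact le_rfl
      · omega
      · exact (h3 x (by omega)).2.2 l hl
      · exact h5 x y hxy (by omega)
    · rw [if_neg (by omega)]; exact h6 x (by omega)
  · rintro f s' ⟨act', hsub, h0, h1, h2, h3, h4, h5, h6⟩ hc
    have : act' = ∅ := by
      rcases h1.root with ⟨-, h⟩ | ⟨l, hl, hb, -⟩
      · exact h
      · simp [hb] at hc
    subst this
    exact ⟨fun x hx => ⟨(h3 x hx).1, (h3 x hx).2.1⟩, fun q hq => h4 q hq (by simp), h5, h6, by omega⟩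

end Net

/-! ## Rounds of the greedy algorithm -/

namespace Net

open RAM GaussJordan

notation "bkCols" => 88
notation "bkNum" => 89
notation "bkDone" => 90

variable {G : Net} {B N g : ℕ} {s : State} {f : Vec →ₗ[ZMod 2] (Fin g → ZMod 2)}
  {par : ℕ → ℕ → ℕ}

/-- The candidate `q`. -/
noncomputable def codeCand (G : Net) (par : ℕ → ℕ → ℕ) (q : ℕ) : Vec :=
  G.cand (q / G.n) (par (q / G.n)) (q % G.n)

/-- The coordinates of the candidate `q - 1`. -/
noncomputable def colLab (G : Net) (f : Vec →ₗ[ZMod 2] (Fin g → ZMod 2)) (par : ℕ → ℕ → ℕ) (q : ℕ) :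
    Fin g → ZMod 2 := if q = 0 then 0 else f (G.codeCand par (q - 1))

/-- The memory `s` holds the coordinates of all edges and paths. -/
structure HoldsLabels (G : Net) (f : Vec →ₗ[ZMod 2] (Fin g → ZMod 2)) (par : ℕ → ℕ → ℕ)
    (s : State) : Prop where
  holds : G.Holds s
  ann : HoldsAnn g f s
  lab : ∀ p < G.m, ∀ v < G.m, HoldsLab f s (p * G.m + v) (G.path p (par p) v)

theorem HoldsLabels.congr {s' : State} (h : G.HoldsLabels f par s)
    (hw : ∀ b, b ≤ 11 ∨ b = bkAnn ∨ b = bkLab → s'.words b = s.words b)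
    (hr : s'.reals 0 = s.reals 0) : G.HoldsLabels f par s' := by
  refine ⟨h.holds.congr (fun b hb => hw b (by omega)) hr, h.ann.congr (hw _ (by simp))
    (hw _ (by simp)), ?_⟩
  unfold HoldsLab; rw [hw bkLab (by simp)]; exact h.lab

/-- The entry in row `r` of the column of the candidate `q - 1`. -/
def entryExpr (r q : Expr) : Expr :=
  (.get bkLab (((q - 1) / numS * numV + .get bkFst ((q - 1) % numS)) * var 2 + r) +
    .get bkAnn (((q - 1) % numS) * var 2 + r) +
    .get bkLab (((q - 1) / numS * numV + .get bkSnd ((q - 1) % numS)) * var 2 + r)) % 2 *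
  (1 - (r + 1 - var 2)) * (1 - (1 - q))

/-- Truncated subtraction replaces case distinctions: `1 - (r + 1 - g)` is 1 exactly for r < g, and
`1 - (1 - q)` is 1 exactly for q ≠ 0. The sum of three bits is the label of the candidate by
linearity. -/
theorem entryExpr_val (hG : G.Good) (h : G.HoldsLabels f par s) {r q : Expr} {i x : ℕ}
    (hr : r.val s = i) (hq : q.val s = x) (hx : x = 0 ∨ x - 1 ∈ G.candCodes (G.m * G.n)) :
    (entryExpr r q).val s < 2 ∧ (((entryExpr r q).val s : ℕ) : ZMod 2) =
      Function.ExtendByZero.linearMap (ZMod 2) (Fin.val : Fin g → ℕ) (G.colLab f par x) i := by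
  have hval : ∃ y < 2, (entryExpr r q).val s = y * (1 - (i + 1 - g)) * (1 - (1 - x)) ∧
      y = (s.words bkLab (((x - 1) / G.n * G.m + G.v0 ((x - 1) % G.n)) * g + i) +
        s.words bkAnn ((x - 1) % G.n * g + i) +
        s.words bkLab (((x - 1) / G.n * G.m + G.v1 ((x - 1) % G.n)) * g + i)) % 2 :=
    ⟨_, Nat.mod_lt _ (by norm_num), by
      simp [entryExpr, hr, hq, h.holds.m, h.holds.n, h.holds.v0, h.holds.v1, h.ann.num], rfl⟩
  obtain ⟨y, hy2, hv, hy⟩ := hval; rw [hv]; by_cases hig : i < g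
  · have hsub : 1 - (i + 1 - g) = 1 := by omega
    rw [hsub, mul_one]
    change _ ∧ _ = Function.extend (Fin.val : Fin g → ℕ) (G.colLab f par x) 0 ((⟨i, hig⟩ : Fin g) : ℕ)
    rw [Fin.val_injective.extend_apply]; by_cases hx0 : x = 0
    · subst hx0; simp [colLab]
    · have hmem := hx.resolve_left hx0; rw [candCodes, Finset.mem_filter, Finset.mem_range] at hmem
      have hsub : 1 - (1 - x) = 1 := by omega
      have hn : 0 < G.n := Nat.pos_of_ne_zero fun h => by simp [h] at hmem
      have he : G.IsEdge ((x - 1) % G.n) := ⟨Nat.mod_lt _ hn, hmem.2⟩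
      have hp : (x - 1) / G.n < G.m := (Nat.div_lt_iff_lt_mul hn).2 hmem.1
      have h1 := h.lab _ hp _ ((hG.lt _ he).trans (hG.lt_m _ he)) ⟨i, hig⟩
      have h2 := h.lab _ hp _ (hG.lt_m _ he) ⟨i, hig⟩
      have h3 := h.ann.coord ((x - 1) % G.n) ⟨i, hig⟩
      rw [hsub, mul_one, colLab, if_neg hx0, codeCand, cand, map_add, map_add, Pi.add_apply,
        Pi.add_apply, ← h1.2, ← h2.2, ← h3, hy, ZMod.natCast_mod, Nat.cast_add, Nat.cast_add]
      exact ⟨Nat.mod_lt _ (by norm_num), by ring⟩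
  · rw [show 1 - (i + 1 - g) = 0 by omega, mul_zero, zero_mul]; refine ⟨by norm_num, ?_⟩
    change _ = Function.extend (Fin.val : Fin g → ℕ) (G.colLab f par x) 0 i
    rw [Function.extend_apply', Nat.cast_zero, Pi.zero_apply]; rintro ⟨a, rfl⟩; exact hig a.2

/-- Fill the matrix with the coordinates of the chosen and of the next candidates. -/
def fillMatrix : Program :=
  forLoop bkItem (var bkN - var bkNum) (.setWord bkCols (var bkNum + var bkItem)
    (.get bkList (var bkDone + var bkItem))) ;;
  forLoop bkItem (var bkN * var bkN) (.setWord bkMat (var bkItem)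
    (entryExpr (var bkItem / var bkN) (.get bkCols (var bkItem % var bkN))))

/-- Reading past the end of the list yields 0, which `colLab` turns into the zero vector. So the
last, incomplete batch is padded by zero columns and needs no separate treatment; the rows from g on
are zero as well. -/
theorem fillMatrix_spec {k P : ℕ} {key : ℕ → ℝ} (hG : G.Good) (h : G.HoldsLabels f par s)
    (hl : HoldsList key (G.candCodes (G.m * G.n)) s) (hv : Valid N s) (hgN : g ≤ N)
    (h1N : 1 ≤ N) (hNB : N * N < B) (h1B : 1 < B) (hk : s.words bkNum 0 = k)
    (hP : s.words bkDone 0 = P)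
    (hcols : ∀ t < k, s.words bkCols t = 0 ∨ s.words bkCols t - 1 ∈ G.candCodes (G.m * G.n)) :
    Tri B fillMatrix s (N * N * 170 + N * 30 + 50) (fun s' => (∀ a, s'.words bkMat a < 2) ∧
      ∀ t < N, s'.words bkCols t = (if t < k then s.words bkCols t else s.words bkList (P + (t - k))) ∧
        col s' N t = Function.ExtendByZero.linearMap (ZMod 2) (Fin.val : Fin g → ℕ)
          (G.colLab f par (s'.words bkCols t))) := by
  have hNN : N ≤ N * N := Nat.le_mul_of_pos_left _ h1N; have hN := hv.order
  refine Tri.seq (T1 := N * 30 + 20) (T2 := N * N * 170 + 20) (R := fun s' => ∀ t < N,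
    s'.words bkCols t = (if t < k then s.words bkCols t else s.words bkList (P + (t - k))))
    (Tri.fillLoop (N := N - k) (fun t => k + t) (fun t => s.words bkList (P + t)) (by decide)
      (by omega) ?_ ?_ (fun i j _ _ _ => by omega) (fun hb i _ => hb _ _)
      ((Nat.add_le_add (Nat.mul_le_mul_right _ (Nat.sub_le _ _)) le_rfl).trans
      (mul_add_le (by decide) (by decide))) ?_) ?_ (by omega)
  · intro s' hf; simp [hf.w bkN (by simp), hf.w bkNum (by simp), hN, hk]
  · intro i s' hi hf hvi _
    simp [hf.w bkNum (by simp), hf.w bkDone (by simp), hf.w bkList (by simp), hvi, hk, hP]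
  · intro s' _ _ h1 h2 t ht; split_ifs with htk
    · exact h2 t fun i _ => by omega
    · have := h1 (t - k) (by omega)
      rwa [show k + (t - k) = t by omega] at this
  intro s1 f1 h₁
  have w1 : ∀ b, b ≠ bkItem ∧ b ≠ bkCols → s1.words b = s.words b := fun b ⟨n1, n2⟩ =>
    f1.w b (by simp [n1, n2])
  have hcode : ∀ t < N, s1.words bkCols t = 0 ∨
      s1.words bkCols t - 1 ∈ G.candCodes (G.m * G.n) := by
    intro t ht; rw [h₁ t ht]; split_ifs with htk
    · exact hcols t htk
    · by_cases hx : P + (t - k) < s.words bkLen 0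
      · exact Or.inr (hl.mem _ hx).2
      · exact Or.inl (hl.out _ (by omega))
  have hent : ∀ s' i, G.HoldsLabels f par s' → s'.words bkN 0 = N → s'.words bkItem 0 = i →
      s'.words bkCols = s1.words bkCols → ((entryExpr (var bkItem / var bkN)
        (.get bkCols (var bkItem % var bkN))).val s' < 2 ∧ (((entryExpr (var bkItem / var bkN)
        (.get bkCols (var bkItem % var bkN))).val s' : ℕ) : ZMod 2) =
      Function.ExtendByZero.linearMap (ZMod 2) (Fin.val : Fin g → ℕ)
        (G.colLab f par (s1.words bkCols (i % N))) (i / N)) := by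
    intro s' i h' hN' hi hc
    exact entryExpr_val hG h' (by simp [hN', hi]) (by simp [hN', hi, hc])
      (hcode _ (Nat.mod_lt _ h1N))
  refine Tri.fillLoop (N := N * N) (fun x => x) (fun x =>
    (Function.ExtendByZero.linearMap (ZMod 2) (Fin.val : Fin g → ℕ)
        (G.colLab f par (s1.words bkCols (x % N))) (x / N)).val) (by decide) hNB ?_ ?_
    (fun i j _ _ _ => by omega) (fun _ i _ => (ZMod.val_lt _).trans_le (by omega))
    (mul_add_le (by decide) (by decide)) ?_
  · intro s' hf; simp [hf.w bkN (by simp), w1, hN]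
  · intro i s' hi hf hvi _
    obtain ⟨e1, e2⟩ := hent s' i (h.congr (fun b hb => by
        rw [hf.w b (by simp; omega), w1 b (by omega)]) (by
        rw [hf.r 0 (by simp), f1.r 0 (by simp)])) (by simp [hf.w bkN (by simp), w1, hN]) hvi
        (hf.w _ (by simp))
    exact ⟨hvi, by rw [← e2, val_cast e1]⟩
  · intro s' hf _ h1 h2; have e1 : s'.words bkCols = s1.words bkCols := hf.w _ (by simp)
    refine ⟨fun a => ?_, fun t ht => ⟨by rw [e1, h₁ t ht], ?_⟩⟩
    · by_cases ha : a < N * N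
      · rw [h1 a ha]; exact ZMod.val_lt _
      · rw [h2 a fun i hi => by omega, w1 _ (by decide)]; exact hv.bit a
    · ext r; rw [col]; split_ifs with hr
      · rw [h1 _ (idx_lt hr ht), ZMod.natCast_val, ZMod.cast_id', id, e1,
          mul_comm r N, Nat.mul_add_mod, Nat.mod_eq_of_lt ht, Nat.mul_add_div h1N,
          Nat.div_eq_of_lt ht, add_zero]
      · change _ = Function.extend (Fin.val : Fin g → ℕ) _ 0 r
        rw [Function.extend_apply', Pi.zero_apply]; rintro ⟨a, rfl⟩; exact hr (a.2.trans_le hgN)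

/-- Keep the columns with a pivot. -/
def compress : Program :=
  assign bkNum 0 ;; forLoop bkItem (var bkN) (.ite (.wordLe 1 (.get bkPiv (var bkItem)))
    (.setWord bkCols (var bkNum) (.get bkCols (var bkItem)) ;; assign bkNum (var bkNum + 1)) .skip)

/-- Here φ enumerates the pivot columns in increasing order. Compressing in place is safe, since the
position written never passes the position read. -/
theorem compress_spec (hN : s.words bkN 0 = N) (hNB : N + 1 < B) :
    Tri B compress s (N * 60 + 30) (fun s' => ∃ φ : ℕ → ℕ,
      (∀ j < s'.words bkNum 0, φ j < N ∧ s.words bkPiv (φ j) ≠ 0) ∧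
      (∀ i j, i < j → j < s'.words bkNum 0 → φ i < φ j) ∧
      (∀ t < N, s.words bkPiv t ≠ 0 → ∃ j < s'.words bkNum 0, φ j = t) ∧
      ∀ j < s'.words bkNum 0, s'.words bkCols j = s.words bkCols (φ j)) := by
  refine Tri.seq (T1 := 5) (T2 := N * 60 + 20) (R := fun s' => s' = s.writeWord bkNum 0 0)
    (Tri.block (fun _ => by simp; omega) (by simp) (by decide)) ?_ (by omega)
  rintro s1 - rfl
  refine Tri.forLoop (N := N) (Tb := 30) (fun k s' => s'.words bkNum 0 ≤ k ∧
      (∀ t, k ≤ t → s'.words bkCols t = s.words bkCols t) ∧ ∃ φ : ℕ → ℕ,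
      (∀ j < s'.words bkNum 0, φ j < k ∧ s.words bkPiv (φ j) ≠ 0) ∧
      (∀ i j, i < j → j < s'.words bkNum 0 → φ i < φ j) ∧
      (∀ t < k, s.words bkPiv t ≠ 0 → ∃ j < s'.words bkNum 0, φ j = t) ∧
      ∀ j < s'.words bkNum 0, s'.words bkCols j = s.words bkCols (φ j)) (by simp) (by omega) ?_ ?_ ?_
    ?_ (mul_add_le (by decide) (by decide)) fun _ _ _ h => h.2.2
  · intro s' hf; simp [hf.w bkN (by simp), hN]
  · exact ⟨by simp, by simp, id, by simp, by simp, by simp, by simp⟩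
  · intro k s' x h; simpa using h
  · rintro k s' hk hv hf ⟨h1, h2, φ, h3, h4, h5, h6⟩
    have e1 : s'.words bkPiv = s.words bkPiv := (hf.w _ (by simp)).trans (by simp)
    refine Tri.ite (T1 := 20) (fun hc => ?_) (fun hc => ?_) (by decide)
    · have hp : s.words bkPiv k ≠ 0 := by
        have : 1 ≤ s.words bkPiv k := by simpa [hv, e1] using hc
        omega
      refine Tri.mono (R := fun s'' => s''.words bkNum 0 = s'.words bkNum 0 + 1 ∧
        ∀ t, s''.words bkCols t = if t = s'.words bkNum 0 then s.words bkCols k else s'.words bkCols t)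
        (Tri.block (fun hb => ⟨by simpa using hb _ _, by simp; omega⟩)
          (by simp [hv, h2 k le_rfl]) (by decide)) le_rfl ?_
      rintro s'' - ⟨e2, e3⟩; simp only [e2, e3]
      refine ⟨by omega, fun t ht => by rw [if_neg (by omega), h2 t (by omega)],
        fun j => if j = s'.words bkNum 0 then k else φ j, fun j hj => ?_, fun i j hij hj => ?_,
        fun t ht h0 => ?_, fun j hj => ?_⟩
      · dsimp only
        split_ifs with hjn
        · exact ⟨by omega, hp⟩
        · have := h3 j (by omega); exact ⟨by omega, this.2⟩
      · dsimp only
        rw [if_neg (by omega : i ≠ _)]; split_ifs with hjn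
        · exact (h3 i (by omega)).1
        · exact h4 i j hij (by omega)
      · rcases Nat.lt_succ_iff_lt_or_eq.1 ht with ht | rfl
        · obtain ⟨j, hj, he⟩ := h5 t ht h0
          exact ⟨j, by omega, by dsimp only; rw [if_neg (by omega), he]⟩
        · exact ⟨_, Nat.lt_succ_self _, if_pos rfl⟩
      · by_cases hjn : j = s'.words bkNum 0
        · simp [hjn]
        · simpa [hjn] using h6 j (by omega)
    · have hp : s.words bkPiv k = 0 := by simpa [hv, e1] using hc
      refine Tri.block (fun _ => by simp) ⟨(Nat.le_succ_of_le h1 :), fun t ht => h2 t (by omega), φ,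
        fun j hj => ⟨(h3 j hj).1.trans (Nat.lt_succ_self k), (h3 j hj).2⟩, h4, fun t ht h0 => ?_,
        h6⟩ (by decide)
      rcases Nat.lt_succ_iff_lt_or_eq.1 ht with ht | rfl
      · exact h5 t ht h0
      · exact absurd hp h0

end Net

/-! ## The greedy algorithm -/

namespace Net

open RAM GaussJordan

variable {G : Net} {B N g κ : ℕ} {s : State} {f : Vec →ₗ[ZMod 2] (Fin g → ZMod 2)}
  {par : ℕ → ℕ → ℕ}

/-- Process the next candidates. -/
def greedyRound (P : Program) (c : ℕ) : Program :=
  fillMatrix ;; eliminate P c ;; assign bkDone (var bkDone + (var bkN - var bkNum)) ;; compress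

/-- Process all candidates. -/
def greedyLoop (P : Program) (c : ℕ) : Program :=
  .loop (.lt (var bkDone) (var bkLen)) (greedyRound P c)

theorem greedyLoop_wr {P : Program} {c b : ℕ} (h : (greedyLoop P c).wr b) :
    b = bkItem ∨ (41 ≤ b ∧ b ≤ 52) ∨ b = bkCols ∨ b = bkNum ∨ b = bkDone ∨ 100 ≤ b := by
  by_cases he : (eliminate P c).wr b
  · have := eliminate_wr he; omega
  · simp [greedyLoop, greedyRound, fillMatrix, compress, he] at h; omega

theorem greedyLoop_wrR {P : Program} {c b : ℕ} (h : (greedyLoop P c).wrR b) : 100 ≤ b := by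
  simp [greedyLoop, greedyRound, fillMatrix, compress] at h; exact eliminate_wrR h

theorem _root_.IsGreedy.card_le {V : Type*} [AddCommGroup V] [Module (ZMod 2) V] [Module.Finite (ZMod 2) V]
    {lab : ℕ → V} {P k : ℕ} {ch : ℕ → ℕ} (h : IsGreedy lab P k ch) :
    k ≤ Module.finrank (ZMod 2) V := by simpa using h.indep.fintype_card_le_finrank

/-- The chosen labels are independent in a space of dimension g, so at most g columns of a round are
old and at least N - g new candidates are processed. Hence F rounds exhaust the list. The fresh
memory consumed is `elimSpace` per round. -/
theorem greedyLoop_spec {P : Program} {c F : ℕ} {τ : ℕ → ℕ} {key : ℕ → ℝ} (hP : Multiplies P c τ)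
    (hc : 2 ≤ c) (hG : G.Good) (h : G.HoldsLabels f par s)
    (hl : HoldsList key (G.candCodes (G.m * G.n)) s) (hv : Valid N s) (hNκ : N = 2 ^ κ)
    (hgN : g < N) (hF : s.words bkLen 0 ≤ F * (N - g)) (hNB : N * N + 1 < B)
    (hMB : s.words bkLen 0 + N < B) (hB : s.words bkBase 0 + F * elimSpace c N κ < B)
    (hnum : s.words bkNum 0 = 0) (hdone : s.words bkDone 0 = 0) :
    Tri B (greedyLoop P c) s (F * (elimTime τ c N κ + N * N * 170 + N * 190 + 300) + 10)
      (fun s' => ∃ Q k ch, s.words bkLen 0 ≤ Q ∧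
        IsGreedy (fun x => G.colLab f par (s.words bkList x)) Q k ch ∧ s'.words bkNum 0 = k ∧
        ∀ j < k, s'.words bkCols j = s.words bkList (ch j)) := by
  have h1N : 1 ≤ N := by omega
  have hNN : N ≤ N * N := Nat.le_mul_of_pos_left _ h1N
  have hcost : (Test.lt (var bkDone) (var bkLen)).cost = 6 := rfl
  refine Tri.loop (f := F) (T1 := elimTime τ c N κ + N * N * 170 + N * 190 + 290) (fun r s' =>
    s'.words bkLen 0 = s.words bkLen 0 ∧
    ∃ Q k ch, s.words bkLen 0 ≤ Q + r * (N - g) ∧ s'.words bkDone 0 = Q ∧ s'.words bkNum 0 = k ∧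
      IsGreedy (fun x => G.colLab f par (s.words bkList x)) Q k ch ∧
      (∀ j < k, s'.words bkCols j = s.words bkList (ch j)) ∧ Valid N s' ∧
      s'.words bkBase 0 + r * elimSpace c N κ ≤ s.words bkBase 0 + F * elimSpace c N κ) ?_ ?_ ?_
    (by rw [hcost]; exact Nat.add_le_add (Nat.mul_le_mul_left _ (by omega)) (by omega)) ?_
  · exact ⟨rfl, 0, 0, id, by omega, hdone, hnum, .zero _ _, by omega, hv, le_rfl⟩
  · rintro s' - ⟨e1, Q, k, ch, h1, h2, -⟩; simp [h2, e1]; omega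
  · rintro r s' hf ⟨-, Q, k, ch, h1, h2, h3, h4, h5, h6, h7⟩ hc'
    have wf : ∀ b, b ≤ 11 ∨ (80 ≤ b ∧ b ≤ 87) → s'.words b = s.words b := fun b hb => hf.w b fun h =>
      by have := greedyLoop_wr h; omega
    have rf : s'.reals 0 = s.reals 0 := hf.r _ fun h => by have := greedyLoop_wrR h; omega
    have eL := wf bkLen (by omega); have eI := wf bkList (by omega)
    have hQ : Q < s.words bkLen 0 := by simpa [h2, eL] using hc'
    have hkg : k ≤ g := by simpa using h4.card_le
    have hl' := hl.congr eL eI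
    refine Tri.seq (T1 := N * N * 170 + N * 30 + 50) (T2 := elimTime τ c N κ + N * 160 + 240)
      (fillMatrix_spec (k := k) (P := Q) (f := f) (par := par) hG
        (h.congr (fun b hb => wf b (by omega)) rf) hl' h6 hgN.le h1N (by omega) (by omega) h3 h2 ?_)
      ?_ (by omega)
    · intro t ht; rw [h5 t ht]; by_cases hx : ch t < s.words bkLen 0
      · exact Or.inr (hl.mem _ hx).2
      · exact Or.inl (hl.out _ (by omega))
    rintro s1 f1 ⟨hbit, hcol⟩
    have w1 : ∀ b, b ≠ bkItem ∧ b ≠ bkCols ∧ b ≠ bkMat → s1.words b = s'.words b := fun b ⟨n1, n2, n3⟩ =>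
      f1.w b (by simp [fillMatrix, n1, n2, n3])
    rw [Nat.succ_mul] at h7 h1
    refine Tri.seq (eliminate_spec hP hc hNκ (by omega) (s := s1) ⟨by
      rw [w1 _ (by decide), h6.order], hbit, fun b a hb ha => ?_⟩ ?_) ?_
      (show _ + (N * 60 + 40) ≤ _ by omega)
    · rw [w1 _ (by omega)] at ha ⊢; rw [f1.r _ (by simp [fillMatrix])]; exact h6.fresh b a hb ha
    · rw [w1 _ (by decide)]; omega
    rintro s2 f2 ⟨hv2, hE, -, hb2⟩
    have w2 : ∀ b, b ≤ 40 ∨ (53 ≤ b ∧ b < 100) → s2.words b = s1.words b := fun b hb => f2.w b fun h =>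
      by have := eliminate_wr h; omega
    refine Tri.seq (T1 := 10) (T2 := N * 60 + 30) (R := fun s3 => s3 = s2.writeWord bkDone 0
      (Q + (N - k))) (Tri.block (fun _ => ?_) ?_ (by decide)) ?_ (by omega)
    · simp [w2, w1, h2, h3, h6.order]; omega
    · simp [w2, w1, h2, h3, h6.order]
    rintro s3 - rfl
    refine Tri.mono (compress_spec (N := N) (by simpa using hv2.order) (by omega)) le_rfl ?_
    rintro s4 f4 ⟨φ, a1, a2, a3, a4⟩
    simp only [State.words_of_ne _ (show (bkPiv : ℕ) ≠ bkDone by decide),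
      State.words_of_ne _ (show (bkCols : ℕ) ≠ bkDone by decide)] at a1 a3 a4
    have w4 : ∀ b, b ≠ bkDone ∧ b ≠ bkNum ∧ b ≠ bkItem ∧ b ≠ bkCols → s4.words b = s2.words b :=
      fun b ⟨n0, n1, n2, n3⟩ => (f4.w b (by simp [compress, n1, n2, n3])).trans (by simp [n0])
    refine ⟨by rw [w4 _ (by decide), w2 _ (by omega),
      w1 _ (by decide), eL], Q + (N - k), s4.words bkNum 0, fun j => if φ j < k then ch (φ j) else Q + (φ j - k),
      by omega, by simp [f4.w bkDone (by simp [compress])], rfl, ?_, ?_, ?_, ?_⟩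
    · refine h4.step (by omega) hE (Function.ExtendByZero.linearMap (ZMod 2) (Fin.val : Fin g → ℕ))
        ?_ ?_ a1 a2 a3 (fun _ _ => rfl)
      · intro x y hxy; exact Function.extend_injective Fin.val_injective (0 : ℕ → ZMod 2) hxy
      · intro t ht; obtain ⟨b1, b2⟩ := hcol t ht; rw [b2, b1]; by_cases htk : t < k
        · simp only [if_pos htk, h5 t htk]
        · simp only [if_neg htk, eI]
    · intro j hj; obtain ⟨b1, -⟩ := hcol (φ j) (a1 j hj).1; rw [a4 j hj, w2 _ (by omega), b1]
      by_cases htk : φ j < k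
      · simp only [if_pos htk, h5 _ htk]
      · simp only [if_neg htk, eI]
    · refine hv2.congr (w4 _ (by decide)) (w4 _ (by decide)) (w4 _ (by decide)) fun b hb =>
        ⟨w4 _ (by omega), f4.r _ (by simp [compress])⟩
    · rw [w4 _ (by decide)]; rw [w1 _ (by decide)] at hb2; omega
  · rintro r s' ⟨h0, Q, k, ch, h1, h2, h3, h4, h5, -⟩ hc'
    exact ⟨Q, k, ch, by simpa [h2, h0] using hc', h4, h3, h5⟩

end Net

/-! ## Writing the cycles -/

namespace Net

open RAM GaussJordan

notation "bkRoot" => 94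

variable {G : Net} {B j p : ℕ} {s : State} {ord par : ℕ → ℕ} {dist : ℕ → ℝ}

/-- Toggle the entry at the edge `bkEdge` in the cycle `bkItem`. -/
def toggleOut : Program :=
  .setWord 3 (var bkItem * numS + var bkEdge) (1 - .get 3 (var bkItem * numS + var bkEdge))

/-- Toggle the edges on the way from the vertex `bkVert` to the root `bkSrc`. -/
def walkOut : Program := .loop (.not (.eq (var bkVert) (var bkSrc)))
    (assign bkDart (.get bkPar (var bkSrc * numV + var bkVert)) ;; assign bkEdge (var bkDart / 2) ;;
      toggleOut ;; assign bkVert (tailExpr (var bkDart)))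

/-- Write the chosen candidates. -/
def output : Program :=
  forLoop bkItem (var bkNum) ((assign bkSrc ((.get bkCols (var bkItem) - 1) / numS) ;;
    assign bkTail ((.get bkCols (var bkItem) - 1) % numS) ;; assign bkEdge (var bkTail) ;;
    toggleOut ;; assign bkVert (.get bkFst (var bkTail))) ;; walkOut ;;
    assign bkVert (.get bkSnd (var bkTail)) ;; walkOut)

/-- The rows after adding the vector `v` to the row `j`. -/
structure AddRow (n j : ℕ) (v : Vec) (s s' : State) : Prop where
  bit : ∀ a, s'.words 3 a < 2
  row : ∀ l, ∀ i < n, (s'.words 3 (l * n + i) : ZMod 2) =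
    s.words 3 (l * n + i) + if l = j then v i else 0

theorem AddRow.trans {n : ℕ} {v v' : Vec} {s' s'' : State} (h : AddRow n j v s s')
    (h' : AddRow n j v' s' s'') : AddRow n j (v + v') s s'' := ⟨h'.bit, fun l i hi => by
    rw [h'.row l i hi, h.row l i hi]; split_ifs <;> simp [add_assoc]⟩

theorem AddRow.toggle {n e : ℕ} {s' : State} (he : e < n) (hbit : ∀ a, s.words 3 a < 2)
    (h : ∀ a, s'.words 3 a = if a = j * n + e then 1 - s.words 3 a else s.words 3 a) :
    AddRow n j (Pi.single e 1) s s' := by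
  refine ⟨fun a => ?_, fun l i hi => ?_⟩
  · have := hbit a; rw [h]; split_ifs <;> omega
  · rw [h]; by_cases hle : l = j ∧ i = e
    · obtain ⟨rfl, rfl⟩ := hle; have := hbit (l * n + i)
      rw [if_pos rfl, if_pos rfl, Pi.single_eq_same]
      interval_cases s.words 3 (l * n + i) <;> decide
    · rw [if_neg fun h' => hle (idx_inj hi he h')]; split_ifs with hl
      · rw [Pi.single_eq_of_ne fun h' => hle ⟨hl, h'⟩, add_zero]
      · rw [add_zero]

/-- The vector already added plus the path still ahead is constantly the whole path. The position in
`ord` decreases at every step, so at most m steps are made. -/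
theorem walkOut_spec {v : ℕ} (hG : G.Good) (hh : G.Holds s) (hS : G.SPTree p ord par dist)
    (hB : G.m < B) (h1B : 1 < B) (hp : s.words bkSrc 0 = p) (hj : s.words bkItem 0 = j)
    (hv : s.words bkVert 0 = v) (hvm : v < G.m)
    (hpar : ∀ x, s.words bkPar (p * G.m + x) = par x) (hbit : ∀ a, s.words 3 a < 2) :
    Tri B walkOut s (G.m * 100 + 20) (AddRow G.n j (G.path p par v) s) := by
  have hcost : (Test.not (.eq (var bkVert) (var bkSrc))).cost = 12 := rfl
  obtain ⟨i0, hi₀, he0⟩ := hS.ord_surj v hvm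
  refine Tri.loop (f := G.m) (T1 := 80) (fun f s' => s'.words bkSrc 0 = p ∧ ∃ i < f, i < G.m ∧ s'.words bkVert 0 = ord i ∧
    ∃ z, AddRow G.n j z s s' ∧ z + G.path p par (ord i) = G.path p par v) ?_ ?_ ?_
    (by rw [hcost]; omega) ?_
  · exact ⟨hp, i0, hi₀, hi₀, by rw [hv, he0], 0, ⟨hbit, by simp⟩, by rw [he0, zero_add]⟩
  · rintro s' - ⟨-, i, hi, -⟩; omega
  · rintro f s' hf ⟨hp', i, hi, him, e1, z, h1, h2⟩ hc
    have w' : ∀ b, b ≠ bkVert ∧ b ≠ bkDart ∧ b ≠ bkEdge ∧ b ≠ 3 → s'.words b = s.words b :=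
      fun b ⟨n1, n2, n3, n4⟩ => hf.w b (by simp [toggleOut, n1, n2, n3, n4])
    have hip : ord i ≠ p := by rw [Test.holds, Test.holds_eq] at hc; simpa [e1, w', hp] using hc
    have hi0 : 0 < i := Nat.pos_of_ne_zero fun h => hip (h ▸ hS.ord_zero)
    obtain ⟨t1, t2, ⟨i', hi', t3⟩, -⟩ := hS.tree i hi0 him
    have hd : s'.words bkPar (s'.words bkSrc 0 * s'.words 0 0 + s'.words bkVert 0) = par (ord i) := by
      simp [w', hp, hh.m, e1, hpar]
    have hd' := hd; rw [w' bkPar (by decide), w' bkSrc (by decide), w' 0 (by decide)] at hd'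
    have htail : ∀ s'' : State, (∀ b, b = 0 ∨ b = bkCard ∨ b = bkFst ∨ b = bkSnd ∨ b = bkThd →
        s''.words b = s'.words b) → s''.reals 0 = s'.reals 0 → s''.words bkDart 0 = par (ord i) →
        (tailExpr (var bkDart)).val s'' = G.tail (par (ord i)) := fun s'' a b c =>
      tailExpr_val (hh.congr (fun b hb => (a b hb).trans
        (w' b (by omega))) (b.trans (hf.r 0 (by simp [toggleOut])))) c
    refine Tri.mono (R := fun s'' => s''.words bkVert 0 = G.tail (par (ord i)) ∧
      ∀ a, s''.words 3 a = if a = j * G.n + par (ord i) / 2 then 1 - s'.words 3 a else s'.words 3 a)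
      (Tri.block (fun hb => ?_) ?_ (by decide)) le_rfl ?_
    · have := hb bkPar (s'.words bkSrc 0 * s'.words 0 0 + s'.words bkVert 0)
      simp only [Program.Safe, Program.exec]; refine ⟨by simpa using this, ?_, ?_, ?_⟩
      · simp [hd]; omega
      · simp [toggleOut]; omega
      · rw [htail]
        · exact (hG.tail_lt t1).trans hB
        · intro b hb; simp only [toggleOut, Program.exec]
          rw [State.words_of_ne _ (by omega), State.words_of_ne _ (by omega),
            State.words_of_ne _ (by omega)]
        · rfl
        · simp [toggleOut, hd]
    · refine ⟨?_, fun a => ?_⟩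
      · simp only [Program.exec]; rw [State.words_same, if_pos (by rfl), htail]
        · intro b hb; simp only [toggleOut, Program.exec]
          rw [State.words_of_ne _ (by omega), State.words_of_ne _ (by omega),
            State.words_of_ne _ (by omega)]
        · rfl
        · simp [toggleOut, hd]
      · by_cases ha : a = j * G.n + par (ord i) / 2 <;>
          simp [toggleOut, hd', w', hj, hh.n, ha]
    · rintro s'' f'' ⟨e2, e3⟩
      refine ⟨by rw [f''.w _ (by simp [toggleOut]), hp'], i', by omega, by omega, by rw [e2, t3], _, h1.trans (.toggle t1.1 h1.bit e3), ?_⟩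
      rw [add_assoc, ← t3, ← hS.path_ord hi0 him, h2]
  · rintro f s' ⟨hp', i, hi, him, e1, z, h1, h2⟩ hc
    have hip : ord i = p := by
      rw [Test.holds, not_not, Test.holds_eq] at hc; simpa [e1, hp'] using hc
    rw [hip, path_root, add_zero] at h2
    rwa [← h2]

/-- Toggling adds modulo two, so edges common to the two paths cancel as in `cand`. One cycle takes
O(m) time, which the O(n²) part of the bound covers since k is at most n. -/
theorem output_spec {k : ℕ} (hG : G.Good) (hh : G.Holds s) (hT : ∀ p < G.m, G.HoldsTree p s)
    (hB : G.n + 1 < B) (hkB : k < B) (hk : s.words bkNum 0 = k)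
    (hc : ∀ j < k, s.words bkCols j - 1 ∈ G.candCodes (G.m * G.n)) (hz : ∀ a, s.words 3 a = 0) :
    Tri B output s (k * (G.m * 200 + 300) + 20) (fun s' => ∀ j < k, ∀ i < G.n,
      s'.words 3 (j * G.n + i) < 2 ∧ (s'.words 3 (j * G.n + i) : ZMod 2) =
        G.codeCand (G.parOf s) (s.words bkCols j - 1) i) := by
  refine Tri.forLoop (N := k) (Tb := G.m * 200 + 250) (fun j s' => (∀ a, s'.words 3 a < 2) ∧
    ∀ l, ∀ i < G.n, (s'.words 3 (l * G.n + i) : ZMod 2) =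
      if l < j then G.codeCand (G.parOf s) (s.words bkCols l - 1) i else 0)
    (by simp [toggleOut, walkOut]) (by omega) ?_ ?_ ?_ ?_
    (Nat.add_le_add (Nat.mul_le_mul_left _ (by
      rw [show (var bkNum).cost = 2 from rfl]; omega)) (by decide)) ?_
  · intro s' hf; simp [hf.w bkNum (by simp [toggleOut, walkOut]), hk]
  · simp [hz]
  · intro j s' x h; simpa using h
  · rintro j s' hj hv hf ⟨h1, h2⟩
    have hwr : ∀ b, b ≤ 2 ∨ b = bkCard ∨ b = bkFst ∨ b = bkSnd ∨ b = bkThd ∨ b = bkPar ∨ b = bkOrd ∨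
        b = bkCols → s'.words b = s.words b := fun b hb =>
      hf.w b fun h => by simp [toggleOut, walkOut] at h; omega
    have hmem := hc j hj; rw [candCodes, Finset.mem_filter, Finset.mem_range] at hmem
    set q := s.words bkCols j - 1 with hq
    have hn : 0 < G.n := Nat.pos_of_ne_zero fun h => by simp [h] at hmem
    have he : G.IsEdge (q % G.n) := ⟨Nat.mod_lt _ hn, hmem.2⟩
    have hp : q / G.n < G.m := (Nat.div_lt_iff_lt_mul hn).2 hmem.1; have hS := hT _ hp
    have hh' : G.Holds s' := hh.congr (fun b hb => hwr b (by omega))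
      (hf.r 0 (by simp [toggleOut, walkOut]))
    refine Tri.seq (T1 := 100) (T2 := G.m * 200 + 140) (R := fun s'' => s''.words bkSrc 0 = q / G.n ∧
      s''.words bkTail 0 = q % G.n ∧ s''.words bkVert 0 = G.v0 (q % G.n) ∧
      ∀ a, s''.words 3 a = if a = j * G.n + q % G.n then 1 - s'.words 3 a else s'.words 3 a)
      (Tri.block (fun hb => ?_) ?_ (by decide)) ?_ (by omega)
    · have := hb bkFst (q % G.n); have hqn := Nat.mod_lt q hn; simp [toggleOut, hv, hwr, hh.n, ← hq]
      have hmn := hG.m_le; refine ⟨by omega, by omega, by omega, ?_⟩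
      rwa [hwr _ (by omega)] at this
    · simp [toggleOut, hv, hwr, hh.n, hh.v0, ← hq]; intro a; split_ifs with ha <;> simp [ha]
    rintro s1 f1 ⟨e1, e2, e3, e4⟩
    have w1 : ∀ b, b ≤ 2 ∨ b = bkCard ∨ b = bkFst ∨ b = bkSnd ∨ b = bkThd ∨ b = bkPar ∨ b = bkItem →
        s1.words b = s'.words b := fun b hb => f1.w b (by simp [toggleOut]; omega)
    have a1 := AddRow.toggle he.1 h1 e4
    have hh1 : G.Holds s1 := hh'.congr (fun b hb => w1 b (by omega)) (f1.r 0 (by simp [toggleOut]))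
    have hpar : ∀ x, s'.words bkPar (q / G.n * G.m + x) = G.parOf s (q / G.n) x := fun x => by
      rw [hwr _ (by omega)]; rfl
    refine Tri.seq (T1 := G.m * 100 + 20) (T2 := G.m * 100 + 100) (walkOut_spec hG hh1 hS
      (by have := hG.m_le; omega) (by omega) e1 (by rw [w1 _ (by omega), hv]) e3
      ((hG.lt _ he).trans (hG.lt_m _ he)) (by rw [w1 _ (by omega)]; exact hpar) a1.bit) ?_ (by omega)
    intro s2 f2 a2
    have w2 : ∀ b, b ≠ bkVert ∧ b ≠ bkDart ∧ b ≠ bkEdge ∧ b ≠ 3 → s2.words b = s1.words b :=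
      fun b ⟨n1, n2, n3, n4⟩ => f2.w b (by simp [walkOut, toggleOut, n1, n2, n3, n4])
    have hh2 : G.Holds s2 := hh1.congr (fun b hb => w2 b (by omega))
      (f2.r 0 (by simp [walkOut, toggleOut]))
    have e2' : s2.words bkTail 0 = q % G.n := by simp [w2, e2]
    refine Tri.seq (T1 := 10) (T2 := G.m * 100 + 20) (R := fun s3 => s3 = s2.writeWord bkVert 0
      (G.v1 (q % G.n))) (Tri.block (fun hb => by simpa using hb _ _) (by simp [e2', hh2.v1])
      (by decide)) ?_ (by omega)
    rintro s3 f3 rfl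
    refine Tri.mono (walkOut_spec (p := q / G.n) (j := j) (v := G.v1 (q % G.n)) hG (hh2.congr
      (fun b hb => f3.w b (by simp; omega)) rfl) hS (by have := hG.m_le; omega) (by omega)
      (by simp [w2, e1]) (by simp [w2, w1, hv]) (by simp) (hG.lt_m _ he) (by
        simpa [w2, w1, parOf] using hpar) (by simpa using a2.bit)) le_rfl ?_
    intro s4 f4 a3
    have a4 := (a1.trans a2).trans (AddRow.mk a3.bit fun l i hi => by simpa using a3.row l i hi)
    refine ⟨a4.bit, fun l i hi => ?_⟩; rw [a4.row l i hi, h2 l i hi]; by_cases hl : l = j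
    · subst hl
      rw [if_neg (by omega), if_pos rfl, if_pos (by omega), zero_add, codeCand, cand, add_assoc]
      rfl
    · rw [if_neg hl, add_zero]; simp only [show l < j + 1 ↔ l < j by omega]
  · rintro s' hf _ ⟨h1, h2⟩ j hj i hi; exact ⟨h1 _, by rw [h2 j i hi, if_pos hj]⟩

end Net

/-! ## The whole computation -/

namespace Net

open RAM GaussJordan Tournament AbstractSimplicialComplex

variable {G : Net} {B γ κ : ℕ} {s : State}

/-- Compute the coordinates of all edges and paths. -/
def coordinates (P : Program) (c : ℕ) : Program :=
  boundaryElim P c ;; collect ;; annotate ;; labelAll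

theorem coordinates_wr {P : Program} {c b : ℕ} (h : (coordinates P c).wr b) :
    b = 2 ∨ b = bkItem ∨ (40 ≤ b ∧ b ≤ 52) ∨ b = bkSrc ∨ (80 ≤ b ∧ b ≤ 85) ∨
      (91 ≤ b ∧ b ≤ 93) ∨ 100 ≤ b := by
  simp only [coordinates, Program.wr] at h; rcases h with h | h | h | h
  · have := boundaryElim_wr h; omega
  · simp [collect] at h; omega
  · simp [annotate] at h; omega
  · have := labelAll_wr h; omega

theorem coordinates_wrR {P : Program} {c b : ℕ} (h : (coordinates P c).wrR b) : 100 ≤ b := by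
  simp [coordinates, collect, annotate, labelAll_wrR] at h; exact boundaryElim_wrR h

/-- The number of coordinates is only found by the run. The hypothesis `hγ` says that any valid
coordinate system has γ coordinates, so that time bounds can refer to γ beforehand; it is supplied
by `CoordData.eq_betti1`. -/
theorem coordinates_spec {P : Program} {c Tel : ℕ} {τ : ℕ → ℕ} (hP : Multiplies P c τ)
    (hc : 2 ≤ c) (hG : G.Good) (hm : 0 < G.m) (hF : G.Faces (G.idxOf s)) (hh : G.Holds s)
    (hT : ∀ p < G.m, G.HoldsTree p s)
    (hB : 2 * (2 * G.n + 1) * ((2 * G.n + 1) * (2 * G.n + 3) ^ c) + 3 < B)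
    (hTel : ∀ K, 2 ^ K ≤ 2 * G.n + 1 → elimTime τ c (2 ^ K) K ≤ Tel)
    (hγ : ∀ N U piv g r, CoordData G (G.idxOf s) (G.ordOf s) (G.parOf s) (G.distOf s) N U piv g r →
      g = γ) (hz : ∀ b, b = 2 ∨ (40 ≤ b ∧ b ≤ 52) ∨ (80 ≤ b ∧ b ≤ 85) → ∀ a, s.words b a = 0)
    (hfresh : Fresh s) :
    Tri B (coordinates P c) s (Tel + G.n * G.n * (γ * 70 + 1000) + G.n * 2000 + 2000) (fun s' =>
      γ ≤ G.n ∧ (∃ N U piv r, CoordData G (G.idxOf s) (G.ordOf s) (G.parOf s) (G.distOf s) N U piv γ r ∧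
        G.HoldsLabels (coords N U piv γ r) (G.parOf s) s') ∧ Fresh s' ∧
      (∀ a, s'.words bkMat a < 2) ∧
      s'.words bkBase 0 ≤ 2 * (2 * G.n + 1) * ((2 * G.n + 1) * (2 * G.n + 3) ^ c)) := by
  have hmn := hG.m_le; set L := (2 * G.n + 1) * (2 * G.n + 3) ^ c with hL
  have hL1 : 2 * G.n + 1 ≤ L := Nat.le_mul_of_pos_right _ (by positivity)
  have hnB : (2 * G.n + 1) * 2 * (2 * G.n + 1) + 3 < B := by nlinarith
  have hnB' : 4 * G.n + 4 < B := by nlinarith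
  refine Tri.seq (T1 := Tel + G.n * 1000 + 1000) (T2 := G.n * G.n * (γ * 70 + 1000) + G.n * 1000 + 1000)
    (boundaryElim_spec hP hc hG hF hh ((Nat.le_add_right _ 3).trans_lt hB) hTel (fun b hb => hz b (by omega)) hfresh) ?_
    (by omega)
  rintro s1 f1 ⟨N, hnN, hNn, hv, htree, hE, hu, hbase⟩
  have w1 : ∀ b, b ≤ 11 ∨ (70 ≤ b ∧ b ≤ 79) ∨ (84 ≤ b ∧ b < 100) → s1.words b = s.words b :=
    fun b hb => f1.w b fun h => by have := boundaryElim_wr h; omega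
  have r1 : ∀ b < 100, s1.reals b = s.reals b := fun b hb => f1.r b fun h => by
    have := boundaryElim_wrR h; omega
  refine Tri.seq (T1 := G.n * 60 + 20) (T2 := G.n * G.n * (γ * 70 + 1000) + G.n * 900 + 900)
    (collect_spec (hh.congr (fun b hb => w1 b (by omega)) (r1 0 (by omega))) hnN (by omega)
      (by rw [w1 _ (by omega), hz 2 (by omega)]) htree hu) ?_ (by omega)
  rintro s2 f2 ⟨hgn, hC⟩
  have w2 : ∀ b, b ≠ 2 ∧ b ≠ bkItem ∧ b ≠ bkRows → s2.words b = s1.words b := fun b ⟨n1, n2, n3⟩ =>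
    f2.w b (by simp [collect, n1, n2, n3])
  have r2 : s2.reals = s1.reals := funext fun b => f2.r b (by simp [collect])
  have hD : CoordData G (G.idxOf s) (G.ordOf s) (G.parOf s) (G.distOf s) N (col s1 N)
      (s1.words bkPiv) (s2.words 2 0) (s2.words bkRows) := ⟨hm, hG, hF, hT, hE, hnN, hC⟩
  obtain hg := hγ _ _ _ _ _ hD; rw [hg] at hD hgn
  have hcol : col s2 N = col s1 N := funext fun t =>
    col_congr (w2 _ (by decide)) _ _
  have hpiv : s2.words bkPiv = s1.words bkPiv := w2 _ (by decide)
  refine Tri.seq (T1 := γ * 40 + N * (γ * 40 + 40) + 40)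
    (T2 := G.m * (G.m * (γ * 70 + 120) + 40) + 20) (annotate_spec (G := G) (T := G.treeOf s) (N := N)
      (by rw [hpiv]; exact hD.isCoords) hnN (by omega) ?_ hg (fun a => ?_) ?_) ?_ ?_
  · exact hv.congr (w2 _ (by decide)) (w2 _ (by decide)) (w2 _ (by decide))
      fun b hb => ⟨w2 _ (by omega), by rw [r2]⟩
  · rw [w2 _ (by decide), w1 _ (by omega), hz _ (by omega)]
  · rw [hpiv]; exact fun t t' ht ht' => hE.unique t t' (Nat.zero_le _) ht (Nat.zero_le _) ht'
  rotate_left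
  · have h1 : N * (γ * 40 + 40) ≤ (2 * G.n + 1) * (G.n * 40 + 40) := Nat.mul_le_mul hNn (by omega)
    have h2 : G.m * (G.m * (γ * 70 + 120) + 40) ≤ G.n * (G.n * (γ * 70 + 120) + 40) :=
      Nat.mul_le_mul hmn (by gcongr)
    have h3 : G.n * (G.n * (γ * 70 + 120) + 40) = G.n * G.n * (γ * 70 + 120) + G.n * 40 := by ring
    have h4 : (2 * G.n + 1) * (G.n * 40 + 40) = G.n * G.n * 80 + G.n * 120 + 40 := by ring
    have h5 : G.n * G.n * (γ * 70 + 1000) = G.n * G.n * (γ * 70 + 120) + G.n * G.n * 880 := by ring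
    omega
  intro s3 f3 h₃; rw [hcol, hpiv] at h₃
  have w3 : ∀ b, b ≠ bkItem ∧ b ≠ bkAnn ∧ b ≠ bkEdge → s3.words b = s2.words b := fun b ⟨n1, n2, n3⟩ =>
    f3.w b (by simp [annotate, n1, n2, n3])
  have r3 : s3.reals = s2.reals := funext fun b => f3.r b (by simp [annotate])
  have w3' : ∀ b, (b ≠ 2 ∧ b ≤ 11) ∨ (70 ≤ b ∧ b ≤ 79) ∨ (85 ≤ b ∧ b < 100) →
      s3.words b = s.words b := fun b hb => by
    rw [w3 b (by omega), w2 b (by omega), w1 b (by omega)]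
  have r3' : ∀ b < 100, s3.reals b = s.reals b := fun b hb => by rw [r3, r2, r1 b hb]
  have hh3 : G.Holds s3 := hh.congr (fun b hb => w3' b (by omega)) (r3' 0 (by omega))
  have hpar : G.parOf s3 = G.parOf s := by unfold parOf; rw [w3' _ (by omega)]
  refine Tri.mono (labelAll_spec hG hh3 h₃ (by omega) (by omega) (fun p hp => (hT p hp).congr
    (fun b hb j _ => by rw [w3' b (by omega)]) (fun j _ => by rw [r3' _ (by omega)]) hG hm)
    (fun x => by rw [w3' _ (by omega), hz _ (by omega)])) le_rfl ?_
  intro s4 f4 h₄; rw [hpar] at h₄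
  have w4 : ∀ b, b < 12 ∨ (14 ≤ b ∧ b < 70) ∨ b = bkAnn ∨ 94 ≤ b → s4.words b = s3.words b :=
    fun b hb => f4.w b fun h => by have := labelAll_wr h; omega
  have r4 : s4.reals = s3.reals := funext fun b => f4.r b (by simp [labelAll_wrR])
  have w4' : ∀ b, (14 ≤ b ∧ b < 70) ∨ 100 ≤ b → s4.words b = s1.words b := fun b hb => by
    rw [w4 b (by omega), w3 b (by omega), w2 b (by omega)]
  refine ⟨hgn, ⟨N, _, _, _, hD, hh3.congr (fun b hb => w4 b (by omega)) (by rw [r4]),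
    h₃.congr (w4 _ (by omega)) (w4 _ (by omega)), h₄⟩, fun b a hb ha => ?_, fun a => ?_, ?_⟩
  · rw [w4' _ (by omega)] at ha ⊢; rw [r4, r3, r2]; exact hv.fresh b a hb ha
  · rw [w4' _ (by omega)]; exact hv.bit a
  · rw [w4' _ (by omega)]
    exact hbase.trans (Nat.mul_le_mul (by omega) (Nat.mul_le_mul hNn (Nat.pow_le_pow_left
      (by omega) _)))

end Net

/-! ### Selecting and writing the cycles. -/

namespace Net

open RAM GaussJordan Tournament AbstractSimplicialComplex

variable {G : Net} {B γ κ N : ℕ} {s : State} {U : ℕ → Vec} {piv r : ℕ → ℕ}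

/-- Choose and write a shortest homology basis. -/
def chooseCycles (P : Program) (c : ℕ) : Program :=
  insertCands ;; extractCands ;; powLoop bkN (2 * var 2) ;; greedyLoop P c ;; output

theorem chooseCycles_spec {P : Program} {c Tgr : ℕ} {τ : ℕ → ℕ} (hP : Multiplies P c τ)
    (hc : 2 ≤ c) (hD : CoordData G (G.idxOf s) (G.ordOf s) (G.parOf s) (G.distOf s) N U piv γ r)
    (h : G.HoldsLabels (coords N U piv γ r) (G.parOf s) s) (hq : Queue κ ∅ s)
    (hκ : G.m * G.n + 1 < 2 ^ κ) (hκB : 2 * 2 ^ κ < B) (hγn : γ ≤ G.n)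
    (hnB : G.n * G.n + 4 * G.n + 1 < B) (hγB : (4 * γ + 1) * (4 * γ + 1) + 1 < B)
    (hB : s.words bkBase 0 + (G.n * G.n + 1) * (2 * (4 * γ + 1) * ((4 * γ + 1) * (4 * γ + 3) ^ c)) < B)
    (hT : ∀ K, 2 * γ ≤ 2 ^ K → 2 ^ K ≤ 4 * γ + 1 → (G.n * G.n / (2 ^ K - γ) + 1) *
      (elimTime τ c (2 ^ K) K + 2 ^ K * 2 ^ K * 170 + 2 ^ K * 190 + 300) ≤ Tgr)
    (hz : ∀ b, b = 3 ∨ (86 ≤ b ∧ b ≤ 90) → ∀ a, s.words b a = 0)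
    (hfresh : Fresh s) (hbit : ∀ a, s.words bkMat a < 2) :
    Tri B (chooseCycles P c) s (G.n * G.n * (κ * 200 + 600) + G.n * 500 + Tgr + 200) (fun s' =>
      ∃ M cp ce lab Q k ch, CycleData G (G.idxOf s) (G.ordOf s) (G.parOf s) (G.distOf s) N U piv γ r
        M cp ce lab ∧ IsGreedy lab Q k ch ∧ M ≤ Q ∧ s'.words 2 0 = γ ∧ ∀ j < k, ∀ i < G.n,
        s'.words 3 (j * G.n + i) < 2 ∧ (s'.words 3 (j * G.n + i) : ZMod 2) =
          G.cand (cp (ch j)) (G.parOf s (cp (ch j))) (ce (ch j)) i) := by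
  have hG := hD.good; have hmn := hG.m_le
  have hmn' : G.m * G.n ≤ G.n * G.n := Nat.mul_le_mul_right _ hmn
  have hcard : (G.candCodes (G.m * G.n)).card ≤ G.m * G.n :=
    (Finset.card_filter_le _ _).trans (Finset.card_range _).le
  refine Tri.seq (T1 := G.m * G.n * (κ * 100 + 200) + 20)
    (T2 := G.n * G.n * (κ * 100 + 400) + G.n * 500 + Tgr + 180)
    (insertCands_spec h.holds (by omega) hκB hq) ?_ (by
      have := Nat.mul_le_mul_right (κ * 100 + 200) hmn'
      have h3 : G.n * G.n * (κ * 200 + 600) = G.n * G.n * (κ * 100 + 200) +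
        G.n * G.n * (κ * 100 + 400) := by ring
      linarith)
  rintro s1 f1 ⟨hq1, hkey⟩
  have w1 : ∀ b, b ≤ 12 ∨ (14 ≤ b ∧ b ≤ 60) ∨ 64 ≤ b → s1.words b = s.words b := fun b hb =>
    f1.w b fun h => by simp [insertCands, insertLeaf_wr] at h; omega
  have r1 : ∀ b, b ≠ rbKey → s1.reals b = s.reals b := fun b hb => f1.r b (by
    simp [insertCands, insertLeaf_wrR, hb])
  refine Tri.seq (T1 := G.m * G.n * (κ * 100 + 100) + 20)
    (T2 := G.n * G.n * 300 + G.n * 500 + Tgr + 160)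
    (Tri.mono (extractCands_spec hκB hq1 (by rw [w1 _ (by omega), hz _ (by omega)])
      (fun x => by rw [w1 _ (by omega), hz _ (by omega)]) (by omega)) (by gcongr) fun _ _ h => h) ?_ (by
      have := Nat.mul_le_mul_right (κ * 100 + 100) hmn'
      have h3 : G.n * G.n * (κ * 100 + 400) = G.n * G.n * (κ * 100 + 100) + G.n * G.n * 300 := by ring
      omega)
  rintro s2 f2 hl
  have w2 : ∀ b, b ≤ 12 ∨ (14 ≤ b ∧ b ≤ 60) ∨ (64 ≤ b ∧ b ≤ 85) ∨ 88 ≤ b → s2.words b = s.words b :=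
    fun b hb => (f2.w b fun h => by simp [extractCands, removeLeaf_wr] at h; omega).trans
      (w1 b (by omega))
  have r2 : ∀ b, b ≠ rbKey → s2.reals b = s.reals b := fun b hb =>
    (f2.r b (by simp [extractCands, removeLeaf_wrR])).trans (r1 b hb)
  have h₂ := h.congr (s' := s2) (fun b hb => w2 b (by omega)) (r2 0 (by decide))
  have hlen : s2.words bkLen 0 ≤ G.n * G.n := (hl.le.trans hcard).trans hmn'
  -- The order of the matrices becomes the least power of two that is at least 2γ. So at least half
  -- of the columns are free for new candidates, while the order is at most 4γ + 1; for γ = 0 it is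
  -- 1, which still leaves one free column.
  refine Tri.seq (T1 := G.n * 28 + 14) (T2 := G.n * G.n * 300 + G.n * 400 + Tgr + 140)
    (Tri.mono (powLoop_spec (x := 2 * γ) (by omega) fun s' hf => ?_) (by
      change 2 * γ * (4 + 10) + (4 + 10) ≤ _; omega) fun _ _ h => h) ?_ (by omega)
  · simp [hf.w 2 (by simp [powLoop_wr]), h₂.ann.num]
  rintro s3 f3 ⟨K, hN, hγK, hKγ, -⟩
  have w3 : ∀ b, b ≠ bkN → s3.words b = s2.words b := fun b hb => f3.w b (by simp [powLoop_wr, hb])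
  have r3 : s3.reals = s2.reals := funext fun b => f3.r b (by simp [powLoop_wrR])
  have w3' : ∀ b, b ≤ 12 ∨ (14 ≤ b ∧ b < 40) ∨ (41 ≤ b ∧ b ≤ 60) ∨ (64 ≤ b ∧ b ≤ 85) ∨ 88 ≤ b →
      s3.words b = s.words b := fun b hb => by rw [w3 b (by omega), w2 b (by omega)]
  have h1K : 1 ≤ 2 ^ K := Nat.one_le_two_pow
  have hlt : γ < 2 ^ K := by omega
  have hKB : 2 ^ K * 2 ^ K ≤ (4 * γ + 1) * (4 * γ + 1) := Nat.mul_le_mul (by omega) (by omega)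
  have hFn : G.n * G.n / (2 ^ K - γ) + 1 ≤ G.n * G.n + 1 := by
    have := Nat.div_le_self (G.n * G.n) (2 ^ K - γ); omega
  have hsp : elimSpace c (2 ^ K) K ≤ 2 * (4 * γ + 1) * ((4 * γ + 1) * (4 * γ + 3) ^ c) :=
    ((Nat.le_add_right _ _).trans (elimSpace_le rfl K le_rfl)).trans
      (Nat.mul_le_mul (by omega) (Nat.mul_le_mul (by omega) (Nat.pow_le_pow_left (by omega) _)))
  have hl3 := hl.congr (s' := s3) (w3 _ (by decide)) (w3 _ (by decide))
  have eL : s3.words bkLen = s2.words bkLen := w3 _ (by decide)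
  have eI : s3.words bkList = s2.words bkList := w3 _ (by decide)
  refine Tri.seq (T1 := Tgr + 10) (T2 := G.n * G.n * 300 + G.n * 400 + 130)
    (Tri.mono (greedyLoop_spec (N := 2 ^ K) (F := G.n * G.n / (2 ^ K - γ) + 1) hP hc hG
    (h₂.congr (fun b hb => w3 b (by omega)) (by rw [r3])) hl3 ⟨hN, fun a => ?_, fun b a hb ha => ?_⟩
    rfl hlt ?_ (by omega) (by rw [eL]; omega) ?_ (by rw [w3' _ (by omega), hz _ (by omega)])
    (by rw [w3' _ (by omega), hz _ (by omega)])) (Nat.add_le_add_right (hT K hγK (by omega)) _)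
    fun _ _ h => h) ?_ (by omega)
  · rw [w3' _ (by omega)]; exact hbit a
  · rw [w3' _ (by omega)] at ha ⊢; rw [r3, r2 _ (by omega)]; exact hfresh b a hb ha
  -- The list has at most n² entries, so n² / (N - γ) + 1 rounds suffice.
  · rw [eL, mul_comm]; exact hlen.trans (Nat.lt_mul_div_succ _ (by omega)).le
  · rw [w3' _ (by omega)]; exact (Nat.add_le_add_left (Nat.mul_le_mul hFn hsp) _).trans_lt hB
  rintro s4 f4 ⟨Q, k, ch, hQ, hgr, hk, hcols⟩; rw [eL] at hQ; rw [eI] at hgr hcols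
  have hcode : ∀ x < s2.words bkLen 0, 0 < G.n ∧ (s2.words bkList x - 1) / G.n < G.m ∧
      G.IsEdge ((s2.words bkList x - 1) % G.n) := by
    intro x hx; have hmem := (hl.mem x hx).2
    rw [candCodes, Finset.mem_filter, Finset.mem_range] at hmem
    have hn : 0 < G.n := Nat.pos_of_ne_zero fun h => by simp [h] at hmem
    exact ⟨hn, (Nat.div_lt_iff_lt_mul hn).2 hmem.1, Nat.mod_lt _ hn, hmem.2⟩
  have hcyc : CycleData G (G.idxOf s) (G.ordOf s) (G.parOf s) (G.distOf s) N U piv γ r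
      (s2.words bkLen 0) (fun x => (s2.words bkList x - 1) / G.n)
      (fun x => (s2.words bkList x - 1) % G.n)
      (fun x => G.colLab (coords N U piv γ r) (G.parOf s) (s2.words bkList x)) := by
    refine ⟨hD, fun x hx => (hcode x hx).2, fun p hp e he => ?_, fun x y hxy hy => ?_, fun x hx => ?_,
      fun x hx => ?_⟩
    · have he1 : (p * G.n + e) / G.n = p := by
        rw [mul_comm, Nat.mul_add_div (by have := he.1; omega), Nat.div_eq_of_lt he.1, add_zero]
      have he2 : (p * G.n + e) % G.n = e := by rw [mul_comm, Nat.mul_add_mod, Nat.mod_eq_of_lt he.1]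
      obtain ⟨x, hx, hxe⟩ := hl.surj (p * G.n + e) (by
        rw [candCodes, Finset.mem_filter, Finset.mem_range, he2]
        exact ⟨idx_lt hp he.1, he.2⟩)
      exact ⟨x, hx, by simp [hxe, he1], by simp [hxe, he2]⟩
    · have h1 := hl.sorted x y hxy hy
      rwa [hkey _ (hl.mem x (by omega)).2, hkey _ (hl.mem y hy).2] at h1
    · have := (hl.mem x hx).1
      simp only [colLab, if_neg (show s2.words bkList x ≠ 0 by omega), codeCand]
    · simp [colLab, hl.out x hx]
  have w4 : ∀ b, b ≤ 12 ∨ (66 ≤ b ∧ b ≤ 85) → s4.words b = s.words b := fun b hb =>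
    (f4.w b fun h => by have := greedyLoop_wr h; omega).trans (w3' b (by omega))
  have r4 : ∀ b, b ≠ rbKey ∧ b < 100 → s4.reals b = s.reals b := fun b ⟨hb, hb'⟩ =>
    (f4.r b fun h => by have := greedyLoop_wrR h; omega).trans (by rw [r3, r2 b hb])
  have hpar : G.parOf s4 = G.parOf s := by unfold parOf; rw [w4 _ (by omega)]
  have hkγ : k ≤ γ := by simpa using hgr.card_le
  refine Tri.mono (output_spec (k := k) hG (h.holds.congr (fun b hb => w4 b (by omega))
    (r4 0 (by decide))) (fun p hp => HoldsTree.congr (hD.tree p hp)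
      (fun b hb j _ => by rw [w4 b (by omega)])
      (fun j _ => by rw [r4 _ (by decide)]) hG hD.pos) (by omega) (by omega) hk
      (fun j hj => ?_) (fun a => by rw [w4 _ (by omega), hz _ (by omega)])) ?_ ?_
  · rw [hcols j hj]; exact (hl.mem _ (hcyc.ch_lt hgr hj)).2
  · have h1 : k * (G.m * 200 + 300) ≤ G.n * (G.n * 200 + 300) :=
      Nat.mul_le_mul (by omega) (by omega)
    have h2 : G.n * (G.n * 200 + 300) = G.n * G.n * 200 + G.n * 300 := by ring
    linarith
  · intro s5 f5 h5; refine ⟨_, _, _, _, Q, k, ch, hcyc, hgr, hQ, ?_, fun j hj i hi => ?_⟩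
    · rw [f5.w 2 (by simp [output, toggleOut, walkOut]), w4 2 (by omega), h.ann.num]
    · have h6 := h5 j hj i hi; rw [hpar, hcols j hj] at h6; exact h6

end Net

/-! ### The recurrence for the elimination time. -/

namespace GaussJordan

/-- At block size S one level adds O(N S^(ω-1)), since N / S products of order S cost O(S^ω) each.
For ω > 2 this grows by the factor 2^(ω-1) > 2 from level to level, so the top level dominates the
recurrence T(2S) = 2 T(S) + O(N S^(ω-1)). -/
theorem elimTime_le {ω C : ℝ} (hω : 2 < ω) (hC : 0 ≤ C) (c : ℕ) : ∃ D : ℝ, 0 ≤ D ∧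
    ∀ K, (elimTime (fun n => ⌊C * (n : ℝ) ^ ω⌋₊) c (2 ^ K) K : ℝ) ≤ D * ((2 : ℝ) ^ K) ^ ω := by
  set τ : ℕ → ℕ := fun n => ⌊C * (n : ℝ) ^ ω⌋₊ with hτ
  set b : ℝ := 2 * (600 + 4 * C + 10 * c) + 360 with hb
  have hd : 0 < (2 : ℝ) ^ (ω - 1) - 2 := by
    have := Real.rpow_lt_rpow_of_exponent_lt (x := 2) (by norm_num) (show (1 : ℝ) < ω - 1 by linarith)
    rw [Real.rpow_one] at this; linarith
  have hb0 : 0 ≤ b := by positivity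
  -- With b the constant for one level, D is the solution of 2D + b = D 2^(ω-1), which makes the
  -- induction close with equality.
  set D := b / ((2 : ℝ) ^ (ω - 1) - 2) with hD
  have hDb : 2 * D + b = D * (2 : ℝ) ^ (ω - 1) := by rw [hD]; field_simp; ring
  have hD0 : 0 ≤ D := by positivity
  refine ⟨D, hD0, fun K => ?_⟩
  have key : ∀ k ≤ K, (elimTime τ c (2 ^ K) k : ℝ) ≤ D * (2 ^ K * ((2 : ℝ) ^ k) ^ (ω - 1)) := by
    intro k hk
    induction k with
    | zero => simp only [elimTime, Nat.cast_zero]; positivity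
    | succ k ih =>
      have ih := ih (by omega); set S : ℝ := 2 ^ k with hS; set N : ℝ := 2 ^ K with hN
      set y := S ^ (ω - 1) with hy; have h1S : 1 ≤ S := one_le_pow₀ (by norm_num)
      have hSN : S ≤ N := pow_le_pow_right₀ (by norm_num) (by omega)
      have hSy : S ≤ y := Real.self_le_rpow_of_one_le h1S (by linarith)
      have hyS : S ^ ω = S * y := by
        rw [hy, ← Real.rpow_one_add' (by positivity) (by linarith)]; ring_nf
      have hq : ((2 ^ K / 2 ^ k : ℕ) : ℝ) * S = N := by
        rw [Nat.pow_div (by omega) (by norm_num), Nat.cast_pow, hS, hN]; norm_num [← pow_add]; omega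
      set q : ℝ := ((2 ^ K / 2 ^ k : ℕ) : ℝ) with hqd; have hq0 : 0 ≤ q := Nat.cast_nonneg _
      have hτS : (τ (2 ^ k) : ℝ) ≤ C * (S * y) := by
        rw [← hyS, hτ]; have := Nat.floor_le (a := C * (((2 ^ k : ℕ) : ℝ)) ^ ω) (by positivity)
        simpa using this
      have hqN : q ≤ N := by nlinarith
      have hNy : N ≤ N * y := le_mul_of_one_le_right (by positivity) (h1S.trans hSy)
      have h1N : 1 ≤ N := h1S.trans hSN
      have hSS : S * S ≤ N * y := mul_le_mul hSN hSy (by positivity) (by positivity)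
      have happ : (applyTime τ c (2 ^ K / 2 ^ k) (2 ^ k) : ℝ) ≤ (600 + 4 * C + 10 * c) * (N * y) := by
        have h1 : q * (S * S) ≤ N * y := by
          rw [← mul_assoc, hq]; exact mul_le_mul_of_nonneg_left hSy (by positivity)
        have h2 : q * (τ (2 ^ k) : ℝ) ≤ C * (N * y) := by
          refine (mul_le_mul_of_nonneg_left hτS hq0).trans_eq ?_; rw [← hq]; ring
        have h3 : q * (200 + 10 * c) ≤ (N * y) * (200 + 10 * c) :=
          mul_le_mul_of_nonneg_right (hqN.trans hNy) (by positivity)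
        simp only [applyTime]; push_cast; rw [← hqd, ← hS]; nlinarith
      rw [elimTime]; push_cast
      have hgoal : D * (N * (2 ^ (k + 1)) ^ (ω - 1)) = (2 * D + b) * (N * y) := by
        rw [hDb, pow_succ, Real.mul_rpow (by positivity) (by norm_num)]; ring
      rw [hgoal, ← hN, hb]; nlinarith
  refine (key K le_rfl).trans_eq ?_; rw [← Real.rpow_one_add' (by positivity) (by linarith)]
  ring_nf

end GaussJordan

/-! ### The complete program and its resources. -/

namespace AbstractSimplicialComplex

open RAM GaussJordan Net Tournament

variable {m n : ℕ} {K : AbstractSimplicialComplex (Fin m)}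
  {S : Fin n ≃ {s : Finset (Fin m) // s ∈ K}} {w : K.Simplex 1 → ℝ} {B : ℕ}

/-- Compute a shortest homology basis. -/
def basisProgram (P : Program) (c : ℕ) : Program :=
  parse ;; powLoop bkLeaves (numS * numS + 2 * numS + 2) ;; searchAll ;; coordinates P c ;;
    chooseCycles P c

theorem inputState_bdd (hmn : m ≤ n) (hB : n + 1 < B) : (K.inputState S w).Bdd B := by
  have hl : ∀ (l : List ℕ), (∀ x ∈ l, x < B) → ∀ a, l.getD a 0 < B := by
    intro l h a; rw [List.getD_eq_getElem?_getD]
    cases hx : l[a]? with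
    | none => simp; omega
    | some x => exact h x (List.mem_of_getElem? hx)
  rintro (_ | _ | b) a
  · refine hl [m, n] (fun x hx => ?_) a; simp at hx; omega
  · refine hl (K.simplexStream S) (fun x hx => ?_) a
    simp only [simplexStream, List.mem_flatMap, List.mem_cons, List.mem_map] at hx
    obtain ⟨i, -, rfl | ⟨x, hx, rfl⟩⟩ := hx
    · have := Finset.card_le_univ (S i).1; rw [Fintype.card_fin] at this; omega
    · simp at hx; obtain ⟨v, -, rfl⟩ := hx; omega
  · exact hl [] (by simp) a

theorem basisProgram_spec {P : Program} {c Tel Tgr : ℕ} {τ : ℕ → ℕ} (hP : Multiplies P c τ)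
    (hc : 2 ≤ c) (hK : K.IsConnected) (hw : ∀ e, 0 ≤ w e) (hB : (n + 2) ^ (2 * c + 20) ≤ B)
    (hTel : ∀ κ, 2 ^ κ ≤ 2 * n + 1 → elimTime τ c (2 ^ κ) κ ≤ Tel)
    (hTgr : K.betti1 ≤ n → ∀ κ, 2 * K.betti1 ≤ 2 ^ κ → 2 ^ κ ≤ 4 * K.betti1 + 1 →
      (n * n / (2 ^ κ - K.betti1) + 1) * (elimTime τ c (2 ^ κ) κ + 2 ^ κ * 2 ^ κ * 170 + 2 ^ κ * 190 +
        300) ≤ Tgr) :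
    Tri B (basisProgram P c) (K.inputState S w) (n * n * (Nat.log 2 (2 * (n * n + 2 * n + 2) + 1) * 600 +
      K.betti1 * 70 + 10000) + 10000 + Tel + Tgr) (fun s => ∃ z : Fin K.betti1 → K.oneCycles,
        K.IsShortestHomologyBasis w z ∧ K.IsOutput S z s) := by
  have hR : K.Represents S w (net K S w) := net_represents
  have hG : (net K S w).Good := hR.good hK hw; have hmn : m ≤ n := hG.m_le
  have hm : 0 < m := by obtain ⟨v⟩ := hK.nonempty; exact v.pos
  set G := net K S w with hGdef; set x := n * n + 2 * n + 2 with hx; set A := (n + 2) ^ 2 with hA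
  have hA2 : A = n * n + 4 * n + 4 := by rw [hA]; ring
  have hnn : n ≤ n * n := Nat.le_mul_self n; have hZ : 1 ≤ A ^ c := Nat.one_le_pow _ _ (by omega)
  -- All sizes that occur, such as 2n + 3, 4γ + 3 and n² + 1, are at most A = (n + 2)². The fresh
  -- memory for both eliminations is then a small multiple of V, and 16V ≤ B leaves room for
  -- everything else.
  set V := A * A * (A * A ^ c) with hV
  have hV1 : 4 * (A * (A * A ^ c)) ≤ V := by
    rw [hV, mul_assoc A A]; exact Nat.mul_le_mul_right _ (by omega)
  have hV2 : A * A ≤ V := Nat.le_mul_of_pos_right _ (by positivity)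
  have hV3 : 4 * A ≤ A * A := Nat.mul_le_mul_right _ (by omega)
  have hVB : 16 * V ≤ B := by
    refine le_trans ?_ hB
    have e : (n + 2) ^ (2 * c + 20) = A ^ 7 * V := by rw [hV, hA]; generalize n + 2 = X; ring
    rw [e]
    refine Nat.mul_le_mul_right _ ((show 16 ≤ 4 ^ 7 by norm_num).trans (Nat.pow_le_pow_left (by omega) _))
  have hpow : ∀ y z, y ≤ A → z ≤ A → 2 * y * (y * z ^ c) ≤ 2 * (A * (A * A ^ c)) := fun y z hy hz => by
    rw [mul_assoc]
    exact Nat.mul_le_mul_left _ (Nat.mul_le_mul hy (Nat.mul_le_mul hy (Nat.pow_le_pow_left hz c)))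
  have hz : ∀ b, 2 ≤ b → ∀ a, (K.inputState S w).words b a = 0 := by
    rintro (_ | _ | b) hb a
    · omega
    · omega
    · rfl
  have hzr : ∀ b, b ≠ 0 → ∀ a, (K.inputState S w).reals b a = 0 := fun b hb a => if_neg hb
  have hn1 : (n + 1) * (n + 2) = n * n + 3 * n + 2 := by ring
  refine Tri.seq (T1 := n * 220 + 20) (parse_spec hG (by omega) rfl rfl rfl
    fun b hb _ a => hz b (by omega) a) (T2 := n * n * (Nat.log 2 (2 * x + 1) * 600 +
      K.betti1 * 70 + 9700) + 9700 + Tel + Tgr) ?_ (by linarith)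
  rintro s1 f1 ⟨hh1, hA1, hidx⟩
  have w1 : ∀ b, 14 ≤ b ∨ b = 2 ∨ b = 3 → ∀ a, s1.words b a = 0 := fun b hb a => by
    rw [f1.w b fun h => by have := parse_wr h; omega, hz b (by omega)]
  have r1 : s1.reals = (K.inputState S w).reals := funext fun b => f1.r b fun h => parse_wrR.1 h
  refine Tri.seq (T1 := x * 22 + 22) (T2 := n * n * (Nat.log 2 (2 * x + 1) * 600 +
      K.betti1 * 70 + 9500) + 9500 + Tel + Tgr) (powLoop_spec (x := x) (by omega) fun s' hf => ?_) ?_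
      (by linarith)
  · simp [hf.w 0 (by simp [powLoop_wr]), hh1.n, net, hx]
  rintro s2 f2 ⟨κ, hN, hxκ, hκx, -⟩
  have w2 : ∀ b, b ≠ bkLeaves → s2.words b = s1.words b := fun b hb =>
    f2.w b (by simp [powLoop_wr, hb])
  have r2 : s2.reals = s1.reals := funext fun b => f2.r b fun h => powLoop_wrR.1 h
  have hκlog : κ ≤ Nat.log 2 (2 * x + 1) := Nat.le_log_of_pow_le (by norm_num) hκx
  have hκ : n * n * (κ * 600) ≤ n * n * (Nat.log 2 (2 * x + 1) * 600) := by gcongr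
  refine Tri.seq (T1 := n * n * (κ * 400 + 1400) + 20) (T2 := n * n * (κ * 200 + K.betti1 * 70 + 7000) +
    8000 + Tel + Tgr) (Tri.mono (searchAll_spec (κ := κ) hG (by omega) ?_
      (hh1.congr (fun b hb => w2 b (by omega)) (by rw [r2])) (hA1.congr (w2 _ (by decide))
      (w2 _ (by decide))) (.empty hN fun a => ?_) (fun a => ?_) fun a => ?_) ?_ fun _ _ h => h) ?_
      (by linarith)
  · change 2 * n ≤ _; omega
  · rw [w2 _ (by decide), w1 _ (by omega)]
  · rw [w2 _ (by decide), w1 _ (by omega)]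
  · rw [r2, r1, hzr _ (by decide)]
  · change m * (4 * n * (κ * 100 + 300) + 130) + 20 ≤ _
    have := Nat.mul_le_mul_right (4 * n * (κ * 100 + 300) + 130) hmn; linarith
  rintro s3 f3 ⟨hq3, hT3⟩
  have w3 : ∀ b, b ≤ 59 ∨ 80 ≤ b → s3.words b = s1.words b := fun b hb =>
    (f3.w b fun h => by have := searchAll_wr h; omega).trans (w2 b (by omega))
  have r3 : ∀ b, b = 0 ∨ 3 ≤ b → s3.reals b = (K.inputState S w).reals b := fun b hb =>
    (f3.r b fun h => by have := searchAll_wrR h; omega).trans (by rw [r2, r1])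
  have hF : G.Faces (G.idxOf s3) := hR.faces fun i hi => by
    rw [idxOf, w3 _ (by omega)]; exact (congrArg (· - 1) (hidx i hi)).trans rfl
  have hz3 : ∀ b, b = 2 ∨ b = 3 ∨ (14 ≤ b ∧ b ≤ 59) ∨ 80 ≤ b → ∀ a, s3.words b a = 0 :=
    fun b hb a => by rw [w3 b (by omega), w1 b (by omega)]
  have hsub : 2 * (2 * n + 1) * ((2 * n + 1) * (2 * n + 3) ^ c) ≤ 2 * (A * (A * A ^ c)) :=
    hpow _ _ (by omega) (by omega)
  refine Tri.seq (coordinates_spec (γ := K.betti1) hP hc hG hm hF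
    (hh1.congr (fun b hb => w3 b (by omega)) (by rw [r3 0 (by simp), r1])) hT3
    (show 2 * (2 * n + 1) * ((2 * n + 1) * (2 * n + 3) ^ c) + 3 < B by omega) hTel
    (fun _ _ _ _ _ h => h.eq_betti1 hR) (fun b hb => hz3 b (by omega))
    fun b a hb _ => ⟨hz3 b (by omega) a, by rw [r3 b (by omega), hzr b (by omega)]⟩) ?_
    (T2 := n * n * (κ * 200 + 600) + n * 500 + Tgr + 200) (by change _ + n * n * _ + n * _ + _ + _ ≤ _; linarith)
  rintro s4 f4 ⟨hγn, ⟨N, U, piv, r, hD, hL⟩, hfresh, hbit, hbase⟩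
  have w4 : ∀ b, b = 3 ∨ b = bkIdx ∨ (53 ≤ b ∧ b ≤ 69) ∨ (71 ≤ b ∧ b ≤ 79) ∨ (86 ≤ b ∧ b ≤ 90) →
      s4.words b = s3.words b := fun b hb => f4.w b fun h => by have := coordinates_wr h; omega
  have r4 : ∀ b < 100, s4.reals b = s3.reals b := fun b hb => f4.r b fun h => by
    have := coordinates_wrR h; omega
  have e1 : G.idxOf s3 = G.idxOf s4 := by unfold idxOf; rw [w4 _ (by omega)]
  have e2 : G.ordOf s3 = G.ordOf s4 := by unfold ordOf; rw [w4 _ (by omega)]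
  have e3 : G.parOf s3 = G.parOf s4 := by unfold parOf; rw [w4 _ (by omega)]
  have e4 : G.distOf s3 = G.distOf s4 := by unfold distOf; rw [r4 _ (by omega)]
  rw [e1, e2, e3, e4] at hD; rw [e3] at hL; set γ := K.betti1; have hγn' : γ ≤ n := hγn
  have hsub' : 2 * (4 * γ + 1) * ((4 * γ + 1) * (4 * γ + 3) ^ c) ≤ 2 * (A * (A * A ^ c)) :=
    hpow _ _ (by omega) (by omega)
  have hmn2 : m * n ≤ n * n := Nat.mul_le_mul_right _ hmn
  refine Tri.mono (chooseCycles_spec hP hc hD hL (hq3.congr (w4 _ (by omega)) (w4 _ (by omega))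
    (r4 _ (by omega))) (show m * n + 1 < 2 ^ κ by omega) (by omega) hγn
    (show n * n + 4 * n + 1 < B by omega) ?_ ?_ (hTgr hγn) (fun b hb a => ?_) hfresh hbit) le_rfl ?_
  · have := Nat.mul_le_mul (show 4 * γ + 1 ≤ A by omega) (show 4 * γ + 1 ≤ A by omega); omega
  · have h1 : (n * n + 1) * (2 * (4 * γ + 1) * ((4 * γ + 1) * (4 * γ + 3) ^ c)) ≤
        A * (2 * (A * (A * A ^ c))) := Nat.mul_le_mul (by omega) hsub'
    have h2 : A * (2 * (A * (A * A ^ c))) = 2 * V := by rw [hV]; ring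
    have h3 : s4.words bkBase 0 ≤ 2 * (2 * n + 1) * ((2 * n + 1) * (2 * n + 3) ^ c) := hbase
    change s4.words bkBase 0 + (n * n + 1) * _ < B; omega
  · rw [w4 b (by omega), hz3 b (by omega)]
  · rintro s5 - ⟨M, cp, ce, lab, Q, k, ch, hcyc, hgr, hQ, hg, hout⟩
    obtain ⟨hk, -, z, hz1, hz2⟩ := hcyc.shortest hR hgr hQ; refine ⟨z, hz1, hg, fun j i => ?_⟩
    obtain ⟨h1, h2⟩ := hout j (by have := j.2; omega) i i.2; have h3 := toVec_fin (S := S) (z j).1 i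
    rw [hz2, ← h2] at h3; rw [← h3]; exact (val_cast h1).symm

end AbstractSimplicialComplex

/-! ## The running time -/

/-- Used with ε = ω - 2: then n² log n is O(n^ω), which pays for the shortest paths and the sorting.
-/
theorem natLog_le {ε : ℝ} (hε : 0 < ε) {n y : ℕ} (hy : y ≤ 11 * n ^ 2) :
    (Nat.log 2 y : ℝ) ≤ 4 * 11 ^ (ε / 2) / ε * (n : ℝ) ^ ε := by
  have h1 := Real.natLog_le_logb y 2; have h2 := Real.log_natCast_le_rpow_div y (half_pos hε)
  have h3 : (y : ℝ) ^ (ε / 2) ≤ 11 ^ (ε / 2) * (n : ℝ) ^ ε := by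
    refine (Real.rpow_le_rpow (by positivity) (show (y : ℝ) ≤ 11 * (n : ℝ) ^ 2 by exact_mod_cast hy) (half_pos hε).le).trans_eq ?_
    rw [Real.mul_rpow (by norm_num) (by positivity), ← Real.rpow_natCast, ← Real.rpow_mul
      (by positivity)]
    norm_num; left; ring_nf
  have h4 : (1 : ℝ) / 2 ≤ Real.log 2 := by have := Real.log_two_gt_d9; linarith
  have h5 : Real.logb (2 : ℕ) y ≤ 2 * Real.log y := by
    rw [Real.logb, div_le_iff₀ (by push_cast; linarith)]; have := Real.log_natCast_nonneg y
    push_cast; nlinarith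
  calc (Nat.log 2 y : ℝ) ≤ 2 * ((y : ℝ) ^ (ε / 2) / (ε / 2)) := by linarith
    _ ≤ 2 * (11 ^ (ε / 2) * (n : ℝ) ^ ε / (ε / 2)) := by gcongr
    _ = _ := by field_simp; ring

/-- For γ > 0, the number of rounds is at most n²/γ + 1 ≤ 2n²/γ because γ ≤ n, and a round costs
O(N^ω) with N ≤ 5γ. One factor γ cancels and leaves n² γ^(ω-1). -/
theorem greedyTime_le {ω D : ℝ} (hω : 2 < ω) (hD : 0 ≤ D) {n γ N E : ℕ} (h1n : 1 ≤ n) (hγn : γ ≤ n)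
    (h1N : 1 ≤ N) (hγN : 2 * γ ≤ N) (hNγ : N ≤ 4 * γ + 1) (hE : (E : ℝ) ≤ D * (N : ℝ) ^ ω) :
    (((n * n / (N - γ) + 1) * (E + N * N * 170 + N * 190 + 300) : ℕ) : ℝ) ≤
      2 * (D + 660) * 5 ^ ω * ((n : ℝ) ^ ω + (n : ℝ) ^ 2 * (γ : ℝ) ^ (ω - 1)) := by
  have hn : (1 : ℝ) ≤ n := by exact_mod_cast h1n
  have hN : (1 : ℝ) ≤ N := by exact_mod_cast h1N
  have h2 : ∀ x : ℝ, 1 ≤ x → x ^ 2 ≤ x ^ ω := fun x hx => by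
    rw [← Real.rpow_natCast]; exact Real.rpow_le_rpow_of_exponent_le hx (by push_cast; linarith)
  have hT : ((E + N * N * 170 + N * 190 + 300 : ℕ) : ℝ) ≤ (D + 660) * (N : ℝ) ^ ω := by
    have := h2 N hN; push_cast; nlinarith
  have h5 : (1 : ℝ) ≤ 5 ^ ω := Real.one_le_rpow (by norm_num) (by linarith); rw [Nat.cast_mul]
  -- Without homology the matrices have order 1, and n² + 1 rounds of constant cost are covered by
  -- the term n^ω.
  rcases Nat.eq_zero_or_pos γ with rfl | hγ
  · obtain rfl : N = 1 := by omega
    have hF : ((n * n / (1 - 0) + 1 : ℕ) : ℝ) ≤ 2 * (n : ℝ) ^ ω := by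
      have := h2 n hn; simp only [Nat.sub_zero, Nat.div_one]; push_cast; nlinarith
    refine (mul_le_mul hF hT (by positivity) (by positivity)).trans ?_
    rw [Nat.cast_one, Real.one_rpow, Nat.cast_zero, Real.zero_rpow (by linarith), mul_zero, add_zero,
      mul_one, show 2 * (n : ℝ) ^ ω * (D + 660) = 2 * (D + 660) * 1 * (n : ℝ) ^ ω by ring]
    gcongr
  · have hγ0 : (0 : ℝ) < γ := by exact_mod_cast hγ
    have hF : ((n * n / (N - γ) + 1 : ℕ) : ℝ) ≤ 2 * (n : ℝ) ^ 2 / γ := by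
      have h3 : ((n * n / (N - γ) : ℕ) : ℝ) ≤ (n : ℝ) ^ 2 / γ := by
        refine (Nat.cast_le.2 (Nat.div_le_div_left (show γ ≤ N - γ by omega) hγ)).trans ?_
        refine Nat.cast_div_le.trans_eq ?_; push_cast; ring
      have h4 : 1 ≤ (n : ℝ) ^ 2 / γ := by
        rw [le_div_iff₀ hγ0]
        have : (γ : ℝ) ≤ n := by exact_mod_cast hγn
        nlinarith
      rw [mul_div_assoc]; push_cast; linarith
    have hNγ' : (N : ℝ) ^ ω ≤ 5 ^ ω * (γ : ℝ) ^ ω := by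
      rw [← Real.mul_rpow (by norm_num) hγ0.le]
      exact Real.rpow_le_rpow (by positivity) (by exact_mod_cast (by omega : N ≤ 5 * γ)) (by linarith)
    refine (mul_le_mul hF (hT.trans (mul_le_mul_of_nonneg_left hNγ' (by positivity))) (by positivity)
      (by positivity)).trans ?_
    have : (γ : ℝ) ^ ω = γ * (γ : ℝ) ^ (ω - 1) := by
      rw [← Real.rpow_one_add' hγ0.le (by linarith)]; ring_nf
    rw [this, show 2 * (n : ℝ) ^ 2 / γ * ((D + 660) * (5 ^ ω * (γ * (γ : ℝ) ^ (ω - 1)))) =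
      2 * (D + 660) * 5 ^ ω * ((n : ℝ) ^ 2 * (γ : ℝ) ^ (ω - 1)) by field_simp]
    have := Real.rpow_nonneg (Nat.cast_nonneg n : (0 : ℝ) ≤ n) ω
    gcongr
    linarith

open AbstractSimplicialComplex in
theorem theorem5p2 (ω : ℝ) (hω : 2 < ω) (hmul : RAM.MatMulIn ω) :
    ∃ (P : RAM.Program) (c : ℕ) (C : ℝ), ∀ (m n : ℕ) (K : AbstractSimplicialComplex (Fin m))
        (S : Fin n ≃ {s : Finset (Fin m) // s ∈ K}) (w : K.Simplex 1 → ℝ),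
        K.IsConnected → (∀ e, 0 ≤ w e) → ∃ (t : ℕ) (s : RAM.State) (z : Fin K.betti1 → K.oneCycles),
          P.Run ((n + 2) ^ c) (K.inputState S w) t s ∧
          (t : ℝ) ≤ C * ((n : ℝ) ^ ω + (n : ℝ) ^ 2 * (K.betti1 : ℝ) ^ (ω - 1)) ∧
          K.IsShortestHomologyBasis w z ∧ K.IsOutput S z s := by
  obtain ⟨P, c, C, hC, hc, hP⟩ := hmul.multiplies
  obtain ⟨D, hD, hE⟩ := GaussJordan.elimTime_le hω hC c
  set Λ : ℝ := 4 * 11 ^ ((ω - 2) / 2) / (ω - 2) with hΛ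
  have hΛ0 : 0 ≤ Λ := div_nonneg (by positivity) (by linarith)
  set D' : ℝ := 2 * (D + 660) * 5 ^ ω with hD'
  -- Stored words stay below (n + 2)^(2c + 20), and the size of the program is the further exponent
  -- required by `Program.Exec.run`. The constant collects the terms of `basisProgram_spec`: the
  -- logarithm (600), the labels (70), two constants 10000, the boundary elimination and the rounds.
  refine ⟨basisProgram P c, (2 * c + 20) * (basisProgram P c).size,
    Λ * 600 + 20070 + D * 3 ^ ω + D', fun m n K S w hK hw => ?_⟩
  have hmn : m ≤ n := ((net_represents (S := S) (w := w)).good hK hw).m_le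
  obtain ⟨v⟩ := hK.nonempty
  have h1n : 1 ≤ n := by have := v.pos; omega
  have hn : (1 : ℝ) ≤ n := by exact_mod_cast h1n
  set γ := K.betti1; set X : ℝ := (n : ℝ) ^ ω + (n : ℝ) ^ 2 * (γ : ℝ) ^ (ω - 1) with hX
  have hγ0 : 0 ≤ (n : ℝ) ^ 2 * (γ : ℝ) ^ (ω - 1) := by positivity
  have hnω : (n : ℝ) ^ 2 ≤ (n : ℝ) ^ ω := by
    rw [← Real.rpow_natCast]; exact Real.rpow_le_rpow_of_exponent_le hn (by push_cast; linarith)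
  have hX2 : (n : ℝ) ^ 2 ≤ X := by linarith
  have hTel : ∀ κ, 2 ^ κ ≤ 2 * n + 1 → ((2 : ℝ) ^ κ) ^ ω ≤ 3 ^ ω * X := by
    intro κ hκ
    have h1 : ((2 : ℝ) ^ κ) ^ ω ≤ (3 * n) ^ ω := by
      refine Real.rpow_le_rpow (by positivity) ?_ (by linarith)
      have : ((2 ^ κ : ℕ) : ℝ) ≤ (2 * n + 1 : ℕ) := Nat.cast_le.2 hκ; push_cast at this; linarith
    rw [Real.mul_rpow (by norm_num) (by positivity)] at h1
    refine h1.trans (mul_le_mul_of_nonneg_left ?_ (by positivity)); linarith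
  obtain ⟨t, s, he, ht, z, hz1, hz2⟩ := basisProgram_spec (S := S) (w := w)
    (B := (n + 2) ^ (2 * c + 20)) (Tel := ⌊D * (3 ^ ω * X)⌋₊) (Tgr := ⌊D' * X⌋₊) hP hc hK hw le_rfl
    (fun κ hκ => Nat.le_floor ((hE κ).trans (mul_le_mul_of_nonneg_left (hTel κ hκ) hD)))
    (fun hγn κ h1 h2 => Nat.le_floor (greedyTime_le hω hD h1n hγn Nat.one_le_two_pow h1 h2
      (by simpa using hE κ)))
    (inputState_bdd hmn ((show n + 1 < n + 2 by omega).trans_le (Nat.le_self_pow (by omega) _)))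
  refine ⟨t, s, z, ?_, ?_, hz1, hz2⟩
  · rw [pow_mul]
    exact he.run ((show 2 ≤ n + 2 by omega).trans (Nat.le_self_pow (by omega) _))
      (inputState_bdd hmn ((show n + 1 < n + 2 by omega).trans_le (Nat.le_self_pow (by omega) _)))
      le_rfl
  · refine (Nat.cast_le.2 ht).trans ?_
    -- Here 2(n² + 2n + 2) + 1 ≤ 11n², because n ≥ 1.
    have h1 := natLog_le (ε := ω - 2) (by linarith) (n := n)
      (y := 2 * (n * n + 2 * n + 2) + 1) (by nlinarith)
    rw [← hΛ] at h1
    have h2 : (n : ℝ) ^ 2 * (n : ℝ) ^ (ω - 2) = (n : ℝ) ^ ω := by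
      rw [← Real.rpow_natCast, ← Real.rpow_add (by linarith)]
      congr 1; push_cast; ring
    -- The cost n²γ of the labels is absorbed by the second term of the bound, since ω - 1 ≥ 1 and γ
    -- is zero or at least 1.
    have h3 : (n : ℝ) ^ 2 * (γ : ℝ) ≤ (n : ℝ) ^ 2 * (γ : ℝ) ^ (ω - 1) := by
      refine mul_le_mul_of_nonneg_left ?_ (by positivity); rcases Nat.eq_zero_or_pos γ with h | h
      · rw [h, Nat.cast_zero]; positivity
      · exact Real.self_le_rpow_of_one_le (by exact_mod_cast h) (by linarith)
    have h4 := Nat.floor_le (a := D * (3 ^ ω * X)) (by positivity)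
    have h5 := Nat.floor_le (a := D' * X) (by positivity)
    have h6 := mul_le_mul_of_nonneg_left h1 (sq_nonneg (n : ℝ))
    have h7 : (n : ℝ) ^ 2 * (Λ * (n : ℝ) ^ (ω - 2)) ≤ Λ * X := by
      rw [mul_left_comm, h2]; exact mul_le_mul_of_nonneg_left (by linarith) hΛ0
    push_cast at h6 ⊢; have h8 : (1 : ℝ) ≤ (n : ℝ) ^ 2 := one_le_pow₀ hn; nlinarith
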